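/- Let $N\ge 1$, $0<T<\infty$, $Q_T=\mathbb R^N\times(0,T)$, $X=L^1(\mathbb R^N)\cap L^\infty(\mathbb R^N)$ with $\|g\|_X=\|g\|_1+\|g\|_\infty$, and let $\star$ denote convolution in time on $(0,t)$. Let $\kappa\in L^1_{loc}([0,\infty))$ be nonnegative and nonincreasing on $(0,\infty)$ with $\lim_{t\to\infty}\kappa(t)=0$, and assume that there is a nonnegative, nonincreasing $\ell\in L^1_{loc}([0,\infty))$ with $\ell\star\kappa=1$ on $(0,\infty)$. Let $\mathcal J:\mathbb R^N\to[0,\infty)$ be radially symmetric and nonincreasing near infinity (i.e. $\mathcal J(y)\le\mathcal J(x)$ if $R\le|x|\le|y|$, for some $R$), with $\int_{\mathbb R^N}\min\{1,|z|^2\}\mathcal J(z)\,dz<\infty$. Put $$\mathcal D_t g=\partial_t\big(\kappa\star(g-g(0))\big),\qquad \mathcal L_xw(x)=\mathrm{P.V.}\!\int_{\mathbb R^N}(w(x)-w(z))\mathcal J(x-z)\,dz,\qquad \mathcal H=\mathcal D_t+\mathcal L_x,$$ $${}_t\mathcal D_T\phi(t)=-\partial_t\Big(\int_t^T\phi(\tau)\kappa(\tau-t)\,d\tau\Big),\qquad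 m(\xi)=\int_{\mathbb R^N}(1-\cos(z\cdot\xi))\mathcal J(z)\,dz .$$ For $\mu\ge0$ let $\varrho_1(\cdot;\mu)$ and $\varrho_2(\cdot;\mu)$ be the locally integrable solutions on $(0,\infty)$ of the Volterra equations $$\varrho_1+\mu\,(\ell\star\varrho_1)=1,\qquad \varrho_2+\mu\,(\ell\star\varrho_2)=\ell ,$$ and let $Z_t,Y_t$ be given by their Fourier transforms in $x$, $\widehat Z_t(\xi)=\varrho_1(t;m(\xi))$, $\widehat Y_t(\xi)=\varrho_2(t;m(\xi))$, $t>0$; these are bounded functions of $\xi$, and for $g\in L^2(\mathbb R^N)$ the convolutions $Z_t*g$ and $Y_t*g$ are the elements of $L^2(\mathbb R^N)$ with Fourier transforms $\widehat Z_t\,\widehat g$ and $\widehat Y_t\,\widehat g$. Let $u_0\in X$ and $f\in L^\infty((0,T);X)$. A function $u\in C([0,T);X)$ is a **mild solution** of $\mathcal Hu=f$ in $Q_T$, $u(x,0)=u_0(x)$, if for all $0<t<T$ and a.e. $x\in\mathbb R^N$ $$u(x,t)=Z_t*u_0(x)+\int_0^tY_{t-\tau}*f(x,\tau)\,d\tau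 .$$ It is a **very weak solution** if for every test function $\zeta$ the three integrals below converge absolutely and $$\int_{Q_T}(u-u_0)\,({}_t\mathcal D_T\zeta)+\int_{Q_T}u\,\mathcal L_x\zeta=\int_{Q_T}f\zeta .$$ Here the test functions are the $\zeta\in L^\infty([0,T);X)\cap C^{2,1}_{x,t}(Q_T)$ with $\zeta(x,t)\to0$ as $t\to T^-$ for every $x$, such that ${}_t\mathcal D_T\zeta$ and $\mathcal L_x\zeta$ can be integrated against $L^\infty((0,T);X)$, in the sense that each of them is bounded in absolute value a.e. in $Q_T$ by some $a(x,t)+b(t)$ with $a\in L^1(Q_T)$, $b\in L^1(0,T)$ (this holds, for instance, if $\zeta_t$ and $D^2_x\zeta$ are bounded). **Proposition.** Every mild solution of $\mathcal Hu=f$ in $Q_T$, $u(x,0)=u_0(x)$, is a very weak solution. -/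

import Mathlib

open MeasureTheory Set Filter Topology
open scoped ENNReal NNReal FourierTransform RealInnerProductSpace

noncomputable section

namespace DoubleNonlocal

/-- The space `ℝ^N` with its Euclidean norm. -/
abbrev Space (N : ℕ) := EuclideanSpace ℝ (Fin N)

/-! ### The two kernels -/

/-- The memory kernel `κ` on `(0,∞)` is locally integrable on `[0,∞)`, nonnegative, nonincreasing,
vanishes at infinity, and `ℓ` is a conjugate kernel: it is locally integrable, nonnegative,
nonincreasing and `ℓ ⋆ κ = 1` on `(0,∞)`. Only the values on `(0,∞)` matter. -/
structure IsMemoryKernel (κ ℓ : ℝ → ℝ) : Prop where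
  integrable : ∀ T > 0, IntegrableOn κ (Ioc 0 T)
  nonneg : ∀ t > 0, 0 ≤ κ t
  antitone : AntitoneOn κ (Ioi 0)
  tendsto_zero : Tendsto κ atTop (𝓝 0)
  conj_integrable : ∀ T > 0, IntegrableOn ℓ (Ioc 0 T)
  conj_nonneg : ∀ t > 0, 0 ≤ ℓ t
  conj_antitone : AntitoneOn ℓ (Ioi 0)
  conj_conv : ∀ t > 0, ∫ s in (0 : ℝ)..t, ℓ (t - s) * κ s = 1

/-- The Lévy kernel `J` is nonnegative, radially symmetric, nonincreasing near infinity, and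
`∫ min {1, |z|²} J(z) dz < ∞`. -/
structure IsLevyKernel {N : ℕ} (J : Space N → ℝ) : Prop where
  nonneg : ∀ z, 0 ≤ J z
  radial : ∀ x y, ‖x‖ = ‖y‖ → J x = J y
  antitone_near_infty : ∃ R : ℝ, ∀ x y, R ≤ ‖x‖ → ‖x‖ ≤ ‖y‖ → J y ≤ J x
  integrable : Integrable (fun z => min 1 (‖z‖ ^ 2) * J z)

/-! ### The two operators -/

/-- The diffusion operator `(L_x w)(x) = P.V. ∫ (w(x) - w(z)) J(x - z) dz`. -/
def levyOp {N : ℕ} (J : Space N → ℝ) (w : Space N → ℝ) (x : Space N) : ℝ :=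
  limUnder (𝓝[>] (0 : ℝ)) fun ε => ∫ z in {z | ε < ‖x - z‖}, (w x - w z) * J (x - z)

/-- The backward Riemann–Liouville-type derivative
`(ₜD_T φ)(t) = - d/dt ∫_t^T φ(τ) κ(τ - t) dτ`. -/
def backwardRL (κ : ℝ → ℝ) (T : ℝ) (φ : ℝ → ℝ) (t : ℝ) : ℝ :=
  - deriv (fun s => ∫ τ in s..T, φ τ * κ (τ - s)) t

/-- The symbol `m(ξ) = ∫ (1 - cos (z · ξ)) J(z) dz` of `L_x`. -/
def symbol {N : ℕ} (J : Space N → ℝ) (ξ : Space N) : ℝ :=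
  ∫ z, (1 - Real.cos ⟪z, ξ⟫) * J z

/-! ### The fundamental pair `(Z_t, Y_t)` -/

/-- `ρ` is a locally integrable solution of the Volterra equation `ρ + μ (ℓ ⋆ ρ) = g` on
`(0,∞)`. -/
def IsVolterraSolution (ℓ g : ℝ → ℝ) (μ : ℝ) (ρ : ℝ → ℝ) : Prop :=
  (∀ T > 0, IntegrableOn ρ (Ioc 0 T)) ∧
    ∀ t > 0, IntervalIntegrable (fun s => ℓ (t - s) * ρ s) volume 0 t ∧
      ρ t + μ * ∫ s in (0 : ℝ)..t, ℓ (t - s) * ρ s = g t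

/-- The solution of the Volterra equation `ρ + μ (ℓ ⋆ ρ) = g` (it is unique on `(0,∞)`). -/
def volterraSolution (ℓ g : ℝ → ℝ) (μ : ℝ) : ℝ → ℝ :=
  Classical.epsilon (IsVolterraSolution ℓ g μ)

/-- `ϱ₁(t; μ)`, the solution of `ϱ₁ + μ (ℓ ⋆ ϱ₁) = 1`. -/
def rho1 (ℓ : ℝ → ℝ) (t μ : ℝ) : ℝ := volterraSolution ℓ (fun _ => 1) μ t

/-- `ϱ₂(t; μ)`, the solution of `ϱ₂ + μ (ℓ ⋆ ϱ₂) = ℓ`. -/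
def rho2 (ℓ : ℝ → ℝ) (t μ : ℝ) : ℝ := volterraSolution ℓ ℓ μ t

/-- The class in `L²(ℝ^N; ℂ)` of a square integrable function (`0` for other functions). -/
def toL2 {N : ℕ} (g : Space N → ℂ) : Lp ℂ 2 (volume : Measure (Space N)) :=
  open Classical in if h : MemLp g 2 volume then h.toLp g else 0

/-- Convolution in space with the kernel whose Fourier transform is the bounded function
`a(ξ) = ∫ e^{- i x · ξ} K(x) dx`, as an operator in `L²`: `(K * g)^ = a ĝ`. Mathlib's Fourier
transform `𝓕` has the phase `e^{- 2 π i x · ξ}`, so that the multiplier is `a(2πξ)`. -/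
def convL2 {N : ℕ} (a : Space N → ℝ) (g : Lp ℂ 2 (volume : Measure (Space N))) :
    Lp ℂ 2 (volume : Measure (Space N)) :=
  𝓕⁻ (toL2 fun ξ => (a ((2 * Real.pi) • ξ) : ℂ) * (𝓕 g) ξ)

/-- `Z_t * g`, where `Z_t` has the Fourier transform `ϱ₁(t; m(ξ))`. -/
def convZ {N : ℕ} (ℓ : ℝ → ℝ) (J : Space N → ℝ) (t : ℝ)
    (g : Lp ℂ 2 (volume : Measure (Space N))) : Lp ℂ 2 (volume : Measure (Space N)) :=
  convL2 (fun ξ => rho1 ℓ t (symbol J ξ)) g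

/-- `Y_t * g`, where `Y_t` has the Fourier transform `ϱ₂(t; m(ξ))`. -/
def convY {N : ℕ} (ℓ : ℝ → ℝ) (J : Space N → ℝ) (t : ℝ)
    (g : Lp ℂ 2 (volume : Measure (Space N))) : Lp ℂ 2 (volume : Measure (Space N)) :=
  convL2 (fun ξ => rho2 ℓ t (symbol J ξ)) g

/-! ### Function spaces

Functions of time and space are written `u t x`. -/

/-- Lebesgue measure on `Q_T = ℝ^N × (0,T)` (here with the time variable first). -/
def measQ (N : ℕ) (T : ℝ) : Measure (ℝ × Space N) :=
  volume.restrict (Ioo 0 T ×ˢ univ)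

/-- `g ∈ X = L¹(ℝ^N) ∩ L^∞(ℝ^N)`. -/
def MemX {N : ℕ} (g : Space N → ℝ) : Prop :=
  MemLp g 1 volume ∧ MemLp g ∞ volume

/-- `‖g‖_X = ‖g‖₁ + ‖g‖_∞`. -/
def normX {N : ℕ} (g : Space N → ℝ) : ℝ≥0∞ :=
  eLpNorm g 1 volume + eLpNorm g ∞ volume

/-- `f ∈ L^∞((0,T); X)`. -/
def MemLinftyX {N : ℕ} (T : ℝ) (f : ℝ → Space N → ℝ) : Prop :=
  AEStronglyMeasurable (fun p : ℝ × Space N => f p.1 p.2) (measQ N T) ∧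
    ∃ M : ℝ≥0, ∀ᵐ t ∂volume.restrict (Ioo 0 T), MemX (f t) ∧ normX (f t) ≤ M

/-- `u ∈ C([0,T); X)`, for a function measurable in the variables `(t,x)`. -/
def MemCX {N : ℕ} (T : ℝ) (u : ℝ → Space N → ℝ) : Prop :=
  AEStronglyMeasurable (fun p : ℝ × Space N => u p.1 p.2) (measQ N T) ∧
    (∀ t ∈ Ico 0 T, MemX (u t)) ∧
    ∀ t ∈ Ico 0 T, Tendsto (fun s => normX (u s - u t)) (𝓝[Ico 0 T] t) (𝓝 0)

/-- `ζ ∈ C^{2,1}_{x,t}(Q_T)`: on the open set `Q_T` the derivatives `ζ_t`, `∇_x ζ` and `D²_x ζ`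
exist, and they and `ζ` are continuous in `(t,x)`. -/
structure IsC21 {N : ℕ} (T : ℝ) (ζ : ℝ → Space N → ℝ) : Prop where
  contDiff_space : ∀ t ∈ Ioo 0 T, ContDiff ℝ 2 (ζ t)
  differentiable_time : ∀ t ∈ Ioo 0 T, ∀ x, DifferentiableAt ℝ (fun s => ζ s x) t
  continuousOn : ContinuousOn (fun p : ℝ × Space N => ζ p.1 p.2) (Ioo 0 T ×ˢ univ)
  continuousOn_fderiv :
    ContinuousOn (fun p : ℝ × Space N => fderiv ℝ (ζ p.1) p.2) (Ioo 0 T ×ˢ univ)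
  continuousOn_fderiv2 :
    ContinuousOn (fun p : ℝ × Space N => fderiv ℝ (fderiv ℝ (ζ p.1)) p.2) (Ioo 0 T ×ˢ univ)
  continuousOn_deriv :
    ContinuousOn (fun p : ℝ × Space N => deriv (fun s => ζ s p.2) p.1) (Ioo 0 T ×ˢ univ)

/-- The function `g` on `Q_T` is bounded by an element of `L¹((0,T); L¹(ℝ^N) + L^∞(ℝ^N))`; such
(measurable) functions are integrable on `Q_T` against every element of `L^∞((0,T); X)`. -/
def IsPairable {N : ℕ} (T : ℝ) (g : ℝ → Space N → ℝ) : Prop :=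
  ∃ (a : ℝ × Space N → ℝ) (b : ℝ → ℝ), Integrable a (measQ N T) ∧ IntegrableOn b (Ioo 0 T) ∧
    ∀ᵐ p ∂measQ N T, |g p.1 p.2| ≤ a p + b p.1

/-- Test functions: `ζ ∈ L^∞([0,T); X) ∩ C^{2,1}_{x,t}(Q_T)` with `ζ(·,T) ≡ 0` (as a limit), for
which the integrals of `v (ₜD_T ζ)` and `v L_x ζ` over `Q_T` make sense for `v ∈ L^∞((0,T); X)`. -/
structure IsTestFunction {N : ℕ} (κ : ℝ → ℝ) (J : Space N → ℝ) (T : ℝ)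
    (ζ : ℝ → Space N → ℝ) : Prop where
  memLinftyX : MemLinftyX T ζ
  isC21 : IsC21 T ζ
  final : ∀ x, Tendsto (fun t => ζ t x) (𝓝[<] T) (𝓝 0)
  pairable_time : IsPairable T fun t x => backwardRL κ T (fun s => ζ s x) t
  pairable_space : IsPairable T fun t x => levyOp J (ζ t) x

/-! ### The two notions of solution of `(D_t + L_x) v = f`, `v(0) = u₀` -/

/-- Mild solutions: `u ∈ C([0,T); X)` with
`u(x,t) = Z_t * u₀(x) + ∫₀ᵗ Y_{t-τ} * f(x,τ) dτ` for a.e. `x` and all `0 < t < T`. -/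
structure IsMildSolution {N : ℕ} (ℓ : ℝ → ℝ) (J : Space N → ℝ) (T : ℝ) (u₀ : Space N → ℝ)
    (f u : ℝ → Space N → ℝ) : Prop where
  memCX : MemCX T u
  eq : ∀ t ∈ Ioo 0 T, ∀ᵐ x ∂(volume : Measure (Space N)),
    (u t x : ℂ) = (convZ ℓ J t (toL2 fun y => (u₀ y : ℂ)) +
      ∫ τ in (0 : ℝ)..t, convY ℓ J (t - τ) (toL2 fun y => (f τ y : ℂ)) :
        Lp ℂ 2 (volume : Measure (Space N))) x

/-- Very weak solutions: `u ∈ C([0,T); X)` such that for every test function `ζ` the three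
integrands are integrable on `Q_T` and
`∫_{Q_T} (u - u₀) (ₜD_T ζ) + ∫_{Q_T} u L_x ζ = ∫_{Q_T} f ζ`. -/
structure IsVeryWeakSolution {N : ℕ} (κ : ℝ → ℝ) (J : Space N → ℝ) (T : ℝ) (u₀ : Space N → ℝ)
    (f u : ℝ → Space N → ℝ) : Prop where
  memCX : MemCX T u
  identity : ∀ ζ : ℝ → Space N → ℝ, IsTestFunction κ J T ζ →
    Integrable (fun p : ℝ × Space N =>
      (u p.1 p.2 - u₀ p.2) * backwardRL κ T (fun s => ζ s p.2) p.1) (measQ N T) ∧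
    Integrable (fun p : ℝ × Space N => u p.1 p.2 * levyOp J (ζ p.1) p.2) (measQ N T) ∧
    Integrable (fun p : ℝ × Space N => f p.1 p.2 * ζ p.1 p.2) (measQ N T) ∧
    (∫ p, (u p.1 p.2 - u₀ p.2) * backwardRL κ T (fun s => ζ s p.2) p.1 ∂measQ N T) +
      (∫ p, u p.1 p.2 * levyOp J (ζ p.1) p.2 ∂measQ N T) =
      ∫ p, f p.1 p.2 * ζ p.1 p.2 ∂measQ N T

end DoubleNonlocal

end

noncomputable section

namespace DoubleNonlocal

/-! On the Fourier side the mild formula is a superposition of scalar Volterra equations in time,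
one for each value m(ξ) of the symbol. If they are integrated against the transform of p ∈ C_c², and
m p̂ is recognised as the transform of L p, the result is the time-integrated equation ∫ p u + ℓ ⋆ ∫
(L p) u = ∫ p u₀ + ℓ ⋆ ∫ p f (`IsMemoryKernel.evolution_identity`, `IsMildSolution.weak_identity`).
The choice p = η(x - ·) makes it pointwise in x: η * (u - u₀) = ℓ ⋆ h with h = η * f - (L η) * u
(`IsMildSolution.sconv_identity`).

Two dualities turn this into the very weak form. In time, ℓ inverts the fractional derivative: for
the reflected test function ψ one has κ ⋆ ψ = 1 ⋆ γ with γ = ∂_t(κ ⋆ ψ), and convolution with ℓ and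
differentiation give ψ = ℓ ⋆ γ. Hence ∫ (ℓ ⋆ h) ₜD_T φ = ∫ h φ
(`IsMemoryKernel.integral_backwardRL_mul`). In space, L is symmetric and passes from η to ζ
(`IsSymmKernel.integral_sconv_symOp_mul`). This gives the identity for mollified data
(`IsMildSolution.mollified_identity`), and the mollifier is then removed.

Two points need real work. The first is the pair of bounds 0 ≤ ϱ₂ ≤ ℓ and 0 ≤ ϱ₁ ≤ 1, for kernels
that are merely monotone. Convolution of the ϱ₂-equation with κ gives (κ + μ) ⋆ ϱ₂ = 1, and for a
positive nonincreasing k the solution of k ⋆ ρ = 1 is nonnegative: if k is replaced by a step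
function, the equation becomes a recursion for point masses, monotonicity makes these masses
nonnegative, and their cumulative functions converge in L¹ to the primitive of ρ
(`ae_nonneg_of_cconv_eq_one`).

The second is that u ∈ C([0,T); X) could a priori be unbounded near T, whereas the test functions
only pair with L^∞((0,T); X). The bound comes from the integrated equation. The Lévy kernel is split
at radius ε. Its far part A is integrable and acts as c - A * with c = ‖A‖₁, so that η * u = ϱ₁(·;c)
(η * u₀) + ϱ₂(·;c) ⋆ (source + A * (η * u)). The damping c compensates the norm of A * exactly, and
a comparison with M₀ + M ∫₀ᵗ ℓ, which solves the corresponding scalar equation for every c, gives a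
bound that does not depend on ε, up to the contribution of the near part, which vanishes as ε → 0
(`IsMemoryKernel.comparison`, `IsMildSolution.sconv_bounds`, `IsMildSolution.exists_isBoundedPath`).
-/

/-! ### Convolution on the half-line -/

/-- The convolution `(a ⋆ b)(t) = ∫₀ᵗ a(t - s) b(s) ds`. -/
def cconv (a b : ℝ → ℝ) (t : ℝ) : ℝ := ∫ s in (0 : ℝ)..t, a (t - s) * b s

/-- The restriction of `a` to `(0,T]`, extended by zero. -/
def cut (T : ℝ) (a : ℝ → ℝ) : ℝ → ℝ := indicator (Ioc 0 T) a

theorem integrable_cut {T : ℝ} {a : ℝ → ℝ} :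
    Integrable (cut T a) ↔ IntegrableOn a (Ioc 0 T) :=
  integrable_indicator_iff measurableSet_Ioc

/-- The lower cut-offs leave exactly 0 < s < t, and the upper ones are inactive because t ≤ T. This
identifies the half-line convolution with the convolution on ℝ of zero extensions, whose L¹ theory
then applies. -/
theorem cut_mul_cut {T t : ℝ} (htT : t ≤ T) (a b : ℝ → ℝ) :
    (fun s => cut T a (t - s) * cut T b s) =
      indicator (Ioo 0 t) fun s => a (t - s) * b s := by
  ext s
  unfold cut
  by_cases hs : s ∈ Ioo 0 t
  · rw [indicator_of_mem hs, indicator_of_mem, indicator_of_mem]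
    · exact ⟨hs.1, hs.2.le.trans htT⟩
    · exact ⟨by linarith [hs.2], by linarith [hs.1]⟩
  · rw [indicator_of_notMem hs]
    by_cases h1 : 0 < s
    · rw [indicator_of_notMem (a := t - s), zero_mul]
      intro h
      exact hs ⟨h1, by linarith [h.1]⟩
    · rw [indicator_of_notMem (a := s), mul_zero]
      exact fun h => h1 h.1

theorem intervalIntegrable_conv_iff {T t : ℝ} (ht : 0 ≤ t) (htT : t ≤ T) (a b : ℝ → ℝ) :
    IntervalIntegrable (fun s => a (t - s) * b s) volume 0 t ↔
      Integrable (fun s => cut T a (t - s) * cut T b s) := by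
  rw [cut_mul_cut htT, integrable_indicator_iff measurableSet_Ioo,
    intervalIntegrable_iff_integrableOn_Ioo_of_le ht]

theorem cconv_eq_convolution {T t : ℝ} (ht : 0 ≤ t) (htT : t ≤ T) (a b : ℝ → ℝ) :
    cconv a b t = convolution (cut T a) (cut T b) (ContinuousLinearMap.mul ℝ ℝ) volume t := by
  rw [convolution_eq_swap]
  simp only [ContinuousLinearMap.mul_apply']
  rw [cut_mul_cut htT, integral_indicator measurableSet_Ioo, cconv,
    intervalIntegral.integral_of_le ht, integral_Ioc_eq_integral_Ioo]

/-- The outer cut is needed: the convolution of the truncated functions does not vanish on (T, 2T],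
and there it differs from `cconv`. -/
theorem cut_cconv {T : ℝ} (a b : ℝ → ℝ) :
    cut T (cconv a b) =
      cut T (convolution (cut T a) (cut T b) (ContinuousLinearMap.mul ℝ ℝ) volume) := by
  ext t
  unfold cut
  by_cases ht : t ∈ Ioc 0 T
  · rw [indicator_of_mem ht, indicator_of_mem ht]
    exact cconv_eq_convolution ht.1.le ht.2 a b
  · rw [indicator_of_notMem ht, indicator_of_notMem ht]

theorem cconv_comm (a b : ℝ → ℝ) (t : ℝ) : cconv a b t = cconv b a t := by
  have := intervalIntegral.integral_comp_sub_left (a := 0) (b := t) (fun s => b (t - s) * a s) t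
  simp only [sub_sub_cancel, sub_self, sub_zero] at this
  unfold cconv
  rw [← this]
  simp only [mul_comm]

theorem integrableOn_cconv {T : ℝ} {a b : ℝ → ℝ} (ha : IntegrableOn a (Ioc 0 T))
    (hb : IntegrableOn b (Ioc 0 T)) : IntegrableOn (cconv a b) (Ioc 0 T) := by
  rw [← integrable_cut, cut_cconv, integrable_cut]
  exact ((integrable_cut.2 ha).integrable_convolution _ (integrable_cut.2 hb)).integrableOn

theorem ae_intervalIntegrable_conv {T : ℝ} {a b : ℝ → ℝ} (ha : IntegrableOn a (Ioc 0 T))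
    (hb : IntegrableOn b (Ioc 0 T)) :
    ∀ᵐ t ∂volume.restrict (Ioc 0 T), IntervalIntegrable (fun s => a (t - s) * b s) volume 0 t := by
  have := (integrable_cut.2 ha).ae_convolution_exists (ContinuousLinearMap.mul ℝ ℝ)
    (integrable_cut.2 hb)
  filter_upwards [ae_restrict_of_ae this, ae_restrict_mem measurableSet_Ioc] with t h1 h2
  rw [intervalIntegrable_conv_iff h2.1.le h2.2]
  exact h1.integrable_swap

theorem abs_cconv_le {a b : ℝ → ℝ} {t : ℝ} (ht : 0 ≤ t) :
    |cconv a b t| ≤ cconv (fun s => |a s|) (fun s => |b s|) t := by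
  unfold cconv
  simp_rw [← abs_mul]
  exact intervalIntegral.abs_integral_le_integral_abs ht

/-- Over all of ℝ the integral of a convolution is the product of the integrals; nonnegative mass
beyond T is discarded. -/
theorem setIntegral_cconv_le {T : ℝ} {a b : ℝ → ℝ} (ha : IntegrableOn a (Ioc 0 T))
    (hb : IntegrableOn b (Ioc 0 T)) (ha0 : ∀ s ∈ Ioc 0 T, 0 ≤ a s)
    (hb0 : ∀ s ∈ Ioc 0 T, 0 ≤ b s) :
    ∫ t in Ioc 0 T, cconv a b t ≤ (∫ t in Ioc 0 T, a t) * ∫ t in Ioc 0 T, b t := by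
  have hn : ∀ t, 0 ≤ cut T a t := fun t => indicator_nonneg ha0 t
  have hn' : ∀ t, 0 ≤ cut T b t := fun t => indicator_nonneg hb0 t
  have h := integral_convolution (μ := (volume : Measure ℝ)) (ν := (volume : Measure ℝ))
    (ContinuousLinearMap.mul ℝ ℝ) (integrable_cut.2 ha) (integrable_cut.2 hb)
  simp only [ContinuousLinearMap.mul_apply'] at h
  rw [cut, integral_indicator measurableSet_Ioc] at h
  rw [cut, integral_indicator measurableSet_Ioc] at h
  rw [← h, setIntegral_congr_fun measurableSet_Ioc
    (fun t ht => cconv_eq_convolution (T := T) ht.1.le ht.2 a b)]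
  refine setIntegral_le_integral
    ((integrable_cut.2 ha).integrable_convolution _ (integrable_cut.2 hb)) ?_
  refine Eventually.of_forall fun t => integral_nonneg fun s => ?_
  exact mul_nonneg (hn _) (hn' _)

theorem setIntegral_abs_cconv_le {T : ℝ} {a b : ℝ → ℝ} (ha : IntegrableOn a (Ioc 0 T))
    (hb : IntegrableOn b (Ioc 0 T)) :
    ∫ t in Ioc 0 T, |cconv a b t| ≤ (∫ t in Ioc 0 T, |a t|) * ∫ t in Ioc 0 T, |b t| := by
  refine le_trans ?_ (setIntegral_cconv_le ha.abs hb.abs (fun _ _ => abs_nonneg _)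
    (fun _ _ => abs_nonneg _))
  exact setIntegral_mono_on (integrableOn_cconv ha hb).abs (integrableOn_cconv ha.abs hb.abs)
    measurableSet_Ioc fun t ht => abs_cconv_le ht.1.le

theorem cconv_congr_right {T : ℝ} {a b b' : ℝ → ℝ} (h : ∀ᵐ t ∂volume.restrict (Ioc 0 T), b t = b' t)
    {t : ℝ} (ht : t ∈ Ioc 0 T) : cconv a b t = cconv a b' t := by
  unfold cconv
  refine intervalIntegral.integral_congr_ae ?_
  rw [uIoc_of_le ht.1.le]
  rw [ae_restrict_iff' measurableSet_Ioc] at h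
  filter_upwards [h] with s hs hst
  rw [hs ⟨hst.1, hst.2.trans ht.2⟩]

theorem cconv_congr_left {T : ℝ} {a a' b : ℝ → ℝ} (h : ∀ᵐ t ∂volume.restrict (Ioc 0 T), a t = a' t)
    {t : ℝ} (ht : t ∈ Ioc 0 T) : cconv a b t = cconv a' b t := by
  rw [cconv_comm, cconv_comm a']
  exact cconv_congr_right h ht

theorem cconv_const_mul (a b : ℝ → ℝ) (c t : ℝ) :
    cconv a (fun s => c * b s) t = c * cconv a b t := by
  unfold cconv
  rw [← intervalIntegral.integral_const_mul]
  congr 1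
  ext s
  ring

theorem cconv_add {a b c : ℝ → ℝ} {t : ℝ}
    (hb : IntervalIntegrable (fun s => a (t - s) * b s) volume 0 t)
    (hc : IntervalIntegrable (fun s => a (t - s) * c s) volume 0 t) :
    cconv a (fun s => b s + c s) t = cconv a b t + cconv a c t := by
  unfold cconv
  rw [← intervalIntegral.integral_add hb hc]
  congr 1
  ext s
  ring

/-- Convolutions of L¹ functions exist only almost everywhere, and so associativity is obtained only
there. Causality makes the truncation at T harmless. -/
theorem cconv_assoc_ae {T : ℝ} {a b c : ℝ → ℝ} (ha : IntegrableOn a (Ioc 0 T))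
    (hb : IntegrableOn b (Ioc 0 T)) (hc : IntegrableOn c (Ioc 0 T)) :
    ∀ᵐ t ∂volume.restrict (Ioc 0 T), cconv (cconv a b) c t = cconv a (cconv b c) t := by
  have ha' := integrable_cut.2 ha
  have hb' := integrable_cut.2 hb
  have hc' := integrable_cut.2 hc
  have h1 := ha'.ae_convolution_exists (ContinuousLinearMap.mul ℝ ℝ) hb'
  have h2 := hb'.norm.ae_convolution_exists (ContinuousLinearMap.mul ℝ ℝ) hc'.norm
  have h3 := ha'.norm.ae_convolution_exists (ContinuousLinearMap.mul ℝ ℝ)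
    (hb'.norm.integrable_convolution (ContinuousLinearMap.mul ℝ ℝ) hc'.norm)
  -- At times t ≤ T the values of the second factor beyond T are not seen.
  have key : ∀ (f g : ℝ → ℝ) (t : ℝ), t ∈ Ioc 0 T →
      convolution (cut T f) g (ContinuousLinearMap.mul ℝ ℝ) volume t =
        convolution (cut T f) (indicator (Iic T) g) (ContinuousLinearMap.mul ℝ ℝ) volume t := by
    intro f g t ht
    refine integral_congr_ae (Eventually.of_forall fun s => ?_)
    simp only [ContinuousLinearMap.mul_apply', cut]
    by_cases hs : s ∈ Ioc 0 T
    · rw [indicator_of_mem (a := t - s)]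
      exact (by linarith [hs.1, ht.2] : t - s ≤ T)
    · rw [indicator_of_notMem hs, zero_mul, zero_mul]
  -- A one-sided cut suffices, because the convolution of functions supported in (0,T] already
  -- vanishes for t ≤ 0.
  have hz : ∀ f g : ℝ → ℝ, indicator (Iic T)
      (convolution (cut T f) (cut T g) (ContinuousLinearMap.mul ℝ ℝ) volume) =
      cut T (cconv f g) := by
    intro f g
    ext t
    rw [cut_cconv]
    by_cases h : t ≤ T
    · rw [indicator_of_mem (show t ∈ Iic T from h)]
      change _ = indicator (Ioc 0 T) _ t
      by_cases h0 : 0 < t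
      · rw [indicator_of_mem (show t ∈ Ioc 0 T from ⟨h0, h⟩)]
      · rw [indicator_of_notMem (show t ∉ Ioc 0 T from fun h' => h0 h'.1)]
        refine integral_eq_zero_of_ae (Eventually.of_forall fun s => ?_)
        simp only [ContinuousLinearMap.mul_apply', cut, Pi.zero_apply]
        by_cases hs : 0 < s
        · rw [indicator_of_notMem (a := t - s), mul_zero]
          exact fun h' => by linarith [h'.1]
        · rw [indicator_of_notMem (fun h' => hs h'.1), zero_mul]
    · rw [indicator_of_notMem (show t ∉ Iic T from h)]
      change _ = indicator (Ioc 0 T) _ t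
      rw [indicator_of_notMem (show t ∉ Ioc 0 T from fun h' => h h'.2)]
  filter_upwards [ae_restrict_of_ae h3, ae_restrict_mem measurableSet_Ioc] with t h4 ht
  have := convolution_assoc (ContinuousLinearMap.mul ℝ ℝ) (ContinuousLinearMap.mul ℝ ℝ)
    (ContinuousLinearMap.mul ℝ ℝ) (ContinuousLinearMap.mul ℝ ℝ) (fun x y z => mul_assoc x y z)
    ha'.aestronglyMeasurable hb'.aestronglyMeasurable hc'.aestronglyMeasurable h1 h2 h4
  rw [key a _ t ht, hz, ← cconv_eq_convolution ht.1.le ht.2] at this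
  rw [← this, cconv_comm, cconv_eq_convolution ht.1.le ht.2, ← hz, ← key _ _ t ht,
    ← convolution_flip]
  congr 1
  ext
  simp

/-- Fubini's theorem on a triangle, for a kernel that is dominated by a function of its first
variable. -/
theorem fubini_triangle {a b : ℝ → ℝ} {B : ℝ → ℝ → ℝ} {t : ℝ} (ht : 0 ≤ t)
    (ha : IntegrableOn a (Ioc 0 t)) (hb : IntegrableOn b (Ioc 0 t))
    (hB : AEStronglyMeasurable (fun p : ℝ × ℝ => B p.1 p.2)
      ((volume.restrict (Ioo 0 t)).prod (volume.restrict (Ioo 0 t))))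
    (hBb : ∀ r ∈ Ioo 0 t, ∀ τ ∈ Ioo 0 t, |B r τ| ≤ b r) :
    ∫ s in (0 : ℝ)..t, a (t - s) * ∫ τ in (0 : ℝ)..s, B (s - τ) τ =
      ∫ τ in (0 : ℝ)..t, ∫ r in (0 : ℝ)..(t - τ), a (t - τ - r) * B r τ := by
  set B' : ℝ × ℝ → ℝ := indicator (Ioo 0 t ×ˢ Ioo 0 t) fun p => B p.1 p.2 with hB'
  have hB'm : AEStronglyMeasurable B' (volume.prod volume) := by
    rw [Measure.prod_restrict] at hB
    exact (aestronglyMeasurable_indicator_iff (measurableSet_Ioo.prod measurableSet_Ioo)).2 hB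
  set H : ℝ × ℝ → ℝ := fun p => cut t a (t - p.2) * B' (p.2 - p.1, p.1) with hH
  have hB'm' : AEStronglyMeasurable (fun p : ℝ × ℝ => B' (p.2 - p.1, p.1))
      (volume.prod volume) := by
    have := (Measure.measurePreserving_swap (μ := (volume : Measure ℝ)) (ν := (volume : Measure ℝ))).comp
      (measurePreserving_prod_sub (volume : Measure ℝ) volume)
    exact hB'm.comp_measurePreserving this
  have hint : Integrable H (volume.prod volume) := by
    have h1 : Integrable (fun s => cut t a (t - s)) := (integrable_cut.2 ha).comp_sub_left t
    have h2 : Integrable (fun s => cut t b (-s)) := (integrable_cut.2 hb).comp_neg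
    -- The majorant |a(t - s)| |b(s - τ)| is a convolution integrand in (τ, s) once b is reflected,
    -- since the library form has the argument τ - s.
    have h3 := h1.convolution_integrand (ContinuousLinearMap.mul ℝ ℝ) h2
    refine h3.mono ?_ (Eventually.of_forall fun p => ?_)
    · exact (h1.aestronglyMeasurable.comp_snd).mul hB'm'
    · simp only [ContinuousLinearMap.mul_apply', hH, norm_mul]
      gcongr
      rw [neg_sub, hB', cut]
      by_cases hp : (p.2 - p.1, p.1) ∈ Ioo 0 t ×ˢ Ioo 0 t
      · have hp' : p.2 - p.1 ∈ Ioc 0 t := ⟨hp.1.1, hp.1.2.le⟩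
        rw [indicator_of_mem hp, indicator_of_mem hp']
        exact (hBb _ hp.1 _ hp.2).trans (le_abs_self _)
      · rw [indicator_of_notMem hp, norm_zero]
        exact norm_nonneg _
  have hswap := integral_integral_swap (f := fun τ s => H (τ, s)) hint
  have e1 : ∀ s τ, H (τ, s) = indicator {q : ℝ × ℝ | 0 < q.1 ∧ q.1 < q.2 ∧ q.2 < t}
      (fun q => a (t - q.2) * B (q.2 - q.1) q.1) (τ, s) := by
    intro s τ
    simp only [hH, hB', cut]
    by_cases h : 0 < τ ∧ τ < s ∧ s < t
    · rw [indicator_of_mem, indicator_of_mem, indicator_of_mem]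
      · exact h
      · exact ⟨⟨by simp; linarith, by simp; linarith⟩, ⟨h.1, by simp; linarith⟩⟩
      · exact ⟨by linarith, by linarith⟩
    · rw [indicator_of_notMem (s := {q : ℝ × ℝ | 0 < q.1 ∧ q.1 < q.2 ∧ q.2 < t}) h]
      by_cases h2 : s < t
      · rw [indicator_of_notMem (s := Ioo 0 t ×ˢ Ioo 0 t), mul_zero]
        rintro ⟨h3, h4⟩
        exact h ⟨h4.1, by have := h3.1; simp at this; exact this, h2⟩
      · rw [indicator_of_notMem (a := t - s), zero_mul]
        exact fun h' => by linarith [h'.1]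
  have e2 : ∀ s, ∫ τ, H (τ, s) =
      indicator (Ioo 0 t) (fun s => a (t - s) * ∫ τ in (0 : ℝ)..s, B (s - τ) τ) s := by
    intro s
    by_cases hs : s ∈ Ioo 0 t
    · rw [indicator_of_mem hs, intervalIntegral.integral_of_le hs.1.le,
        integral_Ioc_eq_integral_Ioo, ← integral_const_mul, ← integral_indicator measurableSet_Ioo]
      congr 1
      ext τ
      rw [e1]
      simp only [indicator, mem_ofPred_eq, mem_Ioo, hs.2, and_true]
    · rw [indicator_of_notMem hs]
      refine integral_eq_zero_of_ae (Eventually.of_forall fun τ => ?_)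
      simp only [Pi.zero_apply]
      rw [e1, indicator_of_notMem]
      rintro ⟨h1, h2, h3⟩
      exact hs ⟨h1.trans h2, h3⟩
  have e3 : ∀ τ, ∫ s, H (τ, s) =
      indicator (Ioo 0 t) (fun τ => ∫ r in (0 : ℝ)..(t - τ), a (t - τ - r) * B r τ) τ := by
    intro τ
    by_cases hs : τ ∈ Ioo 0 t
    · have := intervalIntegral.integral_comp_sub_right (a := τ) (b := t)
        (fun r => a (t - τ - r) * B r τ) τ
      rw [sub_self] at this
      rw [indicator_of_mem hs, ← this, intervalIntegral.integral_of_le hs.2.le,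
        integral_Ioc_eq_integral_Ioo, ← integral_indicator measurableSet_Ioo]
      congr 1
      ext s
      rw [e1]
      have : t - τ - (s - τ) = t - s := by ring
      simp only [indicator, mem_ofPred_eq, mem_Ioo, hs.1, true_and, this]
    · rw [indicator_of_notMem hs]
      refine integral_eq_zero_of_ae (Eventually.of_forall fun s => ?_)
      simp only [Pi.zero_apply]
      rw [e1, indicator_of_notMem]
      rintro ⟨h1, h2, h3⟩
      exact hs ⟨h1, h2.trans h3⟩
  simp_rw [e2, e3] at hswap
  rw [integral_indicator measurableSet_Ioo, integral_indicator measurableSet_Ioo] at hswap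
  rw [intervalIntegral.integral_of_le ht, integral_Ioc_eq_integral_Ioo, ← hswap,
    intervalIntegral.integral_of_le ht, integral_Ioc_eq_integral_Ioo]

/-- Associativity of the convolution, at every point, if the last factor is bounded. -/
theorem cconv_assoc_of_bounded {a b c : ℝ → ℝ} {t C : ℝ} (ht : 0 ≤ t)
    (ha : IntegrableOn a (Ioc 0 t)) (hb : IntegrableOn b (Ioc 0 t))
    (hc : AEStronglyMeasurable c (volume.restrict (Ioo 0 t))) (hC : ∀ τ ∈ Ioo 0 t, |c τ| ≤ C) :
    cconv a (cconv b c) t = cconv (cconv a b) c t := by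
  have h := fubini_triangle (a := a) (b := fun r => |b r| * C) (B := fun r τ => b r * c τ) ht ha
    (hb.abs.mul_const C) ?_ ?_
  · unfold cconv
    rw [h]
    congr 1
    ext τ
    rw [← intervalIntegral.integral_mul_const]
    congr 1
    ext r
    ring
  · exact ((hb.mono_set Ioo_subset_Ioc_self).aestronglyMeasurable.comp_fst).mul hc.comp_snd
  · intro r hr τ hτ
    rw [abs_mul]
    gcongr
    exact hC τ hτ

/-! ### Linear Volterra equations: uniqueness and existence -/

/-- Exponentials are multiplicative, so a weight e^{-rt} passes through the convolution. With a
large r this makes convolution by an integrable kernel a contraction on (0,T] without any smallness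
of T. -/
theorem cconv_exp_mul (a b : ℝ → ℝ) (r t : ℝ) :
    cconv (fun s => Real.exp (-(r * s)) * a s) (fun s => Real.exp (-(r * s)) * b s) t =
      Real.exp (-(r * t)) * cconv a b t := by
  unfold cconv
  rw [← intervalIntegral.integral_const_mul]
  congr 1
  ext s
  have : Real.exp (-(r * t)) = Real.exp (-(r * (t - s))) * Real.exp (-(r * s)) := by
    rw [← Real.exp_add]; ring_nf
  rw [this]
  ring

theorem integrableOn_exp_mul {T : ℝ} {a : ℝ → ℝ} (ha : IntegrableOn a (Ioc 0 T)) (r : ℝ) :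
    IntegrableOn (fun s => Real.exp (-(r * s)) * a s) (Ioc 0 T) := by
  rw [← integrableOn_Icc_iff_integrableOn_Ioc] at ha ⊢
  exact ha.continuousOn_mul (by fun_prop) isCompact_Icc

/-- Dominated convergence as r → ∞: the weight tends to 0 at every s > 0. -/
theorem exists_exp_weight {T : ℝ} {a : ℝ → ℝ} (ha : IntegrableOn a (Ioc 0 T)) (C : ℝ) {ε : ℝ}
    (hε : 0 < ε) :
    ∃ r > 0, C * ∫ s in Ioc 0 T, |Real.exp (-(r * s)) * a s| < ε := by
  have h : Tendsto (fun r : ℝ => C * ∫ s in Ioc 0 T, |Real.exp (-(r * s)) * a s|) atTop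
      (𝓝 (C * ∫ s in Ioc 0 T, (0 : ℝ))) := by
    refine Tendsto.const_mul _ (tendsto_integral_filter_of_dominated_convergence (fun s => |a s|)
      ?_ ?_ ha.abs ?_)
    · exact Eventually.of_forall fun r => (integrableOn_exp_mul ha r).abs.aestronglyMeasurable
    · filter_upwards [eventually_ge_atTop 0] with r hr
      filter_upwards [ae_restrict_mem measurableSet_Ioc] with s hs
      rw [Real.norm_eq_abs, abs_abs, abs_mul, Real.abs_exp]
      refine mul_le_of_le_one_left (abs_nonneg _) (Real.exp_le_one_iff.2 ?_)
      have := mul_nonneg hr hs.1.le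
      linarith
    · filter_upwards [ae_restrict_mem measurableSet_Ioc] with s hs
      have h1 : Tendsto (fun r : ℝ => Real.exp (-(r * s))) atTop (𝓝 0) :=
        Real.tendsto_exp_neg_atTop_nhds_zero.comp (tendsto_id.atTop_mul_const hs.1)
      simpa using (h1.mul_const (a s)).abs
  simp only [integral_zero, mul_zero] at h
  obtain ⟨r, h1, h2⟩ := ((h.eventually (gt_mem_nhds hε)).and (eventually_gt_atTop 0)).exists
  exact ⟨r, h2, h1⟩

/-- Gronwall's inequality for an integrable convolution kernel. -/
theorem ae_eq_zero_of_le_cconv {T C : ℝ} {a z : ℝ → ℝ} (hC : 0 ≤ C)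
    (ha : IntegrableOn a (Ioc 0 T)) (ha0 : ∀ s ∈ Ioc 0 T, 0 ≤ a s)
    (hz : IntegrableOn z (Ioc 0 T)) (hz0 : ∀ s ∈ Ioc 0 T, 0 ≤ z s)
    (h : ∀ᵐ t ∂volume.restrict (Ioc 0 T), z t ≤ C * cconv a z t) :
    ∀ᵐ t ∂volume.restrict (Ioc 0 T), z t = 0 := by
  obtain ⟨r, -, hr⟩ := exists_exp_weight ha C (one_half_pos (α := ℝ))
  have ha' := integrableOn_exp_mul ha r
  have hz' := integrableOn_exp_mul hz r
  have hz'0 : ∀ s ∈ Ioc 0 T, 0 ≤ Real.exp (-(r * s)) * z s := fun s hs =>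
    mul_nonneg (Real.exp_pos _).le (hz0 s hs)
  have ha'0 : ∀ s ∈ Ioc 0 T, 0 ≤ Real.exp (-(r * s)) * a s := fun s hs =>
    mul_nonneg (Real.exp_pos _).le (ha0 s hs)
  -- The weighted mass of z is at most half of itself, by the choice of r.
  have h1 : ∫ s in Ioc 0 T, Real.exp (-(r * s)) * z s ≤
      C * ((∫ s in Ioc 0 T, Real.exp (-(r * s)) * a s) *
        ∫ s in Ioc 0 T, Real.exp (-(r * s)) * z s) := by
    refine le_trans ?_ (mul_le_mul_of_nonneg_left (setIntegral_cconv_le ha' hz' ha'0 hz'0) hC)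
    rw [← integral_const_mul]
    refine integral_mono_ae hz' ((integrableOn_cconv ha' hz').const_mul C) ?_
    filter_upwards [h] with t ht
    rw [cconv_exp_mul]
    calc _ ≤ Real.exp (-(r * t)) * (C * cconv a z t) := by gcongr
      _ = _ := by ring
  have h2 : ∫ s in Ioc 0 T, |Real.exp (-(r * s)) * a s| =
      ∫ s in Ioc 0 T, Real.exp (-(r * s)) * a s :=
    setIntegral_congr_fun measurableSet_Ioc fun s hs => abs_of_nonneg (ha'0 s hs)
  rw [h2] at hr
  have h3 : 0 ≤ ∫ s in Ioc 0 T, Real.exp (-(r * s)) * z s :=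
    setIntegral_nonneg measurableSet_Ioc hz'0
  have h4 : ∫ s in Ioc 0 T, Real.exp (-(r * s)) * z s = 0 := by
    rw [← mul_assoc] at h1
    nlinarith
  rw [setIntegral_eq_zero_iff_of_nonneg_ae ?_ hz'] at h4
  · filter_upwards [h4] with s hs
    simpa using hs
  · filter_upwards [ae_restrict_mem measurableSet_Ioc] with s hs using hz'0 s hs

theorem cconv_sub_ae {T : ℝ} {a b c : ℝ → ℝ} (ha : IntegrableOn a (Ioc 0 T))
    (hb : IntegrableOn b (Ioc 0 T)) (hc : IntegrableOn c (Ioc 0 T)) :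
    ∀ᵐ t ∂volume.restrict (Ioc 0 T),
      cconv a (fun s => b s - c s) t = cconv a b t - cconv a c t := by
  filter_upwards [ae_intervalIntegrable_conv ha hb, ae_intervalIntegrable_conv ha hc] with t h1 h2
  unfold cconv
  rw [← intervalIntegral.integral_sub h1 h2]
  congr 1
  ext s
  ring

/-- Uniqueness for linear Volterra equations. -/
theorem volterra_unique_ae {T m : ℝ} {a b c g : ℝ → ℝ} (ha : IntegrableOn a (Ioc 0 T))
    (hb : IntegrableOn b (Ioc 0 T)) (hc : IntegrableOn c (Ioc 0 T))
    (h1 : ∀ᵐ t ∂volume.restrict (Ioc 0 T), b t + m * cconv a b t = g t)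
    (h2 : ∀ᵐ t ∂volume.restrict (Ioc 0 T), c t + m * cconv a c t = g t) :
    ∀ᵐ t ∂volume.restrict (Ioc 0 T), b t = c t := by
  have := ae_eq_zero_of_le_cconv (z := fun s => |b s - c s|) (abs_nonneg m) ha.abs
    (fun _ _ => abs_nonneg _) (hb.sub hc).abs (fun _ _ => abs_nonneg _) ?_
  · filter_upwards [this] with t ht
    exact sub_eq_zero.1 (abs_eq_zero.1 ht)
  · filter_upwards [h1, h2, cconv_sub_ae ha hb hc, ae_restrict_mem measurableSet_Ioc]
      with t h3 h4 h5 h6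
    have h7 : b t - c t = -m * cconv a (fun s => b s - c s) t := by
      rw [h5]; linarith
    rw [h7, abs_mul, abs_neg]
    gcongr
    exact abs_cconv_le h6.1.le

/-- Banach's fixed point theorem in L¹(0,T) for the exponentially weighted equation, followed by
removal of the weight. -/
theorem exists_volterra_ae {T m : ℝ} {a g : ℝ → ℝ} (ha : IntegrableOn a (Ioc 0 T))
    (hg : IntegrableOn g (Ioc 0 T)) :
    ∃ b : ℝ → ℝ, IntegrableOn b (Ioc 0 T) ∧
      ∀ᵐ t ∂volume.restrict (Ioc 0 T), b t + m * cconv a b t = g t := by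
  obtain ⟨r, -, hr⟩ := exists_exp_weight ha |m| (one_half_pos (α := ℝ))
  set a' : ℝ → ℝ := fun s => Real.exp (-(r * s)) * a s with ha'
  set g' : ℝ → ℝ := fun s => Real.exp (-(r * s)) * g s with hg'
  have hai : IntegrableOn a' (Ioc 0 T) := integrableOn_exp_mul ha r
  have hgi : IntegrableOn g' (Ioc 0 T) := integrableOn_exp_mul hg r
  have hint : ∀ R : Lp ℝ 1 (volume.restrict (Ioc (0 : ℝ) T)),
      Integrable (fun t => g' t - m * cconv a' R t) (volume.restrict (Ioc 0 T)) := fun R =>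
    hgi.sub ((integrableOn_cconv hai (L1.integrable_coeFn R)).const_mul m)
  set Φ : Lp ℝ 1 (volume.restrict (Ioc (0 : ℝ) T)) → Lp ℝ 1 (volume.restrict (Ioc (0 : ℝ) T)) :=
    fun R => (hint R).toL1 with hΦ
  have hlip : ContractingWith (1 / 2) Φ := by
    refine ⟨by norm_num [← NNReal.coe_lt_coe], LipschitzWith.of_dist_le_mul fun R S => ?_⟩
    rw [dist_eq_norm, dist_eq_norm, ← Integrable.toL1_sub, L1.norm_eq_integral_norm,
      L1.norm_eq_integral_norm]
    have hR := L1.integrable_coeFn R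
    have hS := L1.integrable_coeFn S
    calc _ = ∫ t in Ioc 0 T, |m| * |cconv a' (fun s => R s - S s) t| := by
          refine integral_congr_ae ?_
          filter_upwards [Integrable.coeFn_toL1 ((hint R).sub (hint S)),
            cconv_sub_ae hai hR hS] with t h1 h2
          rw [h1, h2, Real.norm_eq_abs, ← abs_mul, ← abs_neg]
          simp only [Pi.sub_apply]
          ring_nf
      _ ≤ |m| * ((∫ s in Ioc 0 T, |a' s|) * ∫ s in Ioc 0 T, |R s - S s|) := by
          rw [integral_const_mul]
          gcongr
          exact setIntegral_abs_cconv_le hai (hR.sub hS)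
      _ ≤ 1 / 2 * ∫ s in Ioc 0 T, |R s - S s| := by
          rw [← mul_assoc]
          gcongr
      _ = _ := by
          congr 1
          refine integral_congr_ae ?_
          filter_upwards [Lp.coeFn_sub R S] with t h1
          rw [h1]
          rfl
  set R := hlip.fixedPoint Φ
  have hR : Φ R = R := hlip.fixedPoint_isFixedPt
  have hRi := L1.integrable_coeFn R
  have hRe : ∀ᵐ t ∂volume.restrict (Ioc 0 T), R t = g' t - m * cconv a' R t := by
    have := Integrable.coeFn_toL1 (hint R)
    rw [show (hint R).toL1 = R from hR] at this
    exact this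
  -- The weight is undone by the same family of exponentials with the parameter -r.
  refine ⟨fun t => Real.exp (-(-r * t)) * R t, integrableOn_exp_mul hRi _, ?_⟩
  filter_upwards [hRe] with t ht
  have e1 : (fun s => Real.exp (-(r * s)) * (Real.exp (-(-r * s)) * R s)) = R := by
    ext s
    rw [← mul_assoc, ← Real.exp_add]
    simp
  have e2 := cconv_exp_mul a (fun t => Real.exp (-(-r * t)) * R t) r t
  rw [e1] at e2
  rw [e2] at ht
  have e3 : Real.exp (-(-r * t)) * Real.exp (-(r * t)) = 1 := by
    rw [← Real.exp_add]
    simp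
  rw [ht, hg']
  linear_combination (g t - m * cconv a (fun t => Real.exp (-(-r * t)) * R t) t) * e3

theorem exists_volterra_ae_global {m : ℝ} {a g : ℝ → ℝ} (ha : ∀ T > 0, IntegrableOn a (Ioc 0 T))
    (hg : ∀ T > 0, IntegrableOn g (Ioc 0 T)) :
    ∃ b : ℝ → ℝ, (∀ T > 0, IntegrableOn b (Ioc 0 T)) ∧
      ∀ᵐ t ∂volume.restrict (Ioi 0), b t + m * cconv a b t = g t := by
  have hex : ∀ n : ℕ, ∃ b : ℝ → ℝ, IntegrableOn b (Ioc 0 (n : ℝ)) ∧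
      ∀ᵐ t ∂volume.restrict (Ioc 0 (n : ℝ)), b t + m * cconv a b t = g t := by
    intro n
    rcases Nat.eq_zero_or_pos n with rfl | hn
    · exact ⟨0, by simp, by simp⟩
    · exact exists_volterra_ae (ha n (by positivity)) (hg n (by positivity))
  choose B hB1 hB2 using hex
  have hmono : ∀ {n k : ℕ}, n ≤ k → Ioc (0 : ℝ) n ⊆ Ioc 0 k := fun h =>
    Ioc_subset_Ioc_right (by exact_mod_cast h)
  have hB : ∀ n k : ℕ, n ≤ k → ∀ᵐ t ∂volume.restrict (Ioc 0 (n : ℝ)), B n t = B k t := by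
    intro n k h
    rcases Nat.eq_zero_or_pos n with rfl | hn
    · simp
    · exact volterra_unique_ae (ha n (by positivity)) (hB1 n) ((hB1 k).mono_set (hmono h)) (hB2 n)
        (ae_restrict_of_ae_restrict_of_subset (hmono h) (hB2 k))
  -- The solutions on the intervals (0,n] are glued; at t the first interval that contains t is
  -- used. By uniqueness they agree almost everywhere on overlaps.
  set b : ℝ → ℝ := fun t => B ⌈t⌉₊ t with hb
  have hbB : ∀ k : ℕ, ∀ᵐ t ∂volume.restrict (Ioc 0 (k : ℝ)), b t = B k t := by
    intro k
    have : ∀ᵐ t : ℝ, ∀ n : ℕ, n ≤ k → t ∈ Ioc 0 (n : ℝ) → B n t = B k t := by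
      rw [ae_all_iff]
      intro n
      by_cases h : n ≤ k
      · have := hB n k h
        rw [ae_restrict_iff' measurableSet_Ioc] at this
        filter_upwards [this] with t ht _ using ht
      · exact Eventually.of_forall fun t h' => absurd h' h
    filter_upwards [ae_restrict_of_ae this, ae_restrict_mem measurableSet_Ioc] with t h1 h2
    exact h1 _ (Nat.ceil_le.2 h2.2) ⟨h2.1, Nat.le_ceil t⟩
  refine ⟨b, fun T hT => ?_, ?_⟩
  · refine IntegrableOn.mono_set ?_ (Ioc_subset_Ioc_right (Nat.le_ceil T))
    exact (hB1 ⌈T⌉₊).congr ((hbB ⌈T⌉₊).mono fun t h => h.symm)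
  · have hU : Ioi (0 : ℝ) = ⋃ n : ℕ, Ioc 0 (n : ℝ) := by
      ext t
      simp only [mem_Ioi, mem_iUnion, mem_Ioc, exists_and_left]
      exact ⟨fun h => ⟨h, ⌈t⌉₊, Nat.le_ceil t⟩, fun h => h.1⟩
    rw [hU, ae_restrict_iUnion_iff]
    intro n
    filter_upwards [hbB n, hB2 n, ae_restrict_mem measurableSet_Ioc] with t h1 h2 h3
    rw [h1, cconv_congr_right (hbB n) h3, h2]

/-! ### Positivity for convolution equations with a nonincreasing kernel -/

/-- The device that turns almost-everywhere inequalities into pointwise ones: they hold at points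
arbitrarily close to t from the right, and one passes to a one-sided limit. -/
theorem frequently_nhdsGT_of_ae {p : ℝ → Prop} (hp : ∀ᵐ x : ℝ, p x) (t : ℝ) :
    ∃ᶠ x in 𝓝[>] t, p x := by
  by_contra hcon
  rw [not_frequently] at hcon
  obtain ⟨u, hu, hsub⟩ := mem_nhdsGT_iff_exists_Ioo_subset.1 hcon
  have h0 : volume (Ioo t u) = 0 := measure_mono_null (fun x hx => hsub hx) hp
  rw [Real.volume_Ioo, ENNReal.ofReal_eq_zero] at h0
  linarith [mem_Ioi.1 hu]

theorem convolution_cut_of_nonpos {T t : ℝ} (ht : t ≤ 0) (a b : ℝ → ℝ) (s : ℝ) :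
    cut T a (t - s) * cut T b s = 0 := by
  unfold cut
  by_cases hs : 0 < s
  · rw [indicator_of_notMem (a := t - s), zero_mul]
    exact fun h' => by linarith [h'.1]
  · rw [indicator_of_notMem (a := s) (fun h' => hs h'.1), mul_zero]

theorem intervalIntegral_cut_shift {T t τ : ℝ} (ht : 0 ≤ t) (htT : t ≤ T) (hτ : τ ≤ t)
    (a b : ℝ → ℝ) :
    ∫ s in (0 : ℝ)..t, cut T a (τ - s) * b s = cut T (cconv a b) τ := by
  have h1 : ∫ s in (0 : ℝ)..t, cut T a (τ - s) * b s = ∫ s, cut T a (τ - s) * cut T b s := by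
    rw [intervalIntegral.integral_of_le ht, ← integral_indicator measurableSet_Ioc]
    congr 1
    ext s
    by_cases hs : s ∈ Ioc 0 t
    · rw [indicator_of_mem hs, cut, cut,
        indicator_of_mem (show s ∈ Ioc 0 T from ⟨hs.1, hs.2.trans htT⟩)]
    · rw [indicator_of_notMem hs, cut, cut]
      by_cases h0 : 0 < s
      · rw [indicator_of_notMem (a := τ - s), zero_mul]
        exact fun h => hs ⟨h0, by linarith [h.1]⟩
      · rw [indicator_of_notMem (a := s) (fun h => h0 h.1), mul_zero]
  rw [h1]
  by_cases h0 : 0 < τ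
  · rw [cut_mul_cut (hτ.trans htT), integral_indicator measurableSet_Ioo]
    change _ = indicator (Ioc 0 T) _ τ
    rw [indicator_of_mem (show τ ∈ Ioc 0 T from ⟨h0, hτ.trans htT⟩), cconv,
      intervalIntegral.integral_of_le h0.le, integral_Ioc_eq_integral_Ioo]
  · change _ = indicator (Ioc 0 T) _ τ
    rw [indicator_of_notMem (show τ ∉ Ioc 0 T from fun h => h0 h.1)]
    simp_rw [convolution_cut_of_nonpos (not_lt.1 h0)]
    simp

/-- The masses `c_j` of the discrete measure that solves the convolution equation for the step
function with the values `k ((j + 1) h)`. -/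
def stepCoeff (k : ℝ → ℝ) (h : ℝ) : ℕ → ℝ
  | n => (1 - ∑ j : Fin n, k (((n : ℝ) + 1 - (j : ℕ)) * h) * stepCoeff k h j) / k h
decreasing_by exact j.2

theorem sum_stepCoeff {k : ℝ → ℝ} {h : ℝ} (hk : k h ≠ 0) (n : ℕ) :
    ∑ j ∈ Finset.range (n + 1), k (((n : ℝ) + 1 - j) * h) * stepCoeff k h j = 1 := by
  rw [Finset.sum_range_succ, stepCoeff,
    Finset.sum_range fun j => k (((n : ℝ) + 1 - j) * h) * stepCoeff k h j]
  rw [show ((n : ℝ) + 1 - n) * h = h by ring, mul_div_cancel₀ _ hk]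
  ring

/-- Passing from one step to the next moves the old masses further into the past. Since k is
nonincreasing, their contribution can only drop below 1, and the new mass fills a nonnegative gap.
-/
theorem stepCoeff_nonneg {k : ℝ → ℝ} {h : ℝ} (hh : 0 < h) (hk : AntitoneOn k (Ioi 0))
    (hk0 : ∀ t > 0, 0 < k t) (n : ℕ) : 0 ≤ stepCoeff k h n := by
  induction n using Nat.strong_induction_on with
  | _ n ih =>
    rw [stepCoeff]
    refine div_nonneg ?_ (hk0 h hh).le
    rw [← Finset.sum_range fun j => k (((n : ℝ) + 1 - j) * h) * stepCoeff k h j]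
    rcases n with _ | n
    · simp
    · have e := sum_stepCoeff (hk0 h hh).ne' n
      refine sub_nonneg.2 (le_trans (Finset.sum_le_sum fun j hj => ?_) e.le)
      refine mul_le_mul_of_nonneg_right ?_ (ih j (Finset.mem_range.1 hj))
      have hjn : (j : ℝ) ≤ n := by exact_mod_cast Nat.lt_succ_iff.1 (Finset.mem_range.1 hj)
      push_cast
      refine hk (mem_Ioi.2 (by nlinarith)) (mem_Ioi.2 (by nlinarith)) (by nlinarith)

/-- In the identity `sum_stepCoeff` every weight is at least k((n + 1) h). This bounds the total
mass independently of the step size. -/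
theorem sum_stepCoeff_le {k : ℝ → ℝ} {h : ℝ} (hh : 0 < h) (hk : AntitoneOn k (Ioi 0))
    (hk0 : ∀ t > 0, 0 < k t) (n : ℕ) :
    ∑ j ∈ Finset.range (n + 1), stepCoeff k h j ≤ (k (((n : ℝ) + 1) * h))⁻¹ := by
  have hp : 0 < k (((n : ℝ) + 1) * h) := hk0 _ (by positivity)
  rw [← one_div, le_div_iff₀ hp, Finset.sum_mul]
  refine (Finset.sum_le_sum fun j hj => ?_).trans (sum_stepCoeff (hk0 h hh).ne' n).le
  rw [mul_comm]
  refine mul_le_mul_of_nonneg_right ?_ (stepCoeff_nonneg hh hk hk0 j)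
  have hjn : (j : ℝ) ≤ n := by exact_mod_cast Nat.lt_succ_iff.1 (Finset.mem_range.1 hj)
  exact hk (mem_Ioi.2 (by nlinarith)) (mem_Ioi.2 (by positivity))
    (by nlinarith [(Nat.cast_nonneg j : (0 : ℝ) ≤ j)])

/-- The lower step function of `k` with step size `h`. -/
def stepKernel (k : ℝ → ℝ) (h t : ℝ) : ℝ := k (⌈t / h⌉₊ * h)

theorem stepKernel_bounds {k : ℝ → ℝ} {h t : ℝ} (hh : 0 < h) (hk : AntitoneOn k (Ioi 0))
    (ht : 0 < t) : k (t + h) ≤ stepKernel k h t ∧ stepKernel k h t ≤ k t := by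
  have h1 : t ≤ ⌈t / h⌉₊ * h := by
    rw [← div_le_iff₀ hh]; exact Nat.le_ceil _
  have h2 : (⌈t / h⌉₊ : ℝ) * h ≤ t + h := by
    have := (Nat.ceil_lt_add_one (div_pos ht hh).le).le
    calc _ ≤ (t / h + 1) * h := by gcongr
      _ = t + h := by field_simp
  exact ⟨hk (mem_Ioi.2 (by linarith)) (mem_Ioi.2 (by linarith)) h2,
    hk (mem_Ioi.2 ht) (mem_Ioi.2 (by linarith)) h1⟩

theorem stepKernel_antitoneOn {k : ℝ → ℝ} {h : ℝ} (hh : 0 < h) (hk : AntitoneOn k (Ioi 0)) :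
    AntitoneOn (stepKernel k h) (Ioi 0) := by
  intro s hs t ht hst
  have hs' : (0 : ℝ) < ⌈s / h⌉₊ := by exact_mod_cast Nat.ceil_pos.2 (div_pos hs hh)
  have ht' : (0 : ℝ) < ⌈t / h⌉₊ := by exact_mod_cast Nat.ceil_pos.2 (div_pos ht hh)
  refine hk (mem_Ioi.2 (by positivity)) (mem_Ioi.2 (by positivity)) ?_
  have : ⌈s / h⌉₊ ≤ ⌈t / h⌉₊ := Nat.ceil_mono (by gcongr)
  gcongr

/-- For t in (nh, (n+1)h] the masses at jh with j > n lie in the future and are cut off, and the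
others see the value k((n+1-j)h). What remains is `sum_stepCoeff`. -/
theorem sum_stepCoeff_stepKernel {k : ℝ → ℝ} {h T t : ℝ} {N : ℕ} (hh : 0 < h) (hT : T = N * h)
    (hk : k h ≠ 0) (ht : t ∈ Ioc 0 T) :
    ∑ j ∈ Finset.range N, stepCoeff k h j * cut T (stepKernel k h) (t - j * h) = 1 := by
  have hn1 : 0 < ⌈t / h⌉₊ := Nat.ceil_pos.2 (div_pos ht.1 hh)
  obtain ⟨n, hn⟩ : ∃ n, ⌈t / h⌉₊ = n + 1 := ⟨⌈t / h⌉₊ - 1, by omega⟩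
  have hle : t ≤ (n + 1) * h := by
    have := Nat.le_ceil (t / h)
    rw [hn, div_le_iff₀ hh] at this
    exact_mod_cast this
  have hlt : n * h < t := by
    have : n < ⌈t / h⌉₊ := by omega
    rw [Nat.lt_ceil, lt_div_iff₀ hh] at this
    exact this
  have hnN : n + 1 ≤ N := by
    rw [← hn, Nat.ceil_le, div_le_iff₀ hh, ← hT]
    exact ht.2
  rw [← sum_stepCoeff hk n]
  symm
  refine Finset.sum_subset_zero_on_sdiff (Finset.range_mono hnN) ?_ ?_
  · intro j hj
    simp only [Finset.mem_sdiff, Finset.mem_range, not_lt] at hj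
    have hj' : (n : ℝ) + 1 ≤ j := by exact_mod_cast hj.2
    rw [cut, indicator_of_notMem, mul_zero]
    exact fun h' => by nlinarith [h'.1]
  · intro j hj
    have hj' : (j : ℝ) ≤ n := by exact_mod_cast Nat.lt_succ_iff.1 (Finset.mem_range.1 hj)
    have hj0 : (0 : ℝ) ≤ j := Nat.cast_nonneg j
    rw [cut, indicator_of_mem, stepKernel, mul_comm]
    · congr 2
      have : ⌈(t - j * h) / h⌉₊ = n + 1 - j := by
        have h1 : (t - j * h) / h = t / h - j := by field_simp
        rw [h1, Nat.ceil_sub_natCast, hn]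
      rw [this, Nat.cast_sub (by have := Finset.mem_range.1 hj; omega)]
      push_cast
      ring
    · exact ⟨by nlinarith, by nlinarith [ht.2]⟩

/-- The step function lies between k(t + h) and k(t), and the integral of k(t) - k(t + h) telescopes
to an integral over (0,h) minus a nonnegative one over (T,T+h). -/
theorem integral_stepKernel_error {k : ℝ → ℝ} {h T : ℝ} (hh : 0 < h) (hT : 0 < T)
    (hk : AntitoneOn k (Ioi 0)) (hk0 : ∀ t > 0, 0 < k t)
    (hki : ∀ T > 0, IntegrableOn k (Ioc 0 T)) :
    IntegrableOn (stepKernel k h) (Ioc 0 T) ∧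
      ∫ t in Ioc 0 T, |stepKernel k h t - k t| ≤ ∫ t in Ioc 0 h, k t := by
  have hm : AEStronglyMeasurable (stepKernel k h) (volume.restrict (Ioc 0 T)) :=
    (aemeasurable_restrict_of_antitoneOn measurableSet_Ioc
      ((stepKernel_antitoneOn hh hk).mono fun t ht => ht.1)).aestronglyMeasurable
  have hi : IntegrableOn (stepKernel k h) (Ioc 0 T) := by
    refine (hki T hT).mono' hm ?_
    filter_upwards [ae_restrict_mem measurableSet_Ioc] with t ht
    rw [Real.norm_eq_abs, abs_of_nonneg]
    · exact (stepKernel_bounds hh hk ht.1).2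
    · exact (hk0 (t + h) (by linarith [ht.1])).le.trans (stepKernel_bounds hh hk ht.1).1
  refine ⟨hi, ?_⟩
  have hI : ∀ a b, 0 ≤ a → a ≤ b → IntervalIntegrable k volume a b := by
    intro a b ha hab
    rw [intervalIntegrable_iff_integrableOn_Ioc_of_le hab]
    rcases eq_or_lt_of_le (ha.trans hab) with h0 | h0
    · rw [Ioc_eq_empty (by linarith)]; simp
    · exact (hki b h0).mono_set (Ioc_subset_Ioc_left ha)
  have hs : IntervalIntegrable (fun t => k (t + h)) volume 0 T := by
    have := (hI (0 + h) (T + h) (by linarith) (by linarith)).comp_add_right h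
    simpa using this
  have h1 : ∫ t in Ioc 0 T, |stepKernel k h t - k t| ≤ ∫ t in Ioc 0 T, (k t - k (t + h)) := by
    refine setIntegral_mono_on (hi.sub (hki T hT)).abs ((hki T hT).sub
      ((intervalIntegrable_iff_integrableOn_Ioc_of_le hT.le).1 hs)) measurableSet_Ioc
      fun t ht => ?_
    have := stepKernel_bounds hh hk ht.1
    rw [abs_of_nonpos (by linarith)]
    linarith
  refine h1.trans ?_
  rw [← intervalIntegral.integral_of_le hT.le, ← intervalIntegral.integral_of_le hh.le,
    intervalIntegral.integral_sub (hI 0 T le_rfl hT.le) hs,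
    intervalIntegral.integral_comp_add_right (fun t => k t) h, zero_add]
  have e1 := intervalIntegral.integral_add_adjacent_intervals (hI 0 T le_rfl hT.le)
    (hI T (T + h) hT.le (by linarith))
  have e2 := intervalIntegral.integral_add_adjacent_intervals (hI 0 h le_rfl hh.le)
    (hI h (T + h) hh.le (by linarith))
  have e3 : 0 ≤ ∫ t in T..(T + h), k t :=
    intervalIntegral.integral_nonneg (by linarith) fun t ht => (hk0 t (by linarith [ht.1])).le
  linarith

/-- The cumulative function of the discrete measure with the masses `c_j`. -/
def stepSum (k : ℝ → ℝ) (h : ℝ) (N : ℕ) (t : ℝ) : ℝ :=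
  ∑ j ∈ Finset.range N, stepCoeff k h j * indicator (Ioi 0) 1 (t - j * h)

theorem stepSum_mono {k : ℝ → ℝ} {h : ℝ} (hh : 0 < h) (hk : AntitoneOn k (Ioi 0))
    (hk0 : ∀ t > 0, 0 < k t) (N : ℕ) : Monotone (stepSum k h N) := by
  intro s t hst
  refine Finset.sum_le_sum fun j _ => mul_le_mul_of_nonneg_left ?_ (stepCoeff_nonneg hh hk hk0 j)
  by_cases h1 : 0 < s - j * h
  · rw [indicator_of_mem (mem_Ioi.2 h1), indicator_of_mem (mem_Ioi.2 (by linarith))]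
    rfl
  · rw [indicator_of_notMem (show s - j * h ∉ Ioi 0 from h1)]
    exact indicator_nonneg (fun _ _ => zero_le_one) _

/-- Let ν be the discrete measure with masses c_j at jh and k_h the step kernel. From ν ⋆ k_h = 1
the primitive of ρ is ν ⋆ k_h ⋆ ρ, while k ⋆ ρ = 1 makes the cumulative function of ν equal to ν ⋆ k
⋆ ρ. The difference is ν ⋆ (k - k_h) ⋆ ρ, and its L¹ norm is at most the product of the mass of ν
with the norms of k - k_h and ρ. -/
theorem integral_stepSum_sub_le {k ρ : ℝ → ℝ} {T h : ℝ} {N : ℕ} (hT : 0 < T) (hh : 0 < h)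
    (hTN : T = (N + 1 : ℕ) * h) (hk : AntitoneOn k (Ioi 0)) (hk0 : ∀ t > 0, 0 < k t)
    (hki : ∀ T > 0, IntegrableOn k (Ioc 0 T)) (hρ : IntegrableOn ρ (Ioc 0 T))
    (heq : ∀ᵐ t ∂volume.restrict (Ioc 0 T), cconv k ρ t = 1) :
    ∫ t in Ioc 0 T, |stepSum k h (N + 1) t - ∫ s in (0 : ℝ)..t, ρ s| ≤
      (k T)⁻¹ * ((∫ t in Ioc 0 h, k t) * ∫ t in Ioc 0 T, |ρ t|) := by
  obtain ⟨hsi, hse⟩ := integral_stepKernel_error hh hT hk hk0 hki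
  have hkT := hki T hT
  set d : ℝ → ℝ := fun t => k t - stepKernel k h t with hd
  have hdi : IntegrableOn d (Ioc 0 T) := hkT.sub hsi
  have hci := integrable_cut.2 (integrableOn_cconv hdi hρ)
  -- the exact formula for the primitive of `ρ`
  have hprim : ∀ t ∈ Ioc 0 T, (∀ j ∈ Finset.range (N + 1),
      IntervalIntegrable (fun s => cut T (stepKernel k h) (t - j * h - s) * ρ s) volume 0 t) →
      ∫ s in (0 : ℝ)..t, ρ s = ∑ j ∈ Finset.range (N + 1),
        stepCoeff k h j * cut T (cconv (stepKernel k h) ρ) (t - j * h) := by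
    intro t ht hint
    have h1 : ∀ s ∈ Ioo 0 t, ρ s = ∑ j ∈ Finset.range (N + 1),
        stepCoeff k h j * (cut T (stepKernel k h) (t - j * h - s) * ρ s) := by
      intro s hs
      have := sum_stepCoeff_stepKernel hh hTN (hk0 h hh).ne' (t := t - s)
        ⟨by linarith [hs.2], by linarith [hs.1, ht.2]⟩
      calc ρ s = (∑ j ∈ Finset.range (N + 1),
            stepCoeff k h j * cut T (stepKernel k h) (t - s - j * h)) * ρ s := by
            rw [this, one_mul]
        _ = _ := by
            rw [Finset.sum_mul]
            refine Finset.sum_congr rfl fun j _ => ?_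
            rw [mul_assoc, sub_right_comm]
    rw [intervalIntegral.integral_of_le ht.1.le, integral_Ioc_eq_integral_Ioo,
      setIntegral_congr_fun measurableSet_Ioo h1, ← integral_Ioc_eq_integral_Ioo,
      ← intervalIntegral.integral_of_le ht.1.le,
      intervalIntegral.integral_finsetSum fun j hj => (hint j hj).const_mul _]
    refine Finset.sum_congr rfl fun j _ => ?_
    rw [intervalIntegral.integral_const_mul, intervalIntegral_cut_shift ht.1.le ht.2]
    have : (0 : ℝ) ≤ j * h := by positivity
    linarith
  -- The convolution exists almost everywhere, hence also at all the shifted points t - jh for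
  -- almost every t, as there are countably many shifts.
  have hex : ∀ᵐ t ∂volume.restrict (Ioc 0 T), ∀ j : ℕ,
      IntervalIntegrable (fun s => cut T (stepKernel k h) (t - j * h - s) * ρ s) volume 0 t := by
    rw [ae_all_iff]
    intro j
    have h1 := (integrable_cut.2 hsi).ae_convolution_exists (ContinuousLinearMap.mul ℝ ℝ)
      (integrable_cut.2 hρ)
    have h2 : ∀ᵐ t : ℝ, ConvolutionExistsAt (cut T (stepKernel k h)) (cut T ρ) (t - j * h)
        (ContinuousLinearMap.mul ℝ ℝ) volume :=
      (measurePreserving_sub_right volume (j * h)).quasiMeasurePreserving.ae h1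
    filter_upwards [ae_restrict_of_ae h2, ae_restrict_mem measurableSet_Ioc] with t h3 ht
    rw [intervalIntegrable_iff_integrableOn_Ioc_of_le ht.1.le]
    refine h3.integrable_swap.integrableOn.congr_fun (fun s hs => ?_) measurableSet_Ioc
    simp only [ContinuousLinearMap.mul_apply', cut]
    rw [indicator_of_mem (show s ∈ Ioc 0 T from ⟨hs.1, hs.2.trans ht.2⟩)]
  have hone : ∀ᵐ t : ℝ, cut T (cconv d ρ) t = cut T 1 t - cut T (cconv (stepKernel k h) ρ) t := by
    have h1 := cconv_sub_ae hρ hkT hsi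
    rw [ae_restrict_iff' measurableSet_Ioc] at h1 heq
    filter_upwards [h1, heq] with t h2 h3
    unfold cut
    by_cases ht : t ∈ Ioc 0 T
    · rw [indicator_of_mem ht, indicator_of_mem ht, indicator_of_mem ht, cconv_comm, h2 ht,
        cconv_comm ρ k, h3 ht, cconv_comm]
      rfl
    · simp [indicator_of_notMem ht]
  have hdiff : ∀ᵐ t ∂volume.restrict (Ioc 0 T),
      stepSum k h (N + 1) t - ∫ s in (0 : ℝ)..t, ρ s =
        ∑ j ∈ Finset.range (N + 1), stepCoeff k h j * cut T (cconv d ρ) (t - j * h) := by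
    have h1 : ∀ᵐ t : ℝ, ∀ j : ℕ, cut T (cconv d ρ) (t - j * h) =
        cut T 1 (t - j * h) - cut T (cconv (stepKernel k h) ρ) (t - j * h) := by
      rw [ae_all_iff]
      exact fun j => (measurePreserving_sub_right volume (j * h)).quasiMeasurePreserving.ae hone
    filter_upwards [hex, ae_restrict_of_ae h1, ae_restrict_mem measurableSet_Ioc] with t h2 h3 ht
    rw [hprim t ht fun j _ => h2 j, stepSum, ← Finset.sum_sub_distrib]
    refine Finset.sum_congr rfl fun j _ => ?_
    rw [h3 j, mul_sub]
    congr 2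
    have hj : (0 : ℝ) ≤ j * h := by positivity
    unfold cut
    by_cases h4 : 0 < t - j * h
    · rw [indicator_of_mem (mem_Ioi.2 h4), indicator_of_mem]
      exact ⟨h4, by linarith [ht.2]⟩
    · rw [indicator_of_notMem (show t - j * h ∉ Ioi 0 from h4), indicator_of_notMem]
      exact fun h' => h4 h'.1
  have hcj : ∀ j : ℕ, Integrable fun t => |cut T (cconv d ρ) (t - j * h)| := fun j =>
    (hci.comp_sub_right (j * h)).abs
  have hc0 := stepCoeff_nonneg hh hk hk0
  have hmain : ∫ t in Ioc 0 T, |cconv d ρ t| ≤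
      (∫ t in Ioc 0 h, k t) * ∫ t in Ioc 0 T, |ρ t| := by
    refine (setIntegral_abs_cconv_le hdi hρ).trans ?_
    refine mul_le_mul_of_nonneg_right ?_ (integral_nonneg fun _ => abs_nonneg _)
    refine le_trans (le_of_eq ?_) hse
    congr 1
    ext t
    exact abs_sub_comm _ _
  have hmain0 : 0 ≤ ∫ t in Ioc 0 T, |cconv d ρ t| := integral_nonneg fun _ => abs_nonneg _
  calc ∫ t in Ioc 0 T, |stepSum k h (N + 1) t - ∫ s in (0 : ℝ)..t, ρ s|
      = ∫ t in Ioc 0 T,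
          |∑ j ∈ Finset.range (N + 1), stepCoeff k h j * cut T (cconv d ρ) (t - j * h)| := by
        refine integral_congr_ae ?_
        filter_upwards [hdiff] with t ht
        rw [ht]
    _ ≤ ∫ t in Ioc 0 T,
          ∑ j ∈ Finset.range (N + 1), stepCoeff k h j * |cut T (cconv d ρ) (t - j * h)| := by
        refine integral_mono ?_ ?_ fun t => ?_
        · have : Integrable fun t => ∑ j ∈ Finset.range (N + 1),
              stepCoeff k h j * cut T (cconv d ρ) (t - j * h) :=
            integrable_finsetSum _ fun j _ => (hci.comp_sub_right (j * h)).const_mul _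
          exact this.abs.integrableOn
        · exact (integrable_finsetSum _ fun j _ => (hcj j).const_mul _).integrableOn
        · refine (Finset.abs_sum_le_sum_abs _ _).trans (le_of_eq ?_)
          refine Finset.sum_congr rfl fun j _ => ?_
          rw [abs_mul, abs_of_nonneg (hc0 j)]
    _ ≤ ∑ j ∈ Finset.range (N + 1), stepCoeff k h j * ∫ t in Ioc 0 T, |cconv d ρ t| := by
        rw [integral_finsetSum _ fun j _ => ((hcj j).const_mul _).integrableOn]
        refine Finset.sum_le_sum fun j _ => ?_
        rw [integral_const_mul]
        refine mul_le_mul_of_nonneg_left ?_ (hc0 j)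
        refine (setIntegral_le_integral (hcj j)
          (Eventually.of_forall fun _ => abs_nonneg _)).trans (le_of_eq ?_)
        rw [integral_sub_right_eq_self (fun t => |cut T (cconv d ρ) t|),
          ← integral_indicator measurableSet_Ioc]
        congr 1
        ext t
        unfold cut
        by_cases ht : t ∈ Ioc 0 T
        · simp [indicator_of_mem ht]
        · simp [indicator_of_notMem ht]
    _ ≤ _ := by
        rw [← Finset.sum_mul]
        have := sum_stepCoeff_le hh hk hk0 N
        rw [show ((N : ℝ) + 1) * h = T by rw [hTN]; push_cast; ring] at this
        have hkTp := hk0 T hT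
        gcongr

/-- If `k` is positive and nonincreasing and `k ⋆ ρ = 1`, then `ρ ≥ 0`. -/
theorem ae_nonneg_of_cconv_eq_one {k ρ : ℝ → ℝ} {T : ℝ} (hT : 0 < T)
    (hk : AntitoneOn k (Ioi 0)) (hk0 : ∀ t > 0, 0 < k t)
    (hki : ∀ T > 0, IntegrableOn k (Ioc 0 T)) (hρ : IntegrableOn ρ (Ioc 0 T))
    (heq : ∀ᵐ t ∂volume.restrict (Ioc 0 T), cconv k ρ t = 1) :
    ∀ᵐ t ∂volume.restrict (Ioc 0 T), 0 ≤ ρ t := by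
  set V : ℝ → ℝ := fun t => ∫ s in (0 : ℝ)..t, ρ s with hV
  set F : ℕ → ℝ → ℝ := fun n => stepSum k (T / (n + 1 : ℕ)) (n + 1) with hF
  have hρI : IntervalIntegrable ρ volume 0 T :=
    (intervalIntegrable_iff_integrableOn_Ioc_of_le hT.le).2 hρ
  have hVm : IntegrableOn V (Ioc 0 T) := by
    have : ContinuousOn V (uIcc 0 T) :=
      intervalIntegral.continuousOn_primitive_interval
        (by rw [uIcc_of_le hT.le, integrableOn_Icc_iff_integrableOn_Ioc]; exact hρ)
    rw [uIcc_of_le hT.le] at this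
    exact (this.integrableOn_Icc).mono_set Ioc_subset_Icc_self
  have hh : ∀ n : ℕ, 0 < T / (n + 1 : ℕ) := fun n => by positivity
  have hFmono : ∀ n, Monotone (F n) := fun n => stepSum_mono (hh n) hk hk0 _
  have hFi : ∀ n, IntegrableOn (F n) (Ioc 0 T) := fun n =>
    (((hFmono n).monotoneOn _).integrableOn_isCompact isCompact_Icc).mono_set Ioc_subset_Icc_self
  have hkey : Tendsto (fun n => ∫ t in Ioc 0 T, |F n t - V t|) atTop (𝓝 0) := by
    have h1 : Tendsto (fun n : ℕ => ∫ t in (0 : ℝ)..(T / (n + 1 : ℕ)), k t) atTop (𝓝 0) := by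
      have hc : ContinuousWithinAt (fun x => ∫ t in (0 : ℝ)..x, k t) (Icc 0 T) 0 := by
        have : ContinuousOn (fun x => ∫ t in (0 : ℝ)..x, k t) (uIcc 0 T) :=
          intervalIntegral.continuousOn_primitive_interval
            (by rw [uIcc_of_le hT.le, integrableOn_Icc_iff_integrableOn_Ioc]; exact hki T hT)
        rw [uIcc_of_le hT.le] at this
        exact this 0 ⟨le_rfl, hT.le⟩
      have h2 : Tendsto (fun n : ℕ => T / (n + 1 : ℕ)) atTop (𝓝[Icc 0 T] 0) := by
        refine tendsto_nhdsWithin_iff.2 ⟨?_, Eventually.of_forall fun n => ⟨(hh n).le, ?_⟩⟩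
        · exact (tendsto_const_div_atTop_nhds_zero_nat T).comp (tendsto_add_atTop_nat 1)
        · exact div_le_self hT.le (by exact_mod_cast Nat.succ_pos n)
      have := hc.tendsto.comp h2
      simpa [Function.comp_def] using this
    have h3 : Tendsto (fun n : ℕ => (k T)⁻¹ *
        ((∫ t in (0 : ℝ)..(T / (n + 1 : ℕ)), k t) * ∫ t in Ioc 0 T, |ρ t|)) atTop (𝓝 0) := by
      simpa using (h1.mul_const (∫ t in Ioc 0 T, |ρ t|)).const_mul (k T)⁻¹
    refine squeeze_zero (fun n => integral_nonneg fun _ => abs_nonneg _) (fun n => ?_) h3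
    rw [intervalIntegral.integral_of_le (hh n).le]
    exact integral_stepSum_sub_le hT (hh n) (by field_simp) hk hk0 hki hρ heq
  -- Convergence in mean yields an almost everywhere convergent subsequence of nondecreasing
  -- functions. Their limit V is therefore nondecreasing on a set of full measure.
  have hmeas : TendstoInMeasure (volume.restrict (Ioc 0 T)) F atTop V := by
    refine tendstoInMeasure_of_tendsto_eLpNorm one_ne_zero
      (fun n => (hFi n).aestronglyMeasurable) hVm.aestronglyMeasurable ?_
    have : ∀ n, eLpNorm (F n - V) 1 (volume.restrict (Ioc 0 T)) =
        ENNReal.ofReal (∫ t in Ioc 0 T, |F n t - V t|) := by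
      intro n
      have hsub : Integrable (fun t => |F n t - V t|) (volume.restrict (Ioc 0 T)) :=
        ((hFi n).sub hVm).abs
      rw [eLpNorm_one_eq_lintegral_enorm, ofReal_integral_eq_lintegral_ofReal
        hsub (Eventually.of_forall fun _ => abs_nonneg _)]
      refine lintegral_congr fun t => ?_
      rw [Pi.sub_apply, Real.enorm_eq_ofReal_abs]
    simp_rw [this]
    simpa using ENNReal.tendsto_ofReal hkey
  obtain ⟨ns, -, hns⟩ := hmeas.exists_seq_tendsto_ae
  have hG : ∀ᵐ t : ℝ, t ∈ Ioc 0 T → Tendsto (fun i => F (ns i) t) atTop (𝓝 (V t)) :=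
    (ae_restrict_iff' measurableSet_Ioc).1 hns
  rw [← restrict_Ioo_eq_restrict_Ioc]
  have hder := hρI.ae_hasDerivAt_integral
  rw [ae_restrict_iff' measurableSet_Ioo]
  filter_upwards [hder, hG] with t h1 h2 ht
  have h1' : HasDerivAt V (ρ t) t := by
    refine h1 ?_ 0 ?_
    · rw [uIcc_of_le hT.le]; exact Ioo_subset_Icc_self ht
    · rw [uIcc_of_le hT.le]; exact ⟨le_rfl, hT.le⟩
  have h3 : Tendsto (slope V t) (𝓝[>] t) (𝓝 (ρ t)) :=
    (hasDerivAt_iff_tendsto_slope.1 h1').mono_left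
      (nhdsWithin_mono _ fun x hx => (ne_of_gt hx : x ≠ t))
  -- At a point of differentiability the sign of the derivative is read off from difference
  -- quotients along the points x > t where the subsequence converges.
  refine ge_of_tendsto_of_frequently h3 ?_
  have h4 := frequently_nhdsGT_of_ae hG t
  refine (h4.and_eventually (Ioo_mem_nhdsGT ht.2)).mono fun x hx => ?_
  have hx' : x ∈ Ioc 0 T := ⟨ht.1.trans hx.2.1, hx.2.2.le⟩
  have h5 : V t ≤ V x := le_of_tendsto_of_tendsto' (h2 ⟨ht.1, ht.2.le⟩) (hx.1 hx')
    fun i => hFmono _ hx.2.1.le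
  rw [slope_def_field]
  exact div_nonneg (by linarith) (by linarith [hx.2.1])

/-! ### The relaxation functions `ϱ₁` and `ϱ₂` -/

/-- One of s and t - s is at least t/2, so the product is at most l(t/2) (l(s) + l(t - s)).
Monotonicity thus provides the convolution at every t > 0 and not only at almost every one, as the
pointwise Volterra equations require. -/
theorem intervalIntegrable_conv_of_antitone {l : ℝ → ℝ} (hl : ∀ T > 0, IntegrableOn l (Ioc 0 T))
    (hl0 : ∀ t > 0, 0 ≤ l t) (hanti : AntitoneOn l (Ioi 0)) {t : ℝ} (ht : 0 < t) :
    IntervalIntegrable (fun s => l (t - s) * l s) volume 0 t := by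
  have h1 : IntervalIntegrable l volume 0 t :=
    (intervalIntegrable_iff_integrableOn_Ioc_of_le ht.le).2 (hl t ht)
  have h2 : IntervalIntegrable (fun s => l (t - s)) volume 0 t := by
    simpa using (h1.comp_sub_left t).symm
  have h3 : IntervalIntegrable (fun s => l (t / 2) * (l s + l (t - s))) volume 0 t :=
    (h1.add h2).const_mul _
  rw [intervalIntegrable_iff_integrableOn_Ioo_of_le ht.le] at h1 h2 h3 ⊢
  refine h3.mono' (h2.aestronglyMeasurable.mul h1.aestronglyMeasurable) ?_
  filter_upwards [ae_restrict_mem measurableSet_Ioo] with s hs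
  have hs1 := hl0 s hs.1
  have hs2 := hl0 (t - s) (by linarith [hs.2])
  have h0 := hl0 (t / 2) (by linarith)
  rw [Real.norm_eq_abs, abs_of_nonneg (by positivity)]
  rcases le_total s (t / 2) with h | h
  · have := hanti (mem_Ioi.2 (by linarith : 0 < t / 2)) (mem_Ioi.2 (by linarith [hs.2] : 0 < t - s))
      (by linarith)
    nlinarith
  · have := hanti (mem_Ioi.2 (by linarith : 0 < t / 2)) (mem_Ioi.2 hs.1) h
    nlinarith

section Kernel

variable {κ ℓ : ℝ → ℝ}

theorem IsMemoryKernel.intervalIntegrable_conv_of_le (hκ : IsMemoryKernel κ ℓ) {b : ℝ → ℝ} {t C : ℝ} (ht : 0 < t)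
    (hb : AEStronglyMeasurable b (volume.restrict (Ioc 0 t)))
    (hbl : ∀ᵐ s ∂volume.restrict (Ioc 0 t), |b s| ≤ C * ℓ s) :
    IntervalIntegrable (fun s => ℓ (t - s) * b s) volume 0 t := by
  have h := intervalIntegrable_conv_of_antitone hκ.conj_integrable hκ.conj_nonneg
    hκ.conj_antitone ht
  have hl : IntervalIntegrable (fun s => ℓ (t - s)) volume 0 t := by
    simpa using (((intervalIntegrable_iff_integrableOn_Ioc_of_le ht.le).2
      (hκ.conj_integrable t ht)).comp_sub_left t).symm
  rw [← restrict_Ioo_eq_restrict_Ioc] at hb hbl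
  rw [intervalIntegrable_iff_integrableOn_Ioo_of_le ht.le] at h hl ⊢
  refine (h.const_mul C).mono' (hl.aestronglyMeasurable.mul hb) ?_
  filter_upwards [ae_restrict_mem measurableSet_Ioo, hbl] with s hs h1
  have hs2 := hκ.conj_nonneg (t - s) (by linarith [hs.2])
  rw [Real.norm_eq_abs, abs_mul, abs_of_nonneg hs2]
  calc ℓ (t - s) * |b s| ≤ ℓ (t - s) * (C * ℓ s) := by gcongr
    _ = _ := by ring

theorem IsMemoryKernel.cconv_eq_one (hκ : IsMemoryKernel κ ℓ) {t : ℝ} (ht : 0 < t) : cconv ℓ κ t = 1 := hκ.conj_conv t ht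

/-- Solutions of the Volterra equation for `ϱ₂` lie between `0` and `ℓ` almost everywhere. -/
theorem IsMemoryKernel.ae_bounds (hκ : IsMemoryKernel κ ℓ) {m : ℝ} (hm : 0 ≤ m) {ρ : ℝ → ℝ}
    (hρ : ∀ T > 0, IntegrableOn ρ (Ioc 0 T))
    (heq : ∀ T > 0, ∀ᵐ t ∂volume.restrict (Ioc 0 T), ρ t + m * cconv ℓ ρ t = ℓ t)
    {T : ℝ} (hT : 0 < T) :
    (∀ᵐ t ∂volume.restrict (Ioc 0 T), 0 ≤ ρ t ∧ ρ t ≤ ℓ t) ∧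
      ∀ᵐ t ∂volume.restrict (Ioc 0 T), cconv κ ρ t + m * ∫ s in (0 : ℝ)..t, ρ s = 1 := by
  have hli := hκ.conj_integrable T hT
  have hki := hκ.integrable T hT
  -- The equation is convolved with κ: both κ ⋆ ℓ on the right and the factor κ ⋆ ℓ in m (κ ⋆ ℓ ⋆ ρ)
  -- become 1.
  have hk : ∀ᵐ t ∂volume.restrict (Ioc 0 T), cconv κ ρ t + m * ∫ s in (0 : ℝ)..t, ρ s = 1 := by
    filter_upwards [cconv_assoc_ae hki hli (hρ T hT), ae_intervalIntegrable_conv hki (hρ T hT),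
      ae_intervalIntegrable_conv hki (integrableOn_cconv hli (hρ T hT)),
      ae_restrict_mem measurableSet_Ioc] with t h1 h2 h3 ht
    have e1 : cconv κ (fun s => ρ s + m * cconv ℓ ρ s) t = 1 := by
      rw [cconv_congr_right (heq T hT) ht, cconv_comm]
      exact hκ.cconv_eq_one ht.1
    rw [cconv_add h2 ?_, cconv_const_mul, ← h1] at e1
    · have e2 : cconv (cconv κ ℓ) ρ t = cconv 1 ρ t := by
        refine cconv_congr_left (T := T) ?_ ht
        filter_upwards [ae_restrict_mem measurableSet_Ioc] with s hs
        rw [cconv_comm]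
        exact hκ.cconv_eq_one hs.1
      rw [e2] at e1
      simpa [cconv] using e1
    · simpa only [mul_left_comm] using h3.const_mul m
  refine ⟨?_, hk⟩
  have hpos : ∀ᵐ t ∂volume.restrict (Ioc 0 T), 0 ≤ ρ t := by
    -- For m = 0 the solution is ℓ itself. For m > 0 the kernel κ + m is strictly positive and
    -- nonincreasing, even where κ vanishes, and the previous line reads (κ + m) ⋆ ρ = 1.
    rcases eq_or_lt_of_le hm with rfl | hm
    · filter_upwards [heq T hT, ae_restrict_mem measurableSet_Ioc] with t h1 ht
      rw [zero_mul, add_zero] at h1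
      rw [h1]
      exact hκ.conj_nonneg t ht.1
    · refine ae_nonneg_of_cconv_eq_one (k := fun t => κ t + m) hT
        (fun s hs t ht hst => by linarith [hκ.antitone hs ht hst])
        (fun t ht => by linarith [hκ.nonneg t ht])
        (fun T hT => (hκ.integrable T hT).add (integrableOn_const (by simp))) (hρ T hT) ?_
      filter_upwards [hk, ae_intervalIntegrable_conv (hρ T hT) hki,
        ae_restrict_mem measurableSet_Ioc] with t h1 h2 ht
      have h3 : IntervalIntegrable (fun s => ρ (t - s) * m) volume 0 t := by
        refine IntervalIntegrable.mul_const ?_ m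
        simpa using (((intervalIntegrable_iff_integrableOn_Ioc_of_le ht.1.le).2
          (hρ t ht.1)).comp_sub_left t).symm
      rw [cconv_comm, cconv_add h2 h3, cconv_comm ρ κ, cconv_comm ρ, ← h1]
      simp [cconv]
  have hpos' := hpos
  rw [ae_restrict_iff' measurableSet_Ioc] at hpos'
  filter_upwards [hpos, heq T hT, ae_restrict_mem measurableSet_Ioc] with t h1 h2 ht
  refine ⟨h1, ?_⟩
  have : 0 ≤ cconv ℓ ρ t := by
    refine intervalIntegral.integral_nonneg_of_ae_restrict ht.1.le ?_
    rw [← restrict_Ioc_eq_restrict_Icc, ← restrict_Ioo_eq_restrict_Ioc,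
      EventuallyLE, ae_restrict_iff' measurableSet_Ioo]
    filter_upwards [hpos'] with s hs hst
    exact mul_nonneg (hκ.conj_nonneg _ (by linarith [hst.2]))
      (hs ⟨hst.1, hst.2.le.trans ht.2⟩)
  nlinarith

/-- The Volterra equation for `ϱ₂` has a solution. -/
theorem IsMemoryKernel.exists_volterra (hκ : IsMemoryKernel κ ℓ) {m : ℝ} (hm : 0 ≤ m) :
    ∃ ρ, IsVolterraSolution ℓ ℓ m ρ := by
  obtain ⟨b, hb1, hb2⟩ := exists_volterra_ae_global (m := m) hκ.conj_integrable hκ.conj_integrable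
  have hb3 : ∀ T > 0, ∀ᵐ t ∂volume.restrict (Ioc 0 T), b t + m * cconv ℓ b t = ℓ t :=
    fun T _ => ae_restrict_of_ae_restrict_of_subset Ioc_subset_Ioi_self hb2
  have hae : ∀ T > 0, ∀ᵐ t ∂volume.restrict (Ioc 0 T), b t = ℓ t - m * cconv ℓ b t :=
    fun T hT => (hb3 T hT).mono fun t ht => by linarith
  -- The almost-everywhere solution b is replaced by the representative that the equation
  -- prescribes. Its convolution with ℓ is unchanged, so the equation holds at every t > 0.
  refine ⟨fun t => ℓ t - m * cconv ℓ b t, fun T hT => (hb1 T hT).congr (hae T hT), fun t ht => ?_⟩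
  constructor
  · have h1 := ((hb1 t ht).congr (hae t ht)).aestronglyMeasurable
    refine hκ.intervalIntegrable_conv_of_le (C := 1) ht h1 ?_
    filter_upwards [hae t ht, (hκ.ae_bounds hm hb1 hb3 ht).1] with s h2 h3
    rw [← h2, abs_of_nonneg h3.1, one_mul]
    exact h3.2
  · have := cconv_congr_right (a := ℓ) (hae t ht) (⟨ht, le_rfl⟩ : t ∈ Ioc 0 t)
    change cconv ℓ b t = ∫ s in (0 : ℝ)..t, ℓ (t - s) * (ℓ s - m * cconv ℓ b s) at this
    rw [← this]
    ring

variable {m : ℝ}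

theorem IsMemoryKernel.rho2_spec (hκ : IsMemoryKernel κ ℓ) (hm : 0 ≤ m) :
    IsVolterraSolution ℓ ℓ m fun t => rho2 ℓ t m :=
  Classical.epsilon_spec (hκ.exists_volterra hm)

theorem IsMemoryKernel.integrableOn_rho2 (hκ : IsMemoryKernel κ ℓ) (hm : 0 ≤ m) {T : ℝ}
    (hT : 0 < T) : IntegrableOn (fun t => rho2 ℓ t m) (Ioc 0 T) := (hκ.rho2_spec hm).1 T hT

theorem IsMemoryKernel.rho2_eq (hκ : IsMemoryKernel κ ℓ) (hm : 0 ≤ m) {t : ℝ} (ht : 0 < t) :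
    rho2 ℓ t m + m * cconv ℓ (fun s => rho2 ℓ s m) t = ℓ t := ((hκ.rho2_spec hm).2 t ht).2

theorem IsMemoryKernel.rho2_ae_bounds (hκ : IsMemoryKernel κ ℓ) (hm : 0 ≤ m) {T : ℝ}
    (hT : 0 < T) :
    (∀ᵐ t ∂volume.restrict (Ioc 0 T), 0 ≤ rho2 ℓ t m ∧ rho2 ℓ t m ≤ ℓ t) ∧
      ∀ᵐ t ∂volume.restrict (Ioc 0 T),
        cconv κ (fun s => rho2 ℓ s m) t + m * ∫ s in (0 : ℝ)..t, rho2 ℓ s m = 1 :=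
  hκ.ae_bounds hm (hκ.rho2_spec hm).1 (fun T _ => by
    filter_upwards [ae_restrict_mem measurableSet_Ioc] with t ht
    exact hκ.rho2_eq hm ht.1) hT

/-- The almost-everywhere bound is carried to a given t through times s ↓ t with ϱ₂(s) ≥ 0. For such
s, ℓ(t) ≥ ℓ(s) ≥ m (ℓ ⋆ ϱ₂)(s) ≥ m I(s), where I(s) integrates only over (0,t); and I(s) → I(t) = (ℓ
⋆ ϱ₂)(t). -/
theorem IsMemoryKernel.rho2_nonneg (hκ : IsMemoryKernel κ ℓ) (hm : 0 ≤ m) {t : ℝ} (ht : 0 < t) :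
    0 ≤ rho2 ℓ t m := by
  set ρ : ℝ → ℝ := fun t => rho2 ℓ t m with hρ
  have hb := (hκ.rho2_ae_bounds hm (T := t + 1) (by linarith)).1
  have hbt := (hκ.rho2_ae_bounds hm ht).1
  have hint := ((hκ.rho2_spec hm).2 t ht).1
  set I : ℝ → ℝ := fun s => ∫ r in (0 : ℝ)..t, ℓ (s - r) * ρ r with hI
  have hρm : AEStronglyMeasurable ρ (volume.restrict (Ioc 0 t)) :=
    (hκ.integrableOn_rho2 hm ht).aestronglyMeasurable
  have hlim : Tendsto I (𝓝[>] t) (𝓝 (I t)) := by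
    refine intervalIntegral.tendsto_integral_filter_of_dominated_convergence
      (fun r => ℓ (t - r) * ρ r) ?_ ?_ hint ?_
    · filter_upwards [self_mem_nhdsWithin] with s hs
      rw [uIoc_of_le ht.le]
      refine AEStronglyMeasurable.mul ?_ hρm
      refine (aemeasurable_restrict_of_monotoneOn measurableSet_Ioc ?_).aestronglyMeasurable
      intro x hx y hy hxy
      exact hκ.conj_antitone (mem_Ioi.2 (by linarith [hy.2, mem_Ioi.1 hs]))
        (mem_Ioi.2 (by linarith [hx.2, mem_Ioi.1 hs])) (by linarith)
    · filter_upwards [self_mem_nhdsWithin] with s hs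
      rw [ae_restrict_iff' measurableSet_Ioc] at hbt
      rw [uIoc_of_le ht.le]
      have hne : ∀ᵐ r : ℝ, r ≠ t := by simp [ae_iff]
      filter_upwards [hbt, hne] with r h1 h2 hr
      have hrt : r < t := lt_of_le_of_ne hr.2 h2
      have hst := mem_Ioi.1 hs
      rw [Real.norm_eq_abs, abs_of_nonneg
        (mul_nonneg (hκ.conj_nonneg _ (by linarith)) (h1 hr).1)]
      refine mul_le_mul_of_nonneg_right ?_ (h1 hr).1
      exact hκ.conj_antitone (mem_Ioi.2 (by linarith)) (mem_Ioi.2 (by linarith)) (by linarith)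
    · rw [uIoc_of_le ht.le]
      have hne : ∀ᵐ r : ℝ, r ≠ t := by simp [ae_iff]
      -- The monotone function ℓ has at most countably many discontinuities, so ℓ(s - r) → ℓ(t - r)
      -- for almost every r.
      have hc := hκ.conj_antitone.countable_not_continuousWithinAt
      have hc' := (hc.preimage (f := fun r : ℝ => t - r) sub_right_injective).ae_notMem volume
      filter_upwards [hne, hc'] with r h2 h3 hr
      have hrt : 0 < t - r := sub_pos.2 (lt_of_le_of_ne hr.2 h2)
      have h4 : ContinuousWithinAt ℓ (Ioi 0) (t - r) := by
        by_contra h5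
        exact h3 ⟨hrt, h5⟩
      have h5 : ContinuousAt ℓ (t - r) := h4.continuousAt (Ioi_mem_nhds hrt)
      have h6 : Tendsto (fun s => s - r) (𝓝[>] t) (𝓝 (t - r)) :=
        ((continuous_sub_right r).tendsto t).mono_left nhdsWithin_le_nhds
      exact (h5.tendsto.comp h6).mul_const _
  have heq : ρ t = ℓ t - m * I t := by
    have := hκ.rho2_eq hm ht
    rw [cconv] at this
    linarith
  rw [show rho2 ℓ t m = ℓ t - m * I t from heq]
  have hlim' : Tendsto (fun s => ℓ t - m * I s) (𝓝[>] t) (𝓝 (ℓ t - m * I t)) :=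
    (hlim.const_mul m).const_sub _
  refine ge_of_tendsto_of_frequently hlim' ?_
  rw [ae_restrict_iff' measurableSet_Ioc] at hb
  refine ((frequently_nhdsGT_of_ae hb t).and_eventually
    (Ioo_mem_nhdsGT (lt_add_one t))).mono fun s hs => ?_
  obtain ⟨h1, hs1, hs2⟩ := hs
  have h2 := h1 ⟨ht.trans hs1, hs2.le⟩
  have h3 := hκ.rho2_eq hm (ht.trans hs1)
  have h4 : I s ≤ cconv ℓ ρ s := by
    have hints := ((hκ.rho2_spec hm).2 s (ht.trans hs1)).1
    have e1 : IntervalIntegrable (fun r => ℓ (s - r) * ρ r) volume 0 t :=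
      hints.mono_set (by rw [uIcc_of_le ht.le, uIcc_of_le (ht.trans hs1).le];
                         exact Icc_subset_Icc_right hs1.le)
    have e2 : IntervalIntegrable (fun r => ℓ (s - r) * ρ r) volume t s :=
      hints.mono_set (by rw [uIcc_of_le hs1.le, uIcc_of_le (ht.trans hs1).le];
                         exact Icc_subset_Icc_left ht.le)
    rw [cconv, ← intervalIntegral.integral_add_adjacent_intervals e1 e2]
    refine le_add_of_nonneg_right (intervalIntegral.integral_nonneg_of_ae_restrict hs1.le ?_)
    rw [← restrict_Ioc_eq_restrict_Icc, ← restrict_Ioo_eq_restrict_Ioc,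
      EventuallyLE, ae_restrict_iff' measurableSet_Ioo]
    filter_upwards [hb] with r hr hrs
    exact mul_nonneg (hκ.conj_nonneg _ (by linarith [hrs.2]))
      (hr ⟨ht.trans hrs.1, by linarith [hrs.2]⟩).1
  have h5 : ℓ s ≤ ℓ t := hκ.conj_antitone (mem_Ioi.2 ht) (mem_Ioi.2 (ht.trans hs1)) hs1.le
  have h6 := h2.1
  nlinarith

theorem IsMemoryKernel.rho2_le (hκ : IsMemoryKernel κ ℓ) (hm : 0 ≤ m) {t : ℝ} (ht : 0 < t) :
    rho2 ℓ t m ≤ ℓ t := by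
  have h1 := hκ.rho2_eq hm ht
  have h2 : 0 ≤ cconv ℓ (fun s => rho2 ℓ s m) t := by
    refine intervalIntegral.integral_nonneg_of_ae_restrict ht.le ?_
    rw [← restrict_Ioc_eq_restrict_Icc, ← restrict_Ioo_eq_restrict_Ioc]
    filter_upwards [ae_restrict_mem measurableSet_Ioo] with s hs
    exact mul_nonneg (hκ.conj_nonneg _ (by linarith [hs.2])) (hκ.rho2_nonneg hm hs.1)
  nlinarith

theorem IsMemoryKernel.intervalIntegrable_rho2 (hκ : IsMemoryKernel κ ℓ) (hm : 0 ≤ m) {t : ℝ}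
    (ht : 0 ≤ t) : IntervalIntegrable (fun s => rho2 ℓ s m) volume 0 t := by
  rw [intervalIntegrable_iff_integrableOn_Ioc_of_le ht]
  rcases eq_or_lt_of_le ht with rfl | ht
  · simp
  · exact hκ.integrableOn_rho2 hm ht

/-- `ϱ₁ = 1 - μ (1 ⋆ ϱ₂)` solves its Volterra equation. -/
theorem IsMemoryKernel.rho1_aux (hκ : IsMemoryKernel κ ℓ) (hm : 0 ≤ m) :
    IsVolterraSolution ℓ (fun _ => 1) m fun t => 1 - m * ∫ s in (0 : ℝ)..t, rho2 ℓ s m := by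
  set r : ℝ → ℝ := fun t => 1 - m * ∫ s in (0 : ℝ)..t, rho2 ℓ s m with hr
  have hcont : ∀ T > 0, ContinuousOn r (Icc 0 T) := by
    intro T hT
    have : ContinuousOn (fun t => ∫ s in (0 : ℝ)..t, rho2 ℓ s m) (uIcc 0 T) :=
      intervalIntegral.continuousOn_primitive_interval
        (by rw [uIcc_of_le hT.le, integrableOn_Icc_iff_integrableOn_Ioc]
            exact hκ.integrableOn_rho2 hm hT)
    rw [uIcc_of_le hT.le] at this
    exact continuousOn_const.sub (this.const_mul m)
  have hl : ∀ t > 0, IntervalIntegrable (fun s => ℓ (t - s)) volume 0 t := fun t ht => by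
    simpa using (((intervalIntegrable_iff_integrableOn_Ioc_of_le ht.le).2
      (hκ.conj_integrable t ht)).comp_sub_left t).symm
  have hV : ∀ t > 0, IntervalIntegrable
      (fun s => ℓ (t - s) * ∫ r in (0 : ℝ)..s, rho2 ℓ r m) volume 0 t := by
    intro t ht
    refine (hl t ht).mul_continuousOn ?_
    exact intervalIntegral.continuousOn_primitive_interval
        (by rw [uIcc_of_le ht.le, integrableOn_Icc_iff_integrableOn_Ioc]
            exact hκ.integrableOn_rho2 hm ht)
  refine ⟨fun T hT => ((hcont T hT).integrableOn_Icc).mono_set Ioc_subset_Icc_self,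
    fun t ht => ⟨(hl t ht).mul_continuousOn
      (by rw [uIcc_of_le ht.le]; exact hcont t ht), ?_⟩⟩
  have e1 : ∫ s in (0 : ℝ)..t, ℓ (t - s) * r s = (∫ s in (0 : ℝ)..t, ℓ s) -
      m * ∫ s in (0 : ℝ)..t, ℓ (t - s) * ∫ r in (0 : ℝ)..s, rho2 ℓ r m := by
    have : ∀ s, ℓ (t - s) * r s =
        ℓ (t - s) - m * (ℓ (t - s) * ∫ r in (0 : ℝ)..s, rho2 ℓ r m) := fun s => by
      rw [hr]; ring
    simp_rw [this]
    rw [intervalIntegral.integral_sub (hl t ht) ((hV t ht).const_mul m),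
      intervalIntegral.integral_const_mul]
    congr 1
    simp
  -- A primitive is a convolution with the constant 1, and associativity moves it outside.
  have e2 : ∫ s in (0 : ℝ)..t, ℓ (t - s) * ∫ r in (0 : ℝ)..s, rho2 ℓ r m =
      ∫ s in (0 : ℝ)..t, cconv ℓ (fun s => rho2 ℓ s m) s := by
    have h1 := cconv_assoc_of_bounded (c := 1) (C := 1) ht.le (hκ.conj_integrable t ht)
      (hκ.integrableOn_rho2 hm ht) aestronglyMeasurable_one (by simp)
    rw [cconv_comm _ 1] at h1
    have h2 : cconv (fun t => rho2 ℓ t m) 1 = fun s => ∫ r in (0 : ℝ)..s, rho2 ℓ r m := by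
      ext s
      rw [cconv_comm]
      simp [cconv]
    rw [h2] at h1
    simpa [cconv] using h1
  have hci : IntervalIntegrable (cconv ℓ fun s => rho2 ℓ s m) volume 0 t := by
    rw [intervalIntegrable_iff_integrableOn_Ioc_of_le ht.le]
    exact integrableOn_cconv (hκ.conj_integrable t ht) (hκ.integrableOn_rho2 hm ht)
  have e3 : ∫ s in (0 : ℝ)..t, ℓ s = (∫ s in (0 : ℝ)..t, rho2 ℓ s m) +
      m * ∫ s in (0 : ℝ)..t, cconv ℓ (fun s => rho2 ℓ s m) s := by
    rw [← intervalIntegral.integral_const_mul,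
      ← intervalIntegral.integral_add (hκ.intervalIntegrable_rho2 hm ht.le) (hci.const_mul m)]
    refine intervalIntegral.integral_congr_ae (Eventually.of_forall fun s hs => ?_)
    rw [uIoc_of_le ht.le] at hs
    exact (hκ.rho2_eq hm hs.1).symm
  rw [e1, e2, e3, hr]
  ring

theorem IsMemoryKernel.rho1_spec (hκ : IsMemoryKernel κ ℓ) (hm : 0 ≤ m) :
    IsVolterraSolution ℓ (fun _ => 1) m fun t => rho1 ℓ t m :=
  Classical.epsilon_spec ⟨_, hκ.rho1_aux hm⟩

/-- Solutions that agree almost everywhere have the same convolution with ℓ, and then the equation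
fixes the value at every t > 0. The choice hidden in `Classical.epsilon` therefore does not matter.
-/
theorem IsMemoryKernel.rho1_eq (hκ : IsMemoryKernel κ ℓ) (hm : 0 ≤ m) {t : ℝ} (ht : 0 < t) :
    rho1 ℓ t m = 1 - m * ∫ s in (0 : ℝ)..t, rho2 ℓ s m := by
  have h1 := hκ.rho1_spec hm
  have h2 := hκ.rho1_aux hm
  have h3 : ∀ᵐ s ∂volume.restrict (Ioc 0 t), rho1 ℓ s m =
      1 - m * ∫ r in (0 : ℝ)..s, rho2 ℓ r m :=
    volterra_unique_ae (a := ℓ) (m := m) (g := fun _ => 1) (hκ.conj_integrable t ht) (h1.1 t ht)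
      (h2.1 t ht)
      (by filter_upwards [ae_restrict_mem measurableSet_Ioc] with s hs using (h1.2 s hs.1).2)
      (by filter_upwards [ae_restrict_mem measurableSet_Ioc] with s hs using (h2.2 s hs.1).2)
  have h4 := cconv_congr_right (a := ℓ) h3 (⟨ht, le_rfl⟩ : t ∈ Ioc 0 t)
  have h5 := (h1.2 t ht).2
  have h6 := (h2.2 t ht).2
  unfold cconv at h4
  rw [← h4] at h6
  linarith

theorem IsMemoryKernel.rho1_volterra (hκ : IsMemoryKernel κ ℓ) (hm : 0 ≤ m) {t : ℝ}
    (ht : 0 < t) : rho1 ℓ t m + m * cconv ℓ (fun s => rho1 ℓ s m) t = 1 :=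
  ((hκ.rho1_spec hm).2 t ht).2

theorem IsMemoryKernel.integral_rho2_nonneg (hκ : IsMemoryKernel κ ℓ) (hm : 0 ≤ m) {s t : ℝ}
    (hs : 0 ≤ s) (hst : s ≤ t) : 0 ≤ ∫ r in s..t, rho2 ℓ r m := by
  refine intervalIntegral.integral_nonneg_of_ae_restrict hst ?_
  rw [← restrict_Ioc_eq_restrict_Icc]
  filter_upwards [ae_restrict_mem measurableSet_Ioc] with r hr
  exact hκ.rho2_nonneg hm (hs.trans_lt hr.1)

theorem IsMemoryKernel.rho1_le_one (hκ : IsMemoryKernel κ ℓ) (hm : 0 ≤ m) {t : ℝ} (ht : 0 < t) :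
    rho1 ℓ t m ≤ 1 := by
  rw [hκ.rho1_eq hm ht]
  have := mul_nonneg hm (hκ.integral_rho2_nonneg hm le_rfl ht.le)
  linarith

/-- What has to be seen is that m ∫₀ᵗ ϱ₂ ≤ 1. The integral is nondecreasing in t, and κ ⋆ ϱ₂ + m ∫₀ˢ
ϱ₂ = 1 with nonnegative first term at some later time s. -/
theorem IsMemoryKernel.rho1_nonneg (hκ : IsMemoryKernel κ ℓ) (hm : 0 ≤ m) {t : ℝ} (ht : 0 < t) :
    0 ≤ rho1 ℓ t m := by
  have h1 := (hκ.rho2_ae_bounds hm (T := t + 1) (by linarith)).2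
  rw [ae_restrict_iff' measurableSet_Ioc] at h1
  obtain ⟨s, h2, hs1, hs2⟩ := ((frequently_nhdsGT_of_ae h1 t).and_eventually
    (Ioo_mem_nhdsGT (lt_add_one t))).exists
  have h3 := h2 ⟨ht.trans hs1, hs2.le⟩
  have h4 : 0 ≤ cconv κ (fun s => rho2 ℓ s m) s := by
    refine intervalIntegral.integral_nonneg_of_ae_restrict (ht.trans hs1).le ?_
    rw [← restrict_Ioc_eq_restrict_Icc, ← restrict_Ioo_eq_restrict_Ioc]
    filter_upwards [ae_restrict_mem measurableSet_Ioo] with r hr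
    exact mul_nonneg (hκ.nonneg _ (by linarith [hr.2])) (hκ.rho2_nonneg hm hr.1)
  have h5 := intervalIntegral.integral_add_adjacent_intervals
    (hκ.intervalIntegrable_rho2 hm ht.le)
    ((hκ.intervalIntegrable_rho2 hm ht.le).symm.trans
      (hκ.intervalIntegrable_rho2 hm (ht.trans hs1).le))
  have h6 := mul_nonneg hm (hκ.integral_rho2_nonneg hm ht.le hs1.le)
  rw [hκ.rho1_eq hm ht]
  nlinarith

end Kernel

/-! ### Measurability of `ϱ₁` and `ϱ₂` in both variables -/

/-- A convolution depends only on the classes of its factors. Borel representatives can be inserted,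
and the result is measurable in the strict sense. -/
theorem measurable_cut_cconv {T : ℝ} {a b : ℝ → ℝ}
    (ha : AEStronglyMeasurable a (volume.restrict (Ioc 0 T)))
    (hb : AEStronglyMeasurable b (volume.restrict (Ioc 0 T))) : Measurable (cut T (cconv a b)) := by
  have h1 : cut T (cconv a b) = cut T (cconv (ha.mk a) (hb.mk b)) := by
    unfold cut
    refine indicator_congr fun t ht => ?_
    rw [cconv_congr_right hb.ae_eq_mk ht, cconv_congr_left ha.ae_eq_mk ht]
  rw [h1, cut_cconv]
  refine Measurable.indicator ?_ measurableSet_Ioc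
  have h2 : StronglyMeasurable (Function.uncurry fun t s : ℝ =>
      cut T (ha.mk a) (t - s) * cut T (hb.mk b) s) := by
    have ha' : StronglyMeasurable (cut T (ha.mk a)) :=
      ha.stronglyMeasurable_mk.indicator measurableSet_Ioc
    have hb' : StronglyMeasurable (cut T (hb.mk b)) :=
      hb.stronglyMeasurable_mk.indicator measurableSet_Ioc
    exact (ha'.comp_measurable (measurable_fst.sub measurable_snd)).mul
      (hb'.comp_measurable measurable_snd)
  have h3 := (h2.integral_prod_right (ν := volume)).measurable
  convert h3 using 1
  ext t
  rw [convolution_eq_swap]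
  rfl

theorem measurable_indicator_of_cut {a : ℝ → ℝ} (h : ∀ n : ℕ, Measurable (cut n a)) :
    Measurable (indicator (Ioi 0) a) := by
  refine measurable_of_tendsto_metrizable h (tendsto_pi_nhds.2 fun t => ?_)
  refine tendsto_const_nhds.congr' ?_
  filter_upwards [eventually_ge_atTop ⌈t⌉₊] with n hn
  unfold cut
  have hn' : t ≤ n := (Nat.le_ceil t).trans (by exact_mod_cast hn)
  by_cases ht : 0 < t
  · rw [indicator_of_mem (mem_Ioi.2 ht), indicator_of_mem (show t ∈ Ioc 0 (n : ℝ) from ⟨ht, hn'⟩)]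
  · rw [indicator_of_notMem (show t ∉ Ioi 0 from ht),
      indicator_of_notMem (show t ∉ Ioc 0 (n : ℝ) from fun h => ht h.1)]

theorem measurable_indicator_of_antitoneOn {a : ℝ → ℝ} (ha : AntitoneOn a (Ioi 0))
    (ha0 : ∀ t > 0, 0 ≤ a t) : Measurable (indicator (Ioi 0) a) := by
  refine measurable_of_Ioi fun c => ?_
  by_cases hc : c < 0
  · have : indicator (Ioi 0) a ⁻¹' Ioi c = univ :=
      eq_univ_of_forall fun t => hc.trans_le (indicator_nonneg (fun t ht => ha0 t ht) t)
    rw [this]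
    exact MeasurableSet.univ
  · have : indicator (Ioi 0) a ⁻¹' Ioi c = {t | 0 < t ∧ c < a t} := by
      ext t
      simp only [mem_preimage, mem_Ioi, mem_ofPred_eq]
      by_cases ht : 0 < t
      · rw [indicator_of_mem (mem_Ioi.2 ht)]
        simp [ht]
      · rw [indicator_of_notMem (show t ∉ Ioi 0 from ht)]
        simp [ht, hc]
    rw [this]
    refine OrdConnected.measurableSet ⟨fun x hx y hy z hz => ⟨hx.1.trans_le hz.1, ?_⟩⟩
    exact hy.2.trans_le (ha (mem_Ioi.2 (hx.1.trans_le hz.1)) (mem_Ioi.2 hy.1) hz.2)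

section Kernel

variable {κ ℓ : ℝ → ℝ}

/-- The equation expresses ϱ₂ at every t > 0 through the monotone function ℓ and a convolution,
which removes any doubt about the representative that was chosen. -/
theorem IsMemoryKernel.measurable_rho2_time (hκ : IsMemoryKernel κ ℓ) {m : ℝ} (hm : 0 ≤ m) :
    Measurable (indicator (Ioi 0) fun t => rho2 ℓ t m) := by
  have h1 : indicator (Ioi 0) (fun t => rho2 ℓ t m) = fun t => indicator (Ioi 0) ℓ t -
      m * indicator (Ioi 0) (cconv ℓ fun s => rho2 ℓ s m) t := by
    ext t
    by_cases ht : t ∈ Ioi (0 : ℝ)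
    · simp only [indicator_of_mem ht]
      linarith [hκ.rho2_eq hm ht]
    · simp [indicator_of_notMem ht]
  rw [h1]
  refine (measurable_indicator_of_antitoneOn hκ.conj_antitone hκ.conj_nonneg).sub
    (measurable_const.mul (measurable_indicator_of_cut fun n => ?_))
  rcases Nat.eq_zero_or_pos n with rfl | hn
  · simp only [cut, CharP.cast_eq_zero, Ioc_self, indicator_empty]
    exact measurable_const
  · have hn' : (0 : ℝ) < n := by exact_mod_cast hn
    exact measurable_cut_cconv (hκ.conj_integrable _ hn').aestronglyMeasurable
      (hκ.integrableOn_rho2 hm hn').aestronglyMeasurable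

/-- The resolvent identity for `ϱ₂`. -/
theorem IsMemoryKernel.rho2_sub_rho2 (hκ : IsMemoryKernel κ ℓ) {m n : ℝ} (hm : 0 ≤ m) (hn : 0 ≤ n)
    {T : ℝ} (hT : 0 < T) : ∀ᵐ t ∂volume.restrict (Ioc 0 T), rho2 ℓ t m - rho2 ℓ t n =
      (n - m) * cconv (fun s => rho2 ℓ s m) (fun s => rho2 ℓ s n) t := by
  have hl := hκ.conj_integrable T hT
  have h1 := hκ.integrableOn_rho2 hm hT
  have h2 := hκ.integrableOn_rho2 hn hT
  have h12 := integrableOn_cconv h1 h2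
  -- Both sides solve the equation with parameter m and the right-hand side (n - m) ℓ ⋆ ϱ₂(·; n).
  refine volterra_unique_ae (a := ℓ) (m := m)
    (g := fun t => (n - m) * cconv ℓ (fun s => rho2 ℓ s n) t) hl
    (h1.sub h2) (h12.const_mul _) ?_ ?_
  · filter_upwards [cconv_sub_ae hl h1 h2, ae_restrict_mem measurableSet_Ioc] with t e1 ht
    rw [e1]
    linear_combination hκ.rho2_eq hm ht.1 - hκ.rho2_eq hn ht.1
  · filter_upwards [cconv_assoc_ae hl h1 h2, ae_intervalIntegrable_conv h2 h1,
      ae_intervalIntegrable_conv h2 (integrableOn_cconv hl h1),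
      ae_restrict_mem measurableSet_Ioc] with t e1 e2 e3 ht
    rw [cconv_const_mul, ← e1]
    have e4 : cconv ℓ (fun s => rho2 ℓ s n) t = cconv (fun s => rho2 ℓ s n)
        (fun s => rho2 ℓ s m + m * cconv ℓ (fun s => rho2 ℓ s m) s) t := by
      rw [cconv_comm]
      refine cconv_congr_right (T := T) ?_ ht
      filter_upwards [ae_restrict_mem measurableSet_Ioc] with s hs
      exact (hκ.rho2_eq hm hs.1).symm
    have e5 := cconv_add (a := fun s => rho2 ℓ s n) (b := fun s => rho2 ℓ s m)
      (c := fun s => m * cconv ℓ (fun s => rho2 ℓ s m) s) e2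
      (by simpa only [mul_left_comm] using e3.const_mul m)
    rw [e4, e5, cconv_const_mul, cconv_comm (fun s => rho2 ℓ s n) (fun s => rho2 ℓ s m),
      cconv_comm (fun s => rho2 ℓ s n) (cconv ℓ fun s => rho2 ℓ s m)]
    ring

theorem IsMemoryKernel.abs_rho2_sub_le (hκ : IsMemoryKernel κ ℓ) {m n : ℝ} (hm : 0 ≤ m)
    (hn : 0 ≤ n) {T : ℝ} (hT : 0 < T) : ∀ᵐ t ∂volume.restrict (Ioc 0 T),
      |rho2 ℓ t m - rho2 ℓ t n| ≤ min (2 * ℓ t) (|n - m| * cconv ℓ ℓ t) := by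
  filter_upwards [hκ.rho2_sub_rho2 hm hn hT, ae_restrict_mem measurableSet_Ioc] with t h1 ht
  have a1 := hκ.rho2_nonneg hm ht.1
  have a2 := hκ.rho2_nonneg hn ht.1
  have a3 := hκ.rho2_le hm ht.1
  have a4 := hκ.rho2_le hn ht.1
  refine le_min (abs_le.2 ⟨by linarith, by linarith⟩) ?_
  rw [h1, abs_mul]
  refine mul_le_mul_of_nonneg_left ((abs_cconv_le ht.1.le).trans ?_) (abs_nonneg _)
  refine intervalIntegral.integral_mono_on_of_le_Ioo ht.1.le ?_ ?_ fun s hs => ?_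
  · have := intervalIntegrable_conv_of_antitone hκ.conj_integrable hκ.conj_nonneg
      hκ.conj_antitone ht.1
    rw [intervalIntegrable_iff_integrableOn_Ioo_of_le ht.1.le] at this ⊢
    refine this.mono' ?_ ?_
    · have b1 := (hκ.measurable_rho2_time hm).comp (measurable_const.sub measurable_id :
        Measurable fun s : ℝ => t - s)
      have b2 := hκ.measurable_rho2_time hn
      refine ((b1.abs.mul b2.abs).aestronglyMeasurable (μ := volume.restrict (Ioo 0 t))).congr ?_
      filter_upwards [ae_restrict_mem measurableSet_Ioo] with s hs
      simp only [Pi.mul_apply, Function.comp_apply, Pi.sub_apply]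
      rw [indicator_of_mem (show t - s ∈ Ioi 0 from sub_pos.2 hs.2),
        indicator_of_mem (show s ∈ Ioi 0 from hs.1)]
    · filter_upwards [ae_restrict_mem measurableSet_Ioo] with s hs
      have c1 := hκ.rho2_nonneg hm (sub_pos.2 hs.2)
      have c2 := hκ.rho2_nonneg hn hs.1
      rw [Real.norm_eq_abs, abs_mul, abs_abs, abs_abs, abs_of_nonneg c1, abs_of_nonneg c2]
      exact mul_le_mul (hκ.rho2_le hm (sub_pos.2 hs.2)) (hκ.rho2_le hn hs.1) c2
        (hκ.conj_nonneg _ (sub_pos.2 hs.2))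
  · exact intervalIntegrable_conv_of_antitone hκ.conj_integrable hκ.conj_nonneg
      hκ.conj_antitone ht.1
  · have c1 := hκ.rho2_nonneg hm (sub_pos.2 hs.2)
    have c2 := hκ.rho2_nonneg hn hs.1
    simp only [abs_of_nonneg c1, abs_of_nonneg c2]
    exact mul_le_mul (hκ.rho2_le hm (sub_pos.2 hs.2)) (hκ.rho2_le hn hs.1) c2
        (hκ.conj_nonneg _ (sub_pos.2 hs.2))

/-- By ϱ₂ = ℓ - μ (ℓ ⋆ ϱ₂) it suffices to treat the convolution, for which almost-everywhere
estimates are enough. In `IsMemoryKernel.abs_rho2_sub_le` the bound 2 ℓ provides the domination and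
|n - m| (ℓ ⋆ ℓ) the convergence. The parameter is replaced by its positive part since nothing is
known about negative ones. -/
theorem IsMemoryKernel.continuous_rho2 (hκ : IsMemoryKernel κ ℓ) {t : ℝ} (ht : 0 < t) :
    Continuous fun m : ℝ => rho2 ℓ t (max m 0) := by
  have h1 : (fun m : ℝ => rho2 ℓ t (max m 0)) =
      fun m => ℓ t - max m 0 * cconv ℓ (fun s => rho2 ℓ s (max m 0)) t := by
    ext m
    linarith [hκ.rho2_eq (le_max_right m 0) ht]
  rw [h1]
  refine continuous_const.sub ((continuous_id.max continuous_const).mul ?_)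
  refine continuous_iff_continuousAt.2 fun n => ?_
  rw [ContinuousAt, tendsto_iff_dist_tendsto_zero]
  have hll := intervalIntegrable_conv_of_antitone hκ.conj_integrable hκ.conj_nonneg
    hκ.conj_antitone ht
  have hq : AEStronglyMeasurable (cconv ℓ ℓ) (volume.restrict (Ioc 0 t)) :=
    (integrableOn_cconv (hκ.conj_integrable t ht) (hκ.conj_integrable t ht)).aestronglyMeasurable
  have hq0 : ∀ s ∈ Ioc 0 t, 0 ≤ cconv ℓ ℓ s := fun s hs => by
    refine intervalIntegral.integral_nonneg_of_ae_restrict hs.1.le ?_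
    rw [← restrict_Ioc_eq_restrict_Icc, ← restrict_Ioo_eq_restrict_Ioc]
    filter_upwards [ae_restrict_mem measurableSet_Ioo] with r hr
    exact mul_nonneg (hκ.conj_nonneg _ (by linarith [hr.2])) (hκ.conj_nonneg _ hr.1)
  have hlm : AEStronglyMeasurable ℓ (volume.restrict (Ioc 0 t)) :=
    (hκ.conj_integrable t ht).aestronglyMeasurable
  set G : ℝ → ℝ → ℝ := fun δ s => min (2 * ℓ s) (δ * cconv ℓ ℓ s) with hG
  have hG0 : ∀ δ ≥ 0, ∀ s ∈ Ioc 0 t, 0 ≤ G δ s ∧ G δ s ≤ 2 * ℓ s := fun δ hδ s hs =>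
    ⟨le_min (by linarith [hκ.conj_nonneg s hs.1]) (mul_nonneg hδ (hq0 s hs)), min_le_left _ _⟩
  have hGm : ∀ δ, AEStronglyMeasurable (G δ) (volume.restrict (Ioc 0 t)) := fun δ =>
    (hlm.const_mul 2).inf (hq.const_mul δ)
  have hGi : ∀ δ ≥ 0, IntervalIntegrable (fun s => ℓ (t - s) * G δ s) volume 0 t := by
    intro δ hδ
    refine hκ.intervalIntegrable_conv_of_le (C := 2) ht (hGm δ) ?_
    filter_upwards [ae_restrict_mem measurableSet_Ioc] with s hs
    rw [abs_of_nonneg (hG0 δ hδ s hs).1]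
    exact (hG0 δ hδ s hs).2
  have hGlim : Tendsto (fun δ => cconv ℓ (G δ) t) (𝓝[≥] 0) (𝓝 0) := by
    have : Tendsto (fun δ => cconv ℓ (G δ) t) (𝓝[≥] 0) (𝓝 (∫ s in (0 : ℝ)..t, (0 : ℝ))) := by
      refine intervalIntegral.tendsto_integral_filter_of_dominated_convergence
        (fun s => 2 * (ℓ (t - s) * ℓ s)) ?_ ?_ (hll.const_mul 2) ?_
      · filter_upwards [self_mem_nhdsWithin] with δ hδ
        have := (hGi δ hδ).aestronglyMeasurable
        rwa [uIoc_of_le ht.le]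
      · filter_upwards [self_mem_nhdsWithin] with δ hδ
        rw [uIoc_of_le ht.le]
        have hne : ∀ᵐ r : ℝ, r ≠ t := by simp [ae_iff]
        filter_upwards [hne] with s h2 hs
        have h3 := hκ.conj_nonneg (t - s) (sub_pos.2 (lt_of_le_of_ne hs.2 h2))
        have h4 := hG0 δ hδ s hs
        rw [Real.norm_eq_abs, abs_of_nonneg (mul_nonneg h3 h4.1)]
        nlinarith [h4.2]
      · rw [uIoc_of_le ht.le]
        refine Eventually.of_forall fun s hs => ?_
        have h5 : Tendsto (fun δ => G δ s) (𝓝[≥] 0) (𝓝 (min (2 * ℓ s) (0 * cconv ℓ ℓ s))) := by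
          have : Continuous fun δ => G δ s := by
            simp only [hG]
            fun_prop
          exact (this.tendsto 0).mono_left nhdsWithin_le_nhds
        rw [zero_mul, min_eq_right (by linarith [hκ.conj_nonneg s hs.1])] at h5
        simpa using h5.const_mul (ℓ (t - s))
    simpa using this
  have hδ : Tendsto (fun m : ℝ => |max n 0 - max m 0|) (𝓝 n) (𝓝[≥] 0) := by
    refine tendsto_nhdsWithin_iff.2 ⟨?_, Eventually.of_forall fun m => mem_Ici.2 (abs_nonneg _)⟩
    have : Continuous fun m : ℝ => |max n 0 - max m 0| := by fun_prop
    simpa using this.tendsto n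
  refine squeeze_zero (fun _ => dist_nonneg) (fun m => ?_) (hGlim.comp hδ)
  have i1 := ((hκ.rho2_spec (le_max_right m 0)).2 t ht).1
  have i2 := ((hκ.rho2_spec (le_max_right n 0)).2 t ht).1
  have hle := hκ.abs_rho2_sub_le (le_max_right m 0) (le_max_right n 0) ht
  rw [Real.dist_eq, cconv, cconv, ← intervalIntegral.integral_sub i1 i2]
  refine (intervalIntegral.abs_integral_le_integral_abs ht.le).trans ?_
  refine intervalIntegral.integral_mono_ae_restrict ht.le (i1.sub i2).abs
    (hGi _ (abs_nonneg _)) ?_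
  rw [← restrict_Ioc_eq_restrict_Icc, ← restrict_Ioo_eq_restrict_Ioc]
  rw [← restrict_Ioo_eq_restrict_Ioc] at hle
  filter_upwards [hle, ae_restrict_mem measurableSet_Ioo] with s h6 hs
  have h7 := hκ.conj_nonneg (t - s) (sub_pos.2 hs.2)
  rw [← mul_sub, abs_mul, abs_of_nonneg h7]
  exact mul_le_mul_of_nonneg_left h6 h7

/-- A Carathéodory function, continuous in the parameter and measurable in time, is jointly
measurable. -/
theorem IsMemoryKernel.stronglyMeasurable_rho2 (hκ : IsMemoryKernel κ ℓ) :
    StronglyMeasurable fun p : ℝ × ℝ =>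
      indicator (Ioi 0) (fun t => rho2 ℓ t (max p.1 0)) p.2 := by
  refine stronglyMeasurable_uncurry_of_continuous_of_stronglyMeasurable
    (u := fun m t => indicator (Ioi 0) (fun t => rho2 ℓ t (max m 0)) t) (fun t => ?_) fun m =>
      (hκ.measurable_rho2_time (le_max_right m 0)).stronglyMeasurable
  by_cases ht : t ∈ Ioi (0 : ℝ)
  · simp only [indicator_of_mem ht]
    exact hκ.continuous_rho2 ht
  · simp only [indicator_of_notMem ht]
    exact continuous_const

theorem IsMemoryKernel.stronglyMeasurable_rho1 (hκ : IsMemoryKernel κ ℓ) :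
    StronglyMeasurable fun p : ℝ × ℝ =>
      indicator (Ioi 0) (fun t => rho1 ℓ t (max p.1 0)) p.2 := by
  have h1 : StronglyMeasurable fun p : ℝ × ℝ => ∫ s, indicator (Iic p.2)
      (fun s => indicator (Ioi 0) (fun t => rho2 ℓ t (max p.1 0)) s) s := by
    have h2 : StronglyMeasurable fun q : (ℝ × ℝ) × ℝ =>
        indicator {q : (ℝ × ℝ) × ℝ | q.2 ≤ q.1.2}
          (fun q => indicator (Ioi 0) (fun t => rho2 ℓ t (max q.1.1 0)) q.2) q := by
      refine StronglyMeasurable.indicator ?_ (measurableSet_le (by fun_prop) (by fun_prop))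
      exact hκ.stronglyMeasurable_rho2.comp_measurable
        (g := fun q : (ℝ × ℝ) × ℝ => (q.1.1, q.2)) (by fun_prop)
    exact h2.integral_prod_right (ν := volume)
  have h3 : StronglyMeasurable fun p : ℝ × ℝ => indicator {p : ℝ × ℝ | 0 < p.2}
      (fun p => 1 - max p.1 0 * ∫ s, indicator (Iic p.2)
      (fun s => indicator (Ioi 0) (fun t => rho2 ℓ t (max p.1 0)) s) s) p := by
    refine StronglyMeasurable.indicator (stronglyMeasurable_const.sub (StronglyMeasurable.mul ?_ h1))
      (measurableSet_lt (by fun_prop) (by fun_prop))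
    exact (by fun_prop : Continuous fun p : ℝ × ℝ => max p.1 0).stronglyMeasurable
  convert h3 using 1
  ext p
  by_cases hp : 0 < p.2
  · rw [indicator_of_mem (mem_Ioi.2 hp), indicator_of_mem (show p ∈ {p : ℝ × ℝ | 0 < p.2} from hp),
      hκ.rho1_eq (le_max_right _ _) hp, intervalIntegral.integral_of_le hp.le,
      integral_indicator measurableSet_Iic, integral_indicator measurableSet_Ioi,
      Measure.restrict_restrict measurableSet_Ioi]
    rfl
  · rw [indicator_of_notMem (show p.2 ∉ Ioi 0 from hp),
      indicator_of_notMem (show p ∉ {p : ℝ × ℝ | 0 < p.2} from hp)]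

/-! ### Representation and comparison for Volterra equations with constant coefficients -/

theorem intervalIntegrable_conv_of_bounded {a h : ℝ → ℝ} {t C : ℝ} (ht : 0 ≤ t)
    (ha : IntegrableOn a (Ioc 0 t)) (hh : AEStronglyMeasurable h (volume.restrict (Ioc 0 t)))
    (hC : ∀ s ∈ Ioo 0 t, |h s| ≤ C) :
    IntervalIntegrable (fun s => a (t - s) * h s) volume 0 t := by
  have h1 : IntervalIntegrable (fun s => a (t - s)) volume 0 t := by
    simpa using (((intervalIntegrable_iff_integrableOn_Ioc_of_le ht).2 ha).comp_sub_left t).symm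
  rw [← restrict_Ioo_eq_restrict_Ioc] at hh
  rw [intervalIntegrable_iff_integrableOn_Ioo_of_le ht] at h1 ⊢
  refine (h1.norm.mul_const C).mono' (h1.aestronglyMeasurable.mul hh) ?_
  filter_upwards [ae_restrict_mem measurableSet_Ioo] with s hs
  rw [norm_mul]
  exact mul_le_mul_of_nonneg_left (hC s hs) (norm_nonneg _)

theorem integrableOn_of_bounded {h : ℝ → ℝ} {T C : ℝ}
    (hh : AEStronglyMeasurable h (volume.restrict (Ioc 0 T)))
    (hC : ∀ s ∈ Ioo 0 T, |h s| ≤ C) : IntegrableOn h (Ioc 0 T) := by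
  rw [IntegrableOn, ← restrict_Ioo_eq_restrict_Ioc] at *
  refine (integrable_const C).mono' hh ?_
  filter_upwards [ae_restrict_mem measurableSet_Ioo] with s hs using hC s hs

/-- Solutions of `y + c (ℓ ⋆ y) = A + ℓ ⋆ h` are given by `y = A ϱ₁ + ϱ₂ ⋆ h`. -/
theorem IsMemoryKernel.volterra_repr (hκ : IsMemoryKernel κ ℓ) {c A C T : ℝ} {y h : ℝ → ℝ}
    (hc : 0 ≤ c) (hy : IntegrableOn y (Ioc 0 T))
    (hh : AEStronglyMeasurable h (volume.restrict (Ioc 0 T)))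
    (hC : ∀ s ∈ Ioo 0 T, |h s| ≤ C)
    (heq : ∀ t ∈ Ioo 0 T, y t + c * cconv ℓ y t = A + cconv ℓ h t) :
    ∀ t ∈ Ioo 0 T, y t = A * rho1 ℓ t c + cconv (fun s => rho2 ℓ s c) h t := by
  intro t₀ ht₀
  have hT : 0 < T := ht₀.1.trans ht₀.2
  set ρ : ℝ → ℝ := fun s => rho2 ℓ s c with hρ
  set Y : ℝ → ℝ := fun t => A * rho1 ℓ t c + cconv ρ h t with hY
  have hhi := integrableOn_of_bounded hh hC
  have hρi := hκ.integrableOn_rho2 hc hT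
  have hYi : IntegrableOn Y (Ioc 0 T) :=
    (((hκ.rho1_spec hc).1 T hT).const_mul A).add (integrableOn_cconv hρi hhi)
  have hYeq : ∀ t ∈ Ioo 0 T, Y t + c * cconv ℓ Y t = A + cconv ℓ h t := by
    intro t ht
    have hsub : Ioc 0 t ⊆ Ioc 0 T := Ioc_subset_Ioc_right ht.2.le
    have hli := hκ.conj_integrable t ht.1
    have hρi' := hκ.integrableOn_rho2 hc ht.1
    have hh' := hh.mono_measure (Measure.restrict_mono_set volume hsub)
    have hC' : ∀ s ∈ Ioo 0 t, |h s| ≤ C := fun s hs => hC s ⟨hs.1, hs.2.trans ht.2⟩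
    have hC0 : 0 ≤ C := (abs_nonneg _).trans (hC' (t / 2) ⟨by linarith [ht.1], by linarith [ht.1]⟩)
    have i1 := ((hκ.rho1_spec hc).2 t ht.1).1
    have i2 : IntervalIntegrable (fun s => ℓ (t - s) * cconv ρ h s) volume 0 t := by
      refine intervalIntegrable_conv_of_bounded (C := C * ∫ s in (0 : ℝ)..t, ρ s) ht.1.le hli
        (integrableOn_cconv hρi' (integrableOn_of_bounded hh' hC')).aestronglyMeasurable
        fun s hs => ?_
      rw [cconv_comm]
      have j1 := hκ.intervalIntegrable_rho2 hc hs.1.le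
      have j2 := intervalIntegral.integral_add_adjacent_intervals j1
        (j1.symm.trans (hκ.intervalIntegrable_rho2 hc ht.1.le))
      have j3 := hκ.integral_rho2_nonneg hc hs.1.le hs.2.le
      have j4 : |cconv h ρ s| ≤ ∫ r in (0 : ℝ)..s, C * ρ r := by
        rw [← Real.norm_eq_abs]
        refine intervalIntegral.norm_integral_le_of_norm_le hs.1.le ?_ (j1.const_mul C)
        have hne : ∀ᵐ r : ℝ, r ≠ s := by simp [ae_iff]
        filter_upwards [hne] with r h2 hr
        have hrs : r < s := lt_of_le_of_ne hr.2 h2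
        have h3 := hκ.rho2_nonneg hc hr.1
        rw [Real.norm_eq_abs, abs_mul, abs_of_nonneg h3]
        exact mul_le_mul_of_nonneg_right
          (hC _ ⟨sub_pos.2 hrs, by linarith [hr.1, hs.2, ht.2]⟩) h3
      refine j4.trans ?_
      rw [intervalIntegral.integral_const_mul]
      exact mul_le_mul_of_nonneg_left (by simp only [hρ]; linarith) hC0
    have e1 : cconv ℓ Y t = A * cconv ℓ (fun s => rho1 ℓ s c) t + cconv ℓ (cconv ρ h) t := by
      rw [hY, cconv_add _ i2, cconv_const_mul]
      simpa only [mul_left_comm] using i1.const_mul A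
    have e2 := cconv_assoc_of_bounded ht.1.le hli hρi'
      (hh'.mono_measure (Measure.restrict_mono_set volume Ioo_subset_Ioc_self)) hC'
    -- The ϱ₂-equation convolved with h.
    have e3 : cconv ℓ h t = cconv ρ h t + c * cconv (cconv ℓ ρ) h t := by
      rw [cconv_comm (cconv ℓ ρ), cconv_comm ρ, ← cconv_const_mul, ← cconv_add, cconv_comm ℓ]
      · refine cconv_congr_right (T := T) ?_ ⟨ht.1, ht.2.le⟩
        filter_upwards [ae_restrict_mem measurableSet_Ioc] with s hs
        exact (hκ.rho2_eq hc hs.1).symm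
      · simpa [mul_comm] using (intervalIntegrable_conv_of_bounded ht.1.le hρi' hh'
          hC').comp_sub_left t |>.symm
      · have := (intervalIntegrable_conv_of_bounded ht.1.le (integrableOn_cconv hli hρi') hh'
          hC').comp_sub_left t |>.symm
        simp only [sub_sub_cancel, sub_self, sub_zero] at this
        simpa [mul_comm, mul_left_comm] using this.const_mul c
    have e4 := hκ.rho1_volterra hc ht.1
    rw [e1, e2, e3, hY]
    linear_combination A * e4
  have hae : ∀ {z : ℝ → ℝ}, (∀ t ∈ Ioo 0 T, z t + c * cconv ℓ z t = A + cconv ℓ h t) →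
      ∀ᵐ t ∂volume.restrict (Ioc 0 T), z t + c * cconv ℓ z t = A + cconv ℓ h t := by
    intro z hz
    rw [← restrict_Ioo_eq_restrict_Ioc]
    filter_upwards [ae_restrict_mem measurableSet_Ioo] with t ht using hz t ht
  -- Equality almost everywhere gives equal convolutions with ℓ at t₀, and then the two pointwise
  -- equations give equality at t₀ itself.
  have huniq := volterra_unique_ae (hκ.conj_integrable T hT) hy hYi (hae heq) (hae hYeq)
  have h1 := cconv_congr_right (a := ℓ) huniq (⟨ht₀.1, ht₀.2.le⟩ : t₀ ∈ Ioc 0 T)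
  have h2 := heq t₀ ht₀
  have h3 := hYeq t₀ ht₀
  rw [h1] at h2
  linarith

/-- A comparison principle by iteration: a bounded function `n` that satisfies the bound
`M₀ ϱ₁ + ϱ₂ ⋆ (M₁ + c β)` for each of its continuous bounds `β` is bounded by
`M₀ + M₁ ∫₀ᵗ ℓ`. -/
theorem IsMemoryKernel.comparison (hκ : IsMemoryKernel κ ℓ) {c M₀ M₁ K T : ℝ} {n : ℝ → ℝ≥0∞}
    (hc : 0 ≤ c) (hM₀ : 0 ≤ M₀) (hM₁ : 0 ≤ M₁) (hK0 : 0 ≤ K)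
    (hK : ∀ t ∈ Ioo 0 T, n t ≤ ENNReal.ofReal K)
    (hstep : ∀ β : ℝ → ℝ, ContinuousOn β (Icc 0 T) → (∀ t ∈ Icc 0 T, 0 ≤ β t) →
      (∀ t ∈ Ioo 0 T, n t ≤ ENNReal.ofReal (β t)) →
      ∀ t ∈ Ioo 0 T, n t ≤ ENNReal.ofReal
        (M₀ * rho1 ℓ t c + cconv (fun s => rho2 ℓ s c) (fun s => M₁ + c * β s) t)) :
    ∀ t ∈ Ioo 0 T, n t ≤ ENNReal.ofReal (M₀ + M₁ * ∫ s in (0 : ℝ)..t, ℓ s) := by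
  intro t₀ ht₀
  have hT : 0 < T := ht₀.1.trans ht₀.2
  obtain ⟨r, hr0, hr⟩ := exists_exp_weight (hκ.conj_integrable T hT) c (one_half_pos (α := ℝ))
  set L : ℝ → ℝ := fun t => ∫ s in (0 : ℝ)..t, ℓ s with hL
  have hLc : ContinuousOn L (Icc 0 T) := by
    have : ContinuousOn L (uIcc 0 T) :=
      intervalIntegral.continuousOn_primitive_interval
        (by rw [uIcc_of_le hT.le, integrableOn_Icc_iff_integrableOn_Ioc]
            exact hκ.conj_integrable T hT)
    rwa [uIcc_of_le hT.le] at this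
  have hL0 : ∀ t ∈ Icc 0 T, 0 ≤ L t := fun t ht => by
    refine intervalIntegral.integral_nonneg_of_ae_restrict ht.1 ?_
    rw [← restrict_Ioc_eq_restrict_Icc]
    filter_upwards [ae_restrict_mem measurableSet_Ioc] with s hs using hκ.conj_nonneg s hs.1
  set y : ℝ → ℝ := fun t => M₀ + M₁ * L t with hy
  have hyc : ContinuousOn y (Icc 0 T) := continuousOn_const.add (continuousOn_const.mul hLc)
  have hyi : IntegrableOn y (Ioc 0 T) := hyc.integrableOn_Icc.mono_set Ioc_subset_Icc_self
  have hy0 : ∀ t ∈ Icc 0 T, 0 ≤ y t := fun t ht => by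
    have := hL0 t ht
    positivity
  have hyh : ContinuousOn (fun s => M₁ + c * y s) (Icc 0 T) :=
    continuousOn_const.add (continuousOn_const.mul hyc)
  have hIm : ∀ {g : ℝ → ℝ}, ContinuousOn g (Icc 0 T) →
      AEStronglyMeasurable g (volume.restrict (Ioc 0 T)) := fun hg =>
    (hg.mono Ioc_subset_Icc_self).aestronglyMeasurable measurableSet_Ioc
  have hIb : ∀ {g : ℝ → ℝ}, ContinuousOn g (Icc 0 T) → ∃ C, ∀ s ∈ Ioo 0 T, |g s| ≤ C := by
    intro g hg
    obtain ⟨C, hC⟩ := isCompact_Icc.exists_bound_of_continuousOn hg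
    exact ⟨C, fun s hs => hC s (Ioo_subset_Icc_self hs)⟩
  have hconv : ∀ {a g : ℝ → ℝ}, (∀ T > 0, IntegrableOn a (Ioc 0 T)) → ContinuousOn g (Icc 0 T) →
      ∀ t ∈ Ioo 0 T, IntervalIntegrable (fun s => a (t - s) * g s) volume 0 t := by
    intro a g ha hg t ht
    obtain ⟨C, hC⟩ := hIb hg
    exact intervalIntegrable_conv_of_bounded ht.1.le (ha t ht.1) ((hIm hg).mono_measure
      (Measure.restrict_mono_set volume (Ioc_subset_Ioc_right ht.2.le)))
      fun s hs => hC s ⟨hs.1, hs.2.trans ht.2⟩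
  -- The function y trivially satisfies y + c (ℓ ⋆ y) = M₀ + ℓ ⋆ (M₁ + c y), so it is a fixed point
  -- of the map that improves the bounds.
  have hrepr : ∀ t ∈ Ioo 0 T, y t =
      M₀ * rho1 ℓ t c + cconv (fun s => rho2 ℓ s c) (fun s => M₁ + c * y s) t := by
    obtain ⟨C, hC⟩ := hIb hyh
    refine hκ.volterra_repr hc hyi (hIm hyh) hC fun t ht => ?_
    have hlt := hconv hκ.conj_integrable hyc t ht
    have h1 := cconv_add (a := ℓ) (b := fun _ => M₁) (c := fun s => c * y s)
      (hconv hκ.conj_integrable continuousOn_const t ht)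
      (by simpa only [mul_left_comm] using hlt.const_mul c)
    rw [h1, cconv_const_mul]
    have : cconv ℓ (fun _ => M₁) t = M₁ * L t := by
      rw [cconv, intervalIntegral.integral_mul_const, mul_comm, hL]
      simp
    rw [this, hy]
    ring
  -- The excess over y is halved at each step when it is measured with the weight e^{rt}. Only the
  -- continuous majorants are iterated, so n needs no measurability.
  have hiter : ∀ j : ℕ, ∀ t ∈ Ioo 0 T,
      n t ≤ ENNReal.ofReal (y t + K * (1 / 2) ^ j * Real.exp (r * t)) := by
    intro j
    induction j with
    | zero =>
      intro t ht
      refine (hK t ht).trans (ENNReal.ofReal_le_ofReal ?_)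
      have h1 := hy0 t (Ioo_subset_Icc_self ht)
      have h2 : 1 ≤ Real.exp (r * t) := Real.one_le_exp (mul_nonneg hr0.le ht.1.le)
      nlinarith
    | succ j ih =>
      intro t ht
      have hec : ContinuousOn (fun s => K * (1 / 2) ^ j * Real.exp (r * s)) (Icc 0 T) := by
        fun_prop
      refine (hstep _ (hyc.add hec) (fun s hs => ?_) ih t ht).trans (ENNReal.ofReal_le_ofReal ?_)
      · exact add_nonneg (hy0 s hs) (by positivity)
      · have h1 : cconv (fun s => rho2 ℓ s c)
            (fun s => M₁ + c * (y s + K * (1 / 2) ^ j * Real.exp (r * s))) t =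
            cconv (fun s => rho2 ℓ s c) (fun s => M₁ + c * y s) t +
              cconv (fun s => rho2 ℓ s c) (fun s => c * (K * (1 / 2) ^ j) * Real.exp (r * s)) t := by
          have h0 := cconv_add (a := fun s => rho2 ℓ s c) (b := fun s => M₁ + c * y s)
            (c := fun s => c * (K * (1 / 2) ^ j) * Real.exp (r * s))
            (hconv (hκ.rho2_spec hc).1 hyh t ht)
            (hconv (a := fun s => rho2 ℓ s c) (hκ.rho2_spec hc).1 (by fun_prop) t ht)
          rw [← h0]
          congr 1
          ext s
          ring
        simp only [Pi.add_apply]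
        rw [h1, ← add_assoc, ← hrepr t ht, cconv_const_mul]
        -- Because 0 ≤ ϱ₂ ≤ ℓ, the weighted norm of ϱ₂ is at most that of ℓ, for which r was chosen.
        have h2 : cconv (fun s => rho2 ℓ s c) (fun s => Real.exp (r * s)) t ≤
            Real.exp (r * t) * ∫ s in Ioc 0 T, |Real.exp (-(r * s)) * ℓ s| := by
          rw [cconv_comm, cconv, ← integral_const_mul, intervalIntegral.integral_of_le ht.1.le]
          have hwi : IntegrableOn (fun s => Real.exp (r * t) * |Real.exp (-(r * s)) * ℓ s|)
              (Ioc 0 T) := (integrableOn_exp_mul (hκ.conj_integrable T hT) r).abs.const_mul _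
          refine (setIntegral_mono_on ?_ (hwi.mono_set (Ioc_subset_Ioc_right ht.2.le))
            measurableSet_Ioc fun s hs => ?_).trans (setIntegral_mono_set hwi ?_ ?_)
          · have := (hconv (hκ.rho2_spec hc).1 (g := fun s => Real.exp (r * s))
              (by fun_prop) t ht).comp_sub_left t |>.symm
            simp only [sub_sub_cancel, sub_self, sub_zero] at this
            rw [intervalIntegrable_iff_integrableOn_Ioc_of_le ht.1.le] at this
            simpa only [mul_comm] using this
          · have h3 := hκ.rho2_nonneg hc hs.1
            have h4 := hκ.rho2_le hc hs.1
            rw [abs_of_nonneg (mul_nonneg (Real.exp_pos _).le (h3.trans h4)), ← mul_assoc,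
              ← Real.exp_add]
            have : r * t + -(r * s) = r * (t - s) := by ring
            rw [this]
            gcongr
          · exact Eventually.of_forall fun s => by simp only [Pi.zero_apply]; positivity
          · exact (Ioc_subset_Ioc_right ht.2.le).eventuallyLE
        have h5 : 0 ≤ K * (1 / 2) ^ j := by positivity
        have h6 := Real.exp_pos (r * t)
        calc y t + c * (K * (1 / 2) ^ j) * cconv (fun s => rho2 ℓ s c) (fun s => Real.exp (r * s)) t
            ≤ y t + c * (K * (1 / 2) ^ j) *
                (Real.exp (r * t) * ∫ s in Ioc 0 T, |Real.exp (-(r * s)) * ℓ s|) := by gcongr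
          _ = y t + (K * (1 / 2) ^ j) * Real.exp (r * t) *
                (c * ∫ s in Ioc 0 T, |Real.exp (-(r * s)) * ℓ s|) := by ring
          _ ≤ y t + (K * (1 / 2) ^ j) * Real.exp (r * t) * (1 / 2) := by gcongr
          _ = _ := by ring
  have hlim : Tendsto (fun j : ℕ => ENNReal.ofReal (y t₀ + K * (1 / 2) ^ j * Real.exp (r * t₀)))
      atTop (𝓝 (ENNReal.ofReal (y t₀ + K * 0 * Real.exp (r * t₀)))) :=
    ENNReal.tendsto_ofReal (((tendsto_pow_atTop_nhds_zero_of_lt_one (by norm_num)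
      (by norm_num)).const_mul K).mul_const _ |>.const_add _)
  simp only [mul_zero, zero_mul, add_zero] at hlim
  exact ge_of_tendsto' hlim fun j => hiter j t₀ ht₀

end Kernel

/-! ### The symmetric form of the diffusion operator -/

variable {N : ℕ}

/-- The second difference `2 w(x) - w(x + z) - w(x - z)`. -/
def secDiff (w : Space N → ℝ) (x z : Space N) : ℝ := 2 * w x - w (x + z) - w (x - z)

/-- The diffusion operator in symmetric form, `½ ∫ (2 w(x) - w(x + z) - w(x - z)) K(z) dz`. -/
def symOp (K : Space N → ℝ) (w : Space N → ℝ) (x : Space N) : ℝ :=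
  1 / 2 * ∫ z, secDiff w x z * K z

/-- A nonnegative even kernel with `∫ min {1, |z|²} K(z) dz < ∞`. -/
structure IsSymmKernel (K : Space N → ℝ) : Prop where
  aesm : AEStronglyMeasurable K
  nonneg : ∀ z, 0 ≤ K z
  even : ∀ z, K (-z) = K z
  integrable : Integrable fun z => min 1 (‖z‖ ^ 2) * K z

/-- Only the product with the weight min {1, |z|²} is known to be measurable. Division by the weight
is possible off the origin, a null set because N ≥ 1. -/
theorem IsLevyKernel.isSymmKernel (hN : 1 ≤ N) {J : Space N → ℝ} (hJ : IsLevyKernel J) :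
    IsSymmKernel J := by
  refine ⟨?_, hJ.nonneg, fun z => hJ.radial _ _ (norm_neg z), hJ.integrable⟩
  have : Nonempty (Fin N) := ⟨⟨0, hN⟩⟩
  have h1 : AEStronglyMeasurable fun z : Space N =>
      (min 1 (‖z‖ ^ 2))⁻¹ * (min 1 (‖z‖ ^ 2) * J z) :=
    AEStronglyMeasurable.mul
      (by fun_prop : Measurable fun z : Space N => (min 1 (‖z‖ ^ 2))⁻¹).aestronglyMeasurable
      hJ.integrable.aestronglyMeasurable
  refine h1.congr ?_
  have h2 : ∀ᵐ z : Space N, z ≠ 0 := by simp [ae_iff]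
  filter_upwards [h2] with z hz
  have : 0 < min 1 (‖z‖ ^ 2) := lt_min one_pos (by positivity)
  field_simp

theorem IsSymmKernel.restrict_norm {K : Space N → ℝ} (hK : IsSymmKernel K) {S : Set ℝ}
    (hS : MeasurableSet S) : IsSymmKernel (indicator {z | ‖z‖ ∈ S} K) := by
  have hS' : MeasurableSet {z : Space N | ‖z‖ ∈ S} := measurable_norm hS
  refine ⟨hK.aesm.indicator hS', fun z => indicator_nonneg (fun z _ => hK.nonneg z) z,
    fun z => ?_, ?_⟩
  · by_cases hz : ‖z‖ ∈ S
    · rw [indicator_of_mem (show -z ∈ {z : Space N | ‖z‖ ∈ S} by simpa using hz),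
        indicator_of_mem (show z ∈ {z : Space N | ‖z‖ ∈ S} from hz), hK.even]
    · rw [indicator_of_notMem (show -z ∉ {z : Space N | ‖z‖ ∈ S} by simpa using hz),
        indicator_of_notMem (show z ∉ {z : Space N | ‖z‖ ∈ S} from hz)]
  · refine (hK.integrable.indicator hS').congr (Eventually.of_forall fun z => ?_)
    by_cases hz : z ∈ {z : Space N | ‖z‖ ∈ S}
    · simp only [indicator_of_mem hz]
    · simp only [indicator_of_notMem hz, mul_zero]

/-- For |z| ≤ 1 this is the mean value inequality for y ↦ w(x + y) + w(x - y), whose derivative is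
at most 2C|y|; for |z| ≥ 1 the bound of w suffices. -/
theorem abs_secDiff_le {w : Space N → ℝ} {x z : Space N} {C M : ℝ} (hC : 0 ≤ C)
    (hw : Differentiable ℝ w)
    (hL : ∀ a ∈ Metric.closedBall x 1, ∀ b ∈ Metric.closedBall x 1,
      ‖fderiv ℝ w a - fderiv ℝ w b‖ ≤ C * ‖a - b‖)
    (hM : ∀ y, |w y| ≤ M) : |secDiff w x z| ≤ (2 * C + 4 * M) * min 1 (‖z‖ ^ 2) := by
  have hM0 : 0 ≤ M := (abs_nonneg _).trans (hM 0)
  rcases le_total ‖z‖ 1 with h | h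
  · rw [min_eq_right (pow_le_one₀ (norm_nonneg _) h)]
    have hd : ∀ y ∈ Metric.closedBall (0 : Space N) ‖z‖,
        HasFDerivWithinAt (fun y => w (x + y) + w (x - y))
          (fderiv ℝ w (x + y) - fderiv ℝ w (x - y)) (Metric.closedBall (0 : Space N) ‖z‖) y := by
      intro y _
      have h1 := ((hw (x + y)).hasFDerivAt.comp y ((hasFDerivAt_id y).const_add x))
      have h2 := ((hw (x - y)).hasFDerivAt.comp y ((hasFDerivAt_id y).const_sub x))
      refine ((h1.add h2).congr_fderiv ?_).hasFDerivWithinAt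
      ext v
      simp [sub_eq_add_neg]
    have hb : ∀ y ∈ Metric.closedBall (0 : Space N) ‖z‖,
        ‖fderiv ℝ w (x + y) - fderiv ℝ w (x - y)‖ ≤ 2 * C * ‖z‖ := by
      intro y hy
      rw [mem_closedBall_zero_iff] at hy
      refine (hL _ (by simp; linarith) _ (by simp; linarith)).trans ?_
      have : x + y - (x - y) = (2 : ℝ) • y := by
        rw [two_smul]; abel
      rw [this, norm_smul, Real.norm_ofNat]
      nlinarith
    have := (convex_closedBall (0 : Space N) ‖z‖).norm_image_sub_le_of_norm_hasFDerivWithin_le hd hb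
      (show (0 : Space N) ∈ Metric.closedBall (0 : Space N) ‖z‖ by simp)
      (show z ∈ Metric.closedBall (0 : Space N) ‖z‖ by simp)
    simp only [add_zero, sub_zero, Real.norm_eq_abs] at this
    rw [← abs_neg]
    have e : -secDiff w x z = w (x + z) + w (x - z) - (w x + w x) := by
      unfold secDiff; ring
    rw [e]
    refine this.trans ?_
    nlinarith [mul_nonneg hM0 (sq_nonneg ‖z‖)]
  · rw [min_eq_left (one_le_pow₀ h), mul_one]
    have h1 := abs_le.1 (hM x)
    have h2 := abs_le.1 (hM (x + z))
    have h3 := abs_le.1 (hM (x - z))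
    unfold secDiff
    exact abs_le.2 ⟨by linarith, by linarith⟩

theorem continuous_secDiff {w : Space N → ℝ} (hw : Continuous w) :
    Continuous fun p : Space N × Space N => secDiff w p.1 p.2 := by
  unfold secDiff
  fun_prop

/-- A local form for test functions, whose second derivatives are controlled on compact sets only.
The ball of radius R + 1 contains all the points x ± z with |z| ≤ 1. -/
theorem exists_secDiff_le_ball {w : Space N → ℝ} (hw : ContDiff ℝ 2 w) {M : ℝ}
    (hM : ∀ y, |w y| ≤ M) (R : ℝ) :
    ∃ C, 0 ≤ C ∧ ∀ x ∈ Metric.closedBall (0 : Space N) R, ∀ z,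
      |secDiff w x z| ≤ C * min 1 (‖z‖ ^ 2) := by
  have hd : ContDiff ℝ 1 (fderiv ℝ w) := hw.fderiv_right (by norm_num)
  obtain ⟨C, hC⟩ := (isCompact_closedBall (0 : Space N) (R + 1)).exists_bound_of_continuousOn
    (hd.continuous_fderiv one_ne_zero).continuousOn
  refine ⟨2 * max C 0 + 4 * M, by have := (abs_nonneg _).trans (hM 0); positivity,
    fun x hx z => abs_secDiff_le (le_max_right _ _) (hw.differentiable two_ne_zero) ?_ hM⟩
  have hsub : Metric.closedBall x 1 ⊆ Metric.closedBall (0 : Space N) (R + 1) := by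
    refine Metric.closedBall_subset_closedBall' ?_
    have := Metric.mem_closedBall.1 hx
    linarith
  intro a ha b hb
  exact (convex_closedBall (0 : Space N) (R + 1)).norm_image_sub_le_of_norm_fderiv_le
    (fun y _ => (hd.differentiable one_ne_zero) y)
    (fun y hy => (hC y hy).trans (le_max_left _ _)) (hsub hb) (hsub ha)

theorem exists_bound_of_compactSupport {η : Space N → ℝ} (hη : Continuous η)
    (hs : HasCompactSupport η) : ∃ M, ∀ x, |η x| ≤ M := hη.bounded_above_of_compact_support hs

theorem exists_secDiff_le {η : Space N → ℝ} (hη : ContDiff ℝ 2 η) (hs : HasCompactSupport η) :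
    ∃ C, 0 ≤ C ∧ ∀ x z, |secDiff η x z| ≤ C * min 1 (‖z‖ ^ 2) := by
  obtain ⟨M, hM⟩ := exists_bound_of_compactSupport hη.continuous hs
  have hd : ContDiff ℝ 1 (fderiv ℝ η) := hη.fderiv_right (by norm_num)
  obtain ⟨C, hC⟩ := hd.lipschitzWith_of_hasCompactSupport (hs.fderiv ℝ) one_ne_zero
  refine ⟨2 * C + 4 * M, by have := (abs_nonneg _).trans (hM 0); positivity,
    fun x z => abs_secDiff_le C.2 (hη.differentiable two_ne_zero) ?_ hM⟩
  intro a _ b _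
  exact hC.norm_sub_le a b

/-- For |z| ≤ 1 the second difference is supported in a fixed ball and pointwise of order |z|²; for
|z| ≥ 1 translation invariance bounds the integral by 4 ‖η‖₁. -/
theorem exists_integral_secDiff_le {η : Space N → ℝ} (hη : ContDiff ℝ 2 η)
    (hs : HasCompactSupport η) :
    ∃ C, 0 ≤ C ∧ ∀ z, ∫ x, |secDiff η x z| ≤ C * min 1 (‖z‖ ^ 2) := by
  obtain ⟨C, hC0, hC⟩ := exists_secDiff_le hη hs
  obtain ⟨R, hR⟩ := hs.isCompact.isBounded.subset_closedBall (0 : Space N)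
  have hint : Integrable η := hη.continuous.integrable_of_hasCompactSupport hs
  set V := (volume : Measure (Space N)).real (Metric.closedBall (0 : Space N) (R + 1))
  refine ⟨C * V + 4 * ∫ x, |η x|, by positivity, fun z => ?_⟩
  have h0 : 0 ≤ ∫ x, |η x| := integral_nonneg fun _ => abs_nonneg _
  rcases le_total ‖z‖ 1 with h | h
  · have hsupp : ∀ x, x ∉ Metric.closedBall (0 : Space N) (R + 1) → secDiff η x z = 0 := by
      intro x hx
      have key : ∀ y : Space N, ‖y - x‖ ≤ 1 → η y = 0 := by
        intro y hy
        refine image_eq_zero_of_notMem_tsupport fun hy' => hx ?_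
        have h1 := mem_closedBall_zero_iff.1 (hR hy')
        rw [mem_closedBall_zero_iff]
        have : ‖x‖ ≤ ‖y‖ + ‖y - x‖ := by
          have := norm_sub_norm_le x y
          rw [norm_sub_rev] at this
          linarith
        linarith
      unfold secDiff
      rw [key x (by simp), key (x + z) (by simpa using h), key (x - z) (by simpa using h)]
      ring
    have h1 : ∫ x, |secDiff η x z| =
        ∫ x in Metric.closedBall (0 : Space N) (R + 1), |secDiff η x z| := by
      refine (setIntegral_eq_integral_of_forall_compl_eq_zero fun x hx => ?_).symm
      rw [hsupp x hx, abs_zero]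
    rw [h1]
    have h2 := norm_setIntegral_le_of_norm_le_const (μ := volume)
      (f := fun x => |secDiff η x z|) (s := Metric.closedBall (0 : Space N) (R + 1))
      (C := C * min 1 (‖z‖ ^ 2)) measure_closedBall_lt_top
      (fun x _ => by rw [Real.norm_eq_abs, abs_abs]; exact hC x z)
    refine (le_abs_self _).trans (h2.trans ?_)
    have h3 : 0 ≤ min 1 (‖z‖ ^ 2) := le_min zero_le_one (sq_nonneg _)
    have h4 : 0 ≤ 4 * (∫ x, |η x|) * min 1 (‖z‖ ^ 2) := by positivity
    calc _ = C * V * min 1 (‖z‖ ^ 2) := by simp only [V]; ring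
      _ ≤ _ := by linarith
  · rw [min_eq_left (one_le_pow₀ h), mul_one]
    have i1 : Integrable fun x => |η (x + z)| := (hint.comp_add_right z).abs
    have i2 : Integrable fun x => |η (x - z)| := (hint.comp_sub_right z).abs
    have h1 : ∫ x, |secDiff η x z| ≤ ∫ x, (2 * |η x| + |η (x + z)| + |η (x - z)|) := by
      refine integral_mono_of_nonneg (Eventually.of_forall fun _ => abs_nonneg _)
        (((hint.abs.const_mul 2).add i1).add i2) (Eventually.of_forall fun x => ?_)
      unfold secDiff
      calc |2 * η x - η (x + z) - η (x - z)| ≤ |2 * η x - η (x + z)| + |η (x - z)| := abs_sub _ _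
        _ ≤ |2 * η x| + |η (x + z)| + |η (x - z)| := by gcongr; exact abs_sub _ _
        _ = _ := by rw [abs_mul, abs_two]
    have e1 : ∫ x, (2 * |η x| + |η (x + z)| + |η (x - z)|) = 4 * ∫ x, |η x| := by
      have a1 : Integrable fun x => 2 * |η x| + |η (x + z)| := (hint.abs.const_mul 2).add i1
      rw [integral_add a1 i2, integral_add (hint.abs.const_mul 2) i1, integral_const_mul,
        integral_add_right_eq_self (fun x => |η x|), integral_sub_right_eq_self (fun x => |η x|)]
      ring
    have : 0 ≤ C * V := by positivity
    linarith

/-! ### The operator on compactly supported C² functions: integrability, symmetry, principal value,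
symbol. -/

section Bump

variable {K : Space N → ℝ} {η : Space N → ℝ}

theorem IsSymmKernel.integrable_secDiff_prod (hK : IsSymmKernel K) (hη : ContDiff ℝ 2 η)
    (hs : HasCompactSupport η) :
    Integrable (fun p : Space N × Space N => secDiff η p.1 p.2 * K p.2) := by
  obtain ⟨C, hC0, hC⟩ := exists_integral_secDiff_le hη hs
  have hm : AEStronglyMeasurable (fun p : Space N × Space N => secDiff η p.1 p.2 * K p.2) :=
    (continuous_secDiff hη.continuous).aestronglyMeasurable.mul hK.aesm.comp_snd
  have hint : Integrable η := hη.continuous.integrable_of_hasCompactSupport hs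
  rw [Measure.volume_eq_prod] at hm ⊢
  rw [integrable_prod_iff' hm]
  constructor
  · refine Eventually.of_forall fun z => Integrable.mul_const (f := fun x => secDiff η x z) ?_ (K z)
    exact ((hint.const_mul 2).sub (hint.comp_add_right z)).sub (hint.comp_sub_right z)
  · refine (hK.integrable.const_mul C).mono' (hm.norm.prod_swap.integral_prod_right')
      (Eventually.of_forall fun z => ?_)
    simp only [norm_mul, Real.norm_eq_abs]
    rw [integral_mul_const, abs_of_nonneg (hK.nonneg z), abs_of_nonneg
      (mul_nonneg (integral_nonneg fun _ => abs_nonneg _) (hK.nonneg z)), ← mul_assoc]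
    exact mul_le_mul_of_nonneg_right (hC z) (hK.nonneg z)

theorem IsSymmKernel.integrable_secDiff (hK : IsSymmKernel K) {w : Space N → ℝ} {x : Space N}
    {C : ℝ} (hw : Continuous w) (hC : ∀ z, |secDiff w x z| ≤ C * min 1 (‖z‖ ^ 2)) :
    Integrable fun z => secDiff w x z * K z := by
  refine (hK.integrable.const_mul C).mono' (AEStronglyMeasurable.mul ?_ hK.aesm)
    (Eventually.of_forall fun z => ?_)
  · exact ((continuous_secDiff hw).comp (by fun_prop : Continuous fun z : Space N =>
      (x, z))).aestronglyMeasurable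
  · rw [norm_mul, Real.norm_eq_abs, Real.norm_eq_abs, abs_of_nonneg (hK.nonneg z), ← mul_assoc]
    exact mul_le_mul_of_nonneg_right (hC z) (hK.nonneg z)

theorem IsSymmKernel.integrable_symOp (hK : IsSymmKernel K) (hη : ContDiff ℝ 2 η)
    (hs : HasCompactSupport η) : Integrable (symOp K η) :=
  ((hK.integrable_secDiff_prod hη hs).integral_prod_left).const_mul _

/-- The L¹ norm of L η is controlled linearly by the Lévy integral of the kernel; hence the part of
the kernel near the origin contributes little. -/
theorem IsSymmKernel.integral_abs_symOp_le (hK : IsSymmKernel K) (hη : ContDiff ℝ 2 η)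
    (hs : HasCompactSupport η) {C : ℝ} (hC : ∀ z, ∫ x, |secDiff η x z| ≤ C * min 1 (‖z‖ ^ 2)) :
    ∫ x, |symOp K η x| ≤ C * ∫ z, min 1 (‖z‖ ^ 2) * K z := by
  have hp := (hK.integrable_secDiff_prod hη hs).abs
  have h1 : ∫ x, |symOp K η x| ≤ ∫ x, ∫ z, |secDiff η x z * K z| := by
    refine integral_mono_of_nonneg (Eventually.of_forall fun _ => abs_nonneg _)
      hp.integral_prod_left (Eventually.of_forall fun x => ?_)
    unfold symOp
    simp only
    rw [abs_mul, abs_of_nonneg (by norm_num : (0 : ℝ) ≤ 1 / 2)]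
    have := abs_integral_le_integral_abs (μ := volume) (f := fun z => secDiff η x z * K z)
    have h0 : 0 ≤ ∫ z, |secDiff η x z * K z| := integral_nonneg fun _ => abs_nonneg _
    linarith
  refine h1.trans ?_
  rw [integral_integral_swap hp, ← integral_const_mul]
  refine integral_mono_of_nonneg (Eventually.of_forall fun z => integral_nonneg fun _ =>
    abs_nonneg _) (hK.integrable.const_mul C) (Eventually.of_forall fun z => ?_)
  simp only [abs_mul]
  rw [integral_mul_const, abs_of_nonneg (hK.nonneg z), ← mul_assoc]
  exact mul_le_mul_of_nonneg_right (hC z) (hK.nonneg z)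

theorem IsSymmKernel.continuous_symOp (hK : IsSymmKernel K) (hη : ContDiff ℝ 2 η)
    (hs : HasCompactSupport η) : Continuous (symOp K η) := by
  obtain ⟨C, hC0, hC⟩ := exists_secDiff_le hη hs
  refine continuous_const.mul (continuous_of_dominated (fun x =>
    (hK.integrable_secDiff hη.continuous (hC x)).aestronglyMeasurable) (fun x =>
      Eventually.of_forall fun z => ?_) (hK.integrable.const_mul C) (Eventually.of_forall fun z => ?_))
  · rw [norm_mul, Real.norm_eq_abs, Real.norm_eq_abs, abs_of_nonneg (hK.nonneg z), ← mul_assoc]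
    exact mul_le_mul_of_nonneg_right (hC x z) (hK.nonneg z)
  · exact ((continuous_secDiff hη.continuous).comp
      (by fun_prop : Continuous fun x : Space N => (x, z))).mul continuous_const

theorem IsSymmKernel.exists_symOp_le (hK : IsSymmKernel K) (hη : ContDiff ℝ 2 η)
    (hs : HasCompactSupport η) : ∃ M, ∀ x, |symOp K η x| ≤ M := by
  obtain ⟨C, hC0, hC⟩ := exists_secDiff_le hη hs
  refine ⟨1 / 2 * ∫ z, C * (min 1 (‖z‖ ^ 2) * K z), fun x => ?_⟩
  unfold symOp
  rw [abs_mul, abs_of_nonneg (by norm_num : (0 : ℝ) ≤ 1 / 2)]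
  refine mul_le_mul_of_nonneg_left ?_ (by norm_num)
  rw [← Real.norm_eq_abs]
  refine norm_integral_le_of_norm_le (hK.integrable.const_mul C) (Eventually.of_forall fun z => ?_)
  rw [norm_mul, Real.norm_eq_abs, Real.norm_eq_abs, abs_of_nonneg (hK.nonneg z), ← mul_assoc]
  exact mul_le_mul_of_nonneg_right (hC x z) (hK.nonneg z)

theorem symOp_comp_sub_left (K η : Space N → ℝ) (x y : Space N) :
    symOp K (fun y => η (x - y)) y = symOp K η (x - y) := by
  unfold symOp secDiff
  congr 2
  ext z
  dsimp only
  rw [show x - (y + z) = x - y - z by abel, show x - (y - z) = x - y + z by abel]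
  ring

theorem symOp_neg (K : Space N → ℝ) (heven : ∀ x, η (-x) = η x) (x : Space N) :
    symOp K η (-x) = symOp K η x := by
  have := symOp_comp_sub_left K η 0 x
  simp only [zero_sub, heven] at this
  exact this.symm

/-- The operator is symmetric. -/
theorem IsSymmKernel.integral_mul_symOp (hK : IsSymmKernel K) (hη : ContDiff ℝ 2 η)
    (hs : HasCompactSupport η) {w : Space N → ℝ} (hw : ContDiff ℝ 2 w) {M : ℝ}
    (hM : ∀ y, |w y| ≤ M) : ∫ x, η x * symOp K w x = ∫ x, w x * symOp K η x := by
  obtain ⟨R, hR⟩ := hs.isCompact.isBounded.subset_closedBall (0 : Space N)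
  obtain ⟨C, hC0, hC⟩ := exists_secDiff_le_ball hw hM R
  have hint : Integrable η := hη.continuous.integrable_of_hasCompactSupport hs
  have hmul : ∀ {f g : Space N → ℝ}, Integrable f → Continuous g → (∀ y, |g y| ≤ M) →
      Integrable fun x => f x * g x := fun hf hg hgM =>
    hf.mul_bdd hg.aestronglyMeasurable (Eventually.of_forall hgM)
  have h1 : Integrable (fun p : Space N × Space N => η p.1 * (secDiff w p.1 p.2 * K p.2))
      (volume.prod volume) := by
    have hp : Integrable (fun p : Space N × Space N =>
        (C * |η p.1|) * (min 1 (‖p.2‖ ^ 2) * K p.2)) (volume.prod volume) :=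
      (hint.abs.const_mul C).mul_prod hK.integrable
    refine hp.mono' ?_ (Eventually.of_forall fun p => ?_)
    · refine hη.continuous.aestronglyMeasurable.comp_fst.mul (AEStronglyMeasurable.mul ?_
        hK.aesm.comp_snd)
      exact (continuous_secDiff hw.continuous).aestronglyMeasurable
    · rw [norm_mul, norm_mul, Real.norm_eq_abs, Real.norm_eq_abs, Real.norm_eq_abs,
        abs_of_nonneg (hK.nonneg p.2)]
      by_cases hp : η p.1 = 0
      · simp [hp]
      · have := hC p.1 (hR (subset_tsupport _ hp)) p.2
        calc |η p.1| * (|secDiff w p.1 p.2| * K p.2)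
            ≤ |η p.1| * ((C * min 1 (‖p.2‖ ^ 2)) * K p.2) := by
              gcongr
              exact hK.nonneg _
          _ = _ := by ring
  have h2 : Integrable (fun p : Space N × Space N => w p.1 * (secDiff η p.1 p.2 * K p.2))
      (volume.prod volume) := by
    have := hK.integrable_secDiff_prod hη hs
    rw [Measure.volume_eq_prod] at this
    exact this.bdd_mul hw.continuous.aestronglyMeasurable.comp_fst
      (Eventually.of_forall fun p => hM p.1)
  have e1 : ∫ x, η x * symOp K w x = 1 / 2 * ∫ x, ∫ z, η x * (secDiff w x z * K z) := by
    rw [← integral_const_mul]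
    congr 1
    ext x
    rw [symOp, integral_const_mul]
    ring
  have e2 : ∫ x, w x * symOp K η x = 1 / 2 * ∫ x, ∫ z, w x * (secDiff η x z * K z) := by
    rw [← integral_const_mul]
    congr 1
    ext x
    rw [symOp, integral_const_mul]
    ring
  -- With z frozen, the translations x ↦ x ± z move the second difference from one factor to the
  -- other.
  rw [e1, e2, integral_integral_swap (f := fun x z => η x * (secDiff w x z * K z)) h1,
    integral_integral_swap (f := fun x z => w x * (secDiff η x z * K z)) h2]
  congr 2
  ext z
  simp_rw [← mul_assoc]
  rw [integral_mul_const, integral_mul_const]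
  congr 1
  have a1 : Integrable fun x => η x * w x := hmul hint hw.continuous hM
  have a2 : Integrable fun x => η x * w (x + z) :=
    hmul hint (hw.continuous.comp (continuous_add_const z)) fun y => hM _
  have a3 : Integrable fun x => η x * w (x - z) :=
    hmul hint (hw.continuous.comp (continuous_sub_right z)) fun y => hM _
  have b2 : Integrable fun x => η (x + z) * w x := hmul (hint.comp_add_right z) hw.continuous hM
  have b3 : Integrable fun x => η (x - z) * w x := hmul (hint.comp_sub_right z) hw.continuous hM
  have l1 : ∫ x, η x * secDiff w x z =
      2 * (∫ x, η x * w x) - (∫ x, η x * w (x + z)) - ∫ x, η x * w (x - z) := by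
    rw [← integral_const_mul, ← integral_sub (a1.const_mul 2) a2,
      ← integral_sub (f := fun x => _ - _) ((a1.const_mul 2).sub a2) a3]
    congr 1
    ext x
    unfold secDiff
    ring
  have l2 : ∫ x, w x * secDiff η x z =
      2 * (∫ x, η x * w x) - (∫ x, η (x + z) * w x) - ∫ x, η (x - z) * w x := by
    rw [← integral_const_mul, ← integral_sub (a1.const_mul 2) b2,
      ← integral_sub (f := fun x => _ - _) ((a1.const_mul 2).sub b2) b3]
    congr 1
    ext x
    unfold secDiff
    ring
  have c1 : ∫ x, η x * w (x + z) = ∫ x, η (x - z) * w x := by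
    rw [← integral_sub_right_eq_self _ z]
    simp
  have c2 : ∫ x, η x * w (x - z) = ∫ x, η (x + z) * w x := by
    rw [← integral_add_right_eq_self _ z]
    simp
  rw [l1, l2, c1, c2]
  ring

/-- The principal value exists for bounded `C²` functions, and it is given by the symmetric
form of the operator. -/
theorem IsSymmKernel.levyOp_eq_symOp (hK : IsSymmKernel K) {w : Space N → ℝ} (hw : ContDiff ℝ 2 w)
    {M : ℝ} (hM : ∀ y, |w y| ≤ M) (x : Space N) : levyOp K w x = symOp K w x := by
  obtain ⟨C, hC0, hC⟩ := exists_secDiff_le_ball hw hM ‖x‖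
  have hCx := hC x (by simp)
  have hI := hK.integrable_secDiff hw.continuous hCx
  refine Tendsto.limUnder_eq ?_
  -- The truncated integral is averaged with its image under z ↦ -z. The symmetrised integrand is
  -- integrable up to the origin, so the truncation can be removed by dominated convergence.
  have key : ∀ ε > 0, ∫ z in {z | ε < ‖x - z‖}, (w x - w z) * K (x - z) =
      1 / 2 * ∫ z, indicator {z | ε < ‖z‖} (fun z => secDiff w x z * K z) z := by
    intro ε hε
    have hms : MeasurableSet {z : Space N | ε < ‖z‖} := measurableSet_lt (by fun_prop) (by fun_prop)
    have hms' : MeasurableSet {z : Space N | ε < ‖x - z‖} :=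
      measurableSet_lt (by fun_prop) (by fun_prop)
    have hKε : IntegrableOn K {z | ε < ‖z‖} := by
      have h1 := (hK.integrable.const_mul (min 1 (ε ^ 2))⁻¹).integrableOn (s := {z | ε < ‖z‖})
      refine h1.mono' hK.aesm.restrict ?_
      filter_upwards [ae_restrict_mem hms] with z hz
      have h2 : min 1 (ε ^ 2) ≤ min 1 (‖z‖ ^ 2) := by
        have : ε ≤ ‖z‖ := le_of_lt hz
        gcongr
      have h3 : 0 < min 1 (ε ^ 2) := lt_min one_pos (by positivity)
      rw [Real.norm_eq_abs, abs_of_nonneg (hK.nonneg z), inv_mul_eq_div, le_div_iff₀ h3, mul_comm]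
      exact mul_le_mul_of_nonneg_right h2 (hK.nonneg z)
    have hI1 : Integrable (indicator {z | ε < ‖z‖} fun z => (w x - w (x - z)) * K z) := by
      rw [integrable_indicator_iff hms]
      refine Integrable.bdd_mul (c := 2 * M) hKε ?_ (Eventually.of_forall fun z => ?_)
      · exact (by fun_prop : Continuous fun z => w x - w (x - z)).aestronglyMeasurable
      · have h1 := abs_le.1 (hM x)
        have h2 := abs_le.1 (hM (x - z))
        exact abs_le.2 ⟨by linarith, by linarith⟩
    have e1 : ∫ z in {z | ε < ‖x - z‖}, (w x - w z) * K (x - z) =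
        ∫ z, indicator {z | ε < ‖z‖} (fun z => (w x - w (x - z)) * K z) z := by
      rw [← integral_indicator hms',
        ← integral_sub_left_eq_self (fun z => indicator {z | ε < ‖z‖}
          (fun z => (w x - w (x - z)) * K z) z) volume x]
      congr 1
      ext z
      by_cases hz : ε < ‖x - z‖
      · rw [indicator_of_mem (show z ∈ {z | ε < ‖x - z‖} from hz),
          indicator_of_mem (show x - z ∈ {z | ε < ‖z‖} from hz), sub_sub_cancel]
      · rw [indicator_of_notMem (show z ∉ {z | ε < ‖x - z‖} from hz),
          indicator_of_notMem (show x - z ∉ {z | ε < ‖z‖} from hz)]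
    have e2 := integral_neg_eq_self (fun z => indicator {z | ε < ‖z‖}
      (fun z => (w x - w (x - z)) * K z) z) volume
    have e3 : ∀ z, indicator {z | ε < ‖z‖} (fun z => secDiff w x z * K z) z =
        indicator {z | ε < ‖z‖} (fun z => (w x - w (x - z)) * K z) z +
          indicator {z | ε < ‖z‖} (fun z => (w x - w (x - z)) * K z) (-z) := by
      intro z
      by_cases hz : ε < ‖z‖
      · rw [indicator_of_mem (show z ∈ {z | ε < ‖z‖} from hz),
          indicator_of_mem (show z ∈ {z | ε < ‖z‖} from hz),
          indicator_of_mem (show -z ∈ {z : Space N | ε < ‖z‖} by simpa using hz), hK.even,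
          secDiff, sub_neg_eq_add]
        ring
      · rw [indicator_of_notMem (show z ∉ {z | ε < ‖z‖} from hz),
          indicator_of_notMem (show z ∉ {z | ε < ‖z‖} from hz),
          indicator_of_notMem (show -z ∉ {z : Space N | ε < ‖z‖} by simpa using hz), add_zero]
    simp_rw [e3]
    rw [integral_add hI1 hI1.comp_neg, e1, e2]
    ring
  have hlim : Tendsto (fun ε : ℝ => 1 / 2 * ∫ z,
      indicator {z | ε < ‖z‖} (fun z => secDiff w x z * K z) z) (𝓝[>] 0) (𝓝 (symOp K w x)) := by
    refine Tendsto.const_mul _ (tendsto_integral_filter_of_dominated_convergence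
      (fun z => ‖secDiff w x z * K z‖) ?_ ?_ hI.norm ?_)
    · exact Eventually.of_forall fun ε => hI.aestronglyMeasurable.indicator
        (measurableSet_lt (by fun_prop) (by fun_prop))
    · exact Eventually.of_forall fun ε => Eventually.of_forall fun z => norm_indicator_le_norm_self _ _
    · refine Eventually.of_forall fun z => ?_
      by_cases hz : z = 0
      · have : secDiff w x z = 0 := by rw [hz, secDiff]; simp; ring
        simp [indicator, this]
      · refine tendsto_const_nhds.congr' ?_
        filter_upwards [Ioo_mem_nhdsGT (norm_pos_iff.2 hz)] with ε hε
        rw [indicator_of_mem (show z ∈ {z | ε < ‖z‖} from hε.2)]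
  exact hlim.congr' (by filter_upwards [self_mem_nhdsWithin] with ε hε using (key ε hε).symm)

/-- For integrable kernels the operator is a multiple of the identity minus a convolution. -/
theorem IsSymmKernel.symOp_of_integrable (hK : IsSymmKernel K) (hKi : Integrable K)
    {w : Space N → ℝ} (hw : Continuous w) {M : ℝ} (hM : ∀ y, |w y| ≤ M) (x : Space N) :
    symOp K w x = (∫ z, K z) * w x - ∫ z, w (x - z) * K z := by
  have i1 : Integrable fun z => w (x - z) * K z :=
    hKi.bdd_mul (hw.comp (continuous_sub_left x)).aestronglyMeasurable
      (Eventually.of_forall fun z => hM _)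
  have i2 : Integrable fun z => w (x + z) * K z :=
    hKi.bdd_mul (hw.comp (continuous_const_add x)).aestronglyMeasurable
      (Eventually.of_forall fun z => hM _)
  have e1 : ∫ z, w (x + z) * K z = ∫ z, w (x - z) * K z := by
    rw [← integral_neg_eq_self]
    simp only [hK.even, ← sub_eq_add_neg]
  have e2 : ∫ z, secDiff w x z * K z =
      2 * w x * (∫ z, K z) - (∫ z, w (x + z) * K z) - ∫ z, w (x - z) * K z := by
    rw [← integral_const_mul, ← integral_sub (hKi.const_mul _) i2,
      ← integral_sub (f := fun x => _ - _) ((hKi.const_mul _).sub i2) i1]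
    congr 1
    ext z
    unfold secDiff
    ring
  rw [symOp, e2, e1]
  ring

/-- The symbol of the operator. -/
theorem IsSymmKernel.fourier_symOp (hK : IsSymmKernel K) (hη : ContDiff ℝ 2 η)
    (hs : HasCompactSupport η) (ξ : Space N) :
    𝓕 (fun x => (symOp K η x : ℂ)) ξ =
      symbol K ((2 * Real.pi) • ξ) * 𝓕 (fun x => (η x : ℂ)) ξ := by
  have hint : Integrable η := hη.continuous.integrable_of_hasCompactSupport hs
  set e : Space N → ℂ := fun x => (Real.fourierChar (-⟪x, ξ⟫) : ℂ) with he
  have hec : Continuous e := by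
    simp only [he]
    fun_prop
  have he1 : ∀ x, ‖e x‖ = 1 := fun x => Circle.norm_coe _
  have headd : ∀ x z, e (x + z) = e x * e z := by
    intro x z
    simp only [he, inner_add_left, neg_add, AddChar.map_add_eq_mul, Circle.coe_mul]
  have hF : ∀ f : Space N → ℂ, 𝓕 f ξ = ∫ x, e x * f x := by
    intro f
    rw [Real.fourier_eq]
    rfl
  have hη' : Integrable fun x => e x * (η x : ℂ) :=
    hint.ofReal.bdd_mul hec.aestronglyMeasurable (Eventually.of_forall fun x => (he1 x).le)
  have h1 : Integrable (fun p : Space N × Space N => e p.1 * ((secDiff η p.1 p.2 * K p.2 : ℝ) : ℂ))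
      (volume.prod volume) := by
    have := hK.integrable_secDiff_prod hη hs
    rw [Measure.volume_eq_prod] at this
    exact this.ofReal.bdd_mul hec.aestronglyMeasurable.comp_fst
      (Eventually.of_forall fun p => (he1 p.1).le)
  have e1 : ∫ x, e x * (symOp K η x : ℂ) =
      1 / 2 * ∫ x, ∫ z, e x * ((secDiff η x z * K z : ℝ) : ℂ) := by
    rw [← integral_const_mul]
    congr 1
    ext x
    rw [symOp, integral_const_mul, integral_complex_ofReal]
    push_cast
    ring
  have hcos : ∀ z, e z + e (-z) = 2 * Real.cos ⟪z, (2 * Real.pi) • ξ⟫ := by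
    intro z
    simp only [he, inner_neg_left, inner_smul_right, neg_neg, Real.fourierChar_apply]
    rw [Complex.ofReal_cos, Complex.two_cos]
    push_cast
    rw [add_comm]
    congr 2
    ring
  -- Translations of η become the factors e(±z), and 2 - e(z) - e(-z) = 2 (1 - cos).
  have e2 : ∀ z, ∫ x, e x * ((secDiff η x z * K z : ℝ) : ℂ) =
      ((2 * (1 - Real.cos ⟪z, (2 * Real.pi) • ξ⟫) * K z : ℝ) : ℂ) * ∫ x, e x * (η x : ℂ) := by
    intro z
    have s1 : ∫ x, e x * (η (x + z) : ℂ) = e (-z) * ∫ x, e x * (η x : ℂ) := by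
      rw [← integral_const_mul, ← integral_add_right_eq_self (fun x => e (-z) * (e x * (η x : ℂ))) z]
      congr 1
      ext x
      rw [← mul_assoc, ← headd]
      congr 2
      abel
    have s2 : ∫ x, e x * (η (x - z) : ℂ) = e z * ∫ x, e x * (η x : ℂ) := by
      rw [← integral_const_mul, ← integral_sub_right_eq_self (fun x => e z * (e x * (η x : ℂ))) z]
      congr 1
      ext x
      rw [← mul_assoc, ← headd]
      congr 2
      abel
    have i1 : Integrable fun x => e x * (η (x + z) : ℂ) :=
      (hint.comp_add_right z).ofReal.bdd_mul hec.aestronglyMeasurable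
        (Eventually.of_forall fun x => (he1 x).le)
    have i2 : Integrable fun x => e x * (η (x - z) : ℂ) :=
      (hint.comp_sub_right z).ofReal.bdd_mul hec.aestronglyMeasurable
        (Eventually.of_forall fun x => (he1 x).le)
    have s3 : ∫ x, e x * ((secDiff η x z * K z : ℝ) : ℂ) = (2 * (∫ x, e x * (η x : ℂ)) -
        (∫ x, e x * (η (x + z) : ℂ)) - ∫ x, e x * (η (x - z) : ℂ)) * (K z : ℂ) := by
      rw [← integral_const_mul, ← integral_sub (hη'.const_mul 2) i1,
        ← integral_sub (f := fun x => _ - _) ((hη'.const_mul 2).sub i1) i2, ← integral_mul_const]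
      congr 1
      ext x
      unfold secDiff
      push_cast
      ring
    have hc := hcos z
    rw [s3, s1, s2]
    push_cast at hc ⊢
    linear_combination (-(∫ x, e x * (η x : ℂ)) * (K z : ℂ)) * hc
  rw [hF, hF, e1, integral_integral_swap h1]
  simp_rw [e2]
  rw [integral_mul_const, integral_complex_ofReal, symbol]
  have : ∫ z, 2 * (1 - Real.cos ⟪z, (2 * Real.pi) • ξ⟫) * K z =
      2 * ∫ z, (1 - Real.cos ⟪z, (2 * Real.pi) • ξ⟫) * K z := by
    rw [← integral_const_mul]
    congr 1
    ext z
    ring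
  rw [this]
  push_cast
  ring

end Bump

/-! ### Weak measurability -/

/-- Orthonormal vectors are at distance √2, so the balls of radius 1/2 around them are disjoint open
sets. -/
theorem countable_of_orthonormal {E : Type*} [NormedAddCommGroup E] [InnerProductSpace ℂ E]
    [SecondCountableTopology E] {w : Set E} (hw : Orthonormal ℂ ((↑) : w → E)) : w.Countable := by
  refine Set.PairwiseDisjoint.countable_of_isOpen (s := fun x : E => Metric.ball x (1 / 2))
    (fun x hx y hy hxy => ?_) (fun _ _ => Metric.isOpen_ball)
    (fun x _ => ⟨x, Metric.mem_ball_self (by norm_num)⟩)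
  refine Metric.ball_disjoint_ball ?_
  have h1 : ‖x‖ = 1 := hw.1 ⟨x, hx⟩
  have h2 : ‖y‖ = 1 := hw.1 ⟨y, hy⟩
  have h3 : inner ℂ x y = 0 := hw.2 (i := ⟨x, hx⟩) (j := ⟨y, hy⟩) (by simpa using hxy)
  have h4 : ‖x - y‖ * ‖x - y‖ = ‖x‖ * ‖x‖ + ‖y‖ * ‖y‖ := by
    have := norm_add_sq_eq_norm_sq_add_norm_sq_of_inner_eq_zero (𝕜 := ℂ) x (-y) (by simp [h3])
    simpa [sub_eq_add_neg] using this
  rw [h1, h2] at h4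
  rw [dist_eq_norm]
  nlinarith [norm_nonneg (x - y)]

/-- In a separable Hilbert space weakly measurable functions are strongly measurable. -/
theorem aestronglyMeasurable_of_inner {α E : Type*} [MeasurableSpace α] {μ : Measure α}
    [NormedAddCommGroup E] [InnerProductSpace ℂ E] [CompleteSpace E] [SecondCountableTopology E]
    {f : α → E} (h : ∀ p, AEStronglyMeasurable (fun t => inner ℂ p (f t)) μ) :
    AEStronglyMeasurable f μ := by
  obtain ⟨w, b, hb⟩ := exists_hilbertBasis ℂ E
  have hw : w.Countable := countable_of_orthonormal (by
    have := b.orthonormal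
    rwa [hb] at this)
  have : Countable w := hw.to_subtype
  refine aestronglyMeasurable_of_tendsto_ae (u := (atTop : Filter (Finset w)))
    (f := fun s t => ∑ i ∈ s, inner ℂ (b i) (f t) • b i) (fun s => ?_)
    (Eventually.of_forall fun t => ?_)
  · exact Finset.aestronglyMeasurable_fun_sum s fun i _ => (h (b i)).smul_const _
  · have := b.hasSum_repr (f t)
    simp only [b.repr_apply_apply] at this
    exact this

/-! ### The Fourier transform and multipliers in `L²` -/

variable {N : ℕ}

/-- The space `L²(ℝ^N; ℂ)`. -/
abbrev L2Space (N : ℕ) : Type := Lp ℂ 2 (volume : Measure (Space N))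

/-- On `L¹ ∩ L²` the Fourier transform of `L²` is given by the Fourier integral. -/
theorem fourier_ae_eq {g : Space N → ℂ} (h1 : Integrable g) (h2 : MemLp g 2) :
    (𝓕 (h2.toLp g) : L2Space N) =ᵐ[volume] 𝓕 g := by
  have hc : Continuous (𝓕 g) := VectorFourier.fourierIntegral_continuous Real.continuous_fourierChar continuous_inner h1
  refine ae_eq_of_integral_contDiff_smul_eq
    ((Lp.memLp (𝓕 (h2.toLp g) : L2Space N)).locallyIntegrable (by norm_num)) hc.locallyIntegrable
    fun φ hφ hs => ?_
  have hs' : HasCompactSupport fun x => (φ x : ℂ) := hs.comp_left (g := Complex.ofReal) rfl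
  set ψ := hs'.toSchwartzMap (Complex.ofRealCLM.contDiff.comp hφ) with hψ
  have hψa : ∀ x, ψ x = φ x := fun x => rfl
  -- The L² transform agrees with the distributional one, and the latter with the Fourier integral
  -- because the transform may be moved to the Schwartz function.
  have e := congrArg (fun T => T ψ) (Lp.fourier_toTemperedDistribution_eq (h2.toLp g))
  simp only [TemperedDistribution.fourier_apply, Lp.toTemperedDistribution_apply] at e
  have e1 : ∫ x, φ x • (𝓕 (h2.toLp g) : L2Space N) x = ∫ x, ψ x • (𝓕 (h2.toLp g) : L2Space N) x := by
    simp [hψa]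
  have e2 : ∫ x, φ x • 𝓕 g x = ∫ x, ψ x • 𝓕 g x := by simp [hψa]
  rw [e1, e2, ← e]
  have e3 := VectorFourier.integral_fourierIntegral_smul_eq_flip (L := innerₗ (Space N))
    (μ := volume) (ν := volume) Real.continuous_fourierChar continuous_inner
    (f := ψ) (g := g) ψ.integrable h1
  rw [flip_innerₗ] at e3
  refine Eq.trans (integral_congr_ae ?_) e3
  filter_upwards [h2.coeFn_toLp] with x hx
  rw [hx]
  rfl

theorem toL2_of_memLp {g : Space N → ℂ} (h : MemLp g 2) : toL2 g = h.toLp g := dif_pos h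

theorem coeFn_toL2 {g : Space N → ℂ} (h : MemLp g 2) : toL2 g =ᵐ[volume] g := by
  rw [toL2_of_memLp h]
  exact h.coeFn_toLp

theorem toL2_congr {g h : Space N → ℂ} (he : g =ᵐ[volume] h) : toL2 g = toL2 h := by
  by_cases hg : MemLp g 2
  · rw [toL2_of_memLp hg, toL2_of_memLp (hg.ae_eq he), MemLp.toLp_eq_toLp_iff]
    exact he
  · rw [toL2, toL2, dif_neg hg, dif_neg fun hh => hg (hh.ae_eq he.symm)]

theorem toL2_coeFn (g : L2Space N) : toL2 g = g := by
  rw [toL2_of_memLp (Lp.memLp g), Lp.toLp_coeFn]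

theorem memLp_mul_of_bounded {a : Space N → ℝ} {C : ℝ} (ha : AEStronglyMeasurable a)
    (hC : ∀ ξ, |a ξ| ≤ C) (g : L2Space N) :
    MemLp (fun ξ => (a ξ : ℂ) * g ξ) 2 := by
  refine MemLp.of_le_mul (c := C) (Lp.memLp g)
    ((Complex.continuous_ofReal.comp_aestronglyMeasurable ha).mul
      (Lp.memLp g).aestronglyMeasurable) (Eventually.of_forall fun ξ => ?_)
  rw [norm_mul, Complex.norm_real]
  exact mul_le_mul_of_nonneg_right (hC ξ) (norm_nonneg _)

/-- Multiplication by the function `a`. -/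
def mulL2 (a : Space N → ℝ) (g : L2Space N) :
    L2Space N := toL2 fun ξ => (a ξ : ℂ) * g ξ

theorem coeFn_mulL2 {a : Space N → ℝ} {C : ℝ} (ha : AEStronglyMeasurable a)
    (hC : ∀ ξ, |a ξ| ≤ C) (g : L2Space N) :
    mulL2 a g =ᵐ[volume] fun ξ => (a ξ : ℂ) * g ξ := coeFn_toL2 (memLp_mul_of_bounded ha hC g)

theorem norm_mulL2_le {a : Space N → ℝ} {C : ℝ} (ha : AEStronglyMeasurable a)
    (hC : ∀ ξ, |a ξ| ≤ C) (g : L2Space N) :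
    ‖mulL2 a g‖ ≤ C * ‖g‖ := by
  refine Lp.norm_le_mul_norm_of_ae_le_mul ?_
  filter_upwards [coeFn_mulL2 ha hC g] with ξ hξ
  rw [hξ, norm_mul, Complex.norm_real]
  exact mul_le_mul_of_nonneg_right (hC ξ) (norm_nonneg _)

theorem mulL2_sub {a : Space N → ℝ} {C : ℝ} (ha : AEStronglyMeasurable a)
    (hC : ∀ ξ, |a ξ| ≤ C) (g h : L2Space N) :
    mulL2 a (g - h) = mulL2 a g - mulL2 a h := by
  refine Lp.ext ?_
  filter_upwards [coeFn_mulL2 ha hC g, coeFn_mulL2 ha hC h, coeFn_mulL2 ha hC (g - h),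
    Lp.coeFn_sub g h, Lp.coeFn_sub (mulL2 a g) (mulL2 a h)] with ξ h1 h2 h3 h4 h5
  rw [h5, h3, h4, Pi.sub_apply, Pi.sub_apply, h1, h2]
  ring

theorem continuous_mulL2 {a : Space N → ℝ} {C : ℝ} (ha : AEStronglyMeasurable a)
    (hC : ∀ ξ, |a ξ| ≤ C) : Continuous (mulL2 a) := by
  have hC0 : 0 ≤ C := (abs_nonneg _).trans (hC 0)
  refine (LipschitzWith.of_dist_le_mul (K := C.toNNReal) fun g h => ?_).continuous
  rw [dist_eq_norm, dist_eq_norm, ← mulL2_sub ha hC, Real.coe_toNNReal _ hC0]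
  exact norm_mulL2_le ha hC _

/-- The real part of `conj (P ξ) · G ξ`. -/
def pairing (P G : L2Space N) (ξ : Space N) : ℝ :=
  (inner ℂ (P ξ) (G ξ)).re

theorem integrable_pairing (P G : L2Space N) :
    Integrable (pairing P G) := (L2.integrable_inner (𝕜 := ℂ) P G).re

theorem re_inner_eq (P G : L2Space N) :
    (inner ℂ P G).re = ∫ ξ, pairing P G ξ := by
  rw [L2.inner_def]
  exact (integral_re (L2.integrable_inner (𝕜 := ℂ) P G)).symm

theorem re_inner_mulL2 {a : Space N → ℝ} {C : ℝ} (ha : AEStronglyMeasurable a)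
    (hC : ∀ ξ, |a ξ| ≤ C) (P G : L2Space N) :
    (inner ℂ P (mulL2 a G)).re = ∫ ξ, a ξ * pairing P G ξ := by
  rw [re_inner_eq]
  refine integral_congr_ae ?_
  filter_upwards [coeFn_mulL2 ha hC G] with ξ hξ
  simp only [pairing, hξ, RCLike.inner_apply, Complex.mul_re, Complex.conj_re, Complex.conj_im,
    Complex.ofReal_re, Complex.ofReal_im, Complex.mul_im]
  ring

theorem fourier_convL2 (a : Space N → ℝ) (g : L2Space N) :
    𝓕 (convL2 a g) = mulL2 (fun ξ => a ((2 * Real.pi) • ξ)) (𝓕 g) :=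
  FourierTransform.fourier_fourierInv_eq _

variable {N : ℕ}

/-! ### The symbol -/

theorem symbol_nonneg {K : Space N → ℝ} (hK : ∀ z, 0 ≤ K z) (ξ : Space N) : 0 ≤ symbol K ξ :=
  integral_nonneg fun z => mul_nonneg (sub_nonneg.2 (Real.cos_le_one _)) (hK z)

theorem measurable_symbol {K : Space N → ℝ} (hK : AEStronglyMeasurable K) :
    Measurable (symbol K) := by
  have h1 : symbol K = fun ξ => ∫ z, (1 - Real.cos ⟪z, ξ⟫) * hK.mk K z := by
    ext ξ
    refine integral_congr_ae ?_
    filter_upwards [hK.ae_eq_mk] with z hz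
    rw [hz]
  rw [h1]
  have h2 : StronglyMeasurable fun p : Space N × Space N =>
      (1 - Real.cos ⟪p.2, p.1⟫) * hK.mk K p.2 :=
    (by fun_prop : Continuous fun p : Space N × Space N =>
      1 - Real.cos ⟪p.2, p.1⟫).stronglyMeasurable.mul
      (hK.stronglyMeasurable_mk.comp_measurable measurable_snd)
  exact (h2.integral_prod_right' (ν := volume)).measurable

/-! ### Volterra equations for the multipliers -/

/-- The scalar equations with parameter c = m(ξ) are integrated against w, and Fubini's theorem
takes the convolution in time outside. It is used for ϱ₁ with b = 1, A = 1, and for ϱ₂ with b = ℓ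
and A the value of ℓ. -/
theorem integral_volterra {κ ℓ : ℝ → ℝ} (hκ : IsMemoryKernel κ ℓ) {ρ : ℝ → ℝ → ℝ} {b : ℝ → ℝ}
    {t A : ℝ} (ht : 0 < t)
    (hρ : StronglyMeasurable fun p : ℝ × ℝ => indicator (Ioi 0) (fun t => ρ t (max p.1 0)) p.2)
    (hb : ∀ s > 0, ∀ c, 0 ≤ c → |ρ s c| ≤ b s)
    (hint : IntervalIntegrable (fun s => ℓ (t - s) * b s) volume 0 t)
    (heq : ∀ c, 0 ≤ c → ρ t c + c * cconv ℓ (fun s => ρ s c) t = A)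
    {m w : Space N → ℝ} (hm : Measurable m) (hm0 : ∀ ξ, 0 ≤ m ξ) (hw : Integrable w)
    (hmw : Integrable fun ξ => m ξ * w ξ) :
    (∫ ξ, ρ t (m ξ) * w ξ) + cconv ℓ (fun s => ∫ ξ, ρ s (m ξ) * (m ξ * w ξ)) t =
      A * ∫ ξ, w ξ := by
  have hρm : ∀ s > 0, Measurable fun ξ => ρ s (m ξ) := by
    intro s hs
    have := hρ.measurable.comp (hm.prodMk (measurable_const (a := s)))
    convert this using 1
    ext ξ
    simp [indicator_of_mem (show s ∈ Ioi (0 : ℝ) from hs), max_eq_left (hm0 ξ)]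
  have hint' := (intervalIntegrable_iff_integrableOn_Ioo_of_le ht.le).1 hint
  have hlm : AEStronglyMeasurable (fun s => ℓ (t - s)) (volume.restrict (Ioo 0 t)) := by
    have h1 : IntervalIntegrable ℓ volume 0 t :=
      (intervalIntegrable_iff_integrableOn_Ioc_of_le ht.le).2 (hκ.conj_integrable t ht)
    have h2 : IntervalIntegrable (fun s => ℓ (t - s)) volume 0 t := by
      have := (h1.comp_sub_left t).symm
      simpa using this
    exact ((intervalIntegrable_iff_integrableOn_Ioo_of_le ht.le).1 h2).aestronglyMeasurable
  have hprod : Integrable (fun p : ℝ × Space N => ℓ (t - p.1) * (ρ p.1 (m p.2) * (m p.2 * w p.2)))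
      ((volume.restrict (Ioo 0 t)).prod volume) := by
    refine (hint'.mul_prod hmw.norm).mono' ?_ ?_
    · refine hlm.comp_fst.mul (AEStronglyMeasurable.mul ?_ hmw.aestronglyMeasurable.comp_snd)
      have h1 : Measurable fun p : ℝ × Space N =>
          indicator (Ioi 0) (fun t => ρ t (max (m p.2) 0)) p.1 :=
        hρ.measurable.comp ((hm.comp measurable_snd).prodMk measurable_fst)
      refine h1.aestronglyMeasurable.congr ?_
      have h2 : ∀ᵐ p ∂((volume.restrict (Ioo 0 t)).prod (volume : Measure (Space N))),
          p.1 ∈ Ioo 0 t := Measure.quasiMeasurePreserving_fst.ae (ae_restrict_mem measurableSet_Ioo)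
      filter_upwards [h2] with p hp
      rw [indicator_of_mem (show p.1 ∈ Ioi (0 : ℝ) from hp.1), max_eq_left (hm0 _)]
    · have h2 : ∀ᵐ p ∂((volume.restrict (Ioo 0 t)).prod (volume : Measure (Space N))),
          p.1 ∈ Ioo 0 t := Measure.quasiMeasurePreserving_fst.ae (ae_restrict_mem measurableSet_Ioo)
      filter_upwards [h2] with p hp
      rw [norm_mul, norm_mul, ← mul_assoc, Real.norm_eq_abs (ℓ _),
        abs_of_nonneg (hκ.conj_nonneg _ (sub_pos.2 hp.2))]
      exact mul_le_mul_of_nonneg_right (mul_le_mul_of_nonneg_left (hb _ hp.1 _ (hm0 _))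
        (hκ.conj_nonneg _ (sub_pos.2 hp.2))) (norm_nonneg _)
  have e1 : cconv ℓ (fun s => ∫ ξ, ρ s (m ξ) * (m ξ * w ξ)) t =
      ∫ ξ, m ξ * cconv ℓ (fun s => ρ s (m ξ)) t * w ξ := by
    unfold cconv
    rw [intervalIntegral.integral_of_le ht.le, integral_Ioc_eq_integral_Ioo]
    simp_rw [← integral_const_mul]
    rw [integral_integral_swap hprod]
    congr 1
    ext ξ
    rw [intervalIntegral.integral_of_le ht.le, integral_Ioc_eq_integral_Ioo, mul_right_comm,
      ← integral_const_mul]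
    congr 1
    ext s
    ring
  have i1 : Integrable fun ξ => ρ t (m ξ) * w ξ :=
    hw.bdd_mul (hρm t ht).aestronglyMeasurable (Eventually.of_forall fun ξ => hb t ht _ (hm0 ξ))
  have e2 : ∀ ξ, ρ t (m ξ) * w ξ + m ξ * cconv ℓ (fun s => ρ s (m ξ)) t * w ξ = A * w ξ := by
    intro ξ
    rw [← heq _ (hm0 ξ)]
    ring
  have i2 : Integrable fun ξ => m ξ * cconv ℓ (fun s => ρ s (m ξ)) t * w ξ := by
    refine ((hw.const_mul A).sub i1).congr (Eventually.of_forall fun ξ => ?_)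
    simp only [Pi.sub_apply]
    linear_combination -(e2 ξ)
  rw [e1, ← integral_add i1 i2, ← integral_const_mul]
  exact integral_congr_ae (Eventually.of_forall e2)

/-! ### The evolution in `L²` -/

/-- Weak measurability suffices, and the pairing with a fixed P is a Carathéodory function of (g,
r): continuous in g, measurable in r. The indicator and the positive part extend the multiplier to
all real r and all parameters. -/
theorem aestronglyMeasurable_mulL2 {ρ : ℝ → ℝ → ℝ} {b : ℝ → ℝ}
    (hρ : StronglyMeasurable fun p : ℝ × ℝ => indicator (Ioi 0) (fun t => ρ t (max p.1 0)) p.2)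
    (hb : ∀ s > 0, ∀ c, 0 ≤ c → |ρ s c| ≤ b s) {m : Space N → ℝ} (hm : Measurable m)
    {α : Type*} [MeasurableSpace α] {ν : Measure α} {G : α → L2Space N} {τ : α → ℝ}
    (hG : AEStronglyMeasurable G ν) (hτ : AEMeasurable τ ν) :
    AEStronglyMeasurable (fun x =>
      mulL2 (fun ξ => indicator (Ioi 0) (fun t => ρ t (max (m ξ) 0)) (τ x)) (G x)) ν := by
  have hmr : ∀ r, AEStronglyMeasurable (fun ξ => indicator (Ioi 0) (fun t => ρ t (max (m ξ) 0)) r) :=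
    fun r => (hρ.measurable.comp (hm.prodMk (measurable_const (a := r)))).aestronglyMeasurable
  have hbr : ∀ r ξ, |indicator (Ioi 0) (fun t => ρ t (max (m ξ) 0)) r| ≤ indicator (Ioi 0) b r := by
    intro r ξ
    by_cases hr : r ∈ Ioi (0 : ℝ)
    · rw [indicator_of_mem hr, indicator_of_mem hr]
      exact hb r hr _ (le_max_right _ _)
    · rw [indicator_of_notMem hr, indicator_of_notMem hr, abs_zero]
  have : Fact ((2 : ℝ≥0∞) ≠ ∞) := ⟨by norm_num⟩
  have : SecondCountableTopology (L2Space N) := inferInstance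
  refine aestronglyMeasurable_of_inner fun P => ?_
  borelize (L2Space N)
  have key : StronglyMeasurable (Function.uncurry fun (g : L2Space N) (r : ℝ) =>
      inner ℂ P (mulL2 (fun ξ => indicator (Ioi 0) (fun t => ρ t (max (m ξ) 0)) r) g)) := by
    refine stronglyMeasurable_uncurry_of_continuous_of_stronglyMeasurable (fun r => ?_) fun g => ?_
    · exact continuous_const.inner (continuous_mulL2 (hmr r) (hbr r))
    · have h1 : ∀ r, inner ℂ P (mulL2 (fun ξ => indicator (Ioi 0)
          (fun t => ρ t (max (m ξ) 0)) r) g) = ∫ ξ, inner ℂ (P ξ)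
            (((indicator (Ioi 0) (fun t => ρ t (max (m ξ) 0)) r : ℝ) : ℂ) * g ξ) := by
        intro r
        rw [L2.inner_def]
        refine integral_congr_ae ?_
        filter_upwards [coeFn_mulL2 (hmr r) (hbr r) g] with ξ hξ
        rw [hξ]
      simp_rw [h1]
      refine StronglyMeasurable.integral_prod_right' (ν := volume) (f := fun p : ℝ × Space N =>
        inner ℂ (P p.2) (((indicator (Ioi 0) (fun t => ρ t (max (m p.2) 0)) p.1 : ℝ) : ℂ)
          * g p.2)) ?_
      refine StronglyMeasurable.inner ((Lp.stronglyMeasurable P).comp_measurable measurable_snd)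
        (StronglyMeasurable.mul ?_ ((Lp.stronglyMeasurable g).comp_measurable measurable_snd))
      exact Complex.continuous_ofReal.comp_stronglyMeasurable (hρ.comp_measurable
        ((hm.comp measurable_snd).prodMk measurable_fst))
  exact (key.measurable.comp_aemeasurable (hG.aemeasurable.prodMk hτ)).aestronglyMeasurable

section Evolution

variable {κ ℓ : ℝ → ℝ} {m : Space N → ℝ} {F : ℝ → L2Space N} {T M : ℝ}

theorem IsMemoryKernel.abs_rho2_le (hκ : IsMemoryKernel κ ℓ) :
    ∀ s > 0, ∀ c, 0 ≤ c → |rho2 ℓ s c| ≤ ℓ s := fun s hs c hc => by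
  rw [abs_of_nonneg (hκ.rho2_nonneg hc hs)]
  exact hκ.rho2_le hc hs

theorem IsMemoryKernel.abs_rho1_le (hκ : IsMemoryKernel κ ℓ) :
    ∀ s > 0, ∀ c, 0 ≤ c → |rho1 ℓ s c| ≤ 1 := fun s hs c hc => by
  rw [abs_of_nonneg (hκ.rho1_nonneg hc hs)]
  exact hκ.rho1_le_one hc hs

theorem measurable_multiplier {ρ : ℝ → ℝ → ℝ}
    (hρ : StronglyMeasurable fun p : ℝ × ℝ => indicator (Ioi 0) (fun t => ρ t (max p.1 0)) p.2)
    (hm : Measurable m) (hm0 : ∀ ξ, 0 ≤ m ξ) {s : ℝ} (hs : 0 < s) :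
    Measurable fun ξ => ρ s (m ξ) := by
  have := hρ.measurable.comp (hm.prodMk (measurable_const (a := s)))
  convert this using 1
  ext ξ
  simp [indicator_of_mem (show s ∈ Ioi (0 : ℝ) from hs), max_eq_left (hm0 ξ)]

theorem indicator_multiplier (ρ : ℝ → ℝ → ℝ) (hm0 : ∀ ξ, 0 ≤ m ξ) {s : ℝ} (hs : 0 < s) :
    (fun ξ => indicator (Ioi 0) (fun t => ρ t (max (m ξ) 0)) s) = fun ξ => ρ s (m ξ) := by
  ext ξ
  rw [indicator_of_mem (show s ∈ Ioi (0 : ℝ) from hs), max_eq_left (hm0 ξ)]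

theorem IsMemoryKernel.intervalIntegrable_mulL2 (hκ : IsMemoryKernel κ ℓ) (hm : Measurable m)
    (hm0 : ∀ ξ, 0 ≤ m ξ) (hF : AEStronglyMeasurable F (volume.restrict (Ioo 0 T)))
    (hM : ∀ τ ∈ Ioo 0 T, ‖F τ‖ ≤ M) {t : ℝ} (ht : t ∈ Ioo 0 T) :
    IntervalIntegrable (fun τ => mulL2 (fun ξ => rho2 ℓ (t - τ) (m ξ)) (F τ)) volume 0 t := by
  have h1 : IntervalIntegrable (fun s => ℓ (t - s)) volume 0 t := by
    simpa using (((intervalIntegrable_iff_integrableOn_Ioc_of_le ht.1.le).2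
      (hκ.conj_integrable t ht.1)).comp_sub_left t).symm
  rw [intervalIntegrable_iff_integrableOn_Ioo_of_le ht.1.le] at h1 ⊢
  have hms := aestronglyMeasurable_mulL2 hκ.stronglyMeasurable_rho2 hκ.abs_rho2_le hm
    (hF.mono_measure (Measure.restrict_mono_set volume (Ioo_subset_Ioo_right ht.2.le)))
    (by fun_prop : AEMeasurable (fun τ => t - τ) (volume.restrict (Ioo 0 t)))
  refine (h1.mul_const M).mono' (hms.congr ?_) ?_
  · filter_upwards [ae_restrict_mem measurableSet_Ioo] with τ hτ
    rw [indicator_multiplier _ hm0 (sub_pos.2 hτ.2)]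
  · filter_upwards [ae_restrict_mem measurableSet_Ioo] with τ hτ
    have hpos := sub_pos.2 hτ.2
    refine (norm_mulL2_le (measurable_multiplier hκ.stronglyMeasurable_rho2 hm hm0
      hpos).aestronglyMeasurable (fun ξ => hκ.abs_rho2_le _ hpos _ (hm0 ξ)) _).trans ?_
    exact mul_le_mul_of_nonneg_left (hM τ ⟨hτ.1, hτ.2.trans ht.2⟩) (hκ.conj_nonneg _ hpos)

theorem abs_re_inner_le (P G : L2Space N) : |(inner ℂ P G).re| ≤ ‖P‖ * ‖G‖ :=
  (Complex.abs_re_le_norm _).trans (norm_inner_le_norm P G)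

/-- The weak form of the evolution equation for the Fourier multipliers `ϱ₁`, `ϱ₂`. -/
theorem IsMemoryKernel.evolution_identity (hκ : IsMemoryKernel κ ℓ) (hm : Measurable m)
    (hm0 : ∀ ξ, 0 ≤ m ξ) (hF : AEStronglyMeasurable F (volume.restrict (Ioo 0 T)))
    (hM : ∀ τ ∈ Ioo 0 T, ‖F τ‖ ≤ M) {P Q G₀ : L2Space N}
    (hQ : Q =ᵐ[volume] fun ξ => (m ξ : ℂ) * P ξ) {V : ℝ → L2Space N}
    (hV : ∀ t ∈ Ioo 0 T, V t = mulL2 (fun ξ => rho1 ℓ t (m ξ)) G₀ +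
      ∫ τ in (0 : ℝ)..t, mulL2 (fun ξ => rho2 ℓ (t - τ) (m ξ)) (F τ)) {t : ℝ}
    (ht : t ∈ Ioo 0 T) :
    (inner ℂ P (V t)).re + cconv ℓ (fun s => (inner ℂ Q (V s)).re) t =
      (inner ℂ P G₀).re + cconv ℓ (fun s => (inner ℂ P (F s)).re) t := by
  have hT : 0 < T := ht.1.trans ht.2
  have hM0 : 0 ≤ M := (norm_nonneg _).trans (hM t ht)
  have hpair : ∀ G, pairing Q G =ᵐ[volume] fun ξ => m ξ * pairing P G ξ := by
    intro G
    filter_upwards [hQ] with ξ hξ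
    simp only [pairing, hξ, RCLike.inner_apply, map_mul, Complex.mul_re, Complex.conj_re,
      Complex.conj_im, Complex.ofReal_re, Complex.ofReal_im, Complex.mul_im]
    ring
  have hmp : ∀ G, Integrable fun ξ => m ξ * pairing P G ξ := fun G =>
    (integrable_pairing Q G).congr (hpair G)
  have hm1 : ∀ {s : ℝ}, 0 < s → Measurable fun ξ => rho1 ℓ s (m ξ) := fun hs =>
    measurable_multiplier hκ.stronglyMeasurable_rho1 hm hm0 hs
  have hm2 : ∀ {s : ℝ}, 0 < s → Measurable fun ξ => rho2 ℓ s (m ξ) := fun hs =>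
    measurable_multiplier hκ.stronglyMeasurable_rho2 hm hm0 hs
  set B : L2Space N → ℝ → ℝ → ℝ := fun P r τ =>
    (inner ℂ P (mulL2 (fun ξ => rho2 ℓ r (m ξ)) (F τ))).re with hB
  set X : L2Space N → ℝ → ℝ := fun P s =>
    (inner ℂ P (mulL2 (fun ξ => rho1 ℓ s (m ξ)) G₀)).re with hX
  have hBb : ∀ P, ∀ r > 0, ∀ τ ∈ Ioo 0 T, |B P r τ| ≤ ‖P‖ * M * ℓ r := by
    intro P r hr τ hτ
    refine (abs_re_inner_le _ _).trans ?_
    have h1 := norm_mulL2_le (hm2 hr).aestronglyMeasurable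
      (fun ξ => hκ.abs_rho2_le _ hr _ (hm0 ξ)) (F τ)
    have h2 : ℓ r * ‖F τ‖ ≤ ℓ r * M := mul_le_mul_of_nonneg_left (hM τ hτ) (hκ.conj_nonneg _ hr)
    calc _ ≤ ‖P‖ * (ℓ r * M) := mul_le_mul_of_nonneg_left (h1.trans h2) (norm_nonneg _)
      _ = _ := by ring
  have hXb : ∀ P, ∀ s > 0, |X P s| ≤ ‖P‖ * ‖G₀‖ := by
    intro P s hs
    refine (abs_re_inner_le _ _).trans ?_
    have h1 := norm_mulL2_le (hm1 hs).aestronglyMeasurable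
      (fun ξ => hκ.abs_rho1_le _ hs _ (hm0 ξ)) G₀
    rw [one_mul] at h1
    exact mul_le_mul_of_nonneg_left h1 (norm_nonneg _)
  have hreM : ∀ (P : L2Space N) {α : Type} [MeasurableSpace α] {ν : Measure α} {g : α → L2Space N},
      AEStronglyMeasurable g ν → AEStronglyMeasurable (fun x => (inner ℂ P (g x)).re) ν :=
    fun P α _ ν g hg => Complex.continuous_re.comp_aestronglyMeasurable
      (aestronglyMeasurable_const.inner hg)
  have hBm : ∀ P, AEStronglyMeasurable (fun p : ℝ × ℝ => B P p.1 p.2)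
      ((volume.restrict (Ioo 0 t)).prod (volume.restrict (Ioo 0 t))) := by
    intro P
    have h1 := aestronglyMeasurable_mulL2 hκ.stronglyMeasurable_rho2 hκ.abs_rho2_le hm
      ((hF.mono_measure (Measure.restrict_mono_set volume
        (Ioo_subset_Ioo_right ht.2.le))).comp_snd (μ := volume.restrict (Ioo 0 t)))
      (measurable_fst.aemeasurable (μ := (volume.restrict (Ioo 0 t)).prod
        (volume.restrict (Ioo 0 t))))
    refine (hreM P h1).congr ?_
    have h2 : ∀ᵐ p ∂((volume.restrict (Ioo 0 t)).prod (volume.restrict (Ioo (0 : ℝ) t))),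
        p.1 ∈ Ioo 0 t := Measure.quasiMeasurePreserving_fst.ae (ae_restrict_mem measurableSet_Ioo)
    filter_upwards [h2] with p hp
    rw [indicator_multiplier _ hm0 hp.1]
  have hXm : ∀ P, AEStronglyMeasurable (X P) (volume.restrict (Ioo 0 t)) := by
    intro P
    have h1 := aestronglyMeasurable_mulL2 hκ.stronglyMeasurable_rho1 hκ.abs_rho1_le hm
      (aestronglyMeasurable_const (b := G₀)) (aemeasurable_id (μ := volume.restrict (Ioo 0 t)))
    refine (hreM P h1).congr ?_
    filter_upwards [ae_restrict_mem measurableSet_Ioo] with s hs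
    simp only [id]
    rw [indicator_multiplier _ hm0 hs.1]
  have hBint : ∀ P, ∀ s ∈ Ioo 0 T, IntervalIntegrable (fun τ => B P (s - τ) τ) volume 0 s := by
    intro P s hs
    have h1 := hκ.intervalIntegrable_mulL2 hm hm0 hF hM hs
    rw [intervalIntegrable_iff_integrableOn_Ioo_of_le hs.1.le] at h1 ⊢
    exact (h1.const_inner (𝕜 := ℂ) P).re
  -- The pairing is continuous and enters the Bochner integral.
  have hVe : ∀ P, ∀ s ∈ Ioo 0 T, (inner ℂ P (V s)).re = X P s + ∫ τ in (0 : ℝ)..s, B P (s - τ) τ := by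
    intro P s hs
    have h1 := hκ.intervalIntegrable_mulL2 hm hm0 hF hM hs
    rw [hV s hs, inner_add_right, Complex.add_re]
    congr 1
    rw [intervalIntegrable_iff_integrableOn_Ioc_of_le hs.1.le] at h1
    rw [intervalIntegral.integral_of_le hs.1.le, intervalIntegral.integral_of_le hs.1.le,
      ← integral_inner h1]
    exact (integral_re (h1.const_inner (𝕜 := ℂ) P)).symm
  have hYm : AEStronglyMeasurable (fun s => ∫ τ in (0 : ℝ)..s, B Q (s - τ) τ)
      (volume.restrict (Ioo 0 t)) := by
    have h1 := aestronglyMeasurable_mulL2 hκ.stronglyMeasurable_rho2 hκ.abs_rho2_le hm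
      ((hF.mono_measure (Measure.restrict_mono_set volume
        (Ioo_subset_Ioo_right ht.2.le))).comp_snd (μ := volume.restrict (Ioo 0 t)))
      (by fun_prop : AEMeasurable (fun p : ℝ × ℝ => p.1 - p.2)
        ((volume.restrict (Ioo 0 t)).prod (volume.restrict (Ioo 0 t))))
    refine (hreM Q h1).integral_prod_right'.congr ?_
    filter_upwards [ae_restrict_mem measurableSet_Ioo] with s hs
    rw [intervalIntegral.integral_of_le hs.1.le, integral_Ioc_eq_integral_Ioo]
    symm
    have hsub : Ioo 0 s ⊆ Ioo 0 t := Ioo_subset_Ioo_right hs.2.le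
    rw [← integral_indicator measurableSet_Ioo, ← integral_indicator measurableSet_Ioo]
    congr 1
    ext τ
    by_cases h1 : τ ∈ Ioo 0 s
    · rw [indicator_of_mem h1, indicator_of_mem (hsub h1)]
      rw [indicator_multiplier _ hm0 (sub_pos.2 h1.2)]
    · rw [indicator_of_notMem h1]
      by_cases h2 : τ ∈ Ioo 0 t
      · rw [indicator_of_mem h2]
        -- For τ ≥ s the extended multiplier is zero, so integration over the fixed interval (0,t)
        -- gives the same value.
        have h3 : s - τ ∉ Ioi (0 : ℝ) := fun h => h1 ⟨h2.1, sub_pos.1 h⟩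
        simp only [indicator_of_notMem h3]
        rw [re_inner_mulL2 (C := 0) aestronglyMeasurable_const (by simp)]
        simp
      · rw [indicator_of_notMem h2]
  have hYb : ∀ s ∈ Ioo 0 t, |∫ τ in (0 : ℝ)..s, B Q (s - τ) τ| ≤
      ‖Q‖ * M * ∫ r in (0 : ℝ)..t, ℓ r := by
    intro s hs
    have hli : ∀ r > 0, IntervalIntegrable ℓ volume 0 r := fun r hr =>
      (intervalIntegrable_iff_integrableOn_Ioc_of_le hr.le).2 (hκ.conj_integrable r hr)
    have hl2 : IntervalIntegrable (fun τ => ‖Q‖ * M * ℓ (s - τ)) volume 0 s := by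
      simpa using ((hli s hs.1).comp_sub_left s).symm.const_mul (‖Q‖ * M)
    have h1 : |∫ τ in (0 : ℝ)..s, B Q (s - τ) τ| ≤ ∫ τ in (0 : ℝ)..s, ‖Q‖ * M * ℓ (s - τ) := by
      rw [← Real.norm_eq_abs]
      refine intervalIntegral.norm_integral_le_of_norm_le hs.1.le ?_ hl2
      have h3 : ∀ᵐ τ : ℝ, τ ≠ s := by simp [ae_iff]
      filter_upwards [h3] with τ hτs hτ
      exact hBb Q _ (sub_pos.2 (lt_of_le_of_ne hτ.2 hτs)) _
        ⟨hτ.1, hτ.2.trans_lt (hs.2.trans ht.2)⟩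
    have h2 : ∫ r in (0 : ℝ)..s, ℓ r ≤ ∫ r in (0 : ℝ)..t, ℓ r := by
      rw [intervalIntegral.integral_of_le hs.1.le, intervalIntegral.integral_of_le ht.1.le]
      refine setIntegral_mono_set (hκ.conj_integrable t ht.1) ?_
        (Ioc_subset_Ioc_right hs.2.le).eventuallyLE
      filter_upwards [ae_restrict_mem measurableSet_Ioc] with r hr using hκ.conj_nonneg r hr.1
    rw [intervalIntegral.integral_const_mul, intervalIntegral.integral_comp_sub_left ℓ s, sub_self,
      sub_zero] at h1
    exact h1.trans (mul_le_mul_of_nonneg_left h2 (by positivity))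
  have hLi := hκ.conj_integrable t ht.1
  have c1 : cconv ℓ (fun s => (inner ℂ Q (V s)).re) t =
      cconv ℓ (X Q) t + cconv ℓ (fun s => ∫ τ in (0 : ℝ)..s, B Q (s - τ) τ) t := by
    unfold cconv
    rw [← intervalIntegral.integral_add]
    · refine intervalIntegral.integral_congr_ae ?_
      have h3 : ∀ᵐ τ : ℝ, τ ≠ t := by simp [ae_iff]
      filter_upwards [h3] with s hst hs
      rw [uIoc_of_le ht.1.le] at hs
      rw [hVe Q s ⟨hs.1, hs.2.trans_lt ht.2⟩, mul_add]
    · refine intervalIntegrable_conv_of_bounded ht.1.le hLi ?_ fun s hs => hXb Q s hs.1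
      rw [← restrict_Ioo_eq_restrict_Ioc]
      exact hXm Q
    · refine intervalIntegrable_conv_of_bounded ht.1.le hLi ?_ hYb
      rw [← restrict_Ioo_eq_restrict_Ioc]
      exact hYm
  have hXe : X P t + cconv ℓ (X Q) t = (inner ℂ P G₀).re := by
    have h0 : IntervalIntegrable (fun s => ℓ (t - s) * 1) volume 0 t :=
      intervalIntegrable_conv_of_bounded (C := 1) ht.1.le hLi aestronglyMeasurable_const (by simp)
    have h1 := integral_volterra hκ ht.1 hκ.stronglyMeasurable_rho1 hκ.abs_rho1_le
      h0 (fun c hc => hκ.rho1_volterra hc ht.1) hm hm0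
      (integrable_pairing P G₀) (hmp G₀)
    rw [one_mul, ← re_inner_eq] at h1
    rw [← h1]
    congr 1
    · exact re_inner_mulL2 (hm1 ht.1).aestronglyMeasurable
        (fun ξ => hκ.abs_rho1_le _ ht.1 _ (hm0 ξ)) P G₀
    · refine intervalIntegral.integral_congr_ae (Eventually.of_forall fun s hs => ?_)
      rw [uIoc_of_le ht.1.le] at hs
      congr 1
      refine (re_inner_mulL2 (hm1 hs.1).aestronglyMeasurable
        (fun ξ => hκ.abs_rho1_le _ hs.1 _ (hm0 ξ)) Q G₀).trans (integral_congr_ae ?_)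
      filter_upwards [hpair G₀] with ξ hξ
      rw [hξ]
  -- The ϱ₂-equations for a frozen source time τ. Integration in τ and Fubini on the triangle turn
  -- them into the Duhamel part of the identity.
  have hYe : ∀ τ ∈ Ioo 0 t, B P (t - τ) τ + cconv ℓ (fun r => B Q r τ) (t - τ) =
      ℓ (t - τ) * (inner ℂ P (F τ)).re := by
    intro τ hτ
    have hpos := sub_pos.2 hτ.2
    have h1 := integral_volterra hκ hpos hκ.stronglyMeasurable_rho2 hκ.abs_rho2_le
      (intervalIntegrable_conv_of_antitone hκ.conj_integrable hκ.conj_nonneg hκ.conj_antitone hpos)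
      (fun c hc => hκ.rho2_eq hc hpos) hm hm0 (integrable_pairing P (F τ)) (hmp (F τ))
    rw [← re_inner_eq] at h1
    rw [← h1]
    congr 1
    · exact re_inner_mulL2 (hm2 hpos).aestronglyMeasurable
        (fun ξ => hκ.abs_rho2_le _ hpos _ (hm0 ξ)) P (F τ)
    · refine intervalIntegral.integral_congr_ae (Eventually.of_forall fun s hs => ?_)
      rw [uIoc_of_le hpos.le] at hs
      congr 1
      refine (re_inner_mulL2 (hm2 hs.1).aestronglyMeasurable
        (fun ξ => hκ.abs_rho2_le _ hs.1 _ (hm0 ξ)) Q (F τ)).trans (integral_congr_ae ?_)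
      filter_upwards [hpair (F τ)] with ξ hξ
      rw [hξ]
  have c2 := fubini_triangle (B := B Q) (b := fun r => ‖Q‖ * M * ℓ r) ht.1.le hLi
    (hLi.const_mul _) (hBm Q) fun r hr τ hτ => hBb Q r hr.1 τ ⟨hτ.1, hτ.2.trans ht.2⟩
  have c3 : ∫ τ in (0 : ℝ)..t, ∫ r in (0 : ℝ)..(t - τ), ℓ (t - τ - r) * B Q r τ =
      cconv ℓ (fun s => (inner ℂ P (F s)).re) t - ∫ τ in (0 : ℝ)..t, B P (t - τ) τ := by
    unfold cconv
    rw [← intervalIntegral.integral_sub _ (hBint P t ht)]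
    · refine intervalIntegral.integral_congr_ae ?_
      have h3 : ∀ᵐ τ : ℝ, τ ≠ t := by simp [ae_iff]
      filter_upwards [h3] with τ hτt hτ
      rw [uIoc_of_le ht.1.le] at hτ
      have := hYe τ ⟨hτ.1, lt_of_le_of_ne hτ.2 hτt⟩
      rw [← this, add_sub_cancel_left]
      rfl
    · refine intervalIntegrable_conv_of_bounded (C := ‖P‖ * M) ht.1.le hLi ?_ fun s hs => ?_
      · rw [← restrict_Ioo_eq_restrict_Ioc]
        exact hreM P (hF.mono_measure (Measure.restrict_mono_set volume
          (Ioo_subset_Ioo_right ht.2.le)))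
      · exact (abs_re_inner_le _ _).trans (mul_le_mul_of_nonneg_left
          (hM s ⟨hs.1, hs.2.trans ht.2⟩) (norm_nonneg _))
  have c4 : cconv ℓ (fun s => ∫ τ in (0 : ℝ)..s, B Q (s - τ) τ) t =
      cconv ℓ (fun s => (inner ℂ P (F s)).re) t - ∫ τ in (0 : ℝ)..t, B P (t - τ) τ := by
    rw [← c3, ← c2]
    rfl
  rw [hVe P t ht, c1, c4, ← hXe]
  ring

end Evolution

variable {N : ℕ}

/-! ### A Borel version of the kernel -/

/-- A Borel representative need be neither even nor nonnegative. Absolute values and averaging over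
±z restore both, and change it only on a null set. -/
theorem IsSymmKernel.exists_measurable {J : Space N → ℝ} (hJ : IsSymmKernel J) :
    ∃ K : Space N → ℝ, Measurable K ∧ IsSymmKernel K ∧ J =ᵐ[volume] K := by
  set k := hJ.aesm.mk J with hk
  have hkm : Measurable k := hJ.aesm.stronglyMeasurable_mk.measurable
  have hK : J =ᵐ[volume] fun z => (|k z| + |k (-z)|) / 2 := by
    have h1 := hJ.aesm.ae_eq_mk
    have h2 : ∀ᵐ z : Space N, J (-z) = k (-z) :=
      (Measure.measurePreserving_neg (volume : Measure (Space N))).quasiMeasurePreserving.ae h1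
    filter_upwards [h1, h2] with z hz hz'
    rw [← hk] at hz
    rw [← hz, ← hz', hJ.even, abs_of_nonneg (hJ.nonneg z)]
    ring
  have hKm : Measurable fun z => (|k z| + |k (-z)|) / 2 := by fun_prop
  refine ⟨_, hKm, ⟨hKm.aestronglyMeasurable, fun z => by positivity, fun z => ?_, ?_⟩, hK⟩
  · rw [neg_neg, add_comm]
  · refine hJ.integrable.congr ?_
    filter_upwards [hK] with z hz
    rw [hz]

theorem symbol_congr {J K : Space N → ℝ} (h : J =ᵐ[volume] K) : symbol J = symbol K := by
  ext ξ
  refine integral_congr_ae ?_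
  filter_upwards [h] with z hz
  rw [hz]

theorem levyOp_congr {J K : Space N → ℝ} (h : J =ᵐ[volume] K) (w : Space N → ℝ) :
    levyOp J w = levyOp K w := by
  ext x
  unfold levyOp
  congr 1
  ext ε
  refine integral_congr_ae (ae_restrict_of_ae ?_)
  have h2 : ∀ᵐ z : Space N, J (x - z) = K (x - z) :=
    (Measure.measurePreserving_sub_left (volume : Measure (Space N)) x).quasiMeasurePreserving.ae h
  filter_upwards [h2] with z hz
  rw [hz]

/-! ### Convolution in space -/

/-- The convolution `(a * w)(x) = ∫ a(x - y) w(y) dy`. -/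
def sconv (a w : Space N → ℝ) (x : Space N) : ℝ := ∫ y, a (x - y) * w y

theorem sconv_eq (a w : Space N → ℝ) (x : Space N) : sconv a w x = ∫ z, w (x - z) * a z := by
  unfold sconv
  rw [← integral_sub_left_eq_self _ volume x]
  simp only [sub_sub_cancel, mul_comm]

theorem integrable_sconv {a w : Space N → ℝ} {C : ℝ} (ha : Integrable a)
    (hw : AEStronglyMeasurable w) (hC : ∀ᵐ y, |w y| ≤ C) (x : Space N) :
    Integrable fun y => a (x - y) * w y :=
  (ha.comp_sub_left x).mul_bdd hw hC

theorem abs_sconv_le {a w : Space N → ℝ} {C : ℝ} (ha : Integrable a) (hC : ∀ᵐ y, |w y| ≤ C)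
    (x : Space N) : |sconv a w x| ≤ (∫ z, |a z|) * C := by
  have h1 : ∫ z, |a z| = ∫ y, |a (x - y)| := (integral_sub_left_eq_self (fun z => |a z|) _ x).symm
  rw [h1, ← integral_mul_const, ← Real.norm_eq_abs]
  refine norm_integral_le_of_norm_le ((ha.comp_sub_left x).abs.mul_const C) ?_
  filter_upwards [hC] with y hy
  rw [norm_mul, Real.norm_eq_abs, Real.norm_eq_abs]
  exact mul_le_mul_of_nonneg_left hy (abs_nonneg _)

theorem lintegral_enorm_sconv_le {a w : Space N → ℝ} (ha : Measurable a)
    (hw : AEStronglyMeasurable w) :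
    ∫⁻ x, ‖sconv a w x‖ₑ ≤ (∫⁻ z, ‖a z‖ₑ) * ∫⁻ y, ‖w y‖ₑ := by
  have hm : AEMeasurable (fun p : Space N × Space N => ‖a (p.1 - p.2)‖ₑ * ‖w p.2‖ₑ)
      (volume.prod volume) :=
    (ha.comp (measurable_fst.sub measurable_snd)).enorm.aemeasurable.mul hw.enorm.comp_snd
  calc ∫⁻ x, ‖sconv a w x‖ₑ ≤ ∫⁻ x, ∫⁻ y, ‖a (x - y)‖ₑ * ‖w y‖ₑ := by
        refine lintegral_mono fun x => ?_
        refine (enorm_integral_le_lintegral_enorm _).trans (le_of_eq ?_)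
        simp only [enorm_mul]
    _ = ∫⁻ y, ∫⁻ x, ‖a (x - y)‖ₑ * ‖w y‖ₑ := lintegral_lintegral_swap hm
    _ = ∫⁻ y, (∫⁻ z, ‖a z‖ₑ) * ‖w y‖ₑ := by
        refine lintegral_congr fun y => ?_
        rw [lintegral_mul_const' _ _ enorm_ne_top, lintegral_sub_right_eq_self (fun z => ‖a z‖ₑ) y]
    _ = _ := lintegral_const_mul'' _ hw.enorm

theorem aestronglyMeasurable_sconv {a : Space N → ℝ} {w : ℝ → Space N → ℝ} {ν : Measure ℝ}
    [SFinite ν] (ha : Measurable a)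
    (hw : AEStronglyMeasurable (fun p : ℝ × Space N => w p.1 p.2) (ν.prod volume)) :
    AEStronglyMeasurable (fun p : ℝ × Space N => sconv a (w p.1) p.2) (ν.prod volume) := by
  have h1 : AEStronglyMeasurable (fun q : (ℝ × Space N) × Space N =>
      a (q.1.2 - q.2) * hw.mk _ (q.1.1, q.2)) ((ν.prod volume).prod volume) :=
    ((ha.comp (by fun_prop : Measurable fun q : (ℝ × Space N) × Space N => q.1.2 - q.2)).mul
      (hw.stronglyMeasurable_mk.measurable.comp
        (by fun_prop : Measurable fun q : (ℝ × Space N) × Space N =>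
          (q.1.1, q.2)))).aestronglyMeasurable
  refine h1.integral_prod_right'.congr ?_
  have h2 : ∀ᵐ p ∂(ν.prod (volume : Measure (Space N))), ∀ᵐ y, w p.1 y = hw.mk _ (p.1, y) :=
    Measure.quasiMeasurePreserving_fst.ae (Measure.ae_ae_of_ae_prod hw.ae_eq_mk)
  filter_upwards [h2] with p hp
  refine integral_congr_ae ?_
  filter_upwards [hp] with y hy
  rw [hy]

theorem aestronglyMeasurable_sconv_time {a : Space N → ℝ} {w : ℝ → Space N → ℝ} {ν : Measure ℝ}
    [SFinite ν] (ha : Measurable a)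
    (hw : AEStronglyMeasurable (fun p : ℝ × Space N => w p.1 p.2) (ν.prod volume)) (x : Space N) :
    AEStronglyMeasurable (fun s => sconv a (w s) x) ν := by
  have h1 : AEStronglyMeasurable (fun q : ℝ × Space N => a (x - q.2) * w q.1 q.2)
      (ν.prod volume) :=
    ((ha.comp (by fun_prop : Measurable fun q : ℝ × Space N => x - q.2)).aestronglyMeasurable).mul
      hw
  exact h1.integral_prod_right'

/-! ### The spaces `X` and `L^∞((0,T); X)` -/

theorem measQ_eq (N : ℕ) (T : ℝ) : measQ N T = (volume.restrict (Ioo 0 T)).prod volume := by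
  rw [measQ, Measure.volume_eq_prod, ← Measure.prod_restrict, Measure.restrict_univ]

/-- Interpolation: ‖g‖₂² ≤ ‖g‖₁ ‖g‖_∞ ≤ (‖g‖₁ + ‖g‖_∞)². -/
theorem eLpNorm_two_le_normX {g : Space N → ℝ} (hg : AEStronglyMeasurable g) :
    eLpNorm g 2 volume ≤ normX g := by
  set A := eLpNorm g 1 volume with hA
  set B := eLpNorm g ∞ volume with hB
  have h1 : ∫⁻ x, ‖g x‖ₑ ^ (2 : ℝ) ≤ A * B := by
    have h2 : ∀ᵐ x, ‖g x‖ₑ ≤ B := by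
      rw [hB, eLpNorm_exponent_top]
      exact ae_le_eLpNormEssSup
    rw [hA, eLpNorm_one_eq_lintegral_enorm, ← lintegral_mul_const'' _ hg.enorm]
    refine lintegral_mono_ae ?_
    filter_upwards [h2] with x hx
    rw [ENNReal.rpow_two, sq]
    gcongr
  rw [eLpNorm_eq_lintegral_rpow_enorm_toReal (by norm_num) (by norm_num), ENNReal.toReal_ofNat]
  calc (∫⁻ x, ‖g x‖ₑ ^ (2 : ℝ)) ^ (1 / (2 : ℝ)) ≤ ((A + B) ^ (2 : ℝ)) ^ (1 / (2 : ℝ)) := by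
        refine ENNReal.rpow_le_rpow (h1.trans ?_) (by norm_num)
        rw [ENNReal.rpow_two, sq]
        gcongr
        · exact le_self_add
        · exact le_add_self
    _ = A + B := by rw [← ENNReal.rpow_mul]; norm_num

theorem MemX.memLp_two {g : Space N → ℝ} (hg : MemX g) : MemLp g 2 := by
  refine ⟨hg.1.1, (eLpNorm_two_le_normX hg.1.1).trans_lt ?_⟩
  exact ENNReal.add_lt_top.2 ⟨hg.1.2, hg.2.2⟩

theorem memLp_ofReal {g : Space N → ℝ} (hg : MemLp g 2) : MemLp (fun x => (g x : ℂ)) 2 := hg.ofReal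

theorem MemX.memLp_two_ofReal {g : Space N → ℝ} (hg : MemX g) :
    MemLp (fun x => (g x : ℂ)) 2 := hg.memLp_two.ofReal

theorem norm_toL2_le {g : Space N → ℝ} (hg : MemX g) {M : ℝ≥0} (hM : normX g ≤ M) :
    ‖toL2 fun x => (g x : ℂ)‖ ≤ M := by
  rw [toL2_of_memLp hg.memLp_two_ofReal, Lp.norm_toLp]
  refine ENNReal.toReal_le_coe_of_le_coe ?_
  refine le_trans (le_of_eq ?_) ((eLpNorm_two_le_normX hg.1.1).trans hM)
  exact eLpNorm_congr_norm_ae (Eventually.of_forall fun x => by simp)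

theorem inner_toL2 {p g : Space N → ℝ} (hp : MemLp p 2) (hg : MemLp g 2) :
    (inner ℂ (toL2 fun x => (p x : ℂ)) (toL2 fun x => (g x : ℂ))).re = ∫ x, p x * g x := by
  rw [re_inner_eq]
  refine integral_congr_ae ?_
  filter_upwards [coeFn_toL2 (memLp_ofReal hp), coeFn_toL2 (memLp_ofReal hg)] with x h1 h2
  simp only [pairing]
  rw [h1, h2]
  simp [mul_comm]

theorem aestronglyMeasurable_toL2 {f : ℝ → Space N → ℝ} {T : ℝ}
    (hf : AEStronglyMeasurable (fun p : ℝ × Space N => f p.1 p.2) (measQ N T))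
    (hX : ∀ t ∈ Ioo 0 T, MemX (f t)) :
    AEStronglyMeasurable (fun t => toL2 fun x => (f t x : ℂ)) (volume.restrict (Ioo 0 T)) := by
  have : Fact ((2 : ℝ≥0∞) ≠ ∞) := ⟨by norm_num⟩
  have : SecondCountableTopology (L2Space N) := inferInstance
  refine aestronglyMeasurable_of_inner fun P => ?_
  rw [measQ_eq] at hf
  have h1 : AEStronglyMeasurable (fun p : ℝ × Space N => inner ℂ (P p.2) ((f p.1 p.2 : ℝ) : ℂ))
      ((volume.restrict (Ioo 0 T)).prod volume) :=
    (Lp.aestronglyMeasurable P).comp_snd.inner (Complex.continuous_ofReal.comp_aestronglyMeasurable hf)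
  refine h1.integral_prod_right'.congr ?_
  filter_upwards [ae_restrict_mem measurableSet_Ioo] with t ht
  rw [L2.inner_def]
  refine integral_congr_ae ?_
  filter_upwards [coeFn_toL2 (hX t ht).memLp_two_ofReal] with x hx
  rw [hx]

/-! ### The mild solution in weak form in space -/

theorem memLp_two_of_bounded {p : Space N → ℝ} {C : ℝ} (hp : Integrable p) (hC : ∀ x, |p x| ≤ C) :
    MemLp p 2 :=
  MemX.memLp_two ⟨memLp_one_iff_integrable.2 hp,
    memLp_top_of_bound hp.aestronglyMeasurable C (Eventually.of_forall hC)⟩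

theorem fourier_intervalIntegral {F : ℝ → L2Space N} {t : ℝ} :
    𝓕 (∫ τ in (0 : ℝ)..t, F τ) = ∫ τ in (0 : ℝ)..t, 𝓕 (F τ) := by
  have h := fun s : Set ℝ => (Lp.fourierTransformₗᵢ (Space N) ℂ).toContinuousLinearEquiv
    |>.integral_comp_comm (μ := volume.restrict s) F
  have h' : ∀ s : Set ℝ, ∫ τ in s, 𝓕 (F τ) = 𝓕 (∫ τ in s, F τ) := h
  rw [intervalIntegral, intervalIntegral, h', h', sub_eq_add_neg, sub_eq_add_neg,
    FourierTransform.fourier_add]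
  congr 1
  exact (Lp.fourierTransformₗᵢ (Space N) ℂ).map_neg _

variable {κ ℓ : ℝ → ℝ} {J : Space N → ℝ} {T : ℝ} {u₀ : Space N → ℝ} {f u : ℝ → Space N → ℝ}

/-- By Plancherel this is `IsMemoryKernel.evolution_identity` for P the transform of p and Q that of
L p. The symbol is evaluated at 2πξ because of the normalisation of the transform. -/
theorem IsMildSolution.weak_identity (hκ : IsMemoryKernel κ ℓ) (hJ : IsSymmKernel J)
    (hu₀ : MemX u₀)
    (hfm : AEStronglyMeasurable (fun p : ℝ × Space N => f p.1 p.2) (measQ N T)) {M : ℝ≥0}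
    (hfX : ∀ t ∈ Ioo 0 T, MemX (f t) ∧ normX (f t) ≤ M) (hu : IsMildSolution ℓ J T u₀ f u)
    {p : Space N → ℝ} (hp : ContDiff ℝ 2 p) (hs : HasCompactSupport p) {t : ℝ} (ht : t ∈ Ioo 0 T) :
    (∫ x, p x * u t x) + cconv ℓ (fun s => ∫ x, symOp J p x * u s x) t =
      (∫ x, p x * u₀ x) + cconv ℓ (fun s => ∫ x, p x * f s x) t := by
  have hpi : Integrable p := hp.continuous.integrable_of_hasCompactSupport hs
  obtain ⟨C, hC⟩ := exists_bound_of_compactSupport hp.continuous hs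
  obtain ⟨C', hC'⟩ := hJ.exists_symOp_le hp hs
  have hqi := hJ.integrable_symOp hp hs
  have hp2 := memLp_two_of_bounded hpi hC
  have hq2 := memLp_two_of_bounded hqi hC'
  set m : Space N → ℝ := fun ξ => symbol J ((2 * Real.pi) • ξ) with hm
  have hmm : Measurable m := (measurable_symbol hJ.aesm).comp (measurable_const_smul _)
  have hm0 : ∀ ξ, 0 ≤ m ξ := fun ξ => symbol_nonneg hJ.nonneg _
  set P : L2Space N := toL2 fun x => (p x : ℂ) with hP
  set Q : L2Space N := toL2 fun x => (symOp J p x : ℂ) with hQ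
  have hPQ : (𝓕 Q : L2Space N) =ᵐ[volume] fun ξ => (m ξ : ℂ) * (𝓕 P : L2Space N) ξ := by
    rw [hQ, hP, toL2_of_memLp (memLp_ofReal hp2), toL2_of_memLp (memLp_ofReal hq2)]
    filter_upwards [fourier_ae_eq (g := fun x => (p x : ℂ)) hpi.ofReal (memLp_ofReal hp2),
      fourier_ae_eq (g := fun x => (symOp J p x : ℂ)) hqi.ofReal (memLp_ofReal hq2)] with ξ h1 h2
    rw [h1, h2]
    exact hJ.fourier_symOp hp hs ξ
  have hut : ∀ s ∈ Ioo 0 T, MemX (u s) := fun s hs => hu.memCX.2.1 s ⟨hs.1.le, hs.2⟩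
  set F : ℝ → L2Space N := fun τ => 𝓕 (toL2 fun y => (f τ y : ℂ)) with hF
  have hFm : AEStronglyMeasurable F (volume.restrict (Ioo 0 T)) :=
    (Lp.fourierTransformₗᵢ (Space N) ℂ).continuous.comp_aestronglyMeasurable
      (aestronglyMeasurable_toL2 hfm fun t ht => (hfX t ht).1)
  have hFM : ∀ τ ∈ Ioo 0 T, ‖F τ‖ ≤ M := fun τ hτ => by
    rw [hF, Lp.norm_fourier_eq]
    exact norm_toL2_le (hfX τ hτ).1 (hfX τ hτ).2
  have hV : ∀ t ∈ Ioo 0 T, (𝓕 (toL2 fun x => (u t x : ℂ)) : L2Space N) =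
      mulL2 (fun ξ => rho1 ℓ t (m ξ)) (𝓕 (toL2 fun y => (u₀ y : ℂ))) +
        ∫ τ in (0 : ℝ)..t, mulL2 (fun ξ => rho2 ℓ (t - τ) (m ξ)) (F τ) := by
    intro t ht
    rw [toL2_congr (hu.eq t ht), toL2_coeFn, FourierTransform.fourier_add,
      fourier_intervalIntegral]
    simp_rw [convZ, convY, fourier_convL2]
    rfl
  have key := hκ.evolution_identity hmm hm0 hFm hFM hPQ hV ht
  simp_rw [hF, Lp.inner_fourier_eq] at key
  rw [hP, inner_toL2 hp2 (hut t ht).memLp_two, inner_toL2 hp2 hu₀.memLp_two] at key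
  have e1 : ∀ {a b : ℝ → ℝ}, (∀ s ∈ Ioo 0 T, a s = b s) → cconv ℓ a t = cconv ℓ b t := by
    intro a b hab
    refine intervalIntegral.integral_congr_ae (Eventually.of_forall fun s hs => ?_)
    rw [uIoc_of_le ht.1.le] at hs
    rw [hab s ⟨hs.1, hs.2.trans_lt ht.2⟩]
  rw [e1 fun s hs => inner_toL2 hq2 (hut s hs).memLp_two,
    e1 fun s hs => inner_toL2 hp2 (hfX s hs).1.memLp_two] at key
  exact key

theorem IsMildSolution.sconv_identity (hκ : IsMemoryKernel κ ℓ) (hJ : IsSymmKernel J)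
    (hu₀ : MemX u₀)
    (hfm : AEStronglyMeasurable (fun p : ℝ × Space N => f p.1 p.2) (measQ N T)) {M : ℝ≥0}
    (hfX : ∀ t ∈ Ioo 0 T, MemX (f t) ∧ normX (f t) ≤ M) (hu : IsMildSolution ℓ J T u₀ f u)
    {η : Space N → ℝ} (hη : ContDiff ℝ 2 η) (hs : HasCompactSupport η) {t : ℝ} (ht : t ∈ Ioo 0 T)
    (x : Space N) :
    sconv η (u t) x + cconv ℓ (fun s => sconv (symOp J η) (u s) x) t =
      sconv η u₀ x + cconv ℓ (fun s => sconv η (f s) x) t := by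
  have h := hu.weak_identity hκ hJ hu₀ hfm hfX (p := fun y => η (x - y))
    (hη.comp (contDiff_const.sub contDiff_id))
    (hs.comp_homeomorph (Homeomorph.subLeft x)) ht
  simp only [symOp_comp_sub_left] at h
  exact h

variable {N : ℕ}

/-! ### Elementary bounds in `X` -/

theorem MemX.ae_abs_le {g : Space N → ℝ} {M : ℝ≥0} (hM : normX g ≤ M) :
    ∀ᵐ y, |g y| ≤ M := by
  have h1 : eLpNormEssSup g volume ≤ M := by
    rw [← eLpNorm_exponent_top]
    exact le_add_self.trans hM
  filter_upwards [ae_le_eLpNormEssSup (f := g) (μ := (volume : Measure (Space N)))] with y hy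
  have := hy.trans h1
  rwa [← Real.norm_eq_abs, ← coe_nnnorm, NNReal.coe_le_coe, ← ENNReal.coe_le_coe]

theorem MemX.lintegral_enorm_le {g : Space N → ℝ} {M : ℝ≥0} (hM : normX g ≤ M) :
    ∫⁻ y, ‖g y‖ₑ ≤ M := by
  rw [← eLpNorm_one_eq_lintegral_enorm]
  exact le_self_add.trans hM

theorem MemX.integrable {g : Space N → ℝ} (hg : MemX g) : Integrable g :=
  memLp_one_iff_integrable.1 hg.1

theorem aestronglyMeasurable_sconv_right {a w : Space N → ℝ} (ha : Measurable a)
    (hw : AEStronglyMeasurable w) : AEStronglyMeasurable (sconv a w) := by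
  have h1 : AEStronglyMeasurable (fun q : Space N × Space N => a (q.1 - q.2) * w q.2)
      (volume.prod volume) :=
    (ha.comp (measurable_fst.sub measurable_snd)).aestronglyMeasurable.mul hw.comp_snd
  exact h1.integral_prod_right'

/-- With one bounded factor, Fubini's theorem applies at every point x. -/
theorem sconv_assoc {a b w : Space N → ℝ} {C : ℝ} (ha : Integrable a) (ham : Measurable a)
    (hb : Integrable b) (hbm : Measurable b) (hw : AEStronglyMeasurable w)
    (hC : ∀ᵐ y, |w y| ≤ C) (x : Space N) :
    sconv (sconv a b) w x = sconv a (sconv b w) x := by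
  have hprod : Integrable (fun p : Space N × Space N => b (x - p.1 - p.2) * a p.2 * w p.1)
      (volume.prod volume) := by
    have hm : AEStronglyMeasurable (fun p : Space N × Space N => b (x - p.1 - p.2) * a p.2 * w p.1)
        (volume.prod volume) :=
      (((hbm.comp (by fun_prop : Measurable fun p : Space N × Space N => x - p.1 - p.2)).mul
        (ham.comp measurable_snd)).aestronglyMeasurable).mul hw.comp_fst
    rw [integrable_prod_iff' hm]
    have hi : ∀ z, Integrable fun y => b (x - y - z) * w y := by
      intro z
      have := integrable_sconv hb hw hC (x - z)
      simpa only [sub_right_comm] using this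
    constructor
    · refine Eventually.of_forall fun z => ((hi z).mul_const (a z)).congr
        (Eventually.of_forall fun y => ?_)
      simp only
      ring
    · refine ((ha.abs.const_mul ((∫ z, |b z|) * C))).mono' hm.norm.prod_swap.integral_prod_right'
        (Eventually.of_forall fun z => ?_)
      rw [Real.norm_eq_abs, abs_of_nonneg (integral_nonneg fun _ => norm_nonneg _)]
      have e : ∀ y, ‖b (x - y - z) * a z * w y‖ = (|b (x - z - y)| * |w y|) * |a z| := by
        intro y
        rw [norm_mul, norm_mul, sub_right_comm]
        simp only [Real.norm_eq_abs]
        ring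
      simp only [e]
      rw [integral_mul_const]
      refine mul_le_mul_of_nonneg_right ?_ (abs_nonneg _)
      have := abs_sconv_le (a := fun z => |b z|) (w := fun y => |w y|) (C := C) hb.abs
        (by simpa using hC) (x - z)
      simp only [abs_abs] at this
      exact (le_abs_self _).trans this
  have e1 : sconv (sconv a b) w x = ∫ y, ∫ z, b (x - y - z) * a z * w y := by
    refine integral_congr_ae (Eventually.of_forall fun y => ?_)
    simp only
    rw [sconv_eq, ← integral_mul_const]
  have e2 : sconv a (sconv b w) x = ∫ z, ∫ y, b (x - y - z) * a z * w y := by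
    rw [sconv_eq]
    refine integral_congr_ae (Eventually.of_forall fun z => ?_)
    simp only [sconv]
    rw [← integral_mul_const]
    congr 1
    ext y
    rw [sub_right_comm x z y]
    ring
  rw [e1, e2]
  exact integral_integral_swap (f := fun y z => b (x - y - z) * a z * w y) hprod

/-! ### Splitting the kernel -/

theorem IsSymmKernel.integrable_far {K : Space N → ℝ} (hK : IsSymmKernel K) {ε : ℝ} (hε : 0 < ε) :
    Integrable (indicator {z | ‖z‖ ∈ Ioi ε} K) := by
  refine (hK.integrable.const_mul (min 1 (ε ^ 2))⁻¹).mono'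
    (hK.restrict_norm measurableSet_Ioi).aesm (Eventually.of_forall fun z => ?_)
  have h3 : 0 < min 1 (ε ^ 2) := lt_min one_pos (by positivity)
  by_cases hz : z ∈ {z : Space N | ‖z‖ ∈ Ioi ε}
  · rw [indicator_of_mem hz, Real.norm_eq_abs, abs_of_nonneg (hK.nonneg z), inv_mul_eq_div,
      le_div_iff₀ h3, mul_comm]
    have : ε ≤ ‖z‖ := le_of_lt hz
    refine mul_le_mul_of_nonneg_right ?_ (hK.nonneg z)
    gcongr
  · rw [indicator_of_notMem hz, norm_zero]
    exact mul_nonneg (inv_nonneg.2 h3.le)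
      (mul_nonneg (le_min zero_le_one (sq_nonneg _)) (hK.nonneg z))

theorem IsSymmKernel.tendsto_near {K : Space N → ℝ} (hK : IsSymmKernel K) :
    Tendsto (fun ε : ℝ => ∫ z, min 1 (‖z‖ ^ 2) * indicator {z | ‖z‖ ∈ Iic ε} K z)
      (𝓝[>] 0) (𝓝 0) := by
  have h := tendsto_integral_filter_of_dominated_convergence (μ := (volume : Measure (Space N)))
    (F := fun (ε : ℝ) z => min 1 (‖z‖ ^ 2) * indicator {z | ‖z‖ ∈ Iic ε} K z)
    (f := fun _ => (0 : ℝ)) (l := 𝓝[>] 0) (fun z => min 1 (‖z‖ ^ 2) * K z) ?_ ?_ hK.integrable ?_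
  · simpa using h
  · exact Eventually.of_forall fun ε =>
      (hK.restrict_norm measurableSet_Iic).integrable.aestronglyMeasurable
  · refine Eventually.of_forall fun ε => Eventually.of_forall fun z => ?_
    have h0 : 0 ≤ min 1 (‖z‖ ^ 2) := le_min zero_le_one (sq_nonneg _)
    rw [norm_mul, Real.norm_eq_abs, abs_of_nonneg h0]
    refine mul_le_mul_of_nonneg_left ((norm_indicator_le_norm_self _ _).trans_eq ?_) h0
    rw [Real.norm_eq_abs, abs_of_nonneg (hK.nonneg z)]
  · refine Eventually.of_forall fun z => tendsto_const_nhds.congr' ?_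
    by_cases hz : z = 0
    · simp [hz]
    · filter_upwards [Ioo_mem_nhdsGT (norm_pos_iff.2 hz)] with ε hε
      rw [indicator_of_notMem (show z ∉ {z : Space N | ‖z‖ ∈ Iic ε} from fun h =>
        absurd hε.2 (not_lt.2 h)), mul_zero]

/-- The far part A of the kernel is integrable, so L η = c η - A * η + L_near η with c = ∫ A.
Convolution with w then puts A on η * w. -/
theorem IsSymmKernel.sconv_symOp {K : Space N → ℝ} (hK : IsSymmKernel K) (hKm : Measurable K)
    {ε : ℝ} (hε : 0 < ε) {η : Space N → ℝ} (hη : ContDiff ℝ 2 η) (hs : HasCompactSupport η)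
    {w : Space N → ℝ} {C : ℝ} (hw : AEStronglyMeasurable w) (hC : ∀ᵐ y, |w y| ≤ C)
    (x : Space N) :
    sconv (symOp K η) w x = (∫ z, indicator {z | ‖z‖ ∈ Ioi ε} K z) * sconv η w x -
      sconv (indicator {z | ‖z‖ ∈ Ioi ε} K) (sconv η w) x +
      sconv (symOp (indicator {z | ‖z‖ ∈ Iic ε} K) η) w x := by
  set A := indicator {z : Space N | ‖z‖ ∈ Ioi ε} K with hA
  set R := indicator {z : Space N | ‖z‖ ∈ Iic ε} K with hR
  have hηi : Integrable η := hη.continuous.integrable_of_hasCompactSupport hs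
  obtain ⟨M, hM⟩ := exists_bound_of_compactSupport hη.continuous hs
  obtain ⟨D, -, hD⟩ := exists_secDiff_le hη hs
  have hAs : IsSymmKernel A := hK.restrict_norm measurableSet_Ioi
  have hRs : IsSymmKernel R := hK.restrict_norm measurableSet_Iic
  have hAi : Integrable A := hK.integrable_far hε
  have hAm : Measurable A := hKm.indicator (measurable_norm measurableSet_Ioi)
  have hAR : ∀ z, K z = A z + R z := by
    intro z
    by_cases hz : ε < ‖z‖
    · rw [hA, hR, indicator_of_mem (show z ∈ {z : Space N | ‖z‖ ∈ Ioi ε} from hz),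
        indicator_of_notMem (show z ∉ {z : Space N | ‖z‖ ∈ Iic ε} from not_le.2 hz), add_zero]
    · rw [hA, hR, indicator_of_notMem (show z ∉ {z : Space N | ‖z‖ ∈ Ioi ε} from hz),
        indicator_of_mem (show z ∈ {z : Space N | ‖z‖ ∈ Iic ε} from not_lt.1 hz), zero_add]
  have e1 : ∀ y, symOp K η y = (∫ z, A z) * η y - sconv A η y + symOp R η y := by
    intro y
    rw [sconv_eq, ← hAs.symOp_of_integrable hAi hη.continuous hM]
    unfold symOp
    rw [← mul_add, ← integral_add (hAs.integrable_secDiff hη.continuous (hD y))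
      (hRs.integrable_secDiff hη.continuous (hD y))]
    simp_rw [hAR, mul_add]
  have hsA : Integrable (sconv A η) := by
    have h1 := (hηi.const_mul (∫ z, A z)).sub (hAs.integrable_symOp hη hs)
    refine h1.congr (Eventually.of_forall fun y => ?_)
    simp only [Pi.sub_apply]
    rw [hAs.symOp_of_integrable hAi hη.continuous hM, sconv_eq, sub_sub_cancel]
  have i1 := integrable_sconv hηi hw hC x
  have i2 := integrable_sconv hsA hw hC x
  have i3 := integrable_sconv (hRs.integrable_symOp hη hs) hw hC x
  rw [← sconv_assoc hAi hAm hηi hη.continuous.measurable hw hC]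
  have i4 : Integrable fun y => (∫ z, A z) * (η (x - y) * w y) - sconv A η (x - y) * w y :=
    (i1.const_mul _).sub i2
  change ∫ y, symOp K η (x - y) * w y = (∫ z, A z) * (∫ y, η (x - y) * w y) -
    (∫ y, sconv A η (x - y) * w y) + ∫ y, symOp R η (x - y) * w y
  rw [← integral_const_mul, ← integral_sub (i1.const_mul _) i2, ← integral_add i4 i3]
  congr 1
  ext y
  rw [e1]
  ring

/-! ### A priori bounds -/

/-- Measurable functions of time and space, bounded by `M` in `X` for all times in `(0,T)`. -/
structure IsBoundedPath (T : ℝ) (M : ℝ≥0) (w : ℝ → Space N → ℝ) : Prop where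
  aesm : AEStronglyMeasurable (fun p : ℝ × Space N => w p.1 p.2) (measQ N T)
  mem : ∀ t ∈ Ioo 0 T, MemX (w t) ∧ normX (w t) ≤ M

theorem lintegral_enorm_eq {a : Space N → ℝ} (ha : Integrable a) :
    ∫⁻ x, ‖a x‖ₑ = ENNReal.ofReal (∫ x, |a x|) := (ofReal_integral_norm_eq_lintegral_enorm ha).symm

section Bounds

variable {κ ℓ : ℝ → ℝ} {K η : Space N → ℝ} {T ε δ : ℝ} {u₀ : Space N → ℝ} {f u : ℝ → Space N → ℝ}
  {M K₀ M₀ : ℝ≥0}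

theorem IsBoundedPath.aesm_sconv {w : ℝ → Space N → ℝ} (hw : IsBoundedPath T M w)
    {a : Space N → ℝ} (ha : Measurable a) :
    AEStronglyMeasurable (fun p : ℝ × Space N => sconv a (w p.1) p.2) (measQ N T) := by
  have := hw.aesm
  rw [measQ_eq] at this ⊢
  exact aestronglyMeasurable_sconv ha this

theorem IsBoundedPath.aesm_sconv_time {w : ℝ → Space N → ℝ} (hw : IsBoundedPath T M w)
    {a : Space N → ℝ} (ha : Measurable a) (x : Space N) :
    AEStronglyMeasurable (fun s => sconv a (w s) x) (volume.restrict (Ioo 0 T)) := by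
  have := hw.aesm
  rw [measQ_eq] at this
  exact aestronglyMeasurable_sconv_time ha this x

theorem IsBoundedPath.abs_sconv_le {w : ℝ → Space N → ℝ} (hw : IsBoundedPath T M w)
    {a : Space N → ℝ} (ha : Integrable a) {s : ℝ} (hs : s ∈ Ioo 0 T) (x : Space N) :
    |sconv a (w s) x| ≤ (∫ z, |a z|) * M :=
  DoubleNonlocal.abs_sconv_le ha (MemX.ae_abs_le (hw.mem s hs).2) x

/-- The source term of the Volterra equation for `η * u`, after splitting the kernel at `ε`. -/
def splitSource (K η : Space N → ℝ) (ε : ℝ) (f u : ℝ → Space N → ℝ) (s : ℝ) (x : Space N) : ℝ :=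
  sconv η (f s) x - sconv (symOp (indicator {z | ‖z‖ ∈ Iic ε} K) η) (u s) x +
    sconv (indicator {z | ‖z‖ ∈ Ioi ε} K) (sconv η (u s)) x

theorem aesm_splitSource (hK : IsSymmKernel K) (hKm : Measurable K)
    (hη : ContDiff ℝ 2 η) (hs : HasCompactSupport η) (hu : IsBoundedPath T K₀ u)
    (hf : IsBoundedPath T M f) :
    AEStronglyMeasurable (fun p : ℝ × Space N => splitSource K η ε f u p.1 p.2) (measQ N T) := by
  refine ((hf.aesm_sconv hη.continuous.measurable).sub (hu.aesm_sconv
    ((hK.restrict_norm measurableSet_Iic).continuous_symOp hη hs).measurable)).add ?_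
  have := hu.aesm_sconv hη.continuous.measurable
  rw [measQ_eq] at this ⊢
  exact aestronglyMeasurable_sconv (w := fun s => sconv η (u s))
    (hKm.indicator (measurable_norm measurableSet_Ioi)) this

theorem aesm_splitSource_time (hK : IsSymmKernel K) (hKm : Measurable K)
    (hη : ContDiff ℝ 2 η) (hs : HasCompactSupport η) (hu : IsBoundedPath T K₀ u)
    (hf : IsBoundedPath T M f) (x : Space N) :
    AEStronglyMeasurable (fun s => splitSource K η ε f u s x) (volume.restrict (Ioo 0 T)) := by
  refine ((hf.aesm_sconv_time hη.continuous.measurable x).sub (hu.aesm_sconv_time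
    ((hK.restrict_norm measurableSet_Iic).continuous_symOp hη hs).measurable x)).add ?_
  have := hu.aesm_sconv hη.continuous.measurable
  rw [measQ_eq] at this
  exact aestronglyMeasurable_sconv_time (w := fun s => sconv η (u s))
    (hKm.indicator (measurable_norm measurableSet_Ioi)) this x

/-- The coefficient of β is the mass of the far kernel, exactly the damping constant of the Volterra
equation. This balance keeps the final bound free of c, which may blow up as ε → 0. -/
theorem abs_splitSource_le (hK : IsSymmKernel K) (hε : 0 < ε) (hη : ContDiff ℝ 2 η)
    (hs : HasCompactSupport η) (hη1 : ∫ x, |η x| = 1)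
    (hδ : ∫ x, |symOp (indicator {z | ‖z‖ ∈ Iic ε} K) η x| ≤ δ) (hu : IsBoundedPath T K₀ u)
    (hf : IsBoundedPath T M f) {s β : ℝ} (hst : s ∈ Ioo 0 T) (hβ : ∀ y, |sconv η (u s) y| ≤ β)
    (x : Space N) :
    |splitSource K η ε f u s x| ≤
      M + δ * K₀ + (∫ z, indicator {z | ‖z‖ ∈ Ioi ε} K z) * β := by
  have hηi : Integrable η := hη.continuous.integrable_of_hasCompactSupport hs
  have h1 := hf.abs_sconv_le hηi hst x
  have h2 := hu.abs_sconv_le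
    ((hK.restrict_norm (S := Iic ε) measurableSet_Iic).integrable_symOp hη hs) hst x
  have h3 := abs_sconv_le (hK.integrable_far hε) (Eventually.of_forall hβ) x
  rw [hη1, one_mul] at h1
  simp_rw [abs_of_nonneg ((hK.restrict_norm measurableSet_Ioi).nonneg _)] at h3
  have h4 := mul_le_mul_of_nonneg_right hδ K₀.2
  unfold splitSource
  refine (abs_add_le _ _).trans (add_le_add ((abs_sub _ _).trans (add_le_add h1 ?_)) h3)
  exact h2.trans h4

theorem lintegral_splitSource_le (hK : IsSymmKernel K) (hKm : Measurable K) (hε : 0 < ε)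
    (hη : ContDiff ℝ 2 η) (hs : HasCompactSupport η) (hη1 : ∫ x, |η x| = 1)
    (hδ : ∫ x, |symOp (indicator {z | ‖z‖ ∈ Iic ε} K) η x| ≤ δ) (hu : IsBoundedPath T K₀ u)
    (hf : IsBoundedPath T M f) {s β : ℝ} (hst : s ∈ Ioo 0 T) (hβ0 : 0 ≤ β)
    (hβ : ∫⁻ y, ‖sconv η (u s) y‖ₑ ≤ ENNReal.ofReal β) :
    ∫⁻ x, ‖splitSource K η ε f u s x‖ₑ ≤
      ENNReal.ofReal (M + δ * K₀ + (∫ z, indicator {z | ‖z‖ ∈ Ioi ε} K z) * β) := by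
  have hηi : Integrable η := hη.continuous.integrable_of_hasCompactSupport hs
  have hR := hK.restrict_norm (S := Iic ε) measurableSet_Iic
  have hA := hK.restrict_norm (S := Ioi ε) measurableSet_Ioi
  have hδ0 : 0 ≤ δ := (integral_nonneg fun _ => abs_nonneg _).trans hδ
  have hc : 0 ≤ ∫ z, indicator {z | ‖z‖ ∈ Ioi ε} K z := integral_nonneg hA.nonneg
  have hAm : Measurable (indicator {z | ‖z‖ ∈ Ioi ε} K) :=
    hKm.indicator (measurable_norm measurableSet_Ioi)
  have hv : AEStronglyMeasurable (sconv η (u s)) :=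
    aestronglyMeasurable_sconv_right hη.continuous.measurable (hu.mem s hst).1.1.1
  have h1 := lintegral_enorm_sconv_le hη.continuous.measurable (hf.mem s hst).1.1.1
  have h2 := lintegral_enorm_sconv_le (hR.continuous_symOp hη hs).measurable (hu.mem s hst).1.1.1
  have h3 := lintegral_enorm_sconv_le hAm hv
  rw [lintegral_enorm_eq hηi, hη1, ENNReal.ofReal_one, one_mul] at h1
  rw [lintegral_enorm_eq (hR.integrable_symOp hη hs)] at h2
  rw [lintegral_enorm_eq (hK.integrable_far hε)] at h3
  simp_rw [abs_of_nonneg (hA.nonneg _)] at h3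
  have hm2 : AEMeasurable fun x => ‖sconv (symOp (indicator {z | ‖z‖ ∈ Iic ε} K) η) (u s) x‖ₑ :=
    (aestronglyMeasurable_sconv_right (hR.continuous_symOp hη hs).measurable
      (hu.mem s hst).1.1.1).enorm
  have hm3 : AEMeasurable fun x => ‖sconv (indicator {z | ‖z‖ ∈ Ioi ε} K) (sconv η (u s)) x‖ₑ :=
    (aestronglyMeasurable_sconv_right hAm hv).enorm
  calc ∫⁻ x, ‖splitSource K η ε f u s x‖ₑ
      ≤ ∫⁻ x, (‖sconv η (f s) x‖ₑ +
          ‖sconv (symOp (indicator {z | ‖z‖ ∈ Iic ε} K) η) (u s) x‖ₑ +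
          ‖sconv (indicator {z | ‖z‖ ∈ Ioi ε} K) (sconv η (u s)) x‖ₑ) :=
        lintegral_mono fun x => (enorm_add_le _ _).trans (add_le_add enorm_sub_le le_rfl)
    _ = (∫⁻ x, ‖sconv η (f s) x‖ₑ) +
          (∫⁻ x, ‖sconv (symOp (indicator {z | ‖z‖ ∈ Iic ε} K) η) (u s) x‖ₑ) +
          ∫⁻ x, ‖sconv (indicator {z | ‖z‖ ∈ Ioi ε} K) (sconv η (u s)) x‖ₑ := by
        rw [lintegral_add_right' _ hm3, lintegral_add_right' _ hm2]
    _ ≤ M + ENNReal.ofReal δ * K₀ + ENNReal.ofReal (∫ z, indicator {z | ‖z‖ ∈ Ioi ε} K z) *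
          ENNReal.ofReal β := by
        refine add_le_add (add_le_add (h1.trans (MemX.lintegral_enorm_le (hf.mem s hst).2))
          (h2.trans ?_)) (h3.trans (mul_le_mul_right hβ _))
        exact mul_le_mul' (ENNReal.ofReal_le_ofReal hδ) (MemX.lintegral_enorm_le (hu.mem s hst).2)
    _ = _ := by
        rw [← ENNReal.ofReal_coe_nnreal (p := M), ← ENNReal.ofReal_coe_nnreal (p := K₀),
          ← ENNReal.ofReal_mul hδ0, ← ENNReal.ofReal_mul hc, ← ENNReal.ofReal_add M.coe_nonneg
            (mul_nonneg hδ0 K₀.coe_nonneg), ← ENNReal.ofReal_add (by positivity) (mul_nonneg hc hβ0)]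

/-- After the splitting, the multiple c (η * u) stays on the left and everything else is a bounded
source. At each fixed x this is a scalar Volterra equation with a constant coefficient. -/
theorem volterra_repr_sconv (hκ : IsMemoryKernel κ ℓ) (hK : IsSymmKernel K) (hKm : Measurable K)
    (hε : 0 < ε) (hη : ContDiff ℝ 2 η) (hs : HasCompactSupport η) (hη1 : ∫ x, |η x| = 1)
    (hu : IsBoundedPath T K₀ u) (hf : IsBoundedPath T M f)
    (heq : ∀ t ∈ Ioo 0 T, ∀ x, sconv η (u t) x + cconv ℓ (fun s => sconv (symOp K η) (u s) x) t =
      sconv η u₀ x + cconv ℓ (fun s => sconv η (f s) x) t) (x : Space N) :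
    ∀ t ∈ Ioo 0 T, sconv η (u t) x =
      sconv η u₀ x * rho1 ℓ t (∫ z, indicator {z | ‖z‖ ∈ Ioi ε} K z) +
        cconv (fun s => rho2 ℓ s (∫ z, indicator {z | ‖z‖ ∈ Ioi ε} K z))
          (fun s => splitSource K η ε f u s x) t := by
  have hηi : Integrable η := hη.continuous.integrable_of_hasCompactSupport hs
  set c := ∫ z, indicator {z | ‖z‖ ∈ Ioi ε} K z with hc
  have hc0 : 0 ≤ c := integral_nonneg (hK.restrict_norm measurableSet_Ioi).nonneg
  have hvb : ∀ s ∈ Ioo 0 T, ∀ y, |sconv η (u s) y| ≤ K₀ := by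
    intro s hs y
    have := hu.abs_sconv_le hηi hs y
    rwa [hη1, one_mul] at this
  have hhb := fun s hs' => abs_splitSource_le hK hε hη hs hη1 le_rfl hu hf hs'
    (hvb s hs') x
  have hhm := aesm_splitSource_time (ε := ε) hK hKm hη hs hu hf x
  have hvm := hu.aesm_sconv_time hη.continuous.measurable x
  refine hκ.volterra_repr hc0 (integrableOn_of_bounded
    (by rw [← restrict_Ioo_eq_restrict_Ioc]; exact hvm) fun s hs => hvb s hs x)
    (by rw [← restrict_Ioo_eq_restrict_Ioc]; exact hhm) hhb fun t ht => ?_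
  have hii : ∀ {b : ℝ → ℝ} {C : ℝ}, AEStronglyMeasurable b (volume.restrict (Ioo 0 T)) →
      (∀ s ∈ Ioo 0 T, |b s| ≤ C) → IntervalIntegrable (fun s => ℓ (t - s) * b s) volume 0 t := by
    intro b C hb hC
    refine intervalIntegrable_conv_of_bounded ht.1.le (hκ.conj_integrable t ht.1) ?_
      fun s hs => hC s ⟨hs.1, hs.2.trans ht.2⟩
    rw [← restrict_Ioo_eq_restrict_Ioc]
    exact hb.mono_measure (Measure.restrict_mono_set volume (Ioo_subset_Ioo_right ht.2.le))
  have i1 := hii hvm fun s hs => hvb s hs x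
  have i2 := hii hhm hhb
  have i3 := hii (hu.aesm_sconv_time (hK.continuous_symOp hη hs).measurable x)
    fun s hs' => hu.abs_sconv_le (hK.integrable_symOp hη hs) hs' x
  have i4 := hii (hf.aesm_sconv_time hη.continuous.measurable x)
    fun s hs' => hf.abs_sconv_le hηi hs' x
  have e1 := heq t ht x
  have e2 : c * cconv ℓ (fun s => sconv η (u s) x) t + cconv ℓ (fun s => sconv η (f s) x) t =
      cconv ℓ (fun s => sconv (symOp K η) (u s) x) t +
        cconv ℓ (fun s => splitSource K η ε f u s x) t := by
    rw [← cconv_const_mul, ← cconv_add _ i4, ← cconv_add i3 i2]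
    · refine intervalIntegral.integral_congr_ae (Eventually.of_forall fun s hs' => ?_)
      rw [uIoc_of_le ht.1.le] at hs'
      have hsT : s ∈ Ioo 0 T := ⟨hs'.1, hs'.2.trans_lt ht.2⟩
      simp only
      rw [hK.sconv_symOp hKm hε hη hs (hu.mem s hsT).1.1.1 (MemX.ae_abs_le (hu.mem s hsT).2) x]
      unfold splitSource
      ring
    · simpa only [mul_left_comm] using i1.const_mul c
  linear_combination e1 + e2

end Bounds

variable {N : ℕ}

section Bounds

variable {κ ℓ : ℝ → ℝ} {K η : Space N → ℝ} {T ε δ : ℝ} {u₀ : Space N → ℝ} {f u : ℝ → Space N → ℝ}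
  {M K₀ M₀ : ℝ≥0}

theorem IsMemoryKernel.intervalIntegrable_rho2_conv (hκ : IsMemoryKernel κ ℓ) {c t C : ℝ}
    (hc : 0 ≤ c) (ht : 0 < t) {b : ℝ → ℝ} (hb : AEStronglyMeasurable b (volume.restrict (Ioo 0 t)))
    (hC : ∀ s ∈ Ioo 0 t, |b s| ≤ C) :
    IntervalIntegrable (fun s => rho2 ℓ (t - s) c * b s) volume 0 t := by
  rw [restrict_Ioo_eq_restrict_Ioc] at hb
  exact intervalIntegrable_conv_of_bounded ht.le (hκ.integrableOn_rho2 hc ht) hb hC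

theorem IsMemoryKernel.intervalIntegrable_rho2_conv_affine (hκ : IsMemoryKernel κ ℓ) {c t M₁ : ℝ}
    (hc : 0 ≤ c) (ht : t ∈ Ioo 0 T) {β : ℝ → ℝ} (hβ : ContinuousOn β (Icc 0 T)) :
    IntervalIntegrable (fun s => rho2 ℓ (t - s) c * (M₁ + c * β s)) volume 0 t := by
  have hc' : ContinuousOn (fun s => M₁ + c * β s) (Icc 0 T) := by fun_prop
  obtain ⟨C, hC⟩ := isCompact_Icc.exists_bound_of_continuousOn hc'
  refine hκ.intervalIntegrable_rho2_conv hc ht.1 ((hc'.mono fun s hs =>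
    ⟨hs.1.le, hs.2.le.trans ht.2.le⟩).aestronglyMeasurable measurableSet_Ioo)
    fun s hs => hC s ⟨hs.1.le, hs.2.le.trans ht.2.le⟩

theorem enorm_sconv_le_of_near (hκ : IsMemoryKernel κ ℓ) (hK : IsSymmKernel K) (hKm : Measurable K)
    (hε : 0 < ε) (hη : ContDiff ℝ 2 η) (hs : HasCompactSupport η) (hη1 : ∫ x, |η x| = 1)
    (hδ : ∫ x, |symOp (indicator {z | ‖z‖ ∈ Iic ε} K) η x| ≤ δ)
    (hu₀ : normX u₀ ≤ M₀) (hu : IsBoundedPath T K₀ u) (hf : IsBoundedPath T M f)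
    (heq : ∀ t ∈ Ioo 0 T, ∀ x, sconv η (u t) x + cconv ℓ (fun s => sconv (symOp K η) (u s) x) t =
      sconv η u₀ x + cconv ℓ (fun s => sconv η (f s) x) t) {t : ℝ} (ht : t ∈ Ioo 0 T) (x : Space N) :
    ‖sconv η (u t) x‖ₑ ≤ ENNReal.ofReal (M₀ + (M + δ * K₀) * ∫ s in (0 : ℝ)..t, ℓ s) := by
  have hηi : Integrable η := hη.continuous.integrable_of_hasCompactSupport hs
  have hδ0 : 0 ≤ δ := (integral_nonneg fun _ => abs_nonneg _).trans hδ
  set c := ∫ z, indicator {z | ‖z‖ ∈ Ioi ε} K z with hc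
  have hc0 : 0 ≤ c := integral_nonneg (hK.restrict_norm measurableSet_Ioi).nonneg
  -- The crude bound K₀ of u starts the iteration; it survives only in the term δ K₀ from the near
  -- part.
  have key := hκ.comparison (n := fun t => ⨆ x, ‖sconv η (u t) x‖ₑ) (T := T) (K := K₀) (M₀ := M₀)
    (M₁ := M + δ * K₀) hc0 M₀.coe_nonneg (by positivity) K₀.coe_nonneg (fun t ht => iSup_le fun x => ?_)
    fun β hβc hβ0 hβ t ht => iSup_le fun x => ?_
  · exact (le_iSup (fun x => ‖sconv η (u t) x‖ₑ) x).trans (key t ht)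
  · rw [Real.enorm_eq_ofReal_abs]
    have := hu.abs_sconv_le hηi ht x
    rw [hη1, one_mul] at this
    exact ENNReal.ofReal_le_ofReal this
  · have hβ' : ∀ s ∈ Ioo 0 T, ∀ y, |sconv η (u s) y| ≤ β s := by
      intro s hs y
      have h1 := (le_iSup (fun x => ‖sconv η (u s) x‖ₑ) y).trans (hβ s hs)
      rw [Real.enorm_eq_ofReal_abs] at h1
      exact (ENNReal.ofReal_le_ofReal_iff (hβ0 s ⟨hs.1.le, hs.2.le⟩)).1 h1
    rw [volterra_repr_sconv hκ hK hKm hε hη hs hη1 hu hf heq x t ht, Real.enorm_eq_ofReal_abs]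
    refine ENNReal.ofReal_le_ofReal ((abs_add_le _ _).trans (add_le_add ?_ ?_))
    · rw [abs_mul, abs_of_nonneg (hκ.rho1_nonneg hc0 ht.1)]
      refine mul_le_mul_of_nonneg_right ?_ (hκ.rho1_nonneg hc0 ht.1)
      have := abs_sconv_le hηi (MemX.ae_abs_le hu₀) x
      rwa [hη1, one_mul] at this
    · rw [← Real.norm_eq_abs]
      refine intervalIntegral.norm_integral_le_of_norm_le ht.1.le ?_
        (hκ.intervalIntegrable_rho2_conv_affine hc0 ht hβc)
      have h3 : ∀ᵐ τ : ℝ, τ ≠ t := by simp [ae_iff]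
      filter_upwards [h3] with s hst hs'
      have hsT : s ∈ Ioo 0 T := ⟨hs'.1, hs'.2.trans_lt ht.2⟩
      have hpos : 0 < t - s := sub_pos.2 (lt_of_le_of_ne hs'.2 hst)
      rw [norm_mul, Real.norm_eq_abs, abs_of_nonneg (hκ.rho2_nonneg hc0 hpos)]
      exact mul_le_mul_of_nonneg_left
        (abs_splitSource_le hK hε hη hs hη1 hδ hu hf hsT (hβ' s hsT) x) (hκ.rho2_nonneg hc0 hpos)

theorem lintegral_sconv_le_of_near (hκ : IsMemoryKernel κ ℓ) (hK : IsSymmKernel K)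
    (hKm : Measurable K)
    (hε : 0 < ε) (hη : ContDiff ℝ 2 η) (hs : HasCompactSupport η) (hη1 : ∫ x, |η x| = 1)
    (hδ : ∫ x, |symOp (indicator {z | ‖z‖ ∈ Iic ε} K) η x| ≤ δ)
    (hu₀m : MemX u₀) (hu₀ : normX u₀ ≤ M₀) (hu : IsBoundedPath T K₀ u) (hf : IsBoundedPath T M f)
    (heq : ∀ t ∈ Ioo 0 T, ∀ x, sconv η (u t) x + cconv ℓ (fun s => sconv (symOp K η) (u s) x) t =
      sconv η u₀ x + cconv ℓ (fun s => sconv η (f s) x) t) {t : ℝ} (ht : t ∈ Ioo 0 T) :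
    ∫⁻ x, ‖sconv η (u t) x‖ₑ ≤ ENNReal.ofReal (M₀ + (M + δ * K₀) * ∫ s in (0 : ℝ)..t, ℓ s) := by
  have hηi : Integrable η := hη.continuous.integrable_of_hasCompactSupport hs
  have hηe : ∫⁻ x, ‖η x‖ₑ = 1 := by rw [lintegral_enorm_eq hηi, hη1, ENNReal.ofReal_one]
  have hδ0 : 0 ≤ δ := (integral_nonneg fun _ => abs_nonneg _).trans hδ
  set c := ∫ z, indicator {z | ‖z‖ ∈ Ioi ε} K z with hc
  have hc0 : 0 ≤ c := integral_nonneg (hK.restrict_norm measurableSet_Ioi).nonneg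
  refine hκ.comparison (n := fun t => ∫⁻ x, ‖sconv η (u t) x‖ₑ) (T := T) (K := K₀) (M₀ := M₀)
    (M₁ := M + δ * K₀) hc0 M₀.coe_nonneg (by positivity) K₀.coe_nonneg (fun t ht => ?_)
    (fun β hβc hβ0 hβ t ht => ?_) t ht
  · have h1 := lintegral_enorm_sconv_le hη.continuous.measurable (hu.mem t ht).1.1.1
    rw [hηe, one_mul] at h1
    rw [ENNReal.ofReal_coe_nnreal]
    exact h1.trans (MemX.lintegral_enorm_le (hu.mem t ht).2)
  · have hρ1 := hκ.rho1_nonneg hc0 ht.1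
    have hii := (hκ.intervalIntegrable_rho2_conv_affine (M₁ := M + δ * K₀) hc0 ht hβc)
    rw [intervalIntegrable_iff_integrableOn_Ioo_of_le ht.1.le] at hii
    -- The positivity of ϱ₁ and ϱ₂ keeps them outside the norms. Tonelli's theorem then reduces the
    -- L¹ norm to the same scalar comparison as the sup norm.
    have hpt : ∀ x, ‖sconv η (u t) x‖ₑ ≤ ‖sconv η u₀ x‖ₑ * ENNReal.ofReal (rho1 ℓ t c) +
        ∫⁻ s in Ioo 0 t, ENNReal.ofReal (rho2 ℓ (t - s) c) * ‖splitSource K η ε f u s x‖ₑ := by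
      intro x
      rw [volterra_repr_sconv hκ hK hKm hε hη hs hη1 hu hf heq x t ht]
      refine (enorm_add_le _ _).trans (add_le_add ?_ ?_)
      · rw [enorm_mul, Real.enorm_eq_ofReal hρ1]
      · unfold cconv
        rw [intervalIntegral.integral_of_le ht.1.le, integral_Ioc_eq_integral_Ioo]
        refine (enorm_integral_le_lintegral_enorm _).trans (le_of_eq ?_)
        refine setLIntegral_congr_fun measurableSet_Ioo fun s hs' => ?_
        simp only
        rw [enorm_mul, Real.enorm_eq_ofReal (hκ.rho2_nonneg hc0 (sub_pos.2 hs'.2))]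
    have hρm : AEMeasurable (fun s => ENNReal.ofReal (rho2 ℓ (t - s) c))
        (volume.restrict (Ioo 0 t)) := by
      have h1 := hκ.intervalIntegrable_rho2_conv (b := fun _ => 1) (C := 1) hc0 ht.1
        aestronglyMeasurable_const (by simp)
      rw [intervalIntegrable_iff_integrableOn_Ioo_of_le ht.1.le] at h1
      simp only [mul_one] at h1
      exact h1.aestronglyMeasurable.aemeasurable.ennreal_ofReal
    have hjm : AEMeasurable (fun p : ℝ × Space N => ENNReal.ofReal (rho2 ℓ (t - p.1) c) *
        ‖splitSource K η ε f u p.1 p.2‖ₑ) ((volume.restrict (Ioo 0 t)).prod volume) := by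
      refine (hρm.comp_fst).mul ?_
      have h1 := (aesm_splitSource (ε := ε) hK hKm hη hs hu hf).enorm
      rw [measQ_eq] at h1
      exact h1.mono_measure (Measure.prod_mono (Measure.restrict_mono_set volume
        (Ioo_subset_Ioo_right ht.2.le)) le_rfl)
    have hm0' : AEMeasurable fun x => ‖sconv η u₀ x‖ₑ :=
      (aestronglyMeasurable_sconv_right hη.continuous.measurable hu₀m.1.1).enorm
    have hm0 : AEMeasurable fun x => ‖sconv η u₀ x‖ₑ * ENNReal.ofReal (rho1 ℓ t c) :=
      hm0'.mul_const _
    calc ∫⁻ x, ‖sconv η (u t) x‖ₑ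
        ≤ ∫⁻ x, (‖sconv η u₀ x‖ₑ * ENNReal.ofReal (rho1 ℓ t c) +
          ∫⁻ s in Ioo 0 t, ENNReal.ofReal (rho2 ℓ (t - s) c) * ‖splitSource K η ε f u s x‖ₑ) :=
          lintegral_mono hpt
      _ = (∫⁻ x, ‖sconv η u₀ x‖ₑ) * ENNReal.ofReal (rho1 ℓ t c) +
          ∫⁻ s in Ioo 0 t, ENNReal.ofReal (rho2 ℓ (t - s) c) *
            ∫⁻ x, ‖splitSource K η ε f u s x‖ₑ := by
          rw [lintegral_add_left' hm0, lintegral_mul_const'' _ hm0']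
          congr 1
          rw [← lintegral_lintegral_swap (f := fun s x => ENNReal.ofReal (rho2 ℓ (t - s) c) *
            ‖splitSource K η ε f u s x‖ₑ) hjm]
          refine lintegral_congr fun s => ?_
          rw [lintegral_const_mul' _ _ ENNReal.ofReal_ne_top]
      _ ≤ ENNReal.ofReal M₀ * ENNReal.ofReal (rho1 ℓ t c) +
          ∫⁻ s in Ioo 0 t, ENNReal.ofReal (rho2 ℓ (t - s) c * (M + δ * K₀ + c * β s)) := by
          refine add_le_add (mul_le_mul_left ?_ _) (setLIntegral_mono' measurableSet_Ioo
            fun s hs' => ?_)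
          · have h1 := lintegral_enorm_sconv_le hη.continuous.measurable hu₀m.1.1
            rw [hηe, one_mul] at h1
            rw [ENNReal.ofReal_coe_nnreal]
            exact h1.trans (MemX.lintegral_enorm_le hu₀)
          · have hsT : s ∈ Ioo 0 T := ⟨hs'.1, hs'.2.trans ht.2⟩
            rw [ENNReal.ofReal_mul (hκ.rho2_nonneg hc0 (sub_pos.2 hs'.2))]
            exact mul_le_mul_right (lintegral_splitSource_le hK hKm hε hη hs hη1 hδ hu hf hsT
              (hβ0 s ⟨hsT.1.le, hsT.2.le⟩) (hβ s hsT)) _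
      _ = _ := by
          have h0 : 0 ≤ᵐ[volume.restrict (Ioo 0 t)]
              fun s => rho2 ℓ (t - s) c * (M + δ * K₀ + c * β s) := by
            filter_upwards [ae_restrict_mem measurableSet_Ioo] with s hs'
            have hsT : s ∈ Icc 0 T := ⟨hs'.1.le, (hs'.2.trans ht.2).le⟩
            exact mul_nonneg (hκ.rho2_nonneg hc0 (sub_pos.2 hs'.2))
              (add_nonneg (by positivity) (mul_nonneg hc0 (hβ0 s hsT)))
          rw [← ofReal_integral_eq_lintegral_ofReal hii h0, ← ENNReal.ofReal_mul M₀.coe_nonneg,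
            ← ENNReal.ofReal_add (mul_nonneg M₀.coe_nonneg hρ1) (integral_nonneg_of_ae h0)]
          unfold cconv
          rw [intervalIntegral.integral_of_le ht.1.le, integral_Ioc_eq_integral_Ioo]

end Bounds

variable {N : ℕ}

/-! ### Mollifiers -/

/-- Bump functions at the origin with radii of order `1 / n`. -/
def bump (N n : ℕ) : ContDiffBump (0 : Space N) :=
  ⟨1 / (n + 1), 2 / (n + 1), by positivity, by gcongr; norm_num⟩

/-- A sequence of mollifiers. -/
def mollifier (N n : ℕ) : Space N → ℝ := (bump N n).normed volume

theorem contDiff_mollifier (n : ℕ) : ContDiff ℝ 2 (mollifier N n) := (bump N n).contDiff_normed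

theorem hasCompactSupport_mollifier (n : ℕ) : HasCompactSupport (mollifier N n) :=
  (bump N n).hasCompactSupport_normed

theorem mollifier_neg (n : ℕ) (x : Space N) : mollifier N n (-x) = mollifier N n x :=
  (bump N n).normed_neg x

theorem integral_abs_mollifier (n : ℕ) : ∫ x, |mollifier N n x| = 1 := by
  have h : ∀ x, |mollifier N n x| = mollifier N n x := fun x =>
    abs_of_nonneg ((bump N n).nonneg_normed x)
  simp_rw [h]
  exact (bump N n).integral_normed

theorem integrable_mollifier (n : ℕ) : Integrable (mollifier N n) := (bump N n).integrable_normed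

theorem measurable_mollifier (n : ℕ) : Measurable (mollifier N n) :=
  (contDiff_mollifier n).continuous.measurable

theorem ae_tendsto_sconv_mollifier {w : Space N → ℝ} (hw : Integrable w) :
    ∀ᵐ x, Tendsto (fun n => sconv (mollifier N n) w x) atTop (𝓝 (w x)) := by
  have h0 : Tendsto (fun n : ℕ => (bump N n).rOut) atTop (𝓝 0) := by
    have := (tendsto_one_div_add_atTop_nhds_zero_nat (𝕜 := ℝ)).const_mul 2
    simpa [bump, mul_div_assoc', div_eq_mul_inv] using this
  filter_upwards [ContDiffBump.ae_convolution_tendsto_right_of_locallyIntegrable (μ := volume)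
    (K := 2) h0 (Eventually.of_forall fun n => by simp [bump, div_eq_mul_inv])
    hw.locallyIntegrable] with x hx
  simp only [convolution_eq_swap] at hx
  exact hx

/-! ### Mild solutions are bounded in `X` -/

theorem normX_le_add {g h : Space N → ℝ} (hg : MemX g) (hh : MemX h) :
    normX g ≤ normX (g - h) + normX h := by
  have h1 := eLpNorm_add_le (hg.1.1.sub hh.1.1) hh.1.1 (p := 1) le_rfl (μ := volume)
  have h2 := eLpNorm_add_le (hg.1.1.sub hh.1.1) hh.1.1 (p := ∞) le_top (μ := volume)
  rw [sub_add_cancel] at h1 h2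
  calc normX g ≤ (eLpNorm (g - h) 1 volume + eLpNorm h 1 volume) +
        (eLpNorm (g - h) ∞ volume + eLpNorm h ∞ volume) := add_le_add h1 h2
    _ = _ := by unfold normX; abel

theorem MemX.normX_lt_top {g : Space N → ℝ} (hg : MemX g) : normX g < ∞ :=
  ENNReal.add_lt_top.2 ⟨hg.1.2, hg.2.2⟩

/-- Continuity into X gives local bounds and compactness makes them uniform, but only on [0,T'] with
T' < T. -/
theorem MemCX.exists_isBoundedPath {T T' : ℝ} {u : ℝ → Space N → ℝ} (hu : MemCX T u)
    (hT' : T' < T) : ∃ K : ℝ≥0, IsBoundedPath T' K u := by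
  have hsub : Icc 0 T' ⊆ Ico 0 T := fun t ht => ⟨ht.1, ht.2.trans_lt hT'⟩
  have key : ∃ K : ℝ≥0, ∀ t ∈ Icc 0 T', normX (u t) ≤ K := by
    refine isCompact_Icc.induction_on (p := fun s => ∃ K : ℝ≥0, ∀ t ∈ s, normX (u t) ≤ K)
      ⟨0, by simp⟩ (fun s t hst ⟨K, hK⟩ => ⟨K, fun x hx => hK x (hst hx)⟩)
      (fun s t ⟨K, hK⟩ ⟨K', hK'⟩ => ⟨max K K', fun x hx => ?_⟩) fun t ht => ?_
    · rcases hx with hx | hx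
      · exact (hK x hx).trans (ENNReal.coe_le_coe.2 (le_max_left _ _))
      · exact (hK' x hx).trans (ENNReal.coe_le_coe.2 (le_max_right _ _))
    · have h1 := hu.2.2 t (hsub ht)
      have h2 : ∀ᶠ s in 𝓝[Icc 0 T'] t, normX (u s - u t) < 1 :=
        (h1.mono_left (nhdsWithin_mono t hsub)).eventually (gt_mem_nhds zero_lt_one)
      refine ⟨_, inter_mem h2 self_mem_nhdsWithin, 1 + (normX (u t)).toNNReal, fun s hs => ?_⟩
      refine (normX_le_add (hu.2.1 s (hsub hs.2)) (hu.2.1 t (hsub ht))).trans ?_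
      rw [ENNReal.coe_add, ENNReal.coe_toNNReal (hu.2.1 t (hsub ht)).normX_lt_top.ne]
      exact add_le_add (le_of_lt hs.1) le_rfl
  obtain ⟨K, hK⟩ := key
  refine ⟨K, hu.1.mono_measure (Measure.restrict_mono_set _ ?_), fun t ht =>
    ⟨hu.2.1 t ⟨ht.1.le, ht.2.trans hT'⟩, hK t ⟨ht.1.le, ht.2.le⟩⟩⟩
  exact prod_mono (Ioo_subset_Ioo_right hT'.le) subset_rfl

theorem IsBoundedPath.mono {T T' : ℝ} {M : ℝ≥0} {w : ℝ → Space N → ℝ} (hw : IsBoundedPath T M w)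
    (h : T' ≤ T) : IsBoundedPath T' M w :=
  ⟨hw.aesm.mono_measure (Measure.restrict_mono_set _ (prod_mono (Ioo_subset_Ioo_right h)
    subset_rfl)), fun t ht => hw.mem t ⟨ht.1, ht.2.trans_le h⟩⟩

variable {κ ℓ : ℝ → ℝ} {K : Space N → ℝ} {T : ℝ} {u₀ : Space N → ℝ} {f u : ℝ → Space N → ℝ}
  {M M₀ : ℝ≥0}

/-- On (0,T') with t < T' < T the provisional bound K₀ is finite, and its coefficient δ tends to 0
with ε. The bound that remains does not depend on T', and so it does not degenerate as t → T. -/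
theorem IsMildSolution.sconv_bounds (hκ : IsMemoryKernel κ ℓ) (hK : IsSymmKernel K)
    (hKm : Measurable K) (hu₀ : MemX u₀) (hM₀ : normX u₀ ≤ M₀) (hf : IsBoundedPath T M f)
    (hu : IsMildSolution ℓ K T u₀ f u) {η : Space N → ℝ} (hη : ContDiff ℝ 2 η)
    (hs : HasCompactSupport η) (hη1 : ∫ x, |η x| = 1) {t : ℝ} (ht : t ∈ Ioo 0 T) :
    (∀ x, ‖sconv η (u t) x‖ₑ ≤ ENNReal.ofReal (M₀ + M * ∫ s in (0 : ℝ)..t, ℓ s)) ∧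
      ∫⁻ x, ‖sconv η (u t) x‖ₑ ≤ ENNReal.ofReal (M₀ + M * ∫ s in (0 : ℝ)..t, ℓ s) := by
  obtain ⟨T', htT', hT'⟩ := exists_between ht.2
  obtain ⟨K₀, hK₀⟩ := hu.memCX.exists_isBoundedPath hT'
  obtain ⟨C, -, hC⟩ := exists_integral_secDiff_le hη hs
  have heq : ∀ t ∈ Ioo 0 T', ∀ x, sconv η (u t) x +
      cconv ℓ (fun s => sconv (symOp K η) (u s) x) t =
        sconv η u₀ x + cconv ℓ (fun s => sconv η (f s) x) t := fun t ht x =>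
    hu.sconv_identity hκ hK hu₀ hf.aesm hf.mem hη hs ⟨ht.1, ht.2.trans hT'⟩ x
  have hlim : Tendsto (fun ε : ℝ => ENNReal.ofReal (M₀ + (M + (C * ∫ z, min 1 (‖z‖ ^ 2) *
      indicator {z | ‖z‖ ∈ Iic ε} K z) * K₀) * ∫ s in (0 : ℝ)..t, ℓ s)) (𝓝[>] 0)
      (𝓝 (ENNReal.ofReal (M₀ + M * ∫ s in (0 : ℝ)..t, ℓ s))) := by
    refine ENNReal.tendsto_ofReal (tendsto_const_nhds.add (Tendsto.mul_const _ ?_))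
    have := ((hK.tendsto_near.const_mul C).mul_const (K₀ : ℝ)).const_add (M : ℝ)
    simpa using this
  have hδ : ∀ ε : ℝ, ∫ x, |symOp (indicator {z | ‖z‖ ∈ Iic ε} K) η x| ≤
      C * ∫ z, min 1 (‖z‖ ^ 2) * indicator {z | ‖z‖ ∈ Iic ε} K z := fun ε =>
    (hK.restrict_norm measurableSet_Iic).integral_abs_symOp_le hη hs hC
  constructor
  · refine fun x => ge_of_tendsto hlim ?_
    filter_upwards [self_mem_nhdsWithin] with ε hε
    exact enorm_sconv_le_of_near hκ hK hKm hε hη hs hη1 (hδ ε) hM₀ hK₀ (hf.mono hT'.le) heq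
      ⟨ht.1, htT'⟩ x
  · refine ge_of_tendsto hlim ?_
    filter_upwards [self_mem_nhdsWithin] with ε hε
    exact lintegral_sconv_le_of_near hκ hK hKm hε hη hs hη1 (hδ ε) hu₀ hM₀ hK₀ (hf.mono hT'.le) heq
      ⟨ht.1, htT'⟩

/-- The bounds for η * u are uniform over the mollifiers. They pass to u by almost everywhere
convergence for the sup norm and by Fatou's lemma for the L¹ norm; the factor 2 adds the two norms.
-/
theorem IsMildSolution.exists_isBoundedPath (hκ : IsMemoryKernel κ ℓ) (hK : IsSymmKernel K)
    (hKm : Measurable K) (hu₀ : MemX u₀) (hf : IsBoundedPath T M f)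
    (hu : IsMildSolution ℓ K T u₀ f u) : ∃ B : ℝ≥0, IsBoundedPath T B u := by
  set M₀ : ℝ≥0 := (normX u₀).toNNReal with hM₀
  have hM₀' : normX u₀ ≤ M₀ := by rw [hM₀, ENNReal.coe_toNNReal hu₀.normX_lt_top.ne]
  set b : ℝ := M₀ + M * ∫ s in (0 : ℝ)..T, ℓ s with hb
  refine ⟨2 * b.toNNReal, hu.memCX.1, fun t ht => ?_⟩
  have hX := hu.memCX.2.1 t ⟨ht.1.le, ht.2⟩
  refine ⟨hX, ?_⟩
  have hT : 0 < T := ht.1.trans ht.2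
  have hmono : ENNReal.ofReal (M₀ + M * ∫ s in (0 : ℝ)..t, ℓ s) ≤ ENNReal.ofReal b := by
    refine ENNReal.ofReal_le_ofReal (add_le_add le_rfl (mul_le_mul_of_nonneg_left ?_ M.2))
    rw [intervalIntegral.integral_of_le ht.1.le, intervalIntegral.integral_of_le hT.le]
    refine setIntegral_mono_set (hκ.conj_integrable T hT) ?_
      (Ioc_subset_Ioc_right ht.2.le).eventuallyLE
    filter_upwards [ae_restrict_mem measurableSet_Ioc] with r hr using hκ.conj_nonneg r hr.1
  have hbd := fun n => hu.sconv_bounds hκ hK hKm hu₀ hM₀' hf (contDiff_mollifier n)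
    (hasCompactSupport_mollifier n) (integral_abs_mollifier n) ht
  have hae := ae_tendsto_sconv_mollifier hX.integrable
  have h1 : eLpNorm (u t) ∞ volume ≤ ENNReal.ofReal b := by
    rw [eLpNorm_exponent_top]
    refine eLpNormEssSup_le_of_ae_enorm_bound ?_
    filter_upwards [hae] with x hx
    exact le_of_tendsto hx.enorm (Eventually.of_forall fun n => ((hbd n).1 x).trans hmono)
  have h2 : eLpNorm (u t) 1 volume ≤ ENNReal.ofReal b := by
    rw [eLpNorm_one_eq_lintegral_enorm]
    calc ∫⁻ x, ‖u t x‖ₑ = ∫⁻ x, liminf (fun n => ‖sconv (mollifier N n) (u t) x‖ₑ) atTop := by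
          refine lintegral_congr_ae ?_
          filter_upwards [hae] with x hx
          exact hx.enorm.liminf_eq.symm
      _ ≤ liminf (fun n => ∫⁻ x, ‖sconv (mollifier N n) (u t) x‖ₑ) atTop :=
          lintegral_liminf_le' fun n =>
            (aestronglyMeasurable_sconv_right (measurable_mollifier n) hX.1.1).enorm
      _ ≤ ENNReal.ofReal b :=
          liminf_le_of_frequently_le' (Frequently.of_forall fun n => (hbd n).2.trans hmono)
  calc normX (u t) ≤ ENNReal.ofReal b + ENNReal.ofReal b := add_le_add h2 h1
    _ = _ := by rw [ENNReal.ofReal]; push_cast; rw [two_mul]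

/-! ### The fractional derivative in time -/

theorem ae_eq_zero_of_integral_ae_eq_zero {z : ℝ → ℝ} {T : ℝ} (hz : IntegrableOn z (Ioc 0 T))
    (h : ∀ᵐ r ∂volume.restrict (Ioo 0 T), ∫ s in (0 : ℝ)..r, z s = 0) :
    ∀ᵐ r ∂volume.restrict (Ioo 0 T), z r = 0 := by
  rcases le_or_gt T 0 with hT | hT
  · rw [Ioo_eq_empty (not_lt.2 hT)]
    simp
  have hi : IntervalIntegrable z volume 0 T :=
    (intervalIntegrable_iff_integrableOn_Ioc_of_le hT.le).2 hz
  have hc : ContinuousOn (fun r => ∫ s in (0 : ℝ)..r, z s) (Ioo 0 T) := by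
    have := intervalIntegral.continuousOn_primitive_interval' hi left_mem_uIcc
    rw [uIcc_of_le hT.le] at this
    exact this.mono Ioo_subset_Icc_self
  have h0 : EqOn (fun r => ∫ s in (0 : ℝ)..r, z s) (fun _ => 0) (Ioo 0 T) :=
    Measure.eqOn_open_of_ae_eq h isOpen_Ioo hc continuousOn_const
  rw [ae_restrict_iff' measurableSet_Ioo]
  filter_upwards [hi.ae_hasDerivAt_integral] with r hr hrT
  have h1 := hr (by rw [uIcc_of_le hT.le]; exact Ioo_subset_Icc_self hrT) 0 left_mem_uIcc
  have h2 : HasDerivAt (fun r => ∫ s in (0 : ℝ)..r, z s) 0 r :=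
    (hasDerivAt_const r (0 : ℝ)).congr_of_eventuallyEq
      (h0.eventuallyEq_of_mem (isOpen_Ioo.mem_nhds hrT))
  exact h1.unique h2

variable {κ ℓ : ℝ → ℝ} {ψ : ℝ → ℝ} {T M : ℝ}

theorem IsMemoryKernel.intervalIntegrable_kernel (hκ : IsMemoryKernel κ ℓ) {x y : ℝ} (hx : 0 ≤ x)
    (hy : 0 ≤ y) : IntervalIntegrable κ volume x y := by
  have h0 : ∀ x, 0 ≤ x → IntervalIntegrable κ volume 0 x := by
    intro x hx
    rw [intervalIntegrable_iff_integrableOn_Ioc_of_le hx]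
    rcases eq_or_lt_of_le hx with rfl | hx
    · simp
    · exact hκ.integrable x hx
  exact (h0 x hx).symm.trans (h0 y hy)

/-- At distance δ from its singularity, κ contributes a Lipschitz function. The change of the kernel
telescopes by monotonicity, and the added interval has length r' - r; each costs M κ(δ)(r' - r). -/
theorem IsMemoryKernel.abs_tail_sub_le (hκ : IsMemoryKernel κ ℓ)
    (hψ : ContinuousOn ψ (Ioo 0 T)) (hM : ∀ t ∈ Ioo 0 T, |ψ t| ≤ M) {δ r r' : ℝ} (hδ : 0 < δ)
    (hr : δ ≤ r) (hrr : r ≤ r') (hr' : r' < T) :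
    |(∫ p in (0 : ℝ)..(r' - δ), κ (r' - p) * ψ p) - ∫ p in (0 : ℝ)..(r - δ), κ (r - p) * ψ p| ≤
      2 * M * κ δ * (r' - r) := by
  have hM0 : 0 ≤ M := (abs_nonneg _).trans (hM r' ⟨by linarith, hr'⟩)
  have hi0 : ∀ {ρ x y : ℝ}, 0 ≤ x → x ≤ y → y < ρ →
      IntervalIntegrable (fun p => κ (ρ - p)) volume x y := by
    intro ρ x y hx hxy hy
    have := (hκ.intervalIntegrable_kernel (x := ρ - x) (y := ρ - y) (by linarith)
      (by linarith)).comp_sub_left ρ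
    simpa using this
  have hi : ∀ {ρ x y : ℝ}, 0 ≤ x → x ≤ y → y < ρ → y < T →
      IntervalIntegrable (fun p => κ (ρ - p) * ψ p) volume x y := by
    intro ρ x y hx hxy hy hyT
    have h1 := hi0 hx hxy hy
    rw [intervalIntegrable_iff_integrableOn_Ioo_of_le hxy] at h1 ⊢
    have hsub : Ioo x y ⊆ Ioo 0 T := Ioo_subset_Ioo hx hyT.le
    refine h1.mul_bdd (c := M) ((hψ.mono hsub).aestronglyMeasurable measurableSet_Ioo) ?_
    filter_upwards [ae_restrict_mem measurableSet_Ioo] with p hp using hM p (hsub hp)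
  have e : (∫ p in (0 : ℝ)..(r' - δ), κ (r' - p) * ψ p) - (∫ p in (0 : ℝ)..(r - δ), κ (r - p) * ψ p)
      = (∫ p in (0 : ℝ)..(r - δ), (κ (r' - p) * ψ p - κ (r - p) * ψ p)) +
        ∫ p in (r - δ)..(r' - δ), κ (r' - p) * ψ p := by
    rw [← intervalIntegral.integral_add_adjacent_intervals
      (hi (ρ := r') le_rfl (sub_nonneg.2 hr) (by linarith) (by linarith))
      (hi (ρ := r') (sub_nonneg.2 hr) (by linarith) (by linarith) (by linarith)),
      intervalIntegral.integral_sub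
        (hi (ρ := r') le_rfl (sub_nonneg.2 hr) (by linarith) (by linarith))
        (hi (ρ := r) le_rfl (sub_nonneg.2 hr) (by linarith) (by linarith))]
    ring
  have b1 : |∫ p in (0 : ℝ)..(r - δ), (κ (r' - p) * ψ p - κ (r - p) * ψ p)| ≤
      M * κ δ * (r' - r) := by
    have h1 : |∫ p in (0 : ℝ)..(r - δ), (κ (r' - p) * ψ p - κ (r - p) * ψ p)| ≤
        ∫ p in (0 : ℝ)..(r - δ), M * (κ (r - p) - κ (r' - p)) := by
      rw [← Real.norm_eq_abs]
      refine intervalIntegral.norm_integral_le_of_norm_le (sub_nonneg.2 hr)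
        (Eventually.of_forall fun p hp => ?_)
        (((hi0 (ρ := r) le_rfl (sub_nonneg.2 hr) (by linarith)).sub
          (hi0 (ρ := r') le_rfl (sub_nonneg.2 hr) (by linarith))).const_mul M)
      have h2 : κ (r' - p) ≤ κ (r - p) :=
        hκ.antitone (show 0 < r - p by linarith [hp.2]) (show 0 < r' - p by linarith [hp.2])
          (by linarith)
      rw [← sub_mul, norm_mul, Real.norm_eq_abs, Real.norm_eq_abs, abs_sub_comm,
        abs_of_nonneg (sub_nonneg.2 h2), mul_comm]
      exact mul_le_mul_of_nonneg_right (hM p ⟨hp.1, by linarith [hp.2]⟩) (sub_nonneg.2 h2)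
    refine h1.trans ?_
    rw [intervalIntegral.integral_const_mul, mul_assoc,
      intervalIntegral.integral_sub (hi0 le_rfl (sub_nonneg.2 hr) (by linarith))
        (hi0 le_rfl (sub_nonneg.2 hr) (by linarith)),
      intervalIntegral.integral_comp_sub_left κ r, intervalIntegral.integral_comp_sub_left κ r']
    refine mul_le_mul_of_nonneg_left ?_ hM0
    rw [sub_zero, sub_zero, sub_sub_cancel, show r' - (r - δ) = δ + (r' - r) by ring,
      intervalIntegral.integral_interval_sub_interval_comm
        (hκ.intervalIntegrable_kernel hδ.le (by linarith))
        (hκ.intervalIntegrable_kernel (by linarith) (by linarith))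
        (hκ.intervalIntegrable_kernel hδ.le (by linarith))]
    have h3 : 0 ≤ ∫ q in r..r', κ q := intervalIntegral.integral_nonneg hrr fun q hq =>
      hκ.nonneg q (by linarith [hq.1])
    have h4 : ∫ q in δ..(δ + (r' - r)), κ q ≤ ∫ q in δ..(δ + (r' - r)), κ δ :=
      intervalIntegral.integral_mono_on (by linarith)
        (hκ.intervalIntegrable_kernel hδ.le (by linarith)) intervalIntegrable_const fun q hq =>
          hκ.antitone hδ (show 0 < q by linarith [hq.1]) hq.1
    rw [intervalIntegral.integral_const, smul_eq_mul, add_sub_cancel_left, mul_comm] at h4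
    linarith
  have b2 : |∫ p in (r - δ)..(r' - δ), κ (r' - p) * ψ p| ≤ M * κ δ * (r' - r) := by
    have h1 := intervalIntegral.norm_integral_le_of_norm_le_const (a := r - δ) (b := r' - δ)
      (f := fun p => κ (r' - p) * ψ p) (C := M * κ δ) fun p hp => ?_
    · rwa [show r' - δ - (r - δ) = r' - r by ring, abs_of_nonneg (sub_nonneg.2 hrr),
        Real.norm_eq_abs] at h1
    · rw [uIoc_of_le (by linarith)] at hp
      have hpos : 0 < r' - p := by linarith [hp.2]
      rw [norm_mul, Real.norm_eq_abs, Real.norm_eq_abs, abs_of_nonneg (hκ.nonneg _ hpos), mul_comm]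
      exact mul_le_mul (hM p ⟨by linarith [hp.1], by linarith [hp.2]⟩)
        (hκ.antitone hδ hpos (by linarith [hp.2])) (hκ.nonneg _ hpos) hM0
  rw [e]
  refine (abs_add_le _ _).trans ?_
  linarith

/-- The convolution is split at distance a/2 from the singularity of κ. In the near part the
difference falls on ψ, whose derivative is bounded on [a/2, b] though perhaps not up to 0; the rest
is `IsMemoryKernel.abs_tail_sub_le`. -/
theorem IsMemoryKernel.lipschitzOnWith_cconv (hκ : IsMemoryKernel κ ℓ)
    (hψ : DifferentiableOn ℝ ψ (Ioo 0 T)) (hψ' : ContinuousOn (deriv ψ) (Ioo 0 T))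
    (hM : ∀ t ∈ Ioo 0 T, |ψ t| ≤ M) {a b : ℝ} (ha : 0 < a) (hb : b < T) :
    ∃ C : ℝ≥0, LipschitzOnWith C (cconv κ ψ) (Icc a b) := by
  have hδ : 0 < a / 2 := by linarith
  have hδa : a / 2 < a := by linarith
  have hsub : Icc (a / 2) b ⊆ Ioo 0 T := fun x hx => ⟨by linarith [hx.1], by linarith [hx.2]⟩
  obtain ⟨L, hL⟩ := isCompact_Icc.exists_bound_of_continuousOn (hψ'.mono hsub)
  have hlip : ∀ x ∈ Icc (a / 2) b, ∀ y ∈ Icc (a / 2) b, |ψ y - ψ x| ≤ L * |y - x| :=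
    fun x hx y hy => (convex_Icc (a / 2) b).norm_image_sub_le_of_norm_deriv_le
      (fun z hz => (hψ z (hsub hz)).differentiableAt (isOpen_Ioo.mem_nhds (hsub hz))) hL hx hy
  set I := ∫ q in (0 : ℝ)..(a / 2), κ q with hI
  have hIi := hκ.intervalIntegrable_kernel le_rfl hδ.le
  have key : ∀ r ∈ Icc a b, ∀ r' ∈ Icc a b, r ≤ r' →
      |cconv κ ψ r' - cconv κ ψ r| ≤ (L * I + 2 * M * κ (a / 2)) * (r' - r) := by
    intro r hr r' hr' hrr
    have hkψ : ∀ ρ ∈ Icc a b, IntervalIntegrable (fun q => κ q * ψ (ρ - q)) volume 0 (a / 2) := by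
      intro ρ hρ
      rw [intervalIntegrable_iff_integrableOn_Ioo_of_le hδ.le] at hIi ⊢
      have hmap : MapsTo (fun q => ρ - q) (Ioo 0 (a / 2)) (Ioo 0 T) := fun q hq =>
        ⟨by linarith [hq.2, hρ.1], by linarith [hq.1, hρ.2]⟩
      refine hIi.mul_bdd (c := M) ((hψ.continuousOn.comp (by fun_prop) hmap).aestronglyMeasurable
        measurableSet_Ioo) ?_
      filter_upwards [ae_restrict_mem measurableSet_Ioo] with q hq using hM _ (hmap hq)
    have hsplit : ∀ ρ ∈ Icc a b, cconv κ ψ ρ = (∫ q in (0 : ℝ)..(a / 2), κ q * ψ (ρ - q)) +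
        ∫ p in (0 : ℝ)..(ρ - a / 2), κ (ρ - p) * ψ p := by
      intro ρ hρ
      have h1 : ∫ q in (0 : ℝ)..(a / 2), κ q * ψ (ρ - q) =
          ∫ p in (ρ - a / 2)..ρ, κ (ρ - p) * ψ p := by
        have := intervalIntegral.integral_comp_sub_left (a := 0) (b := a / 2)
          (fun p => κ (ρ - p) * ψ p) ρ
        simp only [sub_sub_cancel, sub_zero] at this
        exact this
      have i1 : IntervalIntegrable (fun p => κ (ρ - p) * ψ p) volume (ρ - a / 2) ρ := by
        have := ((hkψ ρ hρ).comp_sub_left ρ).symm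
        simpa using this
      have i2 : IntervalIntegrable (fun p => κ (ρ - p) * ψ p) volume 0 (ρ - a / 2) := by
        have h2 : IntervalIntegrable (fun p => κ (ρ - p)) volume 0 (ρ - a / 2) := by
          have := (hκ.intervalIntegrable_kernel (x := ρ) (y := a / 2) (by linarith [hρ.1])
            hδ.le).comp_sub_left ρ
          simpa using this
        rw [intervalIntegrable_iff_integrableOn_Ioo_of_le (by linarith [hρ.1])] at h2 ⊢
        have hs : Ioo 0 (ρ - a / 2) ⊆ Ioo 0 T := Ioo_subset_Ioo_right (by linarith [hρ.2])
        refine h2.mul_bdd (c := M) ((hψ.continuousOn.mono hs).aestronglyMeasurable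
          measurableSet_Ioo) ?_
        filter_upwards [ae_restrict_mem measurableSet_Ioo] with p hp using hM p (hs hp)
      rw [h1, add_comm, intervalIntegral.integral_add_adjacent_intervals i2 i1]
      rfl
    have b2 := hκ.abs_tail_sub_le hψ.continuousOn hM hδ (by linarith [hr.1]) hrr
      (by linarith [hr'.2])
    have b1 : |(∫ q in (0 : ℝ)..(a / 2), κ q * ψ (r' - q)) -
        ∫ q in (0 : ℝ)..(a / 2), κ q * ψ (r - q)| ≤ L * I * (r' - r) := by
      rw [← intervalIntegral.integral_sub (hkψ r' hr') (hkψ r hr), ← Real.norm_eq_abs]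
      have h2 : L * I * (r' - r) = ∫ q in (0 : ℝ)..(a / 2), κ q * (L * (r' - r)) := by
        rw [intervalIntegral.integral_mul_const, hI]
        ring
      rw [h2]
      refine intervalIntegral.norm_integral_le_of_norm_le hδ.le
        (Eventually.of_forall fun q hq => ?_) (hIi.mul_const _)
      rw [← mul_sub, norm_mul, Real.norm_eq_abs, Real.norm_eq_abs, abs_of_nonneg (hκ.nonneg q hq.1)]
      refine mul_le_mul_of_nonneg_left ?_ (hκ.nonneg q hq.1)
      refine (hlip (r - q) ⟨by linarith [hq.2, hr.1], by linarith [hq.1, hr.2]⟩ (r' - q)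
        ⟨by linarith [hq.2, hr'.1], by linarith [hq.1, hr'.2]⟩).trans_eq ?_
      rw [show r' - q - (r - q) = r' - r by ring, abs_of_nonneg (sub_nonneg.2 hrr)]
    rw [hsplit r hr, hsplit r' hr', add_sub_add_comm]
    refine (abs_add_le _ _).trans ?_
    linarith
  refine ⟨(L * I + 2 * M * κ (a / 2)).toNNReal, LipschitzOnWith.of_dist_le_mul fun x hx y hy => ?_⟩
  rw [Real.dist_eq, Real.dist_eq]
  refine le_trans ?_ (mul_le_mul_of_nonneg_right (Real.le_coe_toNNReal _) (abs_nonneg _))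
  rcases le_total x y with h | h
  · rw [abs_sub_comm, abs_sub_comm x y, abs_of_nonneg (sub_nonneg.2 h)]
    exact key x hx y hy h
  · rw [abs_of_nonneg (sub_nonneg.2 h)]
    exact key y hy x hx h

/-- Local Lipschitz continuity gives the fundamental theorem on [a, r]. As a → 0, κ ⋆ ψ tends to 0
because ψ is bounded, and the integrability of the derivative takes care of the other term. -/
theorem IsMemoryKernel.cconv_eq_integral_deriv (hκ : IsMemoryKernel κ ℓ)
    (hψ : DifferentiableOn ℝ ψ (Ioo 0 T)) (hψ' : ContinuousOn (deriv ψ) (Ioo 0 T))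
    (hM : ∀ t ∈ Ioo 0 T, |ψ t| ≤ M) (hγ : IntegrableOn (deriv (cconv κ ψ)) (Ioc 0 T)) {r : ℝ}
    (hr : r ∈ Ioo 0 T) : cconv κ ψ r = ∫ s in (0 : ℝ)..r, deriv (cconv κ ψ) s := by
  have h1 : ∀ᶠ a in 𝓝[>] (0 : ℝ), ∫ s in a..r, deriv (cconv κ ψ) s = cconv κ ψ r - cconv κ ψ a := by
    filter_upwards [Ioo_mem_nhdsGT hr.1] with a ha
    obtain ⟨C, hC⟩ := hκ.lipschitzOnWith_cconv hψ hψ' hM ha.1 hr.2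
    rw [← uIcc_of_le ha.2.le] at hC
    exact hC.absolutelyContinuousOnInterval.integral_deriv_eq_sub
  have hi : IntervalIntegrable (deriv (cconv κ ψ)) volume 0 r :=
    (intervalIntegrable_iff_integrableOn_Ioc_of_le hr.1.le).2
      (hγ.mono_set (Ioc_subset_Ioc_right hr.2.le))
  have hlimP : ∀ {f : ℝ → ℝ}, IntervalIntegrable f volume 0 r →
      Tendsto (fun a => ∫ s in (0 : ℝ)..a, f s) (𝓝[>] 0) (𝓝 0) := by
    intro f hf
    have hc := intervalIntegral.continuousOn_primitive_interval' hf left_mem_uIcc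
    have h2 := (hc 0 left_mem_uIcc).tendsto
    rw [intervalIntegral.integral_same, uIcc_of_le hr.1.le] at h2
    exact h2.mono_left (nhdsWithin_le_of_mem (Icc_mem_nhdsGT_of_mem ⟨le_rfl, hr.1⟩))
  have h2 : Tendsto (cconv κ ψ) (𝓝[>] 0) (𝓝 0) := by
    have h3 := (hlimP (hκ.intervalIntegrable_kernel le_rfl hr.1.le)).mul_const M
    rw [zero_mul] at h3
    refine squeeze_zero_norm' ?_ h3
    filter_upwards [Ioo_mem_nhdsGT hr.1] with a ha
    rw [cconv_comm, ← intervalIntegral.integral_mul_const]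
    refine intervalIntegral.norm_integral_le_of_norm_le ha.1.le ?_
      ((hκ.intervalIntegrable_kernel le_rfl ha.1.le).mul_const M)
    have h3 : ∀ᵐ τ : ℝ, τ ≠ a := by simp [ae_iff]
    filter_upwards [h3] with q hqa hq
    rw [norm_mul, Real.norm_eq_abs, Real.norm_eq_abs, abs_of_nonneg (hκ.nonneg q hq.1), mul_comm]
    refine mul_le_mul_of_nonneg_left (hM _ ⟨?_, ?_⟩) (hκ.nonneg q hq.1)
    · exact sub_pos.2 (lt_of_le_of_ne hq.2 hqa)
    · linarith [hq.1, ha.2, hr.2]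
  have h4 : Tendsto (fun a => ∫ s in a..r, deriv (cconv κ ψ) s) (𝓝[>] 0)
      (𝓝 (∫ s in (0 : ℝ)..r, deriv (cconv κ ψ) s)) := by
    have := (hlimP hi).const_sub (∫ s in (0 : ℝ)..r, deriv (cconv κ ψ) s)
    rw [sub_zero] at this
    refine this.congr' ?_
    filter_upwards [Ioo_mem_nhdsGT hr.1] with a ha
    have hs : uIcc 0 a ⊆ uIcc 0 r := by
      rw [uIcc_of_le ha.1.le, uIcc_of_le hr.1.le]
      exact Icc_subset_Icc_right ha.2.le
    exact intervalIntegral.integral_interval_sub_left hi (hi.mono_set hs)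
  have h5 := (h2.const_sub (cconv κ ψ r)).congr' (h1.mono fun a ha => ha.symm)
  rw [sub_zero] at h5
  exact tendsto_nhds_unique h5 h4

/-- The fractional derivative `∂_t (κ ⋆ ψ)` is inverted by the convolution with `ℓ`. -/
theorem IsMemoryKernel.ae_eq_cconv_deriv (hκ : IsMemoryKernel κ ℓ)
    (hψ : DifferentiableOn ℝ ψ (Ioo 0 T)) (hψ' : ContinuousOn (deriv ψ) (Ioo 0 T))
    (hM : ∀ t ∈ Ioo 0 T, |ψ t| ≤ M) (hγ : IntegrableOn (deriv (cconv κ ψ)) (Ioc 0 T)) :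
    ∀ᵐ r ∂volume.restrict (Ioc 0 T), ψ r = cconv ℓ (deriv (cconv κ ψ)) r := by
  rcases le_or_gt T 0 with hT | hT
  · rw [Ioc_eq_empty (not_lt.2 hT)]
    simp
  set γ := deriv (cconv κ ψ) with hγd
  have hl := hκ.conj_integrable T hT
  have hk := hκ.integrable T hT
  have hone : IntegrableOn (fun _ : ℝ => (1 : ℝ)) (Ioc 0 T) := by simp
  have hψm : AEStronglyMeasurable ψ (volume.restrict (Ioc 0 T)) := by
    rw [← restrict_Ioo_eq_restrict_Ioc]
    exact hψ.continuousOn.aestronglyMeasurable measurableSet_Ioo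
  have hψi : IntegrableOn ψ (Ioc 0 T) := integrableOn_of_bounded hψm hM
  -- The chain is 1 ⋆ ψ = ℓ ⋆ κ ⋆ ψ = ℓ ⋆ 1 ⋆ γ = 1 ⋆ (ℓ ⋆ γ); afterwards both ends are
  -- differentiated.
  have e1 : ∀ᵐ r ∂volume.restrict (Ioc 0 T),
      ∫ s in (0 : ℝ)..r, ψ s = ∫ s in (0 : ℝ)..r, cconv ℓ γ s := by
    have hIoo : ∀ᵐ r ∂volume.restrict (Ioc 0 T), r ∈ Ioo 0 T := by
      rw [← restrict_Ioo_eq_restrict_Ioc]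
      exact ae_restrict_mem measurableSet_Ioo
    filter_upwards [hIoo, cconv_assoc_ae hl hk hψi, cconv_assoc_ae hl hone hγ,
      cconv_assoc_ae hone hl hγ] with r hr a1 a2 a3
    have hrI : r ∈ Ioc 0 T := ⟨hr.1, hr.2.le⟩
    have c1 : cconv (cconv ℓ κ) ψ r = ∫ s in (0 : ℝ)..r, ψ s := by
      rw [cconv_congr_left (T := T) (a' := fun _ => 1) ?_ hrI]
      · simp [cconv]
      · filter_upwards [ae_restrict_mem measurableSet_Ioc] with t ht using hκ.cconv_eq_one ht.1
    have c2 : cconv ℓ (cconv κ ψ) r = cconv ℓ (cconv (fun _ => 1) γ) r := by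
      refine cconv_congr_right (T := T) ?_ hrI
      filter_upwards [hIoo] with t ht
      rw [hκ.cconv_eq_integral_deriv hψ hψ' hM hγ ht]
      simp [cconv, hγd]
    have c3 : cconv (fun _ => 1) (cconv ℓ γ) r = ∫ s in (0 : ℝ)..r, cconv ℓ γ s := by simp [cconv]
    have c4 : cconv ℓ (fun _ => 1) = cconv (fun _ => 1) ℓ := funext fun t => cconv_comm _ _ t
    rw [← c1, a1, c2, ← a2, c4, a3, c3]
  have hdi := hψi.sub (integrableOn_cconv hl hγ)
  have h2 := ae_eq_zero_of_integral_ae_eq_zero (T := T) hdi ?_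
  · rw [restrict_Ioo_eq_restrict_Ioc] at h2
    filter_upwards [h2] with r hr using sub_eq_zero.1 hr
  · rw [restrict_Ioo_eq_restrict_Ioc]
    filter_upwards [e1, ae_restrict_mem measurableSet_Ioc] with r hr hrT
    have hm : ∀ {g : ℝ → ℝ}, IntegrableOn g (Ioc 0 T) → IntervalIntegrable g volume 0 r :=
      fun hg => (intervalIntegrable_iff_integrableOn_Ioc_of_le hrT.1.le).2
        (hg.mono_set (Ioc_subset_Ioc_right hrT.2))
    simp only [Pi.sub_apply]
    rw [intervalIntegral.integral_sub (hm hψi) (hm (integrableOn_cconv hl hγ)), hr, sub_self]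

theorem cconv_reflect (κ φ : ℝ → ℝ) (T r : ℝ) :
    cconv κ (fun p => φ (T - p)) r = ∫ τ in (T - r)..T, φ τ * κ (τ - (T - r)) := by
  have := intervalIntegral.integral_comp_sub_left (a := 0) (b := r)
    (fun τ => φ τ * κ (τ - (T - r))) T
  rw [sub_zero] at this
  rw [← this]
  unfold cconv
  congr 1
  ext p
  rw [show T - p - (T - r) = r - p by ring, mul_comm]

/-- The adjoint relation between the backward derivative and the convolution with `ℓ`. -/
theorem IsMemoryKernel.integral_backwardRL_mul (hκ : IsMemoryKernel κ ℓ) (hT : 0 < T) {φ h : ℝ → ℝ}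
    {C : ℝ} (hφ : DifferentiableOn ℝ φ (Ioo 0 T)) (hφ' : ContinuousOn (deriv φ) (Ioo 0 T))
    (hM : ∀ t ∈ Ioo 0 T, |φ t| ≤ M) (hg : IntegrableOn (backwardRL κ T φ) (Ioo 0 T))
    (hh : AEStronglyMeasurable h (volume.restrict (Ioo 0 T))) (hC : ∀ t ∈ Ioo 0 T, |h t| ≤ C) :
    ∫ t in Ioo 0 T, cconv ℓ h t * backwardRL κ T φ t = ∫ t in Ioo 0 T, h t * φ t := by
  -- Time reversal turns the backward derivative into the forward one, and both integrals into
  -- convolutions evaluated at T: γ ⋆ ℓ ⋆ h and ψ ⋆ h.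
  set ψ : ℝ → ℝ := fun p => φ (T - p) with hψd
  have hmap : MapsTo (fun p => T - p) (Ioo 0 T) (Ioo 0 T) := fun p hp =>
    ⟨sub_pos.2 hp.2, by linarith [hp.1]⟩
  have hdψ : deriv ψ = fun p => -deriv φ (T - p) := by
    ext p
    exact deriv_comp_const_sub φ T p
  have hγe : ∀ r, deriv (cconv κ ψ) r = backwardRL κ T φ (T - r) := by
    intro r
    have h1 : cconv κ ψ = fun r => (fun s => ∫ τ in s..T, φ τ * κ (τ - s)) (T - r) :=
      funext fun r => cconv_reflect κ φ T r
    rw [h1]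
    exact deriv_comp_const_sub (fun s => ∫ τ in s..T, φ τ * κ (τ - s)) T r
  have hg' : IntervalIntegrable (backwardRL κ T φ) volume 0 T :=
    (intervalIntegrable_iff_integrableOn_Ioo_of_le hT.le).2 hg
  have hγi : IntegrableOn (deriv (cconv κ ψ)) (Ioc 0 T) := by
    rw [← intervalIntegrable_iff_integrableOn_Ioc_of_le hT.le, funext hγe]
    simpa using (hg'.comp_sub_left T).symm
  have hrep := hκ.ae_eq_cconv_deriv (ψ := ψ) (hφ.comp (by fun_prop) hmap)
    (by rw [hdψ]; exact (hφ'.comp (by fun_prop) hmap).neg) (fun t ht => hM _ (hmap ht)) hγi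
  set γ := deriv (cconv κ ψ) with hγd
  have hl := hκ.conj_integrable T hT
  have e1 : ∫ t in Ioo 0 T, cconv ℓ h t * backwardRL κ T φ t = cconv γ (cconv ℓ h) T := by
    unfold cconv
    rw [intervalIntegral.integral_of_le hT.le, integral_Ioc_eq_integral_Ioo]
    refine integral_congr_ae (Eventually.of_forall fun t => ?_)
    simp only
    rw [hγe, sub_sub_cancel, mul_comm]
  have e2 : ∫ t in Ioo 0 T, h t * φ t = cconv ψ h T := by
    unfold cconv
    rw [intervalIntegral.integral_of_le hT.le, integral_Ioc_eq_integral_Ioo]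
    refine integral_congr_ae (Eventually.of_forall fun t => ?_)
    simp only [hψd]
    rw [sub_sub_cancel, mul_comm]
  have c1 : cconv γ ℓ = cconv ℓ γ := funext fun t => cconv_comm _ _ t
  rw [e1, e2, cconv_assoc_of_bounded hT.le hγi hl hh hC, c1]
  exact (cconv_congr_left (T := T) hrep ⟨hT, le_rfl⟩).symm

variable {N : ℕ} {κ ℓ : ℝ → ℝ} {J K : Space N → ℝ} {T : ℝ} {ζ : ℝ → Space N → ℝ}

/-! ### Test functions -/

theorem IsTestFunction.exists_bound (hζ : IsTestFunction κ J T ζ) :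
    ∃ M : ℝ, ∀ t ∈ Ioo 0 T, ∀ x, |ζ t x| ≤ M := by
  obtain ⟨-, M, hM⟩ := hζ.memLinftyX
  -- The inequality is written as an equality of continuous functions, which extends from a set of
  -- full measure to all points, first in x and then in t.
  have h1 : ∀ᵐ t ∂volume.restrict (Ioo 0 T), ∀ x, max |ζ t x| M = M := by
    filter_upwards [hM, ae_restrict_mem measurableSet_Ioo] with t ht htT
    have hc : Continuous fun x => max |ζ t x| (M : ℝ) :=
      (hζ.isC21.contDiff_space t htT).continuous.abs.max continuous_const
    have h2 : (fun x => max |ζ t x| (M : ℝ)) =ᵐ[volume] fun _ => (M : ℝ) := by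
      filter_upwards [MemX.ae_abs_le ht.2] with x hx
      exact max_eq_right hx
    exact congrFun ((hc.ae_eq_iff_eq volume continuous_const).1 h2)
  refine ⟨M, fun t ht x => max_eq_right_iff.1 ?_⟩
  have hc : ContinuousOn (fun t => max |ζ t x| (M : ℝ)) (Ioo 0 T) :=
    ContinuousOn.sup (hζ.isC21.continuousOn.comp (f := fun t => (t, x))
      (by fun_prop) fun t ht => ⟨ht, mem_univ _⟩).abs continuousOn_const
  exact Measure.eqOn_open_of_ae_eq (μ := volume) (h1.mono fun t ht => ht x) isOpen_Ioo hc
    continuousOn_const ht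

/-- The extension of a function on `Q_T` by zero. -/
def extendZero (T : ℝ) (ζ : ℝ → Space N → ℝ) : ℝ × Space N → ℝ :=
  indicator (Ioo 0 T ×ˢ univ) fun p => ζ p.1 p.2

theorem extendZero_of_mem {t : ℝ} (ht : t ∈ Ioo 0 T) (x : Space N) :
    extendZero T ζ (t, x) = ζ t x :=
  indicator_of_mem (show (t, x) ∈ Ioo 0 T ×ˢ univ from ⟨ht, mem_univ _⟩) _

theorem extendZero_of_notMem {t : ℝ} (ht : t ∉ Ioo 0 T) (x : Space N) :
    extendZero T ζ (t, x) = 0 :=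
  indicator_of_notMem (show (t, x) ∉ Ioo 0 T ×ˢ univ from fun h => ht h.1) _

theorem measurable_extendZero
    (hζ : ContinuousOn (fun p : ℝ × Space N => ζ p.1 p.2) (Ioo 0 T ×ˢ univ)) :
    Measurable (extendZero T ζ) := by
  classical
  unfold extendZero
  rw [← piecewise_eq_indicator]
  exact hζ.measurable_piecewise continuousOn_const (measurableSet_Ioo.prod MeasurableSet.univ)

theorem continuousAt_extendZero
    (hζ : ContinuousOn (fun p : ℝ × Space N => ζ p.1 p.2) (Ioo 0 T ×ˢ univ)) {t : ℝ} (h0 : t ≠ 0)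
    (hT : t ≠ T) (x : Space N) : ContinuousAt (extendZero T ζ) (t, x) := by
  by_cases ht : t ∈ Ioo 0 T
  · have hm : Ioo 0 T ×ˢ univ ∈ 𝓝 (t, x) :=
      (isOpen_Ioo.prod isOpen_univ).mem_nhds ⟨ht, mem_univ _⟩
    exact (hζ.continuousAt hm).congr
      (mem_of_superset hm fun p hp => (extendZero_of_mem hp.1 p.2).symm)
  · have ht' : t ∉ Icc 0 T := fun h => ht ⟨h.1.lt_of_ne' h0, h.2.lt_of_ne hT⟩
    have hm : (Icc 0 T)ᶜ ×ˢ univ ∈ 𝓝 (t, x) :=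
      (isClosed_Icc.isOpen_compl.prod isOpen_univ).mem_nhds ⟨ht', mem_univ _⟩
    refine (continuousAt_const (y := (0 : ℝ))).congr (mem_of_superset hm fun p hp => ?_)
    exact (extendZero_of_notMem (fun h => hp.1 (Ioo_subset_Icc_self h)) p.2).symm

theorem abs_extendZero_le {M : ℝ} (hM0 : 0 ≤ M) (hM : ∀ t ∈ Ioo 0 T, ∀ x, |ζ t x| ≤ M)
    (p : ℝ × Space N) : |extendZero T ζ p| ≤ M := by
  by_cases h : p.1 ∈ Ioo 0 T
  · rw [show p = (p.1, p.2) from rfl, extendZero_of_mem h]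
    exact hM _ h _
  · rw [show p = (p.1, p.2) from rfl, extendZero_of_notMem h, abs_zero]
    exact hM0

/-- After the substitution r = τ - s the kernel no longer moves. The zero extension of ζ can jump
only at the times 0 and T, that is, for two values of r. Joint continuity is what makes the time
derivative jointly measurable. -/
theorem IsMemoryKernel.continuous_tail (hκ : IsMemoryKernel κ ℓ) (hT : 0 < T)
    (hζ : ContinuousOn (fun p : ℝ × Space N => ζ p.1 p.2) (Ioo 0 T ×ˢ univ)) {M : ℝ}
    (hM0 : 0 ≤ M) (hM : ∀ t ∈ Ioo 0 T, ∀ x, |ζ t x| ≤ M) :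
    Continuous fun p : ℝ × Space N => ∫ r in Ioc 0 T, extendZero T ζ (p.1 + r, p.2) * κ r := by
  refine continuous_iff_continuousAt.2 fun p => continuousAt_of_dominated
    (bound := fun r => M * |κ r|) (Eventually.of_forall fun q => ?_)
    (Eventually.of_forall fun q => Eventually.of_forall fun r => ?_)
    ((hκ.integrable T hT).abs.const_mul M) ?_
  · exact ((measurable_extendZero hζ).comp
      (by fun_prop : Measurable fun r : ℝ => (q.1 + r, q.2))).aestronglyMeasurable.mul
      (hκ.integrable T hT).aestronglyMeasurable
  · rw [norm_mul]
    exact mul_le_mul_of_nonneg_right (abs_extendZero_le hM0 hM _) (norm_nonneg _)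
  · have h1 : ∀ᵐ r ∂volume.restrict (Ioc 0 T), r ≠ -p.1 := Measure.ae_ne _ _
    have h2 : ∀ᵐ r ∂volume.restrict (Ioc 0 T), r ≠ T - p.1 := Measure.ae_ne _ _
    filter_upwards [h1, h2] with r hr1 hr2
    refine ContinuousAt.mul ?_ continuousAt_const
    exact ContinuousAt.comp (f := fun q : ℝ × Space N => (q.1 + r, q.2)) (x := p)
      (continuousAt_extendZero hζ (fun h => hr1 (by linarith)) (fun h => hr2 (by linarith)) _)
      (by fun_prop)

theorem IsMemoryKernel.tail_eq (κ : ℝ → ℝ) {s : ℝ} (hs : s ∈ Ioo 0 T) (x : Space N) :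
    ∫ τ in s..T, ζ τ x * κ (τ - s) = ∫ r in Ioc 0 T, extendZero T ζ (s + r, x) * κ r := by
  have h1 : ∫ τ in s..T, ζ τ x * κ (τ - s) = ∫ r in (0 : ℝ)..(T - s), ζ (s + r) x * κ r := by
    have := intervalIntegral.integral_comp_add_left (a := 0) (b := T - s)
      (fun τ => ζ τ x * κ (τ - s)) s
    simpa using this.symm
  rw [h1, intervalIntegral.integral_of_le (by linarith [hs.2]), integral_Ioc_eq_integral_Ioo]
  have h2 : ∫ r in Ioo 0 (T - s), ζ (s + r) x * κ r =
      ∫ r in Ioo 0 (T - s), extendZero T ζ (s + r, x) * κ r := by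
    refine setIntegral_congr_fun measurableSet_Ioo fun r hr => ?_
    rw [extendZero_of_mem ⟨by linarith [hs.1, hr.1], by linarith [hr.2]⟩]
  rw [h2]
  refine (setIntegral_eq_of_subset_of_forall_sdiff_eq_zero measurableSet_Ioc
    (fun r hr => ⟨hr.1, by linarith [hr.2, hs.1]⟩) fun r hr => ?_).symm
  rw [extendZero_of_notMem, zero_mul]
  exact fun h => hr.2 ⟨hr.1.1, by linarith [h.2]⟩

theorem IsTestFunction.exists_measurable_backwardRL (hκ : IsMemoryKernel κ ℓ) (hT : 0 < T)
    (hζ : IsTestFunction κ J T ζ) : ∃ g : ℝ × Space N → ℝ, Measurable g ∧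
      ∀ t ∈ Ioo 0 T, ∀ x, backwardRL κ T (fun s => ζ s x) t = g (t, x) := by
  obtain ⟨M, hM⟩ := hζ.exists_bound
  have hM0 : 0 ≤ M := (abs_nonneg _).trans (hM (T / 2) ⟨by linarith, by linarith⟩ 0)
  have hc := hκ.continuous_tail hT hζ.isC21.continuousOn hM0 hM
  set F : Space N → ℝ → ℝ :=
    fun x s => ∫ r in Ioc 0 T, extendZero T ζ (s + r, x) * κ r with hF
  have hFc : Continuous F.uncurry :=
    hc.comp (by fun_prop : Continuous fun q : Space N × ℝ => (q.2, q.1))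
  refine ⟨fun p => -deriv (F p.2) p.1, ((measurable_deriv_with_param hFc).comp
    measurable_swap).neg, fun t ht x => ?_⟩
  unfold backwardRL
  refine congrArg Neg.neg (EventuallyEq.deriv_eq ?_)
  filter_upwards [Ioo_mem_nhds ht.1 ht.2] with s hs
  exact IsMemoryKernel.tail_eq κ hs x

theorem IsTestFunction.levyOp_eq (hK : IsSymmKernel K) (hζ : IsTestFunction κ J T ζ) {t : ℝ}
    (ht : t ∈ Ioo 0 T) (x : Space N) : levyOp K (ζ t) x = symOp K (ζ t) x := by
  obtain ⟨M, hM⟩ := hζ.exists_bound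
  exact hK.levyOp_eq_symOp (hζ.isC21.contDiff_space t ht) (hM t ht) x

theorem IsTestFunction.exists_measurable_levyOp (hK : IsSymmKernel K) (hKm : Measurable K)
    (hζ : IsTestFunction κ J T ζ) : ∃ g : ℝ × Space N → ℝ, Measurable g ∧
      ∀ t ∈ Ioo 0 T, ∀ x, levyOp K (ζ t) x = g (t, x) := by
  have hm := measurable_extendZero hζ.isC21.continuousOn
  have h1 : Measurable fun q : (ℝ × Space N) × Space N =>
      (2 * extendZero T ζ (q.1.1, q.1.2) - extendZero T ζ (q.1.1, q.1.2 + q.2) -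
        extendZero T ζ (q.1.1, q.1.2 - q.2)) * K q.2 := by
    fun_prop
  refine ⟨fun p => 1 / 2 * ∫ z, (2 * extendZero T ζ (p.1, p.2) - extendZero T ζ (p.1, p.2 + z) -
    extendZero T ζ (p.1, p.2 - z)) * K z,
    (h1.stronglyMeasurable.integral_prod_right').measurable.const_mul _, fun t ht x => ?_⟩
  rw [hζ.levyOp_eq hK ht]
  simp only [symOp, secDiff, extendZero_of_mem ht]

theorem IsTestFunction.isPairable (hζ : IsTestFunction κ J T ζ) : IsPairable T ζ := by
  obtain ⟨M, hM⟩ := hζ.exists_bound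
  refine ⟨fun _ => 0, fun _ => M, integrable_zero _ _ _, ?_, ?_⟩
  · simp [integrableOn_const_iff]
  · rw [measQ, ae_restrict_iff' (measurableSet_Ioo.prod MeasurableSet.univ)]
    refine Eventually.of_forall fun p hp => ?_
    rw [zero_add]
    exact hM _ hp.1 _

variable {N : ℕ} {T : ℝ} {M : ℝ≥0} {w : ℝ → Space N → ℝ}

/-! ### Pairings of bounded paths with pairable functions -/

theorem IsBoundedPath.ae_abs_le (hw : IsBoundedPath T M w) :
    ∀ᵐ p ∂measQ N T, |w p.1 p.2| ≤ M := by
  have hm := hw.aesm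
  rw [measQ_eq] at hm ⊢
  have h : ∀ᵐ p ∂(volume.restrict (Ioo 0 T)).prod (volume : Measure (Space N)),
      hm.mk _ p ∈ Metric.closedBall (0 : ℝ) M := by
    have hS : MeasurableSet {p | hm.mk _ p ∈ Metric.closedBall (0 : ℝ) M} :=
      hm.stronglyMeasurable_mk.measurable Metric.isClosed_closedBall.measurableSet
    rw [Measure.ae_prod_iff_ae_ae hS]
    filter_upwards [Measure.ae_ae_of_ae_prod hm.ae_eq_mk, ae_restrict_mem measurableSet_Ioo]
      with t ht htT
    filter_upwards [ht, MemX.ae_abs_le (hw.mem t htT).2] with x hx hx'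
    rw [mem_closedBall_zero_iff, ← hx]
    exact hx'
  filter_upwards [h, hm.ae_eq_mk] with p hp hp'
  rw [hp']
  simpa using hp

theorem MemX.integral_abs_le {g : Space N → ℝ} (hg : MemX g) (hM : normX g ≤ M) :
    ∫ x, |g x| ≤ M := by
  have h := MemX.lintegral_enorm_le hM
  have h2 := integral_norm_eq_lintegral_enorm (f := g) hg.1.1
  simp only [Real.norm_eq_abs] at h2
  rw [h2]
  exact ENNReal.toReal_le_of_le_ofReal M.2 (by simpa using h)

theorem MemX.abs_integral_mul_le {w g a : Space N → ℝ} {c : ℝ} (hw : MemX w) (hM : normX w ≤ M)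
    (ha : Integrable a) (hg : ∀ᵐ x, |g x| ≤ |a x| + c) (hc : 0 ≤ c) :
    ∫ x, |w x * g x| ≤ M * ((∫ x, |a x|) + c) := by
  calc ∫ x, |w x * g x| ≤ ∫ x, (M * |a x| + |w x| * c) := by
        refine integral_mono_of_nonneg (Eventually.of_forall fun _ => abs_nonneg _)
          ((ha.abs.const_mul _).add (hw.integrable.abs.mul_const c)) ?_
        filter_upwards [hg, MemX.ae_abs_le hM] with x hx hx'
        rw [abs_mul]
        calc |w x| * |g x| ≤ |w x| * (|a x| + c) := by gcongr
          _ ≤ M * |a x| + |w x| * c := by rw [mul_add]; gcongr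
    _ = M * (∫ x, |a x|) + (∫ x, |w x|) * c := by
        rw [integral_add (ha.abs.const_mul _) (hw.integrable.abs.mul_const c), integral_const_mul,
          integral_mul_const]
    _ ≤ _ := by
        rw [mul_add]
        gcongr
        exact hw.integral_abs_le hM

/-- The majorant a ∈ L¹(Q_T) is paired with the sup bound of w, and b ∈ L¹(0,T) with its L¹ norm in
space. -/
theorem IsBoundedPath.integrable_mul (hw : IsBoundedPath T M w) {g : ℝ → Space N → ℝ}
    (hg : IsPairable T g)
    (hgm : AEStronglyMeasurable (fun p : ℝ × Space N => g p.1 p.2) (measQ N T)) :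
    Integrable (fun p : ℝ × Space N => w p.1 p.2 * g p.1 p.2) (measQ N T) := by
  obtain ⟨a, b, ha, hb, hab⟩ := hg
  have h1 : Integrable (fun p : ℝ × Space N => w p.1 p.2 * b p.1) (measQ N T) := by
    have hm : AEStronglyMeasurable (fun p : ℝ × Space N => w p.1 p.2 * b p.1) (measQ N T) := by
      refine hw.aesm.mul ?_
      rw [measQ_eq]
      exact hb.aestronglyMeasurable.comp_fst
    rw [measQ_eq] at hm ⊢
    rw [integrable_prod_iff hm]
    constructor
    · filter_upwards [ae_restrict_mem measurableSet_Ioo] with t ht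
      exact (hw.mem t ht).1.integrable.mul_const _
    · refine (hb.norm.const_mul (M : ℝ)).mono' hm.norm.integral_prod_right' ?_
      filter_upwards [ae_restrict_mem measurableSet_Ioo] with t ht
      rw [Real.norm_eq_abs, abs_of_nonneg (integral_nonneg fun _ => norm_nonneg _)]
      simp only [norm_mul]
      rw [integral_mul_const]
      exact mul_le_mul_of_nonneg_right ((hw.mem t ht).1.integral_abs_le (hw.mem t ht).2)
        (norm_nonneg _)
  refine ((ha.norm.const_mul (M : ℝ)).add h1.norm).mono' (hw.aesm.mul hgm) ?_
  filter_upwards [hab, hw.ae_abs_le] with p hp hp'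
  simp only [norm_mul, Real.norm_eq_abs, Pi.add_apply]
  calc |w p.1 p.2| * |g p.1 p.2| ≤ |w p.1 p.2| * (|a p| + |b p.1|) := by
        gcongr
        exact hp.trans (add_le_add (le_abs_self _) (le_abs_self _))
    _ ≤ M * |a p| + |w p.1 p.2| * |b p.1| := by rw [mul_add]; gcongr

theorem IsBoundedPath.sconv {η : Space N → ℝ} {A : ℝ≥0} (hw : IsBoundedPath T M w)
    (hηm : Measurable η) (hη : Integrable η) (hA : ∫ x, |η x| ≤ A) :
    IsBoundedPath T (2 * (A * M)) fun t => sconv η (w t) := by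
  refine ⟨?_, fun t ht => ?_⟩
  · have := hw.aesm
    rw [measQ_eq] at this ⊢
    exact aestronglyMeasurable_sconv hηm this
  have hX := hw.mem t ht
  have hm : AEStronglyMeasurable (DoubleNonlocal.sconv η (w t)) :=
    aestronglyMeasurable_sconv_right hηm hX.1.1.1
  have h1 : eLpNorm (DoubleNonlocal.sconv η (w t)) 1 volume ≤ (A * M : ℝ≥0) := by
    rw [eLpNorm_one_eq_lintegral_enorm, ENNReal.coe_mul]
    refine (lintegral_enorm_sconv_le hηm hX.1.1.1).trans
      (mul_le_mul' ?_ (MemX.lintegral_enorm_le hX.2))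
    rw [lintegral_enorm_eq hη]
    exact (ENNReal.ofReal_le_ofReal hA).trans_eq (ENNReal.ofReal_coe_nnreal)
  have h2 : eLpNorm (DoubleNonlocal.sconv η (w t)) ∞ volume ≤ (A * M : ℝ≥0) := by
    rw [eLpNorm_exponent_top]
    refine (eLpNormEssSup_le_of_ae_bound (C := (A * M : ℝ≥0)) (Eventually.of_forall fun x => ?_)).trans_eq
      (ENNReal.ofReal_coe_nnreal)
    refine (DoubleNonlocal.abs_sconv_le hη (MemX.ae_abs_le hX.2) x).trans ?_
    push_cast
    gcongr
  refine ⟨⟨⟨hm, h1.trans_lt ENNReal.coe_lt_top⟩, ⟨hm, h2.trans_lt ENNReal.coe_lt_top⟩⟩, ?_⟩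
  calc normX (DoubleNonlocal.sconv η (w t)) ≤ (A * M : ℝ≥0) + (A * M : ℝ≥0) := add_le_add h1 h2
    _ = _ := by rw [← ENNReal.coe_add, two_mul]

/-! ### Approximate identities -/

/-- A form of Scheffé's lemma. -/
theorem tendsto_integral_abs_sub_of_le {α : Type*} [MeasurableSpace α] {μ : Measure α}
    {v : ℕ → α → ℝ} {w : α → ℝ} (hv : ∀ n, Integrable (v n) μ) (hw : Integrable w μ)
    (hle : ∀ n, ∫ x, |v n x| ∂μ ≤ ∫ x, |w x| ∂μ)
    (h : ∀ᵐ x ∂μ, Tendsto (fun n => v n x) atTop (𝓝 (w x))) :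
    Tendsto (fun n => ∫ x, |v n x - w x| ∂μ) atTop (𝓝 0) := by
  -- The function v_n is clipped to [-|w|, |w|]. The clipped functions converge in L¹ by domination,
  -- and the excess |v_n - c_n| = |v_n| - |c_n| has integral at most ∫ |w| - ∫ |c_n| → 0.
  set c : ℕ → α → ℝ := fun n x => max (-|w x|) (min |w x| (v n x)) with hc
  have hcm : ∀ n, AEStronglyMeasurable (c n) μ := fun n =>
    hw.abs.aestronglyMeasurable.neg.sup (hw.abs.aestronglyMeasurable.inf (hv n).1)
  have hcw : ∀ n x, |c n x| ≤ |w x| := fun n x =>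
    abs_le.2 ⟨le_max_left _ _, max_le (neg_le_self (abs_nonneg _)) (min_le_left _ _)⟩
  have hci : ∀ n, Integrable (c n) μ := fun n =>
    hw.abs.mono' (hcm n) (Eventually.of_forall (hcw n))
  have hvc : ∀ n x, |v n x - c n x| = |v n x| - |c n x| := by
    intro n x
    simp only [hc]
    have h0 := abs_nonneg (w x)
    generalize |w x| = r at h0
    rcases le_total (v n x) r with h1 | h1
    · rw [min_eq_right h1]
      rcases le_total (v n x) (-r) with h2 | h2
      · rw [max_eq_left h2, abs_of_nonpos (by linarith), abs_neg,
          abs_of_nonpos (show v n x ≤ 0 by linarith), abs_of_nonneg h0]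
        ring
      · rw [max_eq_right h2]
        simp
    · rw [min_eq_left h1, max_eq_right (by linarith), abs_of_nonneg (by linarith),
        abs_of_nonneg (show 0 ≤ v n x by linarith), abs_of_nonneg h0]
  have hlim : Tendsto (fun n => ∫ x, |c n x - w x| ∂μ) atTop (𝓝 0) := by
    have := tendsto_integral_of_dominated_convergence (μ := μ) (F := fun n x => |c n x - w x|)
      (f := fun _ => (0 : ℝ)) (fun x => 2 * |w x|) (fun n => ((hcm n).sub hw.1).norm)
      (hw.abs.const_mul 2) (fun n => Eventually.of_forall fun x => ?_) ?_
    · simpa using this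
    · rw [Real.norm_eq_abs, abs_abs]
      have := abs_sub (c n x) (w x)
      linarith [hcw n x]
    · filter_upwards [h] with x hx
      have h1 : Tendsto (fun n => c n x) atTop (𝓝 (max (-|w x|) (min |w x| (w x)))) :=
        (tendsto_const_nhds.max (tendsto_const_nhds.min hx))
      rw [min_eq_right (le_abs_self _), max_eq_right (neg_abs_le _)] at h1
      simpa using (h1.sub_const (w x)).abs
  refine squeeze_zero (fun n => integral_nonneg fun _ => abs_nonneg _) (fun n => ?_)
    (by simpa using hlim.const_mul 2)
  have i1 : Integrable (fun x => |v n x - c n x|) μ := ((hv n).sub (hci n)).abs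
  have i2 : Integrable (fun x => |c n x - w x|) μ := ((hci n).sub hw).abs
  have e1 : ∫ x, |v n x - w x| ∂μ ≤ (∫ x, |v n x - c n x| ∂μ) + ∫ x, |c n x - w x| ∂μ := by
    rw [← integral_add i1 i2]
    exact integral_mono ((hv n).sub hw).abs (i1.add i2) fun x => abs_sub_le _ _ _
  have e2 : ∫ x, |v n x - c n x| ∂μ = (∫ x, |v n x| ∂μ) - ∫ x, |c n x| ∂μ := by
    simp only [hvc]
    exact integral_sub (hv n).abs (hci n).abs
  have e3 : (∫ x, |w x| ∂μ) - ∫ x, |c n x| ∂μ ≤ ∫ x, |c n x - w x| ∂μ := by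
    rw [← integral_sub hw.abs (hci n).abs]
    refine integral_mono (hw.abs.sub (hci n).abs) i2 fun x => ?_
    simp only
    rw [abs_sub_comm]
    exact abs_sub_abs_le_abs_sub _ _
  linarith [hle n]

/-- Against a the convergence is dominated because mollification preserves the sup bound; against
the constant c it is L¹ convergence. -/
theorem MemX.tendsto_integral_sconv_mollifier {w g a : Space N → ℝ} {c : ℝ} (hw : MemX w)
    (hM : normX w ≤ M) (ha : Integrable a) (hg : ∀ᵐ x, |g x| ≤ |a x| + c)
    (hgm : AEStronglyMeasurable g) :
    Tendsto (fun n => ∫ x, sconv (mollifier N n) w x * g x) atTop (𝓝 (∫ x, w x * g x)) := by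
  have hae := ae_tendsto_sconv_mollifier hw.integrable
  have hMw := MemX.ae_abs_le hM
  have hm : ∀ n, AEStronglyMeasurable (sconv (mollifier N n) w) := fun n =>
    aestronglyMeasurable_sconv_right (measurable_mollifier n) hw.1.1
  have hle : ∀ n, ∫⁻ x, ‖sconv (mollifier N n) w x‖ₑ ≤ ∫⁻ x, ‖w x‖ₑ := by
    intro n
    refine (lintegral_enorm_sconv_le (measurable_mollifier n) hw.1.1).trans ?_
    rw [lintegral_enorm_eq (integrable_mollifier n), integral_abs_mollifier, ENNReal.ofReal_one,
      one_mul]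
  have hvi : ∀ n, Integrable (sconv (mollifier N n) w) := fun n =>
    ⟨hm n, (hle n).trans_lt hw.integrable.2⟩
  have hvM : ∀ n x, |sconv (mollifier N n) w x| ≤ M := by
    intro n x
    have := abs_sconv_le (integrable_mollifier n) hMw x
    rwa [integral_abs_mollifier, one_mul] at this
  have hS := tendsto_integral_abs_sub_of_le hvi hw.integrable (fun n => by
    have := ENNReal.toReal_mono hw.integrable.2.ne (hle n)
    rwa [← integral_norm_eq_lintegral_enorm (hm n),
      ← integral_norm_eq_lintegral_enorm hw.1.1] at this) hae
  have hA : Tendsto (fun n => ∫ x, |sconv (mollifier N n) w x - w x| * |a x|) atTop (𝓝 0) := by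
    have := tendsto_integral_of_dominated_convergence (μ := (volume : Measure (Space N)))
      (F := fun n x => |sconv (mollifier N n) w x - w x| * |a x|)
      (f := fun _ => (0 : ℝ)) (fun x => 2 * M * |a x|)
      (fun n => ((hm n).sub hw.1.1).norm.mul ha.1.norm)
      (ha.abs.const_mul _) (fun n => ?_) ?_
    · simpa using this
    · filter_upwards [hMw] with x hx
      rw [norm_mul, Real.norm_eq_abs, Real.norm_eq_abs, abs_abs, abs_abs]
      gcongr
      have := abs_sub (sconv (mollifier N n) w x) (w x)
      linarith [hvM n x]
    · filter_upwards [hae] with x hx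
      simpa using ((hx.sub_const (w x)).abs.mul_const |a x|)
  have hint : ∀ v : Space N → ℝ, Integrable v → (∀ᵐ x, |v x| ≤ M) →
      Integrable fun x => v x * g x := by
    intro v hv hvM
    refine ((ha.abs.const_mul (M : ℝ)).add (hv.abs.mul_const c)).mono' (hv.1.mul hgm) ?_
    filter_upwards [hg, hvM] with x hx hx'
    rw [norm_mul, Real.norm_eq_abs, Real.norm_eq_abs]
    calc |v x| * |g x| ≤ |v x| * (|a x| + c) := by gcongr
      _ ≤ M * |a x| + |v x| * c := by rw [mul_add]; gcongr
  have hiw := hint w hw.integrable hMw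
  rw [tendsto_iff_dist_tendsto_zero]
  refine squeeze_zero (fun n => dist_nonneg) (fun n => ?_)
    (by simpa using hA.add (hS.mul_const c))
  have hiv := hint _ (hvi n) (Eventually.of_forall (hvM n))
  have hd : Integrable fun x => sconv (mollifier N n) w x - w x := (hvi n).sub hw.integrable
  have i1 : Integrable fun x => |sconv (mollifier N n) w x - w x| * |a x| := by
    refine (ha.abs.const_mul (2 * M : ℝ)).mono' (hd.1.norm.mul ha.1.norm) ?_
    filter_upwards [hMw] with x hx
    rw [norm_mul, Real.norm_eq_abs, Real.norm_eq_abs, abs_abs, abs_abs]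
    gcongr
    have := abs_sub (sconv (mollifier N n) w x) (w x)
    linarith [hvM n x]
  have i2 : Integrable fun x => |sconv (mollifier N n) w x - w x| * c := hd.abs.mul_const c
  rw [Real.dist_eq, ← integral_sub hiv hiw, ← integral_mul_const, ← integral_add i1 i2,
    ← Real.norm_eq_abs]
  refine norm_integral_le_of_norm_le (i1.add i2) ?_
  filter_upwards [hg] with x hx
  rw [← sub_mul, norm_mul, Real.norm_eq_abs, Real.norm_eq_abs, ← mul_add]
  gcongr

theorem IsBoundedPath.tendsto_integral_sconv_mollifier (hw : IsBoundedPath T M w)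
    {g : ℝ → Space N → ℝ} (hg : IsPairable T g)
    (hgm : AEStronglyMeasurable (fun p : ℝ × Space N => g p.1 p.2) (measQ N T)) :
    Tendsto (fun n => ∫ p, DoubleNonlocal.sconv (mollifier N n) (w p.1) p.2 * g p.1 p.2 ∂measQ N T)
      atTop (𝓝 (∫ p, w p.1 p.2 * g p.1 p.2 ∂measQ N T)) := by
  have hwn : ∀ n, IsBoundedPath T (2 * (1 * M)) fun t =>
      DoubleNonlocal.sconv (mollifier N n) (w t) := fun n =>
    hw.sconv (measurable_mollifier n) (integrable_mollifier n) (integral_abs_mollifier n).le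
  have hi := hw.integrable_mul hg hgm
  have hin := fun n => (hwn n).integrable_mul hg hgm
  obtain ⟨a, b, ha, hb, hab⟩ := hg
  rw [measQ_eq] at *
  rw [integral_prod _ hi]
  simp only [integral_prod _ (hin _)]
  have hslice : ∀ᵐ t ∂volume.restrict (Ioo 0 T), t ∈ Ioo 0 T ∧ Integrable (fun x => a (t, x)) ∧
      (∀ᵐ x, |g t x| ≤ |a (t, x)| + |b t|) ∧ AEStronglyMeasurable (g t) := by
    filter_upwards [ae_restrict_mem measurableSet_Ioo, ha.prod_right_ae,
      Measure.ae_ae_of_ae_prod hab, hgm.prodMk_left] with t h1 h2 h3 h4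
    refine ⟨h1, h2, ?_, h4⟩
    filter_upwards [h3] with x hx
    exact hx.trans (add_le_add (le_abs_self _) (le_abs_self _))
  refine tendsto_integral_of_dominated_convergence
    (fun t => ((2 * (1 * M) : ℝ≥0) : ℝ) * ((∫ x, |a (t, x)|) + |b t|))
    (fun n => (hin n).integral_prod_left.1) ((ha.abs.integral_prod_left.add hb.abs).const_mul _)
    (fun n => ?_) ?_
  · filter_upwards [hslice] with t ⟨ht, h1, h2, _⟩
    refine (norm_integral_le_integral_norm _).trans ?_
    exact MemX.abs_integral_mul_le ((hwn n).mem t ht).1 ((hwn n).mem t ht).2 h1 h2 (abs_nonneg _)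
  · filter_upwards [hslice] with t ⟨ht, h1, h2, h3⟩
    exact (hw.mem t ht).1.tendsto_integral_sconv_mollifier (hw.mem t ht).2 h1 h2 h3

variable {N : ℕ}

/-! ### The mollified identity -/

theorem integral_sconv_mul {a w g : Space N → ℝ}
    (h : Integrable (fun p : Space N × Space N => a (p.1 - p.2) * w p.2 * g p.1)
      (volume.prod volume)) :
    ∫ x, sconv a w x * g x = ∫ y, w y * ∫ x, a (x - y) * g x := by
  have e1 : ∀ x, sconv a w x * g x = ∫ y, a (x - y) * w y * g x := fun x =>
    (integral_mul_const _ _).symm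
  have e2 : ∀ y, w y * ∫ x, a (x - y) * g x = ∫ x, a (x - y) * w y * g x := by
    intro y
    rw [← integral_const_mul]
    congr 1
    ext x
    ring
  simp only [e1, e2]
  exact integral_integral_swap h

theorem integrable_conv_integrand {a w : Space N → ℝ} (ha : Integrable a) (hw : Integrable w) :
    Integrable (fun p : Space N × Space N => a (p.1 - p.2) * w p.2) (volume.prod volume) := by
  have := hw.convolution_integrand (ContinuousLinearMap.mul ℝ ℝ) (μ := volume) ha
  simpa [mul_comm] using this

/-- The operator is moved from the mollifier to the test function. -/
theorem IsSymmKernel.integral_sconv_symOp_mul {K : Space N → ℝ} (hK : IsSymmKernel K)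
    {η : Space N → ℝ} (hη : ContDiff ℝ 2 η) (hs : HasCompactSupport η)
    (heven : ∀ x, η (-x) = η x) {w z a : Space N → ℝ} {M : ℝ≥0} {c D : ℝ} (hw : MemX w)
    (hM : normX w ≤ M) (hz : ContDiff ℝ 2 z) (hD : ∀ x, |z x| ≤ D) (ha : Integrable a)
    (hg : ∀ᵐ x, |symOp K z x| ≤ |a x| + c) (hgm : AEStronglyMeasurable (symOp K z)) :
    ∫ x, sconv (symOp K η) w x * z x = ∫ x, sconv η w x * symOp K z x := by
  have hηi : Integrable η := hη.continuous.integrable_of_hasCompactSupport hs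
  have h1 := (integrable_conv_integrand (hK.integrable_symOp hη hs) hw.integrable).mul_bdd (c := D)
    hz.continuous.aestronglyMeasurable.comp_fst (Eventually.of_forall fun p => hD p.1)
  -- The part of the majorant with a is a convolution integrand with the variables exchanged, and
  -- evenness of η matches the arguments.
  have h2 : Integrable (fun p : Space N × Space N => η (p.1 - p.2) * w p.2 * symOp K z p.1)
      (volume.prod volume) := by
    have b1 := ((integrable_conv_integrand hηi ha).swap.norm).const_mul (M : ℝ)
    have b2 := ((integrable_conv_integrand hηi hw.integrable).norm).const_mul c
    refine (b1.add b2).mono' ((integrable_conv_integrand hηi hw.integrable).1.mul hgm.comp_fst) ?_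
    filter_upwards [Measure.quasiMeasurePreserving_fst.ae hg,
      Measure.quasiMeasurePreserving_snd.ae (MemX.ae_abs_le hM)] with p hp hp'
    simp only [Pi.add_apply, Function.comp_apply, Prod.fst_swap, Prod.snd_swap, norm_mul,
      Real.norm_eq_abs]
    rw [← neg_sub p.1 p.2, heven]
    calc |η (p.1 - p.2)| * |w p.2| * |symOp K z p.1|
        ≤ |η (p.1 - p.2)| * |w p.2| * (|a p.1| + c) := by gcongr
      _ = |w p.2| * (|η (p.1 - p.2)| * |a p.1|) + c * (|η (p.1 - p.2)| * |w p.2|) := by ring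
      _ ≤ _ := by gcongr
  rw [integral_sconv_mul h1, integral_sconv_mul h2]
  congr 1
  ext y
  congr 1
  have hy : (fun x => η (x - y)) = fun x => η (y - x) := by
    ext x
    rw [← heven, neg_sub]
  have e := hK.integral_mul_symOp (η := fun x => η (y - x))
    (hη.comp (contDiff_const.sub contDiff_id)) (hs.comp_homeomorph (Homeomorph.subLeft y)) hz hD
  simp only [symOp_comp_sub_left] at e
  simp only [congrFun hy]
  rw [e]
  congr 1
  ext x
  rw [← neg_sub y x, symOp_neg K heven, mul_comm]

variable {T : ℝ} {M B : ℝ≥0} {κ ℓ : ℝ → ℝ} {K : Space N → ℝ} {u₀ : Space N → ℝ}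
  {f u ζ : ℝ → Space N → ℝ}

theorem IsBoundedPath.sub_const (hu : IsBoundedPath T B u) (hu₀ : MemX u₀) :
    IsBoundedPath T (B + (normX u₀).toNNReal) fun t x => u t x - u₀ x := by
  refine ⟨hu.aesm.sub ?_, fun t ht => ?_⟩
  · rw [measQ_eq]
    exact hu₀.1.1.comp_snd
  obtain ⟨hX, hB⟩ := hu.mem t ht
  refine ⟨⟨hX.1.sub hu₀.1, hX.2.sub hu₀.2⟩, ?_⟩
  have h1 := eLpNorm_sub_le hX.1.1 hu₀.1.1 (p := 1) le_rfl (μ := volume)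
  have h2 := eLpNorm_sub_le hX.1.1 hu₀.1.1 (p := ∞) le_top (μ := volume)
  calc normX (fun x => u t x - u₀ x) ≤ (eLpNorm (u t) 1 volume + eLpNorm u₀ 1 volume) +
        (eLpNorm (u t) ∞ volume + eLpNorm u₀ ∞ volume) := add_le_add h1 h2
    _ = normX (u t) + normX u₀ := by unfold normX; abel
    _ ≤ _ := by
        rw [ENNReal.coe_add, ENNReal.coe_toNNReal hu₀.normX_lt_top.ne]
        gcongr

theorem IsTestFunction.aesm_backwardRL {J : Space N → ℝ} (hκ : IsMemoryKernel κ ℓ) (hT : 0 < T)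
    (hζ : IsTestFunction κ J T ζ) : AEStronglyMeasurable
      (fun p : ℝ × Space N => backwardRL κ T (fun s => ζ s p.2) p.1) (measQ N T) := by
  obtain ⟨g, hg, h⟩ := hζ.exists_measurable_backwardRL hκ hT
  refine hg.aestronglyMeasurable.congr ?_
  rw [EventuallyEq, measQ, ae_restrict_iff' (measurableSet_Ioo.prod MeasurableSet.univ)]
  exact Eventually.of_forall fun p hp => (h _ hp.1 _).symm

theorem IsTestFunction.aesm_levyOp (hK : IsSymmKernel K) (hKm : Measurable K)
    (hζ : IsTestFunction κ K T ζ) :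
    AEStronglyMeasurable (fun p : ℝ × Space N => levyOp K (ζ p.1) p.2) (measQ N T) := by
  obtain ⟨g, hg, h⟩ := hζ.exists_measurable_levyOp hK hKm
  refine hg.aestronglyMeasurable.congr ?_
  rw [EventuallyEq, measQ, ae_restrict_iff' (measurableSet_Ioo.prod MeasurableSet.univ)]
  exact Eventually.of_forall fun p hp => (h _ hp.1 _).symm

/-- The duality in time is applied on the lines {x} × (0,T), and by Fubini almost every line is
admissible. -/
theorem IsTestFunction.ae_integrableOn_backwardRL {J : Space N → ℝ} (hκ : IsMemoryKernel κ ℓ)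
    (hT : 0 < T) (hζ : IsTestFunction κ J T ζ) :
    ∀ᵐ x : Space N, IntegrableOn (backwardRL κ T fun s => ζ s x) (Ioo 0 T) := by
  obtain ⟨a, b, ha, hb, hab⟩ := hζ.pairable_time
  have hm := hζ.aesm_backwardRL hκ hT
  rw [measQ_eq] at ha hab hm
  have h1 : ∀ᵐ x : Space N, ∀ᵐ t ∂volume.restrict (Ioo 0 T),
      |backwardRL κ T (fun s => ζ s x) t| ≤ a (t, x) + b t :=
    Measure.ae_ae_of_ae_prod (Measure.measurePreserving_swap.quasiMeasurePreserving.ae hab)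
  filter_upwards [h1, ha.prod_left_ae, hm.prod_swap.prodMk_left] with x h2 h3 h4
  exact (h3.add hb).mono' h4 h2

theorem IsMildSolution.mollified_identity (hκ : IsMemoryKernel κ ℓ) (hT : 0 < T)
    (hK : IsSymmKernel K) (hu₀ : MemX u₀) (hf : IsBoundedPath T M f)
    (hub : IsBoundedPath T B u) (hu : IsMildSolution ℓ K T u₀ f u) (hKm : Measurable K)
    (hζ : IsTestFunction κ K T ζ) {η : Space N → ℝ} (hη : ContDiff ℝ 2 η)
    (hs : HasCompactSupport η) (heven : ∀ x, η (-x) = η x) :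
    (∫ p, sconv η (fun x => u p.1 x - u₀ x) p.2 * backwardRL κ T (fun s => ζ s p.2) p.1
        ∂measQ N T) +
      (∫ p, sconv η (u p.1) p.2 * levyOp K (ζ p.1) p.2 ∂measQ N T) =
      ∫ p, sconv η (f p.1) p.2 * ζ p.1 p.2 ∂measQ N T := by
  have hηi : Integrable η := hη.continuous.integrable_of_hasCompactSupport hs
  have hηm : Measurable η := hη.continuous.measurable
  have hΛi : Integrable (symOp K η) := hK.integrable_symOp hη hs
  have hΛm : Measurable (symOp K η) := (hK.continuous_symOp hη hs).measurable
  have habs : ∀ a : Space N → ℝ, ∃ A : ℝ≥0, ∫ x, |a x| ≤ A := fun a =>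
    ⟨⟨∫ x, |a x|, integral_nonneg fun _ => abs_nonneg _⟩, le_rfl⟩
  obtain ⟨A, hA⟩ := habs η
  obtain ⟨L, hL⟩ := habs (symOp K η)
  obtain ⟨D, hD⟩ := hζ.exists_bound
  have hζm := hζ.memLinftyX.1
  have hg1m := hζ.aesm_backwardRL hκ hT
  have hg2m := hζ.aesm_levyOp hK hKm
  have i1 := ((hub.sub_const hu₀).sconv hηm hηi hA).integrable_mul hζ.pairable_time hg1m
  have i2 := (hub.sconv hηm hηi hA).integrable_mul hζ.pairable_space hg2m
  have i3 := (hf.sconv hηm hηi hA).integrable_mul hζ.isPairable hζm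
  have i4 := (hub.sconv hΛm hΛi hL).integrable_mul hζ.isPairable hζm
  have e2 : ∫ p, sconv η (u p.1) p.2 * levyOp K (ζ p.1) p.2 ∂measQ N T =
      ∫ p, sconv (symOp K η) (u p.1) p.2 * ζ p.1 p.2 ∂measQ N T := by
    obtain ⟨a, b, ha, hb, hab⟩ := hζ.pairable_space
    rw [measQ_eq] at ha hab hg2m i2 i4 ⊢
    rw [integral_prod _ i2, integral_prod _ i4]
    refine integral_congr_ae ?_
    filter_upwards [ae_restrict_mem measurableSet_Ioo, ha.prod_right_ae,
      Measure.ae_ae_of_ae_prod hab, hg2m.prodMk_left] with t ht h1 h2 h3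
    have h4 : levyOp K (ζ t) = symOp K (ζ t) := funext (hζ.levyOp_eq hK ht)
    simp only [h4] at h2 h3 ⊢
    refine (hK.integral_sconv_symOp_mul hη hs heven (hub.mem t ht).1 (hub.mem t ht).2
      (hζ.isC21.contDiff_space t ht) (hD t ht) h1 (c := |b t|) ?_ h3).symm
    filter_upwards [h2] with x hx
    exact hx.trans (add_le_add (le_abs_self _) (le_abs_self _))
  have e1 : ∫ p, sconv η (fun x => u p.1 x - u₀ x) p.2 * backwardRL κ T (fun s => ζ s p.2) p.1
        ∂measQ N T =
      ∫ p, (sconv η (f p.1) p.2 * ζ p.1 p.2 - sconv (symOp K η) (u p.1) p.2 * ζ p.1 p.2)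
        ∂measQ N T := by
    have i5 : Integrable (fun p : ℝ × Space N => sconv η (f p.1) p.2 * ζ p.1 p.2 -
        sconv (symOp K η) (u p.1) p.2 * ζ p.1 p.2) (measQ N T) := i3.sub i4
    rw [measQ_eq] at i1 i5 ⊢
    rw [integral_prod_symm _ i1, integral_prod_symm _ i5]
    refine integral_congr_ae ?_
    filter_upwards [hζ.ae_integrableOn_backwardRL hκ hT] with x hx
    -- On this line the integrated equation reads η * (u - u₀) = ℓ ⋆ h, and ₜD_T cancels ℓ.
    set h : ℝ → ℝ := fun s => sconv η (f s) x - sconv (symOp K η) (u s) x with hh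
    have hf1 := hf.aesm_sconv_time hηm x
    have hu1 := hub.aesm_sconv_time hΛm x
    have hf2 : ∀ t ∈ Ioo 0 T, |sconv η (f t) x| ≤ (∫ z, |η z|) * M := fun t ht =>
      hf.abs_sconv_le hηi ht x
    have hu2 : ∀ t ∈ Ioo 0 T, |sconv (symOp K η) (u t) x| ≤ (∫ z, |symOp K η z|) * B :=
      fun t ht => hub.abs_sconv_le hΛi ht x
    have hlift : ∀ {v : ℝ → ℝ} {C : ℝ}, AEStronglyMeasurable v (volume.restrict (Ioo 0 T)) →
        (∀ t ∈ Ioo 0 T, |v t| ≤ C) → IntegrableOn v (Ioc 0 T) := fun hv hC => by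
      rw [integrableOn_Ioc_iff_integrableOn_Ioo]
      exact (integrableOn_const (C := _) (by simp)).mono' hv
        ((ae_restrict_iff' measurableSet_Ioo).2 (Eventually.of_forall hC))
    have hsub := cconv_sub_ae (hκ.conj_integrable T hT) (hlift hf1 hf2) (hlift hu1 hu2)
    rw [← restrict_Ioo_eq_restrict_Ioc] at hsub
    have hkey := hκ.integral_backwardRL_mul hT (φ := fun s => ζ s x) (h := h)
      (fun t ht => (hζ.isC21.differentiable_time t ht x).differentiableWithinAt)
      (hζ.isC21.continuousOn_deriv.comp (f := fun t => (t, x)) (by fun_prop)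
        fun t ht => ⟨ht, mem_univ _⟩) (fun t ht => hD t ht x) hx (hf1.sub hu1)
      (fun t ht => (abs_sub _ _).trans (add_le_add (hf2 t ht) (hu2 t ht)))
    calc ∫ t in Ioo 0 T, sconv η (fun y => u t y - u₀ y) x * backwardRL κ T (fun s => ζ s x) t
        = ∫ t in Ioo 0 T, cconv ℓ h t * backwardRL κ T (fun s => ζ s x) t := by
          refine integral_congr_ae ?_
          filter_upwards [ae_restrict_mem measurableSet_Ioo, hsub] with t ht hst
          have h1 := hu.sconv_identity hκ hK hu₀ hf.aesm hf.mem hη hs ht x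
          have h2 : sconv η (fun y => u t y - u₀ y) x = sconv η (u t) x - sconv η u₀ x := by
            obtain ⟨hX, hB⟩ := hub.mem t ht
            unfold sconv
            simp only [mul_sub]
            exact integral_sub (integrable_sconv hηi hX.1.1 (MemX.ae_abs_le hB) x)
              (integrable_sconv hηi hu₀.1.1 (MemX.ae_abs_le
                (ENNReal.coe_toNNReal hu₀.normX_lt_top.ne).ge) x)
          rw [hst, h2]
          congr 1
          linarith
      _ = ∫ t in Ioo 0 T, h t * ζ t x := hkey
      _ = _ := by
          congr 1
          ext t
          simp only [hh, sub_mul]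
  rw [e1, e2, integral_sub i3 i4, sub_add_cancel]

/-! ### The identity for mild solutions -/

theorem IsMildSolution.weak_formulation (hκ : IsMemoryKernel κ ℓ) (hT : 0 < T)
    (hK : IsSymmKernel K) (hKm : Measurable K) (hu₀ : MemX u₀) (hf : IsBoundedPath T M f)
    (hu : IsMildSolution ℓ K T u₀ f u) (hζ : IsTestFunction κ K T ζ) :
    Integrable (fun p : ℝ × Space N =>
      (u p.1 p.2 - u₀ p.2) * backwardRL κ T (fun s => ζ s p.2) p.1) (measQ N T) ∧
    Integrable (fun p : ℝ × Space N => u p.1 p.2 * levyOp K (ζ p.1) p.2) (measQ N T) ∧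
    Integrable (fun p : ℝ × Space N => f p.1 p.2 * ζ p.1 p.2) (measQ N T) ∧
    (∫ p, (u p.1 p.2 - u₀ p.2) * backwardRL κ T (fun s => ζ s p.2) p.1 ∂measQ N T) +
      (∫ p, u p.1 p.2 * levyOp K (ζ p.1) p.2 ∂measQ N T) =
      ∫ p, f p.1 p.2 * ζ p.1 p.2 ∂measQ N T := by
  obtain ⟨B, hB⟩ := hu.exists_isBoundedPath hκ hK hKm hu₀ hf
  have hw := hB.sub_const hu₀
  have hg1 := hζ.aesm_backwardRL hκ hT
  have hg2 := hζ.aesm_levyOp hK hKm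
  refine ⟨hw.integrable_mul hζ.pairable_time hg1, hB.integrable_mul hζ.pairable_space hg2,
    hf.integrable_mul hζ.isPairable hζ.memLinftyX.1, ?_⟩
  have l1 := hw.tendsto_integral_sconv_mollifier hζ.pairable_time hg1
  have l2 := hB.tendsto_integral_sconv_mollifier hζ.pairable_space hg2
  have l3 := hf.tendsto_integral_sconv_mollifier hζ.isPairable hζ.memLinftyX.1
  exact tendsto_nhds_unique (l1.add l2) (l3.congr fun n =>
    (hu.mollified_identity hκ hT hK hu₀ hf hB hKm hζ (contDiff_mollifier n)
      (hasCompactSupport_mollifier n) (mollifier_neg n)).symm)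

/-- A source in `L^∞((0,T); X)` can be modified on a null set of times. -/
theorem MemLinftyX.exists_isBoundedPath (hf : MemLinftyX T f) :
    ∃ (M : ℝ≥0) (f' : ℝ → Space N → ℝ), IsBoundedPath T M f' ∧
      ∀ᵐ t ∂volume.restrict (Ioo 0 T), f t = f' t := by
  classical
  obtain ⟨hm, M, hM⟩ := hf
  set f' : ℝ → Space N → ℝ := fun t => if MemX (f t) ∧ normX (f t) ≤ M then f t else 0 with hf'
  have he : ∀ᵐ t ∂volume.restrict (Ioo 0 T), f t = f' t := by
    filter_upwards [hM] with t ht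
    simp only [hf', if_pos ht]
  refine ⟨M, f', ⟨hm.congr ?_, fun t ht => ?_⟩, he⟩
  · rw [measQ_eq]
    filter_upwards [Measure.quasiMeasurePreserving_fst.ae he] with p hp
    rw [hp]
  · by_cases h : MemX (f t) ∧ normX (f t) ≤ M
    · simp only [hf', if_pos h]
      exact h
    · simp only [hf', if_neg h]
      exact ⟨⟨MemLp.zero, MemLp.zero⟩, by simp [normX]⟩

/-! ### Changes of the source and of the kernel on null sets. -/

theorem IsMildSolution.congr_source {f' : ℝ → Space N → ℝ} (hu : IsMildSolution ℓ K T u₀ f u)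
    (h : ∀ᵐ t ∂volume.restrict (Ioo 0 T), f t = f' t) : IsMildSolution ℓ K T u₀ f' u := by
  refine ⟨hu.memCX, fun t ht => ?_⟩
  have e : ∫ τ in (0 : ℝ)..t, convY ℓ K (t - τ) (toL2 fun y => (f τ y : ℂ)) =
      ∫ τ in (0 : ℝ)..t, convY ℓ K (t - τ) (toL2 fun y => (f' τ y : ℂ)) := by
    rw [intervalIntegral.integral_of_le ht.1.le, intervalIntegral.integral_of_le ht.1.le]
    refine integral_congr_ae (ae_restrict_of_ae_restrict_of_subset
      (Ioc_subset_Ioo_right ht.2) (h.mono fun s hs => ?_))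
    simp only [hs]
  rw [← e]
  exact hu.eq t ht

theorem IsMildSolution.congr_kernel {J : Space N → ℝ} (hu : IsMildSolution ℓ J T u₀ f u)
    (h : J =ᵐ[volume] K) : IsMildSolution ℓ K T u₀ f u := by
  refine ⟨hu.memCX, ?_⟩
  have e := hu.eq
  simp only [convZ, convY, symbol_congr h] at e ⊢
  exact e

theorem IsTestFunction.congr_kernel {J : Space N → ℝ} (hζ : IsTestFunction κ J T ζ)
    (h : J =ᵐ[volume] K) : IsTestFunction κ K T ζ :=
  ⟨hζ.memLinftyX, hζ.isC21, hζ.final, hζ.pairable_time, by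
    simpa only [levyOp_congr h] using hζ.pairable_space⟩

end DoubleNonlocal

end

theorem mainTheorem8 (N : ℕ) (hN : 1 ≤ N) (κ ℓ : ℝ → ℝ)
    (hκ : DoubleNonlocal.IsMemoryKernel κ ℓ)
    (J : DoubleNonlocal.Space N → ℝ) (hJ : DoubleNonlocal.IsLevyKernel J)
    (T : ℝ) (hT : 0 < T)
    (u₀ : DoubleNonlocal.Space N → ℝ) (hu₀ : DoubleNonlocal.MemX u₀)
    (f : ℝ → DoubleNonlocal.Space N → ℝ) (hf : DoubleNonlocal.MemLinftyX T f)
    (u : ℝ → DoubleNonlocal.Space N → ℝ)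
    (hu : DoubleNonlocal.IsMildSolution ℓ J T u₀ f u) :
    DoubleNonlocal.IsVeryWeakSolution κ J T u₀ f u := by
  refine ⟨hu.memCX, fun ζ hζ => ?_⟩
  -- J is exchanged for a Borel kernel and f for a source bounded in X at every time; neither
  -- exchange affects the solution, the test functions or the integrals.
  obtain ⟨K, hKm, hK, hJK⟩ := (hJ.isSymmKernel hN).exists_measurable
  obtain ⟨M, f', hf', hff'⟩ := hf.exists_isBoundedPath
  have h := ((hu.congr_source hff').congr_kernel hJK).weak_formulation hκ hT hK hKm hu₀ hf'
    (hζ.congr_kernel hJK)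
  have he : (fun p : ℝ × DoubleNonlocal.Space N => f p.1 p.2 * ζ p.1 p.2)
      =ᵐ[DoubleNonlocal.measQ N T] fun p => f' p.1 p.2 * ζ p.1 p.2 := by
    rw [DoubleNonlocal.measQ_eq]
    filter_upwards [Measure.quasiMeasurePreserving_fst.ae hff'] with p hp
    rw [hp]
  rw [integrable_congr he, integral_congr_ae he]
  simpa only [DoubleNonlocal.levyOp_congr hJK] using h
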